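/- Let $d=4\delta+2$ with $\delta\ge 0$ an integer. The quartic melonic tensor model is considered in its matrix-model form: $d$ Hermitian $N\times N$ matrices $M_1,\dots,M_d$ with weight $$\prod_{c=1}^d dM_c\,\exp\Bigl(-\tfrac N2\sum_c\operatorname{tr}M_c^2-N^{2-d}\sum_{a_1+\dots+a_d\ge2}t_{a_1\dots a_d}\prod_c\operatorname{tr}M_c^{a_c}\Bigr),\qquad t_{a_1\dots a_d}=-\frac1{|a|}\binom{|a|}{a_1,\dots,a_d}\prod_c\alpha_c^{a_c}\,N^{d-2-\frac{d-2}2|a|},$$ $|a|=\sum_ca_c$, understood as a formal power series in $\alpha_1,\dots,\alpha_d$ around the Gaussian weight $e^{-\frac N2\sum_c\operatorname{tr}M_c^2}$. At each order in the $\alpha_c$ the connected correlations have a topological expansion, for $n\ge1$ and colours $c_1,\dots,c_n$: $$\Bigl\langle\prod_{i=1}^n\operatorname{tr}\frac1{x_i-M_{c_i}}\Bigr\rangle_{\!c}=\sum_{g\ge0}N^{2-n-2g}\,W^g_{n}(x_1,\dots,x_n).$$ On the disconnected curve $\mathcal C$ with one component for each colour $c$, with coordinate $z$ and $x^{(c)}(z)=(z+1/z)/\sqrt{1-\alpha_c^2}$,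 let $\omega_n^g=W_n^g(x(z_1),\dots,x(z_n))\prod_i dx(z_i)$ for $2g-2+n>0$ (continued analytically in the $z_i$), and let $\omega_2^0=W_2^0(x(z_1),x(z_2))\,dx(z_1)dx(z_2)$, plus $dx(z_1)dx(z_2)/(x(z_1)-x(z_2))^2$ if $z_1,z_2$ lie on the same component. Put $G(z,z_1)=\int^z\omega_2^0(\cdot,z_1)$, let $$P\omega(z_1)=\sum_{p}\operatorname*{Res}_{z\to p}\omega(z)\,G(z,z_1),\qquad H=1-P,$$ the sum running over the zeroes $p$ of $dx$ (the points $z=\pm1$ of every component), let $P_i,H_i$ act on the $i$-th variable, and define the blobs $\phi_n^g=H_1H_2\cdots H_n\,\omega_n^g$ for $n\ge1$ and $2g-2+n>0$. Then, for all $h\ge0$ and $n\ge1$ with $h\le\delta-1$ and $2h-2+n>0$, the blob $\phi_n^h$ is well defined and vanishes identically. In particular, for $d=6$ one has $\phi_n^0=0$ for all $n\ge3$. Moreover, if $\delta\ge1$, the potential is Gaussian at large $N$ with first non-trivial correction at order $h=\delta$: writing its terms as $N^2t_a\prod_c\bigl(\operatorname{tr}M_c^{a_c}/N\bigr)$ and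 $N^2t_a=\sum_{h\ge0}N^{2-2h}\,T_h(a)\prod_c\alpha_c^{a_c}$ with numbers $T_h(a)$ independent of $N$, one has $T_0(a)\ne0$ exactly when $|a|=2$, $T_h(a)=0$ for all $a$ when $1\le h\le\delta-1$, and $T_\delta(a)\ne0$ exactly when $|a|=3$. -/

import Mathlib

open MeasureTheory ProbabilityTheory Filter Topology

noncomputable section

namespace QuarticMelonic

/-! ### The matrix model

All quantities are formal power series in the `d` coupling parameters `α_1, …, α_d`. -/

/-- Formal power series in `α_1, …, α_d` with complex coefficients. -/
abbrev Ser (d : ℕ) : Type := MvPowerSeries (Fin d) ℂ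

/-- The `d` real `N × N` arrays that parametrize `d` Hermitian matrices. -/
abbrev Arrays (d N : ℕ) : Type := Fin d → Fin N → Fin N → ℝ

/-- Orthonormal linear parametrization of the Hermitian `N × N` matrices by real `N × N` arrays:
`tr (herm A) ^ 2 = ∑ i j, (A i j) ^ 2`. -/
def herm {N : ℕ} (A : Fin N → Fin N → ℝ) : Matrix (Fin N) (Fin N) ℂ :=
  Matrix.of fun i j =>
    if i = j then (A i i : ℂ)
    else if i < j then ((A i j : ℂ) + (A j i : ℂ) * Complex.I) / (Real.sqrt 2 : ℂ)
    else ((A j i : ℂ) - (A i j : ℂ) * Complex.I) / (Real.sqrt 2 : ℂ)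

/-- The normalized Gaussian measure proportional to `exp (-(N/2) ∑_c tr M_c ^ 2) ∏_c dM_c` on
`d`-tuples of Hermitian matrices `M_c = herm (A c)`: the real coordinates `A c i j` are
independent centred Gaussians of variance `1/N`. -/
def gaussian (d N : ℕ) : Measure (Arrays d N) :=
  Measure.pi fun _ => Measure.pi fun _ => Measure.pi fun _ => gaussianReal 0 (N : NNReal)⁻¹

/-- `t_a`, without its factor `∏_c α_c ^ a_c`, for `|a| = ∑ a_c ≥ 2`:
`- (1/|a|) (|a| choose a_1, …, a_d) N ^ (d - 2 - (d-2)/2 * |a|)`. -/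
def coupling (d N : ℕ) (a : Fin d →₀ ℕ) : ℂ :=
  if 2 ≤ a.degree then
    -(1 / (a.degree : ℂ)) * (a.multinomial : ℂ) *
      (((N : ℝ) ^ ((d : ℝ) - 2 - ((d : ℝ) - 2) / 2 * (a.degree : ℝ)) : ℝ) : ℂ)
  else 0

/-- Minus the `α`-dependent part of the action, `- N ^ (2-d) ∑_a t_a ∏_c tr M_c ^ a_c`, which is
`tr ∑_{p ≥ 2} N ^ ((2-d) p / 2) / p * (∑_c α_c 1 ⊗ ⋯ ⊗ M_c ⊗ ⋯ ⊗ 1) ^ p`,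
as a formal power series in the `α_c`. -/
def interaction (d N : ℕ) (A : Arrays d N) : Ser d := fun a =>
  -((N : ℂ) ^ (2 - (d : ℤ))) * coupling d N a * ∏ c, (herm (A c) ^ a c).trace

/-- Exponential of a power series without constant term. -/
def expSer {d : ℕ} (V : Ser d) : Ser d := fun m =>
  ∑ k ∈ Finset.range (m.degree + 1), ((k.factorial : ℂ))⁻¹ * MvPowerSeries.coeff m (V ^ k)

/-- Coefficientwise Gaussian integral. -/
def formalIntegral {d N : ℕ} (F : Arrays d N → Ser d) : Ser d := fun m =>
  ∫ A, MvPowerSeries.coeff m (F A) ∂(gaussian d N)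

/-- The expectation `⟨∏_{i ∈ S} tr M_{c i} ^ p i⟩` in the matrix model. -/
def expectation (d N : ℕ) {n : ℕ} (c : Fin n → Fin d) (p : Fin n → ℕ) (S : Finset (Fin n)) :
    Ser d :=
  formalIntegral (fun A : Arrays d N =>
      MvPowerSeries.C (∏ i ∈ S, (herm (A (c i)) ^ p i).trace) * expSer (interaction d N A)) *
    (formalIntegral fun A : Arrays d N => expSer (interaction d N A))⁻¹

/-- The connected correlation (joint cumulant) of `tr M_{c i} ^ p i`, `i = 1, …, n`, `n ≥ 1`. -/
def connected (d N : ℕ) {n : ℕ} (c : Fin n → Fin d) (p : Fin n → ℕ) : Ser d :=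
  ∑ π : Finpartition (Finset.univ : Finset (Fin n)),
    (-1 : Ser d) ^ (π.parts.card - 1) * ((π.parts.card - 1).factorial : Ser d) *
      ∏ S ∈ π.parts, expectation d N c p S

/-! ### Topological expansion -/

/-- `f N = ∑_g N ^ (2 - n - 2g) u_g` for every `N ≥ 1`, with finitely many non-zero terms. -/
def IsGenusExpansion (n : ℕ) (f : ℕ → ℂ) (u : ℕ → ℂ) : Prop :=
  (Function.support u).Finite ∧
    ∀ N : ℕ, 1 ≤ N → f N = ∑ᶠ g : ℕ, u g * (N : ℂ) ^ (2 - (n : ℤ) - 2 * (g : ℤ))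

/-- The genus `g`, `n`-point coefficients, indexed by `g`, `n`, the colours and the exponents. -/
abbrev GenusData (d : ℕ) : Type := ℕ → ∀ n : ℕ, (Fin n → Fin d) → (Fin n → ℕ) → Ser d

/-- `w` is the topological expansion of the connected correlations of the model, at each order
in the `α_c`. It determines `w g n` for all `n ≥ 1`. -/
def IsTopologicalExpansion (d : ℕ) (w : GenusData d) : Prop :=
  ∀ n : ℕ, 1 ≤ n → ∀ (c : Fin n → Fin d) (p : Fin n → ℕ) (m : Fin d →₀ ℕ),
    IsGenusExpansion n (fun N => MvPowerSeries.coeff m (connected d N c p))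
      (fun g => MvPowerSeries.coeff m (w g n c p))

/-! ### The disconnected spectral curve and the correlation forms -/

/-- The spectral curve: one copy of the plane of the Joukowsky variable for each colour. -/
abbrev Curve (d : ℕ) : Type := Fin d × ℂ

/-- `√(1 - α_c ^ 2)`, the root with constant term `1`. -/
def sqrtOneSub {d : ℕ} (c : Fin d) : Ser d :=
  (PowerSeries.binomialSeries ℂ (1 / 2 : ℚ)).subst (-(MvPowerSeries.X c : Ser d) ^ 2)

/-- `x^{(c)}(z) = (z + 1/z) / √(1 - α_c ^ 2)`. -/
def xCurve {d : ℕ} (q : Curve d) : Ser d :=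
  MvPowerSeries.C (q.2 + q.2⁻¹) * (sqrtOneSub q.1)⁻¹

/-- The derivative of `x^{(c)}(z)` in `z`. -/
def dxCurve {d : ℕ} (q : Curve d) : Ser d :=
  MvPowerSeries.C (1 - (q.2 ^ 2)⁻¹) * (sqrtOneSub q.1)⁻¹

/-- Where the continued functions `W_n^g(x(z_1), …, x(z_n))` are regular: away from `z_i = 0`,
from the ramification points `z_i = ±1`, and from `z_i z_j = 1`. -/
def regularDomain (n : ℕ) : Set (Fin n → ℂ) :=
  {z | (∀ i, z i ≠ 0 ∧ z i ≠ 1 ∧ z i ≠ -1) ∧ ∀ i j, i ≠ j → z i * z j ≠ 1}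

/-- An `n`-form `f(z_1, …, z_n) dz_1 ⋯ dz_n` on the curve is given by its coefficient `f`. -/
abbrev Form (d n : ℕ) : Type := (Fin n → Curve d) → Ser d

/-- `F` is the global form `W_n^g(x(z_1), …, x(z_n)) dx(z_1) ⋯ dx(z_n)`, where
`W_n^g(x_1, …, x_n) = ∑_p w(p_1, …, p_n) ∏ x_i ^ (-p_i - 1)` near infinity on each choice of
components, continued analytically (at each order in the `α_c`) to the regular domain. -/
def IsCorrelationForm {d : ℕ} (w : GenusData d) (g n : ℕ) (F : Form d n) : Prop :=
  ∀ (c : Fin n → Fin d) (m : Fin d →₀ ℕ),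
    AnalyticOnNhd ℂ (fun z : Fin n → ℂ => MvPowerSeries.coeff m (F fun i => (c i, z i)))
      (regularDomain n) ∧
    ∃ r : ℝ, ∀ z : Fin n → ℂ, (∀ i, r < ‖z i‖) →
      HasSum (fun p : Fin n → ℕ => MvPowerSeries.coeff m
          (w g n c p * ∏ i, ((xCurve (c i, z i))⁻¹ ^ (p i + 1) * dxCurve (c i, z i))))
        (MvPowerSeries.coeff m (F fun i => (c i, z i)))

/-- `ω_2^0 = (W_2^0(x(z_1), x(z_2)) + 1/(x(z_1) - x(z_2))^2) dx(z_1) dx(z_2)`, the second term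
being present only if both points are on the same component; `F` is the form of `W_2^0`. -/
def omegaTwo {d : ℕ} (F : Form d 2) (q q' : Curve d) : Ser d :=
  F ![q, q'] +
    if q.1 = q'.1 then dxCurve q * dxCurve q' * ((xCurve q - xCurve q') ^ 2)⁻¹ else 0

/-- `G(z, z_1) = ∫^z B(·, z_1)`, a primitive in the first variable on each component. -/
def IsPrimitive {d : ℕ} (B G : Curve d → Curve d → Ser d) : Prop :=
  ∀ (c : Fin d) (q : Curve d) (m : Fin d →₀ ℕ) (z : ℂ),
    q.2 ≠ 0 → q.2 ≠ 1 → q.2 ≠ -1 → z ≠ 0 → z ≠ 1 → z ≠ -1 → z ≠ q.2 → z * q.2 ≠ 1 →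
      HasDerivAt (fun u : ℂ => MvPowerSeries.coeff m (G (c, u) q))
        (MvPowerSeries.coeff m (B (c, z) q)) z

/-! ### Polar and holomorphic projections, blobs -/

/-- Residue of `f` at an isolated singularity `p`. -/
def residue (f : ℂ → ℂ) (p : ℂ) : ℂ :=
  limUnder (𝓝[>] (0 : ℝ)) fun ε : ℝ =>
    (2 * (Real.pi : ℂ) * Complex.I)⁻¹ * ∮ u in C(p, ε), f u

/-- Residue, coefficientwise in the `α_c`. -/
def residueSer {d : ℕ} (f : ℂ → Ser d) (p : ℂ) : Ser d := fun m =>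
  residue (fun u => MvPowerSeries.coeff m (f u)) p

/-- The polar projection in the `i`-th variable: the sum over the zeroes `±1` of `dx` on all
components of `Res_{z → ±1} ω(…, z, …) G(z, z_i)`. -/
def polarPart {d n : ℕ} (G : Curve d → Curve d → Ser d) (i : Fin n) (ω : Form d n) : Form d n :=
  fun q => ∑ c : Fin d, ∑ p ∈ ({1, -1} : Finset ℂ),
    residueSer (fun u => ω (Function.update q i (c, u)) * G (c, u) (q i)) p

/-- The holomorphic projection `H_i = 1 - P_i`. -/
def holPart {d n : ℕ} (G : Curve d → Curve d → Ser d) (i : Fin n) (ω : Form d n) : Form d n :=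
  fun q => ω q - polarPart G i ω q

/-- `H_1 H_2 ⋯ H_n ω`. -/
def holPartAll {d n : ℕ} (G : Curve d → Curve d → Ser d) (ω : Form d n) : Form d n :=
  (List.finRange n).foldr (fun i f => holPart G i f) ω

/-- `φ` is the blob `φ_n^h = H_1 ⋯ H_n ω_n^h` of the quartic melonic model with `d` colours
(for `n ≥ 1` and `2h - 2 + n > 0`, so that `ω_n^h` is just the form of `W_n^h`). -/
def IsBlob (d h n : ℕ) (φ : Form d n) : Prop :=
  ∃ (w : GenusData d) (ω : Form d n) (F : Form d 2) (G : Curve d → Curve d → Ser d),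
    IsTopologicalExpansion d w ∧ IsCorrelationForm w h n ω ∧ IsCorrelationForm w 0 2 F ∧
      IsPrimitive (omegaTwo F) G ∧ φ = holPartAll G ω

/-- The blob `φ_n^h` is well defined and vanishes identically. -/
def BlobVanishes (d h n : ℕ) : Prop :=
  (∃ φ : Form d n, IsBlob d h n φ) ∧
    ∀ φ : Form d n, IsBlob d h n φ →
      ∀ q : Fin n → Curve d, (fun i => (q i).2) ∈ regularDomain n → φ q = 0

/-- The topological expansion of the potential: when the multi-trace term of multidegree `a` is
written as `N ^ 2 t_a ∏_c (tr M_c ^ a_c / N)`, its prefactor is `∑_h N ^ (2 - 2h) T_h(a)`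
(times `∏_c α_c ^ a_c`). -/
def IsPotentialExpansion (d : ℕ) (T : ℕ → (Fin d →₀ ℕ) → ℂ) : Prop :=
  ∀ a : Fin d →₀ ℕ,
    IsGenusExpansion 0 (fun N => (N : ℂ) ^ 2 * coupling d N a) (fun h => T h a)

end QuarticMelonic

end

/-! For `d = 4δ + 2` a vertex of degree `p` enters the loop equations with relative weight `N ^
(-2δ(p - 2))`. Below genus `δ` the model is therefore indistinguishable from one with a quadratic
potential: the terms `α_c ^ 2` change the variance of colour `c`, and the terms `α_c α_c'` couple
`tr M_c` to `tr M_c'`. A quadratic potential with such bilinear couplings has correlations governed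
by their poles at the ramification points, and this is what makes the blobs vanish.

The loop equations come from Gaussian integration by parts. Written for the logarithm of the
generating function of the moments of `N tr M_c ^ k`, they are a recursion in the order in `α` and
in the total exponent. The recursion shows that every coefficient is a polynomial in `N ^ (-2)`
(`scaledLog_polyBelow`), so that the topological expansion exists, and that it can be read genus by
genus (`genusKappa_loop`). Rescaling colour `c` by `√(1 - α_c ^ 2)` turns the equations into a
`LoopSystem`.

In such a system let `t = 1/x`, `y = √(x ^ 2 - 4)`, and let `spec` be twice the resolvent minus the
derivative of the effective potential, which contains the sources and the linear potential created
by the other colours. Completing the square, the loop equation says that `spec ^ 2` plus a term of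
lower genus is a polynomial in `x` (`topLe_spec_sq`). The leading term of `spec` is `-y`
(`one_sub_row`), and induction on `2g + n` shows that every stable `spec` is a polynomial in `x`
divided by an odd power of `y` (`exists_adm_spec`). In the coordinate `z` this oddness is the
oddness under `z ↦ 1/z`.

Hence each stable form is, in each variable, a finite combination of the forms `basisForm M j`. For
`j ≥ 2` these have poles at `z = ±1` only, and vanish at infinity to second order; `j = 1` is
excluded because `tr 1` has no fluctuations. The form `j = 0` is `2 dz / z ^ 2`, which has no pole
at `±1`; it carries the linear potential, and its coefficient is a linear response to the
coefficients of `j = 2` through a matrix `kmat` (`NoZero.two_polC_zero`, `eq_sum_kmat`). The same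
matrix appears in the two-point function: `ω_2^0` is `dz dw / (z - w) ^ 2` on the diagonal
components plus `kmat dz dw / (z ^ 2 w ^ 2)`. In the polar projection the first part of the kernel
reproduces the forms `j ≥ 2` by partial fractions, and the second part reproduces exactly the form
`j = 0`. So `P` acts as the identity in the last variable (`polarPart_last_omegaForm`), `H_n ω = 0`,
and the other projections preserve zero.

The blob is well defined because the expansion is determined by infinitely many values of `N`, the
forms by analytic continuation over a connected domain, and the primitive `G` up to constants, whose
contribution vanishes as the total residue at `±1` is zero. -/

noncomputable section

namespace QuarticMelonic

/-! ### Generating functions of sources -/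

/-- Functions on multisets of labels, multiplied by convolution over sub-multisets: the algebra of
exponential generating functions with one source for each label. -/
@[ext]
structure Src (A T : Type*) where
  /-- The value at a multiset. -/
  toFun : Multiset T → A

namespace Src

variable {A B T : Type*}

instance : CoeFun (Src A T) fun _ => Multiset T → A := ⟨toFun⟩

theorem ext' {f g : Src A T} (h : ∀ P, f P = g P) : f = g := Src.ext (funext h)

@[simp] theorem mk_apply (f : Multiset T → A) (P : Multiset T) : (⟨f⟩ : Src A T) P = f P := rfl

/-- Differentiation with respect to the source of the label `a`. -/
def der (a : T) (f : Src A T) : Src A T := ⟨fun P => f (a ::ₘ P)⟩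

@[simp] theorem der_apply (a : T) (f : Src A T) (P : Multiset T) : der a f P = f (a ::ₘ P) := rfl

theorem der_comm (a b : T) (f : Src A T) : der a (der b f) = der b (der a f) := by
  refine ext' fun P => ?_; simp [Multiset.cons_swap]

section Ring

variable [CommRing A]

instance : Zero (Src A T) := ⟨⟨fun _ => 0⟩⟩
instance : Add (Src A T) := ⟨fun f g => ⟨fun P => f P + g P⟩⟩
instance : Neg (Src A T) := ⟨fun f => ⟨fun P => -f P⟩⟩
instance : Sub (Src A T) := ⟨fun f g => ⟨fun P => f P - g P⟩⟩

@[simp] theorem add_apply (f g : Src A T) (P : Multiset T) : (f + g) P = f P + g P := rfl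
@[simp] theorem sub_apply (f g : Src A T) (P : Multiset T) : (f - g) P = f P - g P := rfl
@[simp] theorem neg_apply (f : Src A T) (P : Multiset T) : (-f) P = -f P := rfl
@[simp] theorem zero_apply (P : Multiset T) : (0 : Src A T) P = 0 := rfl

instance : AddCommGroup (Src A T) where
  add_assoc f g k := by refine ext' fun P => ?_; simp [add_assoc]
  zero_add f := by refine ext' fun P => ?_; simp
  add_zero f := by refine ext' fun P => ?_; simp
  add_comm f g := by refine ext' fun P => ?_; simp [add_comm]
  neg_add_cancel f := by refine ext' fun P => ?_; simp
  sub_eq_add_neg f g := by refine ext' fun P => ?_; simp [sub_eq_add_neg]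
  zsmul := zsmulRec
  nsmul := nsmulRec

/-- Evaluation at a multiset. -/
def evalHom (P : Multiset T) : Src A T →+ A where
  toFun f := f P
  map_zero' := rfl
  map_add' _ _ := rfl

@[simp] theorem sum_apply {ι : Type*} (s : Finset ι) (f : ι → Src A T) (P : Multiset T) :
    (∑ i ∈ s, f i) P = ∑ i ∈ s, f i P :=
  map_sum (evalHom P) f s

instance : Mul (Src A T) :=
  ⟨fun f g => ⟨fun P => (P.antidiagonal.map fun q => f q.1 * g q.2).sum⟩⟩

theorem mul_apply (f g : Src A T) (P : Multiset T) :
    (f * g) P = (P.antidiagonal.map fun q => f q.1 * g q.2).sum := rfl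

instance : One (Src A T) := ⟨⟨fun P => if P.card = 0 then 1 else 0⟩⟩

theorem one_apply (P : Multiset T) : (1 : Src A T) P = if P.card = 0 then 1 else 0 := rfl

@[simp] theorem one_apply_zero : (1 : Src A T) 0 = 1 := by simp [one_apply]

@[simp] theorem one_apply_cons (a : T) (P : Multiset T) : (1 : Src A T) (a ::ₘ P) = 0 := by
  simp [one_apply]

@[simp] theorem mul_apply_zero (f g : Src A T) : (f * g) 0 = f 0 * g 0 := by
  simp [mul_apply]

theorem mul_apply_cons (f g : Src A T) (a : T) (P : Multiset T) :
    (f * g) (a ::ₘ P) = (der a f * g) P + (f * der a g) P := by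
  simp [mul_apply, Multiset.antidiagonal_cons, add_comm]

theorem der_mul (a : T) (f g : Src A T) : der a (f * g) = der a f * g + f * der a g := by
  refine ext' fun P => ?_; simp [mul_apply_cons]

@[simp] theorem der_one (a : T) : der a (1 : Src A T) = 0 := by refine ext' fun P => ?_; simp
@[simp] theorem der_add (a : T) (f g : Src A T) : der a (f + g) = der a f + der a g := rfl

theorem add_mul' (f g k : Src A T) : (f + g) * k = f * k + g * k := by
  refine ext' fun P => ?_; simp [mul_apply, add_mul]

theorem mul_add' (f g k : Src A T) : f * (g + k) = f * g + f * k := by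
  refine ext' fun P => ?_; simp [mul_apply, mul_add]

instance : CommRing (Src A T) where
  __ := (inferInstance : AddCommGroup (Src A T))
  left_distrib := mul_add'
  right_distrib := add_mul'
  zero_mul f := by refine ext' fun P => ?_; simp [mul_apply]
  mul_zero f := by refine ext' fun P => ?_; simp [mul_apply]
  mul_assoc f g k := by
    refine ext' fun P => ?_
    induction P using Multiset.induction generalizing f g k with
    | empty => simp [mul_assoc]
    | cons a P ih =>
      rw [mul_apply_cons, mul_apply_cons, der_mul, der_mul, add_mul', mul_add']
      simp [ih, add_assoc]
  mul_comm f g := by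
    refine ext' fun P => ?_
    induction P using Multiset.induction generalizing f g with
    | empty => simp [mul_comm]
    | cons a P ih =>
      rw [mul_apply_cons, mul_apply_cons, ih, ih f, add_comm]
  one_mul f := by
    refine ext' fun P => ?_
    induction P using Multiset.induction generalizing f with
    | empty => simp
    | cons a P ih => rw [mul_apply_cons, ih, der_one]; simp [mul_apply]
  mul_one f := by
    refine ext' fun P => ?_
    induction P using Multiset.induction generalizing f with
    | empty => simp
    | cons a P ih => rw [mul_apply_cons, ih, der_one]; simp [mul_apply]
  zsmul := zsmulRec
  nsmul := nsmulRec

/-- Source-independent generating functions. -/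
def const (x : A) : Src A T := ⟨fun P => if P.card = 0 then x else 0⟩

@[simp] theorem const_apply_zero (x : A) : (const x : Src A T) 0 = x := by simp [const]
@[simp] theorem const_apply_cons (x : A) (a : T) (P : Multiset T) :
    (const x : Src A T) (a ::ₘ P) = 0 := by simp [const]
@[simp] theorem der_const (a : T) (x : A) : der a (const x : Src A T) = 0 := by refine ext' fun P => ?_; simp

@[simp] theorem const_mul_apply (x : A) (f : Src A T) (P : Multiset T) :
    ((const x : Src A T) * f) P = x * f P := by
  induction P using Multiset.induction generalizing f with
  | empty => simp
  | cons a P ih => rw [mul_apply_cons, ih, der_const]; simp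

@[simp] theorem der_const_mul (a : T) (x : A) (f : Src A T) :
    der a (const x * f) = const x * der a f := by refine ext' fun P => ?_; simp

/-- Generating functions that agree up to some number of labels have products which agree there. -/
theorem mul_apply_congr {f f' g g' : Src A T} {P : Multiset T}
    (h : ∀ I ≤ P, f I = f' I) (h' : ∀ I ≤ P, g I = g' I) : (f * g) P = (f' * g') P := by
  rw [mul_apply, mul_apply]
  congr 1
  refine Multiset.map_congr rfl fun q hq => ?_
  rw [Multiset.mem_antidiagonal] at hq
  rw [h _ (hq ▸ Multiset.le_add_right _ _), h' _ (hq ▸ Multiset.le_add_left _ _)]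

/-- Distributing fewer than `k` labels over `k` factors leaves one factor without labels. This makes
the geometric series in `inv` finite on each multiset. -/
theorem pow_apply_eq_zero {f : Src A T} (h : f 0 = 0) {k : ℕ} {P : Multiset T}
    (hk : P.card < k) : (f ^ k) P = 0 := by
  induction k generalizing P with
  | zero => simp at hk
  | succ k ih =>
    rw [pow_succ, mul_apply]
    refine Multiset.sum_eq_zero fun x hx => ?_
    obtain ⟨q, hq, rfl⟩ := Multiset.mem_map.1 hx
    rw [Multiset.mem_antidiagonal] at hq
    rcases Nat.eq_zero_or_pos q.2.card with h0 | h0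
    · rw [Multiset.card_eq_zero.1 h0, h, mul_zero]
    · rw [ih, zero_mul]
      have := congrArg Multiset.card hq
      rw [Multiset.card_add] at this
      omega

/-- The multiplicative inverse of a generating function with constant term `1`. -/
def inv (f : Src A T) : Src A T := ⟨fun P => (∑ k ∈ Finset.range (P.card + 1), (1 - f) ^ k) P⟩

theorem mul_inv {f : Src A T} (h : f 0 = 1) : f * inv f = 1 := by
  refine ext' fun P => ?_
  have h0 : (1 - f) 0 = 0 := by simp [h]
  -- A single truncation order, fixed by `P`, serves all sub-multisets that occur in the
  -- convolution.
  have key : ∀ I ≤ P, inv f I = (∑ k ∈ Finset.range (P.card + 1), (1 - f) ^ k) I := by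
    intro I hI
    have hc := Multiset.card_le_card hI
    rw [inv, sum_apply, sum_apply]
    refine Finset.sum_subset (Finset.range_mono (by omega)) fun k _ hk => ?_
    exact pow_apply_eq_zero h0 (by simpa using hk)
  rw [mul_apply_congr (fun I _ => rfl) key]
  have := mul_neg_geom_sum (1 - f) (P.card + 1)
  rw [sub_sub_cancel] at this
  rw [this, sub_apply, pow_apply_eq_zero h0 (Nat.lt_succ_self _), sub_zero]

/-- The effect of a change of coefficients. -/
def map [CommRing B] (φ : A →+* B) (f : Src A T) : Src B T := ⟨fun P => φ (f P)⟩

@[simp] theorem map_apply [CommRing B] (φ : A →+* B) (f : Src A T) (P : Multiset T) :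
    map φ f P = φ (f P) := rfl

theorem map_mul [CommRing B] (φ : A →+* B) (f g : Src A T) : map φ (f * g) = map φ f * map φ g := by
  refine ext' fun P => ?_; simp [mul_apply, map_multiset_sum]

theorem map_one [CommRing B] (φ : A →+* B) : map φ (1 : Src A T) = 1 := by
  refine ext' fun P => ?_; simp only [map_apply, one_apply]; split_ifs <;> simp

/-- Multiplication of all sources by a scalar. -/
def scale (x : A) (f : Src A T) : Src A T := ⟨fun P => x ^ P.card * f P⟩

@[simp] theorem scale_apply (x : A) (f : Src A T) (P : Multiset T) :
    scale x f P = x ^ P.card * f P := rfl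

theorem der_scale (x : A) (a : T) (f : Src A T) :
    der a (scale x f) = const x * scale x (der a f) := by
  refine ext' fun P => ?_; simp [pow_succ]; ring

theorem scale_mul (x : A) (f g : Src A T) : scale x (f * g) = scale x f * scale x g := by
  refine ext' fun P => ?_
  induction P using Multiset.induction generalizing f g with
  | empty => simp
  | cons a P ih =>
    have : scale x (f * g) (a ::ₘ P) = x * scale x (der a (f * g)) P := by
      simp [pow_succ]; ring
    rw [this, der_mul, mul_apply_cons, der_scale, der_scale]
    have h : scale x (der a f * g + f * der a g) P =
      scale x (der a f * g) P + scale x (f * der a g) P := by simp [mul_add]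
    rw [h, ih, ih, mul_assoc, const_mul_apply, mul_left_comm, const_mul_apply, mul_add]

/-! ### Logarithmic derivatives -/

/-- The logarithmic derivative in the source of `a`. -/
def logDer (Z : Src A T) (a : T) : Src A T := der a Z * inv Z

theorem logDer_mul {Z : Src A T} (h : Z 0 = 1) (a : T) : logDer Z a * Z = der a Z := by
  rw [logDer, mul_assoc, mul_comm (inv Z), mul_inv h, mul_one]

theorem mul_right_cancel_of_zero {Z f g : Src A T} (h : Z 0 = 1) (hfg : f * Z = g * Z) : f = g := by
  have := congrArg (· * inv Z) hfg
  simpa [mul_assoc, mul_inv h] using this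

/-- Closedness of `d log Z`: differentiate `∂_a Z = L_a Z` once more and use that derivatives
commute. It makes `log` independent of the label chosen in its definition, without any denominators
in the coefficient ring. -/
theorem der_logDer_comm {Z : Src A T} (h : Z 0 = 1) (a b : T) :
    der b (logDer Z a) = der a (logDer Z b) := by
  refine mul_right_cancel_of_zero h ?_
  have h1 := congrArg (der b) (logDer_mul h a)
  have h2 := congrArg (der a) (logDer_mul h b)
  rw [der_mul, ← logDer_mul h b] at h1
  rw [der_mul, ← logDer_mul h a] at h2
  rw [der_comm b a, ← h2] at h1
  linear_combination h1

open Classical in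
/-- A logarithm of `Z`: its derivatives are the logarithmic derivatives of `Z`. -/
def log (Z : Src A T) : Src A T :=
  ⟨fun X => if h : ∃ a : T, a ∈ X then logDer Z h.choose (X.erase h.choose) else 0⟩

theorem der_log {Z : Src A T} (hZ : Z 0 = 1) (a : T) : der a (log Z) = logDer Z a := by
  classical
  refine ext' fun P => ?_
  have h : ∃ b : T, b ∈ a ::ₘ P := ⟨a, Multiset.mem_cons_self a P⟩
  have hb : h.choose ::ₘ ((a ::ₘ P).erase h.choose) = a ::ₘ P :=
    Multiset.cons_erase h.choose_spec
  have he : log Z (a ::ₘ P) = logDer Z h.choose ((a ::ₘ P).erase h.choose) := by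
    rw [log, mk_apply, dif_pos h]
    try congr
  rw [der_apply, he]
  generalize h.choose = b at hb
  generalize (a ::ₘ P).erase b = Q at hb
  -- Either the chosen label is `a` itself, or both labels are present and closedness exchanges
  -- them.
  rcases Multiset.cons_eq_cons.1 hb with ⟨rfl, rfl⟩ | ⟨_, R, rfl, rfl⟩
  · rfl
  · exact congrArg (fun f : Src A T => f R) (der_logDer_comm hZ b a)

theorem log_unique {Z κ : Src A T} (hZ : Z 0 = 1) (h : ∀ a, der a κ * Z = der a Z) {X : Multiset T}
    (hX : X ≠ 0) : κ X = log Z X := by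
  obtain ⟨a, P, rfl⟩ : ∃ a P, X = a ::ₘ P := by
    obtain ⟨a, ha⟩ := Multiset.exists_mem_of_ne_zero hX
    exact ⟨a, _, (Multiset.exists_cons_of_mem ha).choose_spec⟩
  have : der a κ = der a (log Z) :=
    mul_right_cancel_of_zero hZ (by rw [h, der_log hZ, logDer_mul hZ])
  exact congrArg (fun f : Src A T => f P) this

/-! ### Shifts of sources -/

/-- For every source `j` in the multiset: replace it by `e j`, with weight `p j`, and insert into the
family `K` the new label. -/
def shift [DecidableEq T] (p : T → A) (e : T → T) (K : T → Src A T) : Src A T :=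
  ⟨fun P => (P.map fun j => p j * K (e j) (P.erase j)).sum⟩

variable [DecidableEq T] (p : T → A) (e : T → T)

@[simp] theorem shift_apply_zero (K : T → Src A T) : shift p e K 0 = 0 := by simp [shift]

theorem shift_apply_cons (K : T → Src A T) (b : T) (P : Multiset T) :
    shift p e K (b ::ₘ P) = p b * K (e b) P + shift p e (fun a => der b (K a)) P := by
  simp only [shift, Multiset.map_cons, Multiset.sum_cons, Multiset.erase_cons_head, der_apply]
  congr 2
  refine Multiset.map_congr rfl fun j hj => ?_
  by_cases hjb : j = b
  · subst hjb; rw [Multiset.erase_cons_head, Multiset.cons_erase hj]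
  · rw [Multiset.erase_cons_tail _ (Ne.symm hjb)]

/-- The source that is moved is counted with `K`, while the others are distributed freely over the
two factors. This allows `Z` to be cancelled from the loop equations. -/
theorem shift_mul (K : T → Src A T) (Z : Src A T) :
    shift p e (fun a => K a * Z) = shift p e K * Z := by
  refine ext' fun P => ?_
  induction P using Multiset.induction generalizing K Z with
  | empty => simp
  | cons b P ih =>
    have hd : der b (shift p e K) = const (p b) * K (e b) + shift p e (fun a => der b (K a)) := by
      refine ext' fun Q => ?_; simp [shift_apply_cons]
    rw [shift_apply_cons, mul_apply_cons, hd, add_mul, add_apply, ← ih, ← ih, mul_assoc,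
      const_mul_apply, add_assoc]
    congr 1
    simp only [shift, der_mul, add_apply, mul_add, Multiset.sum_map_add]

end Ring

end Src

/-! ### Joint cumulants -/

section Cumulants

variable {ι A T : Type*} [DecidableEq ι] [CommRing A]

/-- `Q` is the set of blocks of a partition of `s`. -/
def IsBlockSet (s : Finset ι) (Q : Finset (Finset ι)) : Prop :=
  (∀ B ∈ Q, B ⊆ s) ∧ ∅ ∉ Q ∧ ∀ x ∈ s, ∃! B, B ∈ Q ∧ x ∈ B

open Classical in
/-- The block sets of all partitions of `s`. -/
def blockSets (s : Finset ι) : Finset (Finset (Finset ι)) :=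
  s.powerset.powerset.filter (IsBlockSet s)

theorem mem_blockSets {s : Finset ι} {Q : Finset (Finset ι)} :
    Q ∈ blockSets s ↔ IsBlockSet s Q := by
  simp only [blockSets, Finset.mem_filter, Finset.mem_powerset, and_iff_right_iff_imp]
  exact fun h B hB => Finset.mem_powerset.2 (h.1 B hB)

theorem sum_finpartition_eq (s : Finset ι) (F : Finset (Finset ι) → A) :
    ∑ π : Finpartition s, F π.parts = ∑ Q ∈ blockSets s, F Q := by
  refine Finset.sum_bij' (i := fun π _ => π.parts)
    (j := fun Q hQ => Finpartition.ofExistsUnique Q (mem_blockSets.1 hQ).1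
      (mem_blockSets.1 hQ).2.2 (mem_blockSets.1 hQ).2.1) ?_ ?_ ?_ ?_ ?_
  · intro π _
    exact mem_blockSets.2 ⟨fun B hB => π.le hB, π.empty_notMem_parts,
      fun x hx => π.existsUnique_mem hx⟩
  · intros; simp
  · intro π _; ext1; rfl
  · intros; rfl
  · intros; rfl

/-- The Möbius weight of a partition with `k` blocks. -/
def mobius (k : ℕ) : A := (-1 : A) ^ (k - 1) * ((k - 1).factorial : A)

/-- The joint cumulant with joint moments `m`. -/
def cumulant (m : Finset ι → A) (s : Finset ι) : A :=
  ∑ π : Finpartition s, mobius π.parts.card * ∏ B ∈ π.parts, m B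

theorem cumulant_eq (m : Finset ι → A) (s : Finset ι) :
    cumulant m s = ∑ Q ∈ blockSets s, mobius Q.card * ∏ B ∈ Q, m B :=
  sum_finpartition_eq s fun Q => mobius Q.card * ∏ B ∈ Q, m B

theorem IsBlockSet.eq_of_mem {s : Finset ι} {Q : Finset (Finset ι)} (h : IsBlockSet s Q)
    {B C : Finset ι} (hB : B ∈ Q) (hC : C ∈ Q) {x : ι} (hxB : x ∈ B) (hxC : x ∈ C) : B = C :=
  (h.2.2 x (h.1 B hB hxB)).unique ⟨hB, hxB⟩ ⟨hC, hxC⟩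

theorem IsBlockSet.erase {s : Finset ι} {Q : Finset (Finset ι)} (h : IsBlockSet s Q)
    {C : Finset ι} (hC : C ∈ Q) : IsBlockSet (s \ C) (Q.erase C) := by
  refine ⟨fun B hB x hx => ?_, fun h0 => h.2.1 (Finset.mem_of_mem_erase h0), fun x hx => ?_⟩
  · rw [Finset.mem_erase] at hB
    exact Finset.mem_sdiff.2 ⟨h.1 B hB.2 hx, fun hxC => hB.1 (h.eq_of_mem hB.2 hC hx hxC)⟩
  · rw [Finset.mem_sdiff] at hx
    obtain ⟨B, ⟨hB, hxB⟩, hu⟩ := h.2.2 x hx.1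
    refine ⟨B, ⟨Finset.mem_erase.2 ⟨?_, hB⟩, hxB⟩, fun D hD => hu D ⟨(Finset.mem_erase.1 hD.1).2, hD.2⟩⟩
    rintro rfl
    exact hx.2 hxB

theorem IsBlockSet.insert {s B : Finset ι} {Q : Finset (Finset ι)} (h : IsBlockSet B Q)
    (hB : B ⊆ s) (hne : s \ B ≠ ∅) : IsBlockSet s (insert (s \ B) Q) := by
  refine ⟨fun D hD => ?_, fun h0 => ?_, fun x hx => ?_⟩
  · rcases Finset.mem_insert.1 hD with rfl | hD
    · exact Finset.sdiff_subset
    · exact (h.1 D hD).trans hB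
  · rcases Finset.mem_insert.1 h0 with h0 | h0
    · exact hne h0.symm
    · exact h.2.1 h0
  · by_cases hxB : x ∈ B
    · obtain ⟨D, ⟨hD, hxD⟩, hu⟩ := h.2.2 x hxB
      refine ⟨D, ⟨Finset.mem_insert_of_mem hD, hxD⟩, fun E hE => ?_⟩
      rcases Finset.mem_insert.1 hE.1 with h1 | h1
      · rw [h1, Finset.mem_sdiff] at hE
        exact absurd hxB hE.2.2
      · exact hu E ⟨h1, hE.2⟩
    · refine ⟨s \ B, ⟨Finset.mem_insert_self _ _, Finset.mem_sdiff.2 ⟨hx, hxB⟩⟩, fun E hE => ?_⟩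
      rcases Finset.mem_insert.1 hE.1 with h1 | h1
      · exact h1
      · exact absurd (h.1 E h1 hE.2) hxB

theorem IsBlockSet.sdiff_notMem {s B : Finset ι} {Q : Finset (Finset ι)} (h : IsBlockSet B Q)
    (hne : s \ B ≠ ∅) : s \ B ∉ Q := by
  intro hQ
  obtain ⟨x, hx⟩ := Finset.nonempty_iff_ne_empty.2 hne
  exact (Finset.mem_sdiff.1 hx).2 (h.1 _ hQ hx)

theorem mobius_succ {k : ℕ} (hk : 1 ≤ k) : (mobius (k + 1) : A) = -(k * mobius k) := by
  obtain ⟨k, rfl⟩ := Nat.exists_eq_add_of_le' hk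
  simp only [mobius, Nat.add_sub_cancel, pow_succ, Nat.factorial_succ]
  push_cast; ring

/-- Partitions with a marked block not containing `i`, in two ways. -/
theorem sum_marked_blockSets (s : Finset ι) (i : ι) (hi : i ∈ s) (F : Finset (Finset ι) → Finset ι → A) :
    ∑ B ∈ s.ssubsets.filter (i ∈ ·), ∑ Q ∈ blockSets B, F (insert (s \ B) Q) (s \ B) =
      ∑ Q ∈ blockSets s, ∑ C ∈ Q.filter (i ∉ ·), F Q C := by
  rw [Finset.sum_sigma', Finset.sum_sigma']
  refine Finset.sum_bij' (i := fun q _ => ⟨insert (s \ q.1) q.2, s \ q.1⟩)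
    (j := fun q _ => ⟨s \ q.2, q.1.erase q.2⟩) ?_ ?_ ?_ ?_ ?_
  · rintro ⟨B, Q⟩ hq
    simp only [Finset.mem_sigma, Finset.mem_filter, Finset.mem_ssubsets, mem_blockSets] at hq ⊢
    have hne : s \ B ≠ ∅ := fun h => hq.1.1.2 (Finset.sdiff_eq_empty_iff_subset.1 h)
    exact ⟨hq.2.insert hq.1.1.1 hne, Finset.mem_insert_self _ _, by simp [hq.1.2]⟩
  · rintro ⟨Q, C⟩ hq
    simp only [Finset.mem_sigma, Finset.mem_filter, Finset.mem_ssubsets, mem_blockSets] at hq ⊢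
    refine ⟨⟨⟨Finset.sdiff_subset, fun h => ?_⟩, Finset.mem_sdiff.2 ⟨hi, hq.2.2⟩⟩, hq.1.erase hq.2.1⟩
    obtain ⟨x, hx⟩ := Finset.nonempty_iff_ne_empty.2 fun h0 => hq.1.2.1 (h0 ▸ hq.2.1)
    exact (Finset.mem_sdiff.1 (h (hq.1.1 _ hq.2.1 hx))).2 hx
  · rintro ⟨B, Q⟩ hq
    simp only [Finset.mem_sigma, Finset.mem_filter, Finset.mem_ssubsets, mem_blockSets] at hq
    have hne : s \ B ≠ ∅ := fun h => hq.1.1.2 (Finset.sdiff_eq_empty_iff_subset.1 h)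
    have h1 : s \ (s \ B) = B := Finset.sdiff_sdiff_eq_self hq.1.1.1
    simp only [Finset.erase_insert (hq.2.sdiff_notMem hne), h1]
  · rintro ⟨Q, C⟩ hq
    simp only [Finset.mem_sigma, Finset.mem_filter, mem_blockSets] at hq
    have h1 : s \ (s \ C) = C := Finset.sdiff_sdiff_eq_self (hq.1.1 _ hq.2.1)
    simp only [h1, Finset.insert_erase hq.2.1]
  · intros; rfl

/-- A partition of a proper block `B` completed by `s \ B` is a partition of `s` with a marked block
avoiding `i`. A partition into `k` blocks has `k - 1` such blocks, and `(k - 1) * mobius (k - 1) =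
-mobius k` for `k ≥ 2` cancels its weight in `cumulant m s`. Only the one-block partition survives.
-/
theorem sum_cumulant_mul (m : Finset ι → A) (h0 : m ∅ = 1) {s : Finset ι} {i : ι} (hi : i ∈ s) :
    ∑ B ∈ s.powerset.filter (i ∈ ·), cumulant m B * m (s \ B) = m s := by
  have hsplit : s.powerset.filter (i ∈ ·) = insert s (s.ssubsets.filter (i ∈ ·)) := by
    ext B
    simp only [Finset.mem_filter, Finset.mem_powerset, Finset.mem_insert, Finset.mem_ssubsets]
    constructor
    · rintro ⟨h, h'⟩
      rcases h.eq_or_ssubset with rfl | h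
      · exact Or.inl rfl
      · exact Or.inr ⟨h, h'⟩
    · rintro (rfl | h)
      · exact ⟨subset_rfl, hi⟩
      · exact ⟨h.1.1, h.2⟩
  rw [hsplit, Finset.sum_insert (by simp), Finset.sdiff_self]
  have hrest : ∑ B ∈ s.ssubsets.filter (i ∈ ·), cumulant m B * m (s \ B) =
      ∑ Q ∈ blockSets s, ∑ C ∈ Q.filter (i ∉ ·), mobius (Q.card - 1) * ∏ B ∈ Q, m B := by
    rw [← sum_marked_blockSets s i hi fun Q _ => mobius (Q.card - 1) * ∏ B ∈ Q, m B]
    refine Finset.sum_congr rfl fun B hB => ?_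
    rw [cumulant_eq, Finset.sum_mul]
    refine Finset.sum_congr rfl fun Q hQ => ?_
    rw [Finset.mem_filter, Finset.mem_ssubsets] at hB
    have hne : s \ B ≠ ∅ := fun h => hB.1.2 (Finset.sdiff_eq_empty_iff_subset.1 h)
    have hn := (mem_blockSets.1 hQ).sdiff_notMem hne
    rw [Finset.card_insert_of_notMem hn, Finset.prod_insert hn, Nat.add_sub_cancel]
    ring
  have hone : ∀ Q ∈ blockSets s, (Q.filter (i ∉ ·)).card + 1 = Q.card := by
    intro Q hQ
    obtain ⟨B, ⟨hB, hiB⟩, hu⟩ := (mem_blockSets.1 hQ).2.2 i hi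
    have : Q.filter (i ∉ ·) = Q.erase B := by
      ext C
      simp only [Finset.mem_filter, Finset.mem_erase]
      constructor
      · rintro ⟨h1, h2⟩
        exact ⟨fun h => h2 (h ▸ hiB), h1⟩
      · rintro ⟨h1, h2⟩
        exact ⟨h2, fun h => h1 (hu C ⟨h2, h⟩)⟩
    rw [this, Finset.card_erase_add_one hB]
  have hs : IsBlockSet s {s} := by
    refine ⟨by simp, ?_, fun x hx => ⟨s, by simp [hx], by simp⟩⟩
    rw [Finset.mem_singleton]
    rintro rfl
    simp at hi
  rw [h0, mul_one, hrest, cumulant_eq, ← Finset.sum_add_distrib,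
    Finset.sum_eq_single_of_mem _ (mem_blockSets.2 hs)]
  · have : Finset.filter (i ∉ ·) {s} = ∅ := by
      rw [Finset.filter_singleton, if_neg (by simpa using hi)]
    rw [this]
    simp [mobius]
  · intro Q hQ hne
    have hc := hone Q hQ
    rw [Finset.sum_const, nsmul_eq_mul, ← hc, Nat.add_sub_cancel]
    rcases Nat.eq_zero_or_pos (Q.filter (i ∉ ·)).card with h | h
    · exfalso
      rw [h, zero_add] at hc
      obtain ⟨B, rfl⟩ := Finset.card_eq_one.1 hc.symm
      have hb := mem_blockSets.1 hQ
      have : B = s := by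
        refine subset_antisymm (hb.1 B (by simp)) fun x hx => ?_
        obtain ⟨C, hC, -⟩ := hb.2.2 x hx
        rw [Finset.mem_singleton] at hC
        exact hC.1 ▸ hC.2
      exact hne (this ▸ rfl)
    · rw [mobius_succ h]; ring

/-- Multiset convolution is the sum over subsets of an index set, so repeated labels are counted as
if they were distinguishable. -/
theorem sum_antidiagonal_map (t : ι → T) (s : Finset ι) (f : Multiset T → Multiset T → A) :
    ((s.val.map t).antidiagonal.map fun q => f q.1 q.2).sum =
      ∑ B ∈ s.powerset, f (B.val.map t) ((s \ B).val.map t) := by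
  induction s using Finset.induction_on generalizing f with
  | empty => simp
  | insert i s hi ih =>
    rw [Finset.sum_powerset_insert hi, Finset.insert_val_of_notMem hi, Multiset.map_cons,
      Multiset.antidiagonal_cons, Multiset.map_add, Multiset.sum_add, Multiset.map_map,
      Multiset.map_map]
    congr 1
    · have := ih fun I J => f I (t i ::ₘ J)
      simp only [Function.comp_def, Prod.map_fst, Prod.map_snd, id]
      rw [this]
      refine Finset.sum_congr rfl fun B hB => ?_
      have hiB : i ∉ B := fun h => hi (Finset.mem_powerset.1 hB h)
      rw [Finset.insert_sdiff_of_notMem _ hiB, Finset.insert_val_of_notMem (by simp [hi]),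
        Multiset.map_cons]
    · have := ih fun I J => f (t i ::ₘ I) J
      simp only [Function.comp_def, Prod.map_fst, Prod.map_snd, id]
      rw [this]
      refine Finset.sum_congr rfl fun B hB => ?_
      have hiB : i ∉ B := fun h => hi (Finset.mem_powerset.1 hB h)
      rw [Finset.insert_val_of_notMem hiB, Multiset.map_cons]
      congr 3
      ext x
      simp only [Finset.mem_sdiff, Finset.mem_insert]
      constructor
      · rintro ⟨h1, h2⟩
        exact ⟨Or.inr h1, fun h => h.elim (fun h => hi (h ▸ h1)) h2⟩
      · rintro ⟨h1, h2⟩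
        exact ⟨h1.resolve_left fun h => h2 (Or.inl h), fun h => h2 (Or.inr h)⟩

/-- Cumulants are the coefficients of the logarithm of the generating function of the moments. -/
theorem cumulant_eq_log {Z : Src A T} (hZ : Z 0 = 1) (t : ι → T) {s : Finset ι}
    (hs : s.Nonempty) :
    cumulant (fun B => Z (B.val.map t)) s = Src.log Z (s.val.map t) := by
  induction s using Finset.strongInduction with
  | H s ih =>
    obtain ⟨i, hi⟩ := hs
    set m : Finset ι → A := fun B => Z (B.val.map t) with hm
    -- Cumulants and coefficients of `log` obey the same recursion over the blocks containing `i`.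
    -- The term `B = s` isolates the unknown, and the other terms agree by induction.
    have h1 := sum_cumulant_mul m (by simp [hm, hZ]) hi
    have h2 : ∑ B ∈ s.powerset.filter (i ∈ ·), Src.log Z (B.val.map t) * m (s \ B) = m s := by
      have h3 := congrArg (fun f : Src A T => f ((s.erase i).val.map t)) (Src.logDer_mul hZ (t i))
      simp only [← Src.der_log hZ, Src.mul_apply] at h3
      rw [sum_antidiagonal_map t (s.erase i) fun I J => Src.der (t i) (Src.log Z) I * Z J] at h3
      have hms : t i ::ₘ ((s.erase i).val.map t) = s.val.map t := by
        rw [← Multiset.map_cons, Finset.erase_val, Multiset.cons_erase hi]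
      simp only [Src.der_apply] at h3
      rw [hms] at h3
      rw [show m s = Z (s.val.map t) from rfl, ← h3]
      symm
      refine Finset.sum_bij' (i := fun B _ => insert i B) (j := fun B _ => B.erase i) ?_ ?_ ?_ ?_ ?_
      · intro B hB
        have := Finset.mem_powerset.1 hB
        simp only [Finset.mem_filter, Finset.mem_powerset, Finset.mem_insert_self, and_true]
        exact Finset.insert_subset hi (this.trans (Finset.erase_subset _ _))
      · intro B hB
        exact Finset.mem_powerset.2 (Finset.erase_subset_erase _
          (Finset.mem_powerset.1 (Finset.mem_filter.1 hB).1))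
      · intro B hB
        exact Finset.erase_insert fun h => by simpa using Finset.mem_powerset.1 hB h
      · intro B hB
        exact Finset.insert_erase (Finset.mem_filter.1 hB).2
      · intro B hB
        have hiB : i ∉ B := fun h => by simpa using Finset.mem_powerset.1 hB h
        have hsd : s \ insert i B = s.erase i \ B := by
          ext x
          simp only [Finset.mem_sdiff, Finset.mem_insert, Finset.mem_erase]
          tauto
        rw [Finset.insert_val_of_notMem hiB, Multiset.map_cons, hsd]
    have hmem : s ∈ s.powerset.filter (i ∈ ·) := by simp [hi]
    rw [← Finset.add_sum_erase _ _ hmem] at h1 h2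
    have h3 : ∑ B ∈ (s.powerset.filter (i ∈ ·)).erase s, cumulant m B * m (s \ B) =
        ∑ B ∈ (s.powerset.filter (i ∈ ·)).erase s, Src.log Z (B.val.map t) * m (s \ B) := by
      refine Finset.sum_congr rfl fun B hB => ?_
      simp only [Finset.mem_erase, Finset.mem_filter, Finset.mem_powerset] at hB
      rw [ih B (hB.2.1.ssubset_of_ne hB.1) ⟨i, hB.2.2⟩]
    have hmm : m (s \ s) = 1 := by simp [hm, hZ]
    rw [h3, hmm, mul_one] at h1
    rw [hmm, mul_one] at h2
    exact add_right_cancel (h1.trans h2.symm)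

end Cumulants

/-! ### Gaussian integration by parts -/

section Gaussian

open MvPolynomial

/-- The moments of the centred Gaussian of variance `v`. -/
def gaussMoment (v : NNReal) (n : ℕ) : ℂ := ∫ x : ℝ, (x : ℂ) ^ n ∂(gaussianReal 0 v)

theorem integrable_pow_gaussianReal (v : NNReal) (n : ℕ) :
    Integrable (fun x : ℝ => x ^ n) (gaussianReal 0 v) := by
  have h := (memLp_id_gaussianReal (μ := 0) (v := v) n).integrable_norm_pow'
  rw [← integrable_norm_iff (by fun_prop)]
  simpa using h

theorem integrable_cpow_gaussianReal (v : NNReal) (n : ℕ) :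
    Integrable (fun x : ℝ => (x : ℂ) ^ n) (gaussianReal 0 v) := by
  simpa using (integrable_pow_gaussianReal v n).ofReal (𝕜 := ℂ)

theorem gaussMoment_zero (v : NNReal) : gaussMoment v 0 = 1 := by simp [gaussMoment]

theorem hasDerivAt_gaussianPDFReal (v : NNReal) (x : ℝ) :
    HasDerivAt (gaussianPDFReal 0 v) (-(x / v) * gaussianPDFReal 0 v x) x := by
  have h1 : HasDerivAt (fun y : ℝ => -(y - 0) ^ 2 / (2 * (v : ℝ))) (-(x / v)) x := by
    have h : HasDerivAt (fun y : ℝ => -(y - 0) ^ 2 / (2 * (v : ℝ)))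
        (-(2 * (x - 0) ^ 1 * 1) / (2 * (v : ℝ))) x :=
      (((hasDerivAt_id' x).sub_const 0).fun_pow 2).fun_neg.div_const (2 * (v : ℝ))
    refine h.congr_deriv ?_
    by_cases hv : (v : ℝ) = 0
    · simp [hv]
    · field_simp; ring
  have h3 : gaussianPDFReal 0 v = fun y => (√(2 * Real.pi * v))⁻¹ * Real.exp (-(y - 0) ^ 2 / (2 * v)) := by
    ext y; rw [gaussianPDFReal]
  rw [h3]
  refine (h1.exp.const_mul (√(2 * Real.pi * v))⁻¹).congr_deriv ?_
  ring

/-- Integration by parts against the density, whose logarithmic derivative is `-x/v`. For `n = 0`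
the truncated exponent `n - 1` is harmless because of the factor `n`. -/
theorem integral_pow_gaussianReal_succ {v : NNReal} (hv : v ≠ 0) (n : ℕ) :
    ∫ x : ℝ, x ^ (n + 1) ∂(gaussianReal 0 v) = n * v * ∫ x : ℝ, x ^ (n - 1) ∂(gaussianReal 0 v) := by
  have hint : ∀ k : ℕ, Integrable (fun x : ℝ => x ^ k * gaussianPDFReal 0 v x) := by
    intro k
    have h := integrable_pow_gaussianReal v k
    rw [gaussianReal_of_var_ne_zero 0 hv, gaussianPDF_def,
      integrable_withDensity_iff (by fun_prop) (by simp)] at h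
    simpa [ENNReal.toReal_ofReal (gaussianPDFReal_nonneg 0 v _)] using h
  have hv' : (v : ℝ) ≠ 0 := by exact_mod_cast hv
  simp only [integral_gaussianReal_eq_integral_smul hv, smul_eq_mul]
  have hu : ∀ x : ℝ, HasDerivAt (fun x : ℝ => x ^ n) (n * x ^ (n - 1)) x := fun x => hasDerivAt_pow n x
  have := integral_mul_deriv_eq_deriv_mul_of_integrable (u := fun x : ℝ => x ^ n)
    (v := gaussianPDFReal 0 v) (u' := fun x => n * x ^ (n - 1))
    (v' := fun x => -(x / v) * gaussianPDFReal 0 v x) (fun x _ => hu x)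
    (fun x _ => hasDerivAt_gaussianPDFReal v x) ?_ ?_ ?_
  · have e1 : ∀ x : ℝ, gaussianPDFReal 0 v x * x ^ (n + 1) =
        -(v : ℝ) * (x ^ n * (-(x / v) * gaussianPDFReal 0 v x)) := by
      intro x; field_simp; ring
    simp_rw [e1]
    rw [integral_const_mul, this, neg_mul_neg, ← integral_const_mul, ← integral_const_mul]
    congr 1; ext x; ring
  · have := (hint (n + 1)).const_mul (-(v : ℝ)⁻¹)
    refine this.congr (Eventually.of_forall fun x => ?_)
    simp only [Pi.mul_apply]
    rw [pow_succ]; field_simp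
  · refine ((hint (n - 1)).const_mul (n : ℝ)).congr (Eventually.of_forall fun x => ?_)
    simp only [Pi.mul_apply]; ring
  · exact hint n

theorem gaussMoment_succ {v : NNReal} (hv : v ≠ 0) (n : ℕ) :
    gaussMoment v (n + 1) = n * v * gaussMoment v (n - 1) := by
  have h : ∀ k, gaussMoment v k = ((∫ x : ℝ, x ^ k ∂(gaussianReal 0 v) : ℝ) : ℂ) := by
    intro k
    rw [gaussMoment, ← integral_complex_ofReal]
    simp
  rw [h, h, integral_pow_gaussianReal_succ hv]
  push_cast; ring

/-- The entries of `d` arrays of size `N × N`. -/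
abbrev Entry (d N : ℕ) : Type := Fin d × Fin N × Fin N

/-- Polynomials in the entries of the matrices. -/
abbrev EntryPoly (d N : ℕ) : Type := MvPolynomial (Entry d N) ℂ

variable {d N : ℕ}

/-- Evaluation of polynomials in the entries. -/
def evalArrays (A : Arrays d N) : EntryPoly d N →+* ℂ :=
  eval fun i => (A i.1 i.2.1 i.2.2 : ℂ)

theorem evalArrays_monomial (A : Arrays d N) (s : Entry d N →₀ ℕ) (a : ℂ) :
    evalArrays A (monomial s a) = a * ∏ c, ∏ i, ∏ j, (A c i j : ℂ) ^ s (c, i, j) := by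
  rw [evalArrays, eval_monomial, Finsupp.prod_fintype _ _ (by simp), Fintype.prod_prod_type]
  simp only [Fintype.prod_prod_type]

theorem integrable_evalArrays_monomial (s : Entry d N →₀ ℕ) (a : ℂ) :
    Integrable (fun A : Arrays d N => evalArrays A (monomial s a)) (gaussian d N) := by
  simp only [evalArrays_monomial]
  refine Integrable.const_mul ?_ a
  refine Integrable.fintype_prod (f := fun c (x : Fin N → Fin N → ℝ) =>
    ∏ i, ∏ j, (x i j : ℂ) ^ s (c, i, j)) fun c => ?_
  refine Integrable.fintype_prod (f := fun i (x : Fin N → ℝ) =>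
    ∏ j, (x j : ℂ) ^ s (c, i, j)) fun i => ?_
  exact Integrable.fintype_prod (f := fun j (x : ℝ) => (x : ℂ) ^ s (c, i, j)) fun j =>
    integrable_cpow_gaussianReal _ _

theorem integral_evalArrays_monomial (s : Entry d N →₀ ℕ) (a : ℂ) :
    ∫ A, evalArrays A (monomial s a) ∂(gaussian d N) =
      a * ∏ e : Entry d N, gaussMoment (N : NNReal)⁻¹ (s e) := by
  simp only [evalArrays_monomial, integral_const_mul, gaussian]
  rw [integral_fintype_prod_eq_prod (f := fun c (x : Fin N → Fin N → ℝ) =>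
    ∏ i, ∏ j, (x i j : ℂ) ^ s (c, i, j))]
  rw [Fintype.prod_prod_type]
  congr 1
  refine Finset.prod_congr rfl fun c _ => ?_
  rw [integral_fintype_prod_eq_prod (f := fun i (x : Fin N → ℝ) => ∏ j, (x j : ℂ) ^ s (c, i, j))]
  rw [Fintype.prod_prod_type]
  refine Finset.prod_congr rfl fun i _ => ?_
  rw [integral_fintype_prod_eq_prod (f := fun j (x : ℝ) => (x : ℂ) ^ s (c, i, j))]
  rfl

theorem integrable_evalArrays (f : EntryPoly d N) :
    Integrable (fun A : Arrays d N => evalArrays A f) (gaussian d N) := by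
  induction f using MvPolynomial.induction_on' with
  | monomial s a => exact integrable_evalArrays_monomial s a
  | add p q hp hq =>
    simp only [map_add]
    exact hp.add hq

/-- The Gaussian expectation of a polynomial in the entries. -/
def gaussE (d N : ℕ) : EntryPoly d N →ₗ[ℂ] ℂ where
  toFun f := ∫ A, evalArrays A f ∂(gaussian d N)
  map_add' f g := by
    simp only [map_add]
    exact integral_add (integrable_evalArrays f) (integrable_evalArrays g)
  map_smul' a f := by
    simp only [smul_eq_C_mul, map_mul, RingHom.id_apply]
    have h : ∀ A : Arrays d N, evalArrays A (C a) = a := fun A => by simp [evalArrays]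
    simp_rw [h]
    exact integral_const_mul _ _

theorem gaussE_apply (f : EntryPoly d N) :
    gaussE d N f = ∫ A, evalArrays A f ∂(gaussian d N) := rfl

theorem gaussE_one : gaussE d N 1 = 1 := by
  have h := integral_evalArrays_monomial (d := d) (N := N) 0 1
  simpa [gaussE_apply, gaussMoment_zero] using h

/-- Stein's identity. On a monomial only the moment of the coordinate `e` changes, which reduces it
to `gaussMoment_succ`. -/
theorem gaussE_X_mul (hN : 1 ≤ N) (e : Entry d N) (f : EntryPoly d N) :
    gaussE d N (X e * f) = (N : ℂ)⁻¹ * gaussE d N (pderiv e f) := by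
  classical
  induction f using MvPolynomial.induction_on' with
  | add p q hp hq => rw [mul_add, map_add, hp, hq, map_add, map_add, mul_add]
  | monomial s a =>
    have hv : (N : NNReal)⁻¹ ≠ 0 := by
      have : (N : NNReal) ≠ 0 := by exact_mod_cast (by omega : N ≠ 0)
      exact inv_ne_zero this
    rw [pderiv_monomial, X, monomial_mul, one_mul, gaussE_apply, gaussE_apply,
      integral_evalArrays_monomial, integral_evalArrays_monomial,
      Fintype.prod_eq_mul_prod_compl e, Fintype.prod_eq_mul_prod_compl e]
    have h1 : ∀ i ∈ ({e} : Finset (Entry d N))ᶜ, gaussMoment (N : NNReal)⁻¹ ((Finsupp.single e 1 + s : Entry d N →₀ ℕ) i) =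
        gaussMoment (N : NNReal)⁻¹ ((s - Finsupp.single e 1 : Entry d N →₀ ℕ) i) := by
      intro i hi
      have hne : e ≠ i := fun h => by simp [h] at hi
      simp [Finsupp.single_apply, hne]
    rw [Finset.prod_congr rfl h1]
    simp only [Finsupp.add_apply, Finsupp.tsub_apply, Finsupp.single_eq_same]
    rw [add_comm 1, gaussMoment_succ hv]
    push_cast
    ring

end Gaussian

/-! ### Matrix loop equations -/

section Matrices

open MvPolynomial Matrix

variable {d N : ℕ}

/-- The parametrization `herm`, extended to complex arrays. -/
def hermC (A : Fin N → Fin N → ℂ) (i j : Fin N) : ℂ :=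
  if i = j then A i i
  else if i < j then (A i j + A j i * Complex.I) / (Real.sqrt 2 : ℂ)
  else (A j i - A i j * Complex.I) / (Real.sqrt 2 : ℂ)

theorem herm_apply (A : Fin N → Fin N → ℝ) (i j : Fin N) :
    herm A i j = hermC (fun k l => (A k l : ℂ)) i j := by
  simp [herm, hermC]

/-- The orthonormal basis of the Hermitian matrices underlying `herm`. -/
def hermBasis (k l i j : Fin N) : ℂ := hermC (fun k' l' => if k = k' ∧ l = l' then 1 else 0) i j

theorem sum_mul_hermBasis (A : Fin N → Fin N → ℂ) (i j : Fin N) :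
    ∑ k, ∑ l, A k l * hermBasis k l i j = hermC A i j := by
  have h : ∀ a b : Fin N, ∑ k, ∑ l, A k l * (if k = a ∧ l = b then 1 else 0) = A a b := by
    intro a b
    simp [ite_and]
  simp only [hermBasis, hermC]
  split_ifs
  · exact h i i
  · simp only [mul_div_assoc', mul_add, ← mul_assoc, ← Finset.sum_div, Finset.sum_add_distrib,
      ← Finset.sum_mul, h]
  · simp only [mul_div_assoc', mul_sub, ← mul_assoc, ← Finset.sum_div, Finset.sum_sub_distrib,
      ← Finset.sum_mul, h]

/-- The coefficient of the entry `(i, j)` of the array in the entry `(i, j)` of the matrix. -/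
def hermP (i j : Fin N) : ℂ :=
  if i = j then 1 else if i < j then (Real.sqrt 2 : ℂ)⁻¹ else -Complex.I * (Real.sqrt 2 : ℂ)⁻¹

/-- The coefficient of the entry `(j, i)` of the array in the entry `(i, j)` of the matrix. -/
def hermQ (i j : Fin N) : ℂ :=
  if i = j then 0 else if i < j then Complex.I * (Real.sqrt 2 : ℂ)⁻¹ else (Real.sqrt 2 : ℂ)⁻¹

theorem hermC_eq (A : Fin N → Fin N → ℂ) (i j : Fin N) :
    hermC A i j = hermP i j * A i j + hermQ i j * A j i := by
  simp only [hermC, hermP, hermQ]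
  split_ifs with h1 h2
  · subst h1; ring
  · ring
  · ring

theorem hermP_sq_add (i j : Fin N) :
    hermP i j * hermP i j + hermQ i j * hermQ i j = if i = j then 1 else 0 := by
  have hI := Complex.I_mul_I
  simp only [hermP, hermQ]
  split_ifs
  · ring
  · linear_combination (Real.sqrt 2 : ℂ)⁻¹ ^ 2 * hI
  · linear_combination (Real.sqrt 2 : ℂ)⁻¹ ^ 2 * hI

theorem hermP_mul_hermQ (i j : Fin N) :
    hermP i j * hermQ j i + hermQ i j * hermP j i = if i = j then 0 else 1 := by
  have hI := Complex.I_mul_I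
  have h2 : (Real.sqrt 2 : ℂ)⁻¹ * (Real.sqrt 2 : ℂ)⁻¹ = 2⁻¹ := by
    rw [← mul_inv, ← Complex.ofReal_mul, Real.mul_self_sqrt (by norm_num)]; norm_num
  simp only [hermP, hermQ]
  rcases lt_trichotomy i j with h | rfl | h
  · simp only [h.ne, h.ne', h, h.not_gt, if_true, if_false]
    linear_combination (1 - Complex.I * Complex.I) * h2 - (2 : ℂ)⁻¹ * hI
  · simp
  · simp only [h.ne, h.ne', h, h.not_gt, if_true, if_false]
    linear_combination (1 - Complex.I * Complex.I) * h2 - (2 : ℂ)⁻¹ * hI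

/-- Completeness of the basis: up to the factor `1/N` this is the propagator of the Gaussian
Hermitian ensemble. -/
theorem sum_hermBasis_mul (i j i' j' : Fin N) :
    ∑ k, ∑ l, hermBasis k l i j * hermBasis k l i' j' = if i = j' ∧ j = i' then 1 else 0 := by
  rw [sum_mul_hermBasis (fun k l => hermBasis k l i j) i' j']
  simp only [hermBasis, hermC_eq]
  have e1 := hermP_sq_add i j
  have e2 := hermP_mul_hermQ i j
  by_cases h1 : i = i' ∧ j = j'
  · obtain ⟨rfl, rfl⟩ := h1
    by_cases h : i = j
    · subst h; simp [hermP, hermQ]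
    · simp [h, Ne.symm h] at e1 ⊢
      linear_combination e1
  · have h1' : ¬(i' = i ∧ j' = j) := fun h => h1 ⟨h.1.symm, h.2.symm⟩
    have h1'' : ¬(j' = j ∧ i' = i) := fun h => h1 ⟨h.2.symm, h.1.symm⟩
    by_cases h2 : i = j' ∧ j = i'
    · obtain ⟨rfl, rfl⟩ := h2
      have h : i ≠ j := fun h => h1 ⟨h, h.symm⟩
      simp [h, Ne.symm h] at e2 ⊢
      linear_combination e2
    · have h2' : ¬(i' = j ∧ j' = i) := fun h => h2 ⟨h.2.symm, h.1.symm⟩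
      have h2'' : ¬(j' = i ∧ i' = j) := fun h => h2 ⟨h.1.symm, h.2.symm⟩
      simp [h1', h1'', h2, h2', h2'']

/-- The elements of the basis, as constant polynomial matrices. -/
def basisMat (d : ℕ) {N : ℕ} (k l : Fin N) : Matrix (Fin N) (Fin N) (EntryPoly d N) :=
  Matrix.of fun i j => C (hermBasis k l i j)

/-- The generic Hermitian matrix of colour `c`. -/
def genMat (N : ℕ) (c : Fin d) : Matrix (Fin N) (Fin N) (EntryPoly d N) :=
  ∑ k, ∑ l, (X (c, k, l) : EntryPoly d N) • basisMat d k l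

theorem map_evalArrays_genMat (A : Arrays d N) (c : Fin d) :
    (genMat N c).map (evalArrays A) = herm (A c) := by
  ext i j
  rw [herm_apply, ← sum_mul_hermBasis]
  simp [genMat, basisMat, Matrix.sum_apply, evalArrays]

theorem sum_basisMat_mul (i j i' j' : Fin N) :
    ∑ k, ∑ l, basisMat d k l i j * basisMat d k l i' j' =
      if i = j' ∧ j = i' then (1 : EntryPoly d N) else 0 := by
  simp only [basisMat, Matrix.of_apply, ← C_mul, ← map_sum, sum_hermBasis_mul]
  split_ifs <;> simp

theorem sum_contract (u : (Fin N × Fin N) → (Fin N × Fin N) → EntryPoly d N) :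
    ∑ k, ∑ l, ∑ f : Fin N × Fin N, ∑ f' : Fin N × Fin N,
      basisMat d k l f.1 f.2 * basisMat d k l f'.1 f'.2 * u f f' =
        ∑ f : Fin N × Fin N, u f (f.2, f.1) := by
  rw [← Fintype.sum_prod_type' fun k l => ∑ f : Fin N × Fin N, ∑ f' : Fin N × Fin N,
      basisMat d k l f.1 f.2 * basisMat d k l f'.1 f'.2 * u f f', Finset.sum_comm]
  refine Finset.sum_congr rfl fun f _ => ?_
  rw [Finset.sum_comm]
  have h : ∀ f' : Fin N × Fin N, ∑ e : Fin N × Fin N, basisMat d e.1 e.2 f.1 f.2 *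
      basisMat d e.1 e.2 f'.1 f'.2 * u f f' = if f' = (f.2, f.1) then u f f' else 0 := by
    intro f'
    rw [← Finset.sum_mul, Fintype.sum_prod_type, sum_basisMat_mul, ite_mul, one_mul, zero_mul]
    refine if_congr ?_ rfl rfl
    rw [Prod.ext_iff]
    exact ⟨fun h => ⟨h.2.symm, h.1.symm⟩, fun h => ⟨h.2.symm, h.1.symm⟩⟩
  simp only [h, Finset.sum_ite_eq', Finset.mem_univ, if_true]

theorem trace_mul_eq_sum {R : Type*} [CommRing R] (P Q : Matrix (Fin N) (Fin N) R) :
    (P * Q).trace = ∑ f : Fin N × Fin N, P f.1 f.2 * Q f.2 f.1 := by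
  simp only [Matrix.trace, Matrix.diag, Matrix.mul_apply, Fintype.sum_prod_type]

/-- A propagator between two traces merges them, while one inside a single trace splits it
(`sum_trace_mul_mul`). All terms of the loop equations arise in these two ways. -/
theorem sum_trace_mul_trace (P Q : Matrix (Fin N) (Fin N) (EntryPoly d N)) :
    ∑ k, ∑ l, (basisMat d k l * P).trace * (basisMat d k l * Q).trace = (P * Q).trace := by
  have := sum_contract fun f f' : Fin N × Fin N => P f.2 f.1 * Q f'.2 f'.1
  rw [Matrix.trace_mul_comm P Q, trace_mul_eq_sum Q P]
  calc _ = _ := ?_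
    _ = _ := this
    _ = _ := ?_
  · simp only [trace_mul_eq_sum, Finset.sum_mul_sum]
    refine Finset.sum_congr rfl fun k _ => Finset.sum_congr rfl fun l _ =>
      Finset.sum_congr rfl fun f _ => Finset.sum_congr rfl fun f' _ => ?_
    ring
  · exact Finset.sum_congr rfl fun f _ => mul_comm _ _

theorem sum_trace_mul_mul (P Q : Matrix (Fin N) (Fin N) (EntryPoly d N)) :
    ∑ k, ∑ l, (basisMat d k l * P * basisMat d k l * Q).trace = P.trace * Q.trace := by
  have := sum_contract fun f f' : Fin N × Fin N => P f.2 f'.1 * Q f'.2 f.1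
  calc _ = _ := ?_
    _ = _ := this
    _ = _ := ?_
  · refine Finset.sum_congr rfl fun k _ => Finset.sum_congr rfl fun l _ => ?_
    rw [Matrix.mul_assoc, trace_mul_eq_sum]
    simp only [Fintype.sum_prod_type]
    refine Finset.sum_congr rfl fun i _ => ?_
    simp only [Matrix.mul_apply, Finset.sum_mul_sum]
    rw [Finset.sum_comm]
    refine Finset.sum_congr rfl fun a _ => Finset.sum_congr rfl fun j _ =>
      Finset.sum_congr rfl fun b _ => ?_
    ring
  · simp only [Matrix.trace, Matrix.diag, Fintype.sum_prod_type, Finset.sum_mul_sum]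
    exact Finset.sum_comm

/-! ### Derivatives of traces -/

theorem map_derivation_mul {R : Type*} [CommRing R] [Algebra ℂ R] (D : Derivation ℂ R R)
    (P Q : Matrix (Fin N) (Fin N) R) : (P * Q).map D = P.map D * Q + P * Q.map D := by
  ext i j
  simp only [Matrix.map_apply, Matrix.mul_apply, Matrix.add_apply, map_sum, Derivation.leibniz,
    smul_eq_mul, ← Finset.sum_add_distrib]
  refine Finset.sum_congr rfl fun k _ => ?_
  ring

theorem map_derivation_pow {R : Type*} [CommRing R] [Algebra ℂ R] (D : Derivation ℂ R R)
    (M : Matrix (Fin N) (Fin N) R) (p : ℕ) :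
    (M ^ p).map D = ∑ i ∈ Finset.range p, M ^ i * M.map D * M ^ (p - 1 - i) := by
  induction p with
  | zero =>
    ext i j
    simp only [pow_zero, Matrix.map_apply, Finset.range_zero, Finset.sum_empty, Matrix.zero_apply,
      Matrix.one_apply]
    split_ifs <;> simp
  | succ p ih =>
    rw [pow_succ, map_derivation_mul, ih, Finset.sum_range_succ, Finset.sum_mul]
    congr 1
    · refine Finset.sum_congr rfl fun i hi => ?_
      have : p + 1 - 1 - i = p - 1 - i + 1 := by
        have := Finset.mem_range.1 hi; omega
      rw [this, pow_succ, ← Matrix.mul_assoc]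
    · simp

theorem derivation_trace {R : Type*} [CommRing R] [Algebra ℂ R] (D : Derivation ℂ R R)
    (M : Matrix (Fin N) (Fin N) R) : D M.trace = (M.map D).trace := by
  simp [Matrix.trace, map_sum]

theorem derivation_trace_pow {R : Type*} [CommRing R] [Algebra ℂ R] (D : Derivation ℂ R R)
    (M : Matrix (Fin N) (Fin N) R) (p : ℕ) :
    D (M ^ p).trace = p * (M.map D * M ^ (p - 1)).trace := by
  rw [derivation_trace, map_derivation_pow, Matrix.trace_sum]
  have h : ∀ i ∈ Finset.range p, (M ^ i * M.map D * M ^ (p - 1 - i)).trace =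
      (M.map D * M ^ (p - 1)).trace := by
    intro i hi
    have := Finset.mem_range.1 hi
    rw [Matrix.mul_assoc, Matrix.trace_mul_comm, Matrix.mul_assoc, ← pow_add]
    congr 3; omega
  rw [Finset.sum_congr rfl h]
  simp

theorem map_pderiv_genMat (e : Entry d N) (c : Fin d) :
    (genMat N c).map (pderiv e) = if e.1 = c then basisMat d e.2.1 e.2.2 else 0 := by
  refine Matrix.ext fun i j => ?_
  obtain ⟨c', k, l⟩ := e
  have h : ∀ k' l', pderiv (c', k, l) (X (c, k', l') * C (hermBasis k' l' i j) : EntryPoly d N) =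
      if k = k' ∧ l = l' then (if c' = c then C (hermBasis k' l' i j) else 0) else 0 := by
    intro k' l'
    rw [Derivation.leibniz, pderiv_C, smul_zero, zero_add, pderiv_X, smul_eq_mul, Pi.single_apply]
    by_cases h1 : c' = c <;> by_cases h2 : k = k' <;> by_cases h3 : l = l' <;>
      simp [h1, h2, h3, eq_comm] <;> grind
  simp only [Matrix.map_apply, genMat, Matrix.sum_apply, Matrix.smul_apply, basisMat,
    Matrix.of_apply, smul_eq_mul, map_sum, h]
  rw [Finset.sum_eq_single_of_mem k (Finset.mem_univ _) (by
      intro b _ hb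
      exact Finset.sum_eq_zero fun x _ => if_neg fun h => hb h.1.symm),
    Finset.sum_eq_single_of_mem l (Finset.mem_univ _) (by
      intro b _ hb
      exact if_neg fun h => hb h.2.symm), if_pos ⟨rfl, rfl⟩]
  split_ifs <;> rfl

/-- The trace of a power of a generic matrix. -/
def genTr (N : ℕ) (c : Fin d) (p : ℕ) : EntryPoly d N := (genMat N c ^ p).trace

theorem genTr_zero (c : Fin d) : genTr N c 0 = (N : EntryPoly d N) := by
  simp [genTr]

theorem evalArrays_genTr (A : Arrays d N) (c : Fin d) (p : ℕ) :
    evalArrays A (genTr N c p) = (herm (A c) ^ p).trace := by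
  rw [← map_evalArrays_genMat A c, genTr, AddMonoidHom.map_trace (evalArrays A)]
  congr 1
  exact Matrix.map_pow (genMat N c) (evalArrays A) p

/-- The vector field `∑ tr(H M ^ k) ∂_H` of the loop equations, `H` running over an orthonormal
basis. -/
def loopDer (N : ℕ) (c : Fin d) (k : ℕ) : Derivation ℂ (EntryPoly d N) (EntryPoly d N) :=
  ∑ i, ∑ j, (basisMat d i j * genMat N c ^ k).trace • pderiv (c, i, j)

theorem loopDer_apply (c : Fin d) (k : ℕ) (f : EntryPoly d N) : loopDer N c k f =
    ∑ i, ∑ j, (basisMat d i j * genMat N c ^ k).trace * pderiv (c, i, j) f := by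
  have h : ∀ {ι : Type} (s : Finset ι) (D : ι → Derivation ℂ (EntryPoly d N) (EntryPoly d N)),
      (∑ i ∈ s, D i) f = ∑ i ∈ s, D i f := by
    intro ι s D
    classical
    induction s using Finset.induction_on with
    | empty => simp
    | insert a s ha ih => rw [Finset.sum_insert ha, Finset.sum_insert ha, Derivation.add_apply, ih]
  simp [loopDer, h]

theorem loopDer_genTr (c c' : Fin d) (k p : ℕ) : loopDer N c k (genTr N c' p) =
    if c = c' then p * genTr N c (k + p - 1) else 0 := by
  rw [loopDer_apply]
  simp only [genTr, derivation_trace_pow, map_pderiv_genMat]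
  split_ifs with h
  · subst h
    simp only [mul_left_comm _ (p : EntryPoly d N), ← Finset.mul_sum, sum_trace_mul_trace, ← pow_add]
    rcases Nat.eq_zero_or_pos p with rfl | hp
    · simp
    · rw [Nat.add_sub_assoc hp]
  · simp

/-- The Gaussian loop equation. -/
theorem gaussE_loop (hN : 1 ≤ N) (c : Fin d) (k : ℕ) (f : EntryPoly d N) :
    N * gaussE d N (genTr N c (k + 1) * f) =
      gaussE d N ((∑ i ∈ Finset.range k, genTr N c i * genTr N c (k - 1 - i)) * f) +
        gaussE d N (loopDer N c k f) := by
  have hN0 : (N : ℂ) ≠ 0 := by exact_mod_cast (by omega : N ≠ 0)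
  have h1 : genTr N c (k + 1) * f = ∑ i, ∑ j, (X (c, i, j) : EntryPoly d N) *
      ((basisMat d i j * genMat N c ^ k).trace * f) := by
    rw [genTr, pow_succ']
    nth_rw 1 [genMat]
    simp only [Finset.sum_mul, Matrix.trace_sum, Matrix.smul_mul, Matrix.trace_smul, smul_eq_mul,
      mul_assoc]
  -- The derivative also hits the coefficient `tr(H M ^ k)` of the vector field and puts a second
  -- `H` at each of the `k` positions; the contraction then splits the trace into two.
  have h2 : ∀ i j, pderiv (c, i, j) ((basisMat d i j * genMat N c ^ k).trace * f) =
      (∑ a ∈ Finset.range k, (basisMat d i j * genMat N c ^ a * basisMat d i j *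
        genMat N c ^ (k - 1 - a)).trace) * f +
      (basisMat d i j * genMat N c ^ k).trace * pderiv (c, i, j) f := by
    intro i j
    have hb : (basisMat d i j).map (pderiv (c, i, j)) = 0 := by
      ext a b; simp [basisMat]
    rw [Derivation.leibniz, derivation_trace, map_derivation_mul, hb, map_derivation_pow,
      map_pderiv_genMat, if_pos rfl, Matrix.zero_mul, zero_add, Matrix.mul_sum, Matrix.trace_sum,
      smul_eq_mul, smul_eq_mul, mul_comm f, add_comm]
    simp only [Matrix.mul_assoc]
  rw [h1, map_sum, Finset.mul_sum]
  simp only [map_sum, Finset.mul_sum, gaussE_X_mul hN, mul_inv_cancel_left₀ hN0]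
  simp only [← map_sum]
  rw [← map_add]
  congr 1
  simp only [h2, Finset.sum_add_distrib, loopDer_apply]
  congr 1
  simp only [← Finset.sum_mul]
  congr 1
  simp only [genTr, ← sum_trace_mul_mul]
  calc _ = ∑ i : Fin N, ∑ a ∈ Finset.range k, ∑ j : Fin N, (basisMat d i j * genMat N c ^ a *
        basisMat d i j * genMat N c ^ (k - 1 - a)).trace :=
        Finset.sum_congr rfl fun i _ => Finset.sum_comm
    _ = _ := Finset.sum_comm

end Matrices

/-! ### Formal power series with polynomial coefficients -/

section Series

variable {σ R S : Type*} [CommRing R] [CommRing S] [DecidableEq σ]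

theorem sum_antidiagonal_eq_sum_Iic {M : Type*} [AddCommMonoid M] (m : σ →₀ ℕ)
    (f : (σ →₀ ℕ) → (σ →₀ ℕ) → M) :
    ∑ q ∈ Finset.HasAntidiagonal.antidiagonal m, f q.1 q.2 = ∑ a ∈ Finset.Iic m, f a (m - a) := by
  refine Finset.sum_bij' (i := fun q _ => q.1) (j := fun a _ => (a, m - a)) ?_ ?_ ?_ ?_ ?_
  · rintro ⟨a, b⟩ h
    rw [Finset.HasAntidiagonal.mem_antidiagonal] at h
    exact Finset.mem_Iic.2 (h ▸ le_self_add)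
  · intro a h
    exact Finset.HasAntidiagonal.mem_antidiagonal.2 (add_tsub_cancel_of_le (Finset.mem_Iic.1 h))
  · rintro ⟨a, b⟩ h
    rw [Finset.HasAntidiagonal.mem_antidiagonal] at h
    simp only at h ⊢
    rw [← h, add_tsub_cancel_left]
  · intros; rfl
  · rintro ⟨a, b⟩ h
    rw [Finset.HasAntidiagonal.mem_antidiagonal] at h
    simp only at h ⊢
    rw [← h, add_tsub_cancel_left]

/-- The formal sum `∑_a α ^ a G_a`. -/
def diagSum (G : (σ →₀ ℕ) → MvPowerSeries σ R) : MvPowerSeries σ R := fun m =>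
  ∑ a ∈ Finset.Iic m, MvPowerSeries.coeff (m - a) (G a)

theorem coeff_diagSum (G : (σ →₀ ℕ) → MvPowerSeries σ R) (m : σ →₀ ℕ) :
    MvPowerSeries.coeff m (diagSum G) = ∑ a ∈ Finset.Iic m, MvPowerSeries.coeff (m - a) (G a) := rfl

/-- Up to a given order the formal sum is an honest finite sum, so algebraic identities can be
checked there. -/
theorem coeff_diagSum_eq_of_le (G : (σ →₀ ℕ) → MvPowerSeries σ R) {m n : σ →₀ ℕ} (h : m ≤ n) :
    MvPowerSeries.coeff m (diagSum G) =
      MvPowerSeries.coeff m (∑ a ∈ Finset.Iic n, MvPowerSeries.monomial a 1 * G a) := by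
  rw [coeff_diagSum, map_sum]
  simp only [MvPowerSeries.coeff_monomial_mul, one_mul]
  rw [← Finset.sum_filter]
  refine Finset.sum_congr ?_ fun _ _ => rfl
  ext a
  simp only [Finset.mem_Iic, Finset.mem_filter]
  exact ⟨fun h' => ⟨h'.trans h, h'⟩, fun h' => h'.2⟩

theorem diagSum_mul (G : (σ →₀ ℕ) → MvPowerSeries σ R) (s : MvPowerSeries σ R) :
    diagSum G * s = diagSum fun a => G a * s := by
  ext m
  rw [coeff_diagSum_eq_of_le _ le_rfl, MvPowerSeries.coeff_mul]
  simp only [← mul_assoc, ← Finset.sum_mul]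
  rw [MvPowerSeries.coeff_mul]
  refine Finset.sum_congr rfl fun q hq => ?_
  rw [coeff_diagSum_eq_of_le G (n := m)]
  rw [← Finset.HasAntidiagonal.mem_antidiagonal.1 hq]
  exact le_self_add

theorem diagSum_add (G H : (σ →₀ ℕ) → MvPowerSeries σ R) :
    diagSum (fun a => G a + H a) = diagSum G + diagSum H := by
  ext m; simp [coeff_diagSum, Finset.sum_add_distrib]

theorem diagSum_zero : diagSum (fun _ => (0 : MvPowerSeries σ R)) = 0 := by
  ext m; simp [coeff_diagSum]

theorem map_diagSum (φ : R →+* S) (G : (σ →₀ ℕ) → MvPowerSeries σ R) :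
    MvPowerSeries.map φ (diagSum G) = diagSum fun a => MvPowerSeries.map φ (G a) := by
  ext m; simp [coeff_diagSum]

/-- `diagSum` for families of generating functions. -/
def srcDiagSum {T : Type*} (G : (σ →₀ ℕ) → Src (MvPowerSeries σ R) T) :
    Src (MvPowerSeries σ R) T := ⟨fun P => diagSum fun a => G a P⟩

theorem srcDiagSum_mul {T : Type*} (G : (σ →₀ ℕ) → Src (MvPowerSeries σ R) T)
    (f : Src (MvPowerSeries σ R) T) :
    srcDiagSum G * f = srcDiagSum fun a => G a * f := by
  have hm : ∀ (M : Multiset (Multiset T × Multiset T)),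
      (M.map fun q => diagSum (fun a => G a q.1) * f q.2).sum =
        diagSum fun a => (M.map fun q => G a q.1 * f q.2).sum := by
    intro M
    induction M using Multiset.induction with
    | empty => simp [diagSum_zero]
    | cons q M ih => simp only [Multiset.map_cons, Multiset.sum_cons, diagSum_add, ← ih, diagSum_mul]
  refine Src.ext' fun P => ?_
  exact hm _

end Series

/-! ### Exponentials of formal series and derivations of their coefficients. -/

section Exponential

open MvPowerSeries

variable {d : ℕ} {R : Type*} [CommRing R] [Algebra ℂ R]

/-- Apply a derivation to all coefficients. -/
def serDer (D : Derivation ℂ R R) :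
    Derivation ℂ (MvPowerSeries (Fin d) R) (MvPowerSeries (Fin d) R) :=
  Derivation.mk'
    { toFun := fun F m => D (coeff m F)
      map_add' := fun F G => by ext m; exact map_add D _ _
      map_smul' := fun a F => by ext m; exact D.map_smul a _ }
    (by
      intro F G
      ext m
      change D (coeff m (F * G)) = coeff m _
      rw [map_add, smul_eq_mul, smul_eq_mul, mul_comm G, coeff_mul, coeff_mul, coeff_mul, map_sum,
        ← Finset.sum_add_distrib]
      refine Finset.sum_congr rfl fun q _ => ?_
      rw [Derivation.leibniz, smul_eq_mul, smul_eq_mul, mul_comm (coeff q.2 G)]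
      rfl)

@[simp] theorem coeff_serDer (D : Derivation ℂ R R) (F : MvPowerSeries (Fin d) R) (m : Fin d →₀ ℕ) :
    coeff m (serDer D F) = D (coeff m F) := rfl

/-- The exponential of a series without constant term. -/
def expS (V : MvPowerSeries (Fin d) R) : MvPowerSeries (Fin d) R := fun m =>
  ∑ k ∈ Finset.range (m.degree + 1), ((k.factorial : ℂ)⁻¹) • coeff m (V ^ k)

theorem coeff_expS (V : MvPowerSeries (Fin d) R) (m : Fin d →₀ ℕ) : coeff m (expS V) =
    ∑ k ∈ Finset.range (m.degree + 1), ((k.factorial : ℂ)⁻¹) • coeff m (V ^ k) := rfl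

theorem coeff_pow_eq_zero {V : MvPowerSeries (Fin d) R} (hV : constantCoeff V = 0) {m : Fin d →₀ ℕ}
    {k : ℕ} (h : m.degree < k) : coeff m (V ^ k) = 0 :=
  coeff_of_lt_order (lt_of_lt_of_le (by exact_mod_cast h)
    (le_order_pow_of_constantCoeff_eq_zero k hV))

theorem coeff_expS_of_le {V : MvPowerSeries (Fin d) R} (hV : constantCoeff V = 0) {m : Fin d →₀ ℕ}
    {n : ℕ} (h : m.degree < n) : coeff m (expS V) =
    coeff m (∑ k ∈ Finset.range n, ((k.factorial : ℂ)⁻¹) • V ^ k) := by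
  rw [coeff_expS, map_sum]
  refine Finset.sum_subset (Finset.range_mono (by omega)) fun k _ hk => ?_
  rw [Finset.mem_range, not_lt] at hk
  rw [coeff_pow_eq_zero hV (by omega), smul_zero]

theorem serDer_expS (D : Derivation ℂ R R) {V : MvPowerSeries (Fin d) R}
    (hV : constantCoeff V = 0) : serDer D (expS V) = serDer D V * expS V := by
  ext m
  have h1 : coeff m (serDer D V * expS V) = coeff m (serDer D V *
      ∑ k ∈ Finset.range (m.degree + 1), ((k.factorial : ℂ)⁻¹) • V ^ k) := by
    rw [coeff_mul, coeff_mul]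
    refine Finset.sum_congr rfl fun q hq => ?_
    rw [coeff_expS_of_le hV (n := m.degree + 1)]
    have := congrArg Finsupp.degree (Finset.HasAntidiagonal.mem_antidiagonal.1 hq)
    rw [map_add] at this
    omega
  -- One more term than on the right, since the derivation lowers each power of `V` by one. The
  -- additional term vanishes at this order because `V` has no constant term.
  have h2 : coeff m (serDer D (expS V)) =
      coeff m (serDer D (∑ k ∈ Finset.range (m.degree + 2), ((k.factorial : ℂ)⁻¹) • V ^ k)) := by
    rw [coeff_serDer, coeff_serDer, coeff_expS_of_le hV (n := m.degree + 2) (by omega)]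
  rw [h1, h2, Finset.sum_range_succ', Finset.mul_sum]
  simp only [map_add, map_sum, Derivation.map_smul]
  rw [Derivation.leibniz_pow]
  simp only [Derivation.leibniz_pow, zero_smul, smul_zero, map_zero, add_zero]
  refine Finset.sum_congr rfl fun k _ => congrArg (coeff m) ?_
  rw [Nat.add_sub_cancel, Nat.factorial_succ, smul_eq_mul, ← Nat.cast_smul_eq_nsmul ℂ, smul_smul,
    mul_smul_comm, mul_comm (V ^ k)]
  congr 1
  have : ((k : ℂ) + 1) ≠ 0 := by exact_mod_cast Nat.succ_ne_zero k
  have hk : (k.factorial : ℂ) ≠ 0 := by exact_mod_cast k.factorial_ne_zero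
  push_cast
  field_simp

end Exponential

/-! ### Loop equations of the model -/

namespace Src

variable {A T : Type*} [CommRing A]

/-- The rescaled derivative `h ∂_a`. -/
def hder (h : A) (a : T) (f : Src A T) : Src A T := const h * der a f

/-- Insertion of a list of labels. -/
def insertList (h : A) (L : List T) (f : Src A T) : Src A T := L.foldr (hder h) f

/-- The normalized insertion of a list of labels into a generating function with rescaled
logarithmic derivatives `K`. -/
def nablaList (h : A) (K : T → Src A T) (L : List T) : Src A T :=
  L.foldr (fun a f => hder h a f + K a * f) 1

/-- Conjugation by `Z`: `h ∂_a (f Z) = (h ∂_a f + K_a f) Z`. Products of traces are thereby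
expressed through connected correlations. -/
theorem insertList_eq {h : A} {K : T → Src A T} {Z : Src A T} (hK : ∀ a, hder h a Z = K a * Z)
    (L : List T) : insertList h L Z = nablaList h K L * Z := by
  induction L with
  | nil => simp [insertList, nablaList]
  | cons a L ih =>
    change hder h a (insertList h L Z) = (hder h a (nablaList h K L) + K a * nablaList h K L) * Z
    have := hK a
    simp only [hder] at this ⊢
    rw [ih, der_mul, mul_add]
    linear_combination nablaList h K L * this

end Src

section Model

open MvPowerSeries

variable {d N : ℕ}

/-- Labels of the observables `tr M_c ^ k`. -/
abbrev Label (d : ℕ) : Type := Fin d × ℕ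

/-- The interaction as a series of polynomials in the entries. -/
def modelV (d N : ℕ) : MvPowerSeries (Fin d) (EntryPoly d N) := fun a =>
  MvPolynomial.C (-((N : ℂ) ^ (2 - (d : ℤ))) * coupling d N a) * ∏ c, genTr N c (a c)

theorem coeff_modelV (a : Fin d →₀ ℕ) : coeff a (modelV d N) =
    MvPolynomial.C (-((N : ℂ) ^ (2 - (d : ℤ))) * coupling d N a) * ∏ c, genTr N c (a c) := rfl

theorem constantCoeff_modelV : constantCoeff (modelV d N) = 0 := by
  rw [← coeff_zero_eq_constantCoeff_apply, coeff_modelV]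
  simp [coupling]

theorem map_evalArrays_modelV (A : Arrays d N) :
    map (evalArrays A) (modelV d N) = interaction d N A := by
  ext a
  rw [coeff_map, coeff_modelV, map_mul, map_prod]
  simp only [evalArrays_genTr]
  have : evalArrays A (MvPolynomial.C (-((N : ℂ) ^ (2 - (d : ℤ))) * coupling d N a)) =
      -((N : ℂ) ^ (2 - (d : ℤ))) * coupling d N a := by simp [evalArrays]
  rw [this]
  rfl

theorem map_evalArrays_expS (A : Arrays d N) :
    map (evalArrays A) (expS (modelV d N)) = expSer (interaction d N A) := by
  ext m
  rw [coeff_map, coeff_expS, map_sum]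
  change _ = ∑ k ∈ Finset.range (m.degree + 1), _
  refine Finset.sum_congr rfl fun k _ => ?_
  rw [← map_evalArrays_modelV, ← map_pow, coeff_map, MvPolynomial.smul_eq_C_mul, map_mul]
  congr 1
  simp [evalArrays]

/-- The coefficientwise Gaussian expectation. -/
def serE (F : MvPowerSeries (Fin d) (EntryPoly d N)) : Ser d := fun m => gaussE d N (coeff m F)

theorem coeff_serE (F : MvPowerSeries (Fin d) (EntryPoly d N)) (m : Fin d →₀ ℕ) :
    coeff m (serE F) = gaussE d N (coeff m F) := rfl

/-- The unnormalized expectation in the model of a polynomial in the entries. -/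
def modelE (d N : ℕ) (F : EntryPoly d N) : Ser d := serE (C F * expS (modelV d N))

theorem coeff_modelE (F : EntryPoly d N) (m : Fin d →₀ ℕ) :
    coeff m (modelE d N F) = gaussE d N (F * coeff m (expS (modelV d N))) := by
  rw [modelE, coeff_serE, coeff_C_mul]

theorem modelE_add (F G : EntryPoly d N) : modelE d N (F + G) = modelE d N F + modelE d N G := by
  ext m; simp [coeff_modelE, add_mul]

theorem modelE_C_mul (a : ℂ) (F : EntryPoly d N) :
    modelE d N (MvPolynomial.C a * F) = C a * modelE d N F := by
  ext m
  rw [coeff_C_mul, coeff_modelE, coeff_modelE, mul_assoc, ← MvPolynomial.smul_eq_C_mul, map_smul,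
    smul_eq_mul]

/-- `modelE` as an additive map. -/
def modelEHom (d N : ℕ) : EntryPoly d N →+ Ser d := AddMonoidHom.mk' (modelE d N) modelE_add

theorem modelE_multiset_sum (s : Multiset (EntryPoly d N)) :
    modelE d N s.sum = (s.map (modelE d N)).sum := map_multiset_sum (modelEHom d N) s

theorem formalIntegral_eq (F : EntryPoly d N) (f : Arrays d N → ℂ)
    (h : ∀ A, evalArrays A F = f A) :
    formalIntegral (fun A : Arrays d N => C (f A) * expSer (interaction d N A)) = modelE d N F := by
  ext m
  rw [coeff_modelE]
  change ∫ A, _ ∂_ = ∫ A, _ ∂_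
  congr 1
  ext A
  rw [coeff_C_mul, ← map_evalArrays_expS, coeff_map, map_mul, h]

theorem constantCoeff_modelE_one : constantCoeff (modelE d N 1) = 1 := by
  rw [← coeff_zero_eq_constantCoeff_apply, coeff_modelE, coeff_expS]
  simp [gaussE_one]

theorem modelE_one_mul_inv : modelE d N 1 * (modelE d N 1)⁻¹ = 1 :=
  MvPowerSeries.mul_inv_cancel _ (by rw [constantCoeff_modelE_one]; exact one_ne_zero)

theorem derivation_prod_eq_zero {ι : Type*} (D : Derivation ℂ (EntryPoly d N) (EntryPoly d N))
    (s : Finset ι) (f : ι → EntryPoly d N) (h : ∀ i ∈ s, D (f i) = 0) : D (∏ i ∈ s, f i) = 0 := by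
  classical
  induction s using Finset.induction_on with
  | empty => simp
  | insert a s ha ih =>
    rw [Finset.prod_insert ha, Derivation.leibniz, h a (by simp),
      ih fun i hi => h i (Finset.mem_insert_of_mem hi)]
    simp

/-- Only the trace of colour `c` is affected. If `a c = 0` the truncated exponent `k + a c - 1` is
irrelevant, since the prefactor vanishes. -/
theorem loopDer_prod (c : Fin d) (k : ℕ) (a : Fin d → ℕ) :
    loopDer N c k (∏ c', genTr N c' (a c')) =
      MvPolynomial.C (a c : ℂ) * ∏ c', genTr N c' (Function.update a c (k + a c - 1) c') := by
  rw [← Finset.mul_prod_erase _ _ (Finset.mem_univ c), ← Finset.mul_prod_erase _ _ (Finset.mem_univ c),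
    Derivation.leibniz, derivation_prod_eq_zero, loopDer_genTr, if_pos rfl, Function.update_self]
  · have : ∏ x ∈ Finset.univ.erase c, genTr N x (Function.update a c (k + a c - 1) x) =
        ∏ x ∈ Finset.univ.erase c, genTr N x (a x) := by
      refine Finset.prod_congr rfl fun x hx => ?_
      rw [Function.update_of_ne (Finset.ne_of_mem_erase hx)]
    rw [this]
    simp only [smul_eq_mul, mul_zero, zero_add, map_natCast]
    ring
  · intro c' hc'
    rw [loopDer_genTr, if_neg (Finset.ne_of_mem_erase hc').symm]

theorem derivation_multiset_prod {ι : Type*} [DecidableEq ι]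
    (D : Derivation ℂ (EntryPoly d N) (EntryPoly d N)) (P : Multiset ι) (f : ι → EntryPoly d N) :
    D (P.map f).prod = (P.map fun j => D (f j) * ((P.erase j).map f).prod).sum := by
  induction P using Multiset.induction with
  | empty => simp
  | cons b P ih =>
    rw [Multiset.map_cons, Multiset.prod_cons, Derivation.leibniz, ih, Multiset.map_cons,
      Multiset.sum_cons, Multiset.erase_cons_head, smul_eq_mul, smul_eq_mul, add_comm,
      ← Multiset.sum_map_mul_left]
    congr 1
    · ring
    · congr 1
      refine Multiset.map_congr rfl fun j hj => ?_
      by_cases hjb : j = b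
      · subst hjb
        rw [Multiset.erase_cons_head, mul_left_comm, ← Multiset.prod_cons, ← Multiset.map_cons,
          Multiset.cons_erase hj]
      · rw [Multiset.erase_cons_tail _ (Ne.symm hjb), Multiset.map_cons, Multiset.prod_cons]
        ring

theorem gaussE_C_mul (a : ℂ) (F : EntryPoly d N) :
    gaussE d N (MvPolynomial.C a * F) = a * gaussE d N F := by
  rw [← MvPolynomial.smul_eq_C_mul, map_smul, smul_eq_mul]

/-- The loop equation for unnormalized expectations. -/
theorem modelE_loop (hN : 1 ≤ N) (c : Fin d) (k : ℕ) (F : EntryPoly d N) :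
    C (N : ℂ) * modelE d N (genTr N c (k + 1) * F) =
      ∑ i ∈ Finset.range k, modelE d N (genTr N c i * (genTr N c (k - 1 - i) * F)) +
      modelE d N (loopDer N c k F) +
      diagSum fun a => C (-((N : ℂ) ^ (2 - (d : ℤ))) * coupling d N a * a c) *
        modelE d N ((∏ c', genTr N c' (Function.update a c (k + a c - 1) c')) * F) := by
  ext m
  rw [coeff_C_mul, coeff_modelE, mul_assoc, gaussE_loop hN, map_add, map_add]
  have h1 : gaussE d N ((∑ i ∈ Finset.range k, genTr N c i * genTr N c (k - 1 - i)) *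
      (F * coeff m (expS (modelV d N)))) = coeff m (∑ i ∈ Finset.range k,
        modelE d N (genTr N c i * (genTr N c (k - 1 - i) * F))) := by
    rw [map_sum, Finset.sum_mul, map_sum]
    refine Finset.sum_congr rfl fun i _ => ?_
    rw [coeff_modelE]
    congr 1; ring
  rw [h1, add_assoc]
  congr 1
  -- The vector field acts on the observable and on the weight. By `serDer_expS` the latter inserts
  -- the derivative of the interaction, one vertex for each multidegree `a`.
  have h2 : loopDer N c k (F * coeff m (expS (modelV d N))) =
      loopDer N c k F * coeff m (expS (modelV d N)) +
        F * coeff m (serDer (loopDer N c k) (expS (modelV d N))) := by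
    rw [Derivation.leibniz, coeff_serDer, smul_eq_mul, smul_eq_mul, add_comm, mul_comm (coeff m _)]
  rw [h2, map_add, coeff_modelE]
  congr 1
  rw [serDer_expS _ constantCoeff_modelV, coeff_mul,
    sum_antidiagonal_eq_sum_Iic m fun a b =>
      coeff a (serDer (loopDer N c k) (modelV d N)) * coeff b (expS (modelV d N)),
    coeff_diagSum, Finset.mul_sum, map_sum]
  refine Finset.sum_congr rfl fun a _ => ?_
  have h3 : (loopDer N c k) (MvPolynomial.C (-((N : ℂ) ^ (2 - (d : ℤ))) * coupling d N a)) = 0 :=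
    (loopDer N c k).map_algebraMap _
  have h4 : loopDer N c k (coeff a (modelV d N)) =
      MvPolynomial.C (-((N : ℂ) ^ (2 - (d : ℤ))) * coupling d N a * a c) *
        ∏ c', genTr N c' (Function.update (a : Fin d → ℕ) c (k + a c - 1) c') := by
    rw [coeff_modelV, Derivation.leibniz, h3, smul_zero, add_zero, loopDer_prod, smul_eq_mul,
      MvPolynomial.C_mul (a' := (a c : ℂ)), mul_assoc]
  rw [coeff_serDer, h4, coeff_C_mul, coeff_modelE, ← gaussE_C_mul]
  refine congrArg (gaussE d N) ?_
  generalize MvPolynomial.C (-((N : ℂ) ^ (2 - (d : ℤ))) * coupling d N a * a c) = x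
  generalize coeff (m - a) (expS (modelV d N)) = y
  generalize ∏ c', genTr N c' (Function.update (a : Fin d → ℕ) c (k + a c - 1) c') = z
  ring

/-- The product of the sources' observables `N tr M_c ^ k`. -/
def srcProd (d N : ℕ) (P : Multiset (Label d)) : EntryPoly d N :=
  (P.map fun j => MvPolynomial.C (N : ℂ) * genTr N j.1 j.2).prod

/-- The normalized expectations of `F` times a product of sources' observables. -/
def srcE (d N : ℕ) (F : EntryPoly d N) : Src (Ser d) (Label d) :=
  ⟨fun P => modelE d N (F * srcProd d N P) * (modelE d N 1)⁻¹⟩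

/-- The scale `h = N ^ (-2)`, as a series. -/
def hScale (d N : ℕ) : Ser d := C (((N : ℂ) ^ 2)⁻¹)

/-- The generating function of the moments of `N tr M_c ^ k`. -/
def momentZ (d N : ℕ) : Src (Ser d) (Label d) := srcE d N 1

theorem momentZ_zero : momentZ d N 0 = 1 := by
  simp only [momentZ, srcE, Src.mk_apply, srcProd, Multiset.map_zero, Multiset.prod_zero, mul_one]
  exact modelE_one_mul_inv

theorem hder_srcE (hN : 1 ≤ N) (a : Label d) (F : EntryPoly d N) :
    Src.hder (hScale d N) a (srcE d N F) =
      srcE d N (MvPolynomial.C ((N : ℂ)⁻¹) * genTr N a.1 a.2 * F) := by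
  have hN0 : (N : ℂ) ≠ 0 := by exact_mod_cast (by omega : N ≠ 0)
  refine Src.ext' fun P => ?_
  simp only [Src.hder, Src.const_mul_apply, Src.der_apply, srcE, Src.mk_apply, srcProd,
    Multiset.map_cons, Multiset.prod_cons]
  rw [hScale, ← mul_assoc, ← modelE_C_mul]
  congr 2
  have : MvPolynomial.C (((N : ℂ) ^ 2)⁻¹) * MvPolynomial.C (N : ℂ) =
      (MvPolynomial.C ((N : ℂ)⁻¹) : EntryPoly d N) := by
    rw [← MvPolynomial.C_mul]; congr 1; field_simp
  rw [← this]; ring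

theorem insertList_srcE (hN : 1 ≤ N) (L : List (Label d)) (F : EntryPoly d N) :
    Src.insertList (hScale d N) L (srcE d N F) =
      srcE d N ((L.map fun a => MvPolynomial.C ((N : ℂ)⁻¹) * genTr N a.1 a.2).prod * F) := by
  induction L with
  | nil => simp [Src.insertList]
  | cons a L ih =>
    change Src.hder _ a (Src.insertList _ L _) = _
    rw [ih, hder_srcE hN, List.map_cons, List.prod_cons, mul_assoc, mul_assoc, mul_assoc]

/-- The labels inserted by the term of multidegree `a` of the action. -/
def vertexLabels (c : Fin d) (k : ℕ) (a : Fin d → ℕ) : List (Label d) :=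
  (List.finRange d).map fun c' => (c', Function.update a c (k + a c - 1) c')

/-- The weight of a source in the shift of the loop equation. -/
def shiftWeight {A : Type*} [CommRing A] (c : Fin d) (j : Label d) : A :=
  if j.1 = c then (j.2 : A) else 0

/-- The label that replaces a source in the shift of the loop equation. -/
def shiftLabel (c : Fin d) (k : ℕ) (j : Label d) : Label d := (c, k + j.2 - 1)

/-- A derivative that falls on a source merges it with the marked trace. The factor `N ^ (-2)` turns
its normalization `N` into `N ^ (-1)`, that of an insertion by `hder`. -/
theorem srcE_loopDer (hN : 1 ≤ N) (c : Fin d) (k : ℕ) (P : Multiset (Label d)) :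
    C (((N : ℂ) ^ 2)⁻¹) * modelE d N (loopDer N c k (srcProd d N P)) * (modelE d N 1)⁻¹ =
      Src.shift (shiftWeight c) (shiftLabel c k)
        (fun a => Src.hder (hScale d N) a (momentZ d N)) P := by
  have hN0 : (N : ℂ) ≠ 0 := by exact_mod_cast (by omega : N ≠ 0)
  rw [srcProd, derivation_multiset_prod, modelE_multiset_sum, Multiset.map_map, Src.shift,
    Src.mk_apply, ← Multiset.sum_map_mul_left, ← Multiset.sum_map_mul_right]
  refine congrArg Multiset.sum (Multiset.map_congr rfl fun j _ => ?_)
  have hD : loopDer N c k (MvPolynomial.C (N : ℂ) * genTr N j.1 j.2) =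
      MvPolynomial.C (N : ℂ) * loopDer N c k (genTr N j.1 j.2) := by
    rw [Derivation.leibniz,
      show loopDer N c k (MvPolynomial.C (N : ℂ)) = 0 from (loopDer N c k).map_algebraMap _,
      smul_zero, add_zero, smul_eq_mul]
  rw [momentZ, hder_srcE hN, srcE, Src.mk_apply, Function.comp_apply, hD, loopDer_genTr,
    shiftWeight, shiftLabel, ← srcProd]
  by_cases hj : j.1 = c
  · rw [if_pos hj, if_pos hj.symm, ← mul_assoc, ← modelE_C_mul,
      show ((j.2 : ℕ) : Ser d) = C (j.2 : ℂ) by simp, ← mul_assoc (C (j.2 : ℂ)), ← modelE_C_mul]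
    refine congrArg (fun F => modelE d N F * (modelE d N 1)⁻¹) ?_
    have hz : (MvPolynomial.C ((N : ℂ)⁻¹) : EntryPoly d N) =
      MvPolynomial.C (((N : ℂ) ^ 2)⁻¹) * MvPolynomial.C (N : ℂ) := by
        rw [← MvPolynomial.C_mul]; congr 1; field_simp
    have hn : (MvPolynomial.C (j.2 : ℂ) : EntryPoly d N) = (j.2 : EntryPoly d N) := map_natCast _ _
    rw [hz, hn]
    generalize (MvPolynomial.C (((N : ℂ) ^ 2)⁻¹) : EntryPoly d N) = x
    generalize (MvPolynomial.C (N : ℂ) : EntryPoly d N) = y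
    generalize srcProd d N (P.erase j) = s
    generalize genTr N c (k + j.2 - 1) = t
    ring
  · rw [if_neg hj, if_neg (Ne.symm hj), zero_mul, mul_zero, zero_mul,
      show modelE d N 0 = 0 from map_zero (modelEHom d N), mul_zero, zero_mul]

/-- A vertex is a product of `d` traces, with `tr M ^ 0 = N` for absent colours. Each insertion
brings `N ^ (-1)`, which `N ^ (d - 2)` compensates up to the overall `N ^ (-2)`. -/
theorem srcE_vertex (hN : 1 ≤ N) (c : Fin d) (k : ℕ) (a : Fin d → ℕ) (x : ℂ)
    (P : Multiset (Label d)) :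
    C (((N : ℂ) ^ 2)⁻¹) * (C x * modelE d N ((∏ c', genTr N c' (Function.update a c (k + a c - 1) c')) *
      srcProd d N P)) * (modelE d N 1)⁻¹ =
      C (x * (N : ℂ) ^ ((d : ℤ) - 2)) *
        Src.insertList (hScale d N) (vertexLabels c k a) (momentZ d N) P := by
  have hN0 : (N : ℂ) ≠ 0 := by exact_mod_cast (by omega : N ≠ 0)
  have h : ((vertexLabels c k a).map fun a =>
      (MvPolynomial.C ((N : ℂ)⁻¹) : EntryPoly d N) * genTr N a.1 a.2).prod =
      MvPolynomial.C ((N : ℂ)⁻¹ ^ d) *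
        ∏ c', genTr N c' (Function.update (a : Fin d → ℕ) c (k + a c - 1) c') := by
    rw [vertexLabels, List.map_map, ← List.ofFn_eq_map, List.prod_ofFn]
    simp only [Finset.prod_mul_distrib, Finset.prod_const, Finset.card_univ, Fintype.card_fin,
      Function.comp_apply, map_pow]
  rw [momentZ, insertList_srcE hN, srcE, Src.mk_apply, h, mul_one, mul_assoc (MvPolynomial.C _),
    modelE_C_mul, ← mul_assoc, ← mul_assoc, ← mul_assoc, ← map_mul, ← map_mul]
  congr 3
  have : (N : ℂ) ^ ((d : ℤ) - 2) = (N : ℂ) ^ d * ((N : ℂ) ^ 2)⁻¹ := by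
    rw [zpow_sub₀ hN0]; norm_cast
  rw [this, inv_pow]
  field_simp

/-- The loop equations, for moments. -/
theorem momentZ_loop (hN : 1 ≤ N) (c : Fin d) (k : ℕ) :
    Src.hder (hScale d N) (c, k + 1) (momentZ d N) =
      ∑ i ∈ Finset.range k,
        Src.hder (hScale d N) (c, i) (Src.hder (hScale d N) (c, k - 1 - i) (momentZ d N)) +
      Src.shift (shiftWeight c) (shiftLabel c k) (fun a => Src.hder (hScale d N) a (momentZ d N)) +
      srcDiagSum fun a =>
        Src.const (C (-((N : ℂ) ^ (2 - (d : ℤ))) * coupling d N a * a c * (N : ℂ) ^ ((d : ℤ) - 2))) *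
          Src.insertList (hScale d N) (vertexLabels c k a) (momentZ d N) := by
  have hN0 : (N : ℂ) ≠ 0 := by exact_mod_cast (by omega : N ≠ 0)
  refine Src.ext' fun P => ?_
  have h := congrArg (fun s => C (((N : ℂ) ^ 2)⁻¹) * s * (modelE d N 1)⁻¹)
    (modelE_loop hN c k (srcProd d N P))
  simp only [mul_add, add_mul] at h
  rw [Src.add_apply, Src.add_apply]
  refine Eq.trans ?_ (h.trans ?_)
  · rw [momentZ, hder_srcE hN, ← mul_assoc, ← map_mul, srcE, Src.mk_apply, mul_one, mul_assoc,
      modelE_C_mul]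
    congr 3
    field_simp
  · rw [srcE_loopDer hN]
    congr 1
    · congr 1
      rw [Src.sum_apply, Finset.mul_sum, Finset.sum_mul]
      refine Finset.sum_congr rfl fun i _ => ?_
      rw [momentZ, hder_srcE hN, hder_srcE hN, srcE, Src.mk_apply, ← modelE_C_mul]
      congr 2
      have : (MvPolynomial.C (((N : ℂ) ^ 2)⁻¹) : EntryPoly d N) =
        MvPolynomial.C ((N : ℂ)⁻¹) * MvPolynomial.C ((N : ℂ)⁻¹) := by
          rw [← MvPolynomial.C_mul]; congr 1; field_simp
      rw [this]; ring
    · rw [mul_assoc, diagSum_mul, mul_comm, diagSum_mul]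
      change diagSum _ = diagSum _
      congr 1
      funext a
      rw [Src.const_mul_apply, ← srcE_vertex hN]
      ring

end Model

/-! ### Genus expansion -/

section Genus

open MvPowerSeries

variable {d : ℕ}

/-- The rescaled logarithm of the generating function of moments: its coefficients are the connected
correlations times `N ^ (n - 2)`. -/
def scaledLog (d N : ℕ) : Src (Ser d) (Label d) := Src.const (hScale d N) * Src.log (momentZ d N)

theorem hder_momentZ (N : ℕ) (a : Label d) :
    Src.hder (hScale d N) a (momentZ d N) = Src.der a (scaledLog d N) * momentZ d N := by
  rw [scaledLog, Src.der_const_mul, Src.der_log momentZ_zero, mul_assoc,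
    Src.logDer_mul momentZ_zero, Src.hder]

/-- `N⁻¹ tr 1 = 1` is deterministic: a label with exponent zero is disconnected from everything. -/
theorem der_scaledLog_zero {N : ℕ} (hN : 1 ≤ N) (c : Fin d) :
    Src.der (c, 0) (scaledLog d N) = 1 := by
  have hN0 : (N : ℂ) ≠ 0 := by exact_mod_cast (by omega : N ≠ 0)
  refine Src.mul_right_cancel_of_zero (Z := momentZ d N) momentZ_zero ?_
  rw [← hder_momentZ, one_mul, momentZ, hder_srcE hN, genTr_zero, mul_one]
  congr 1
  rw [← map_natCast MvPolynomial.C N, ← MvPolynomial.C_mul, inv_mul_cancel₀ hN0, map_one]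

/-- The coefficient of the vertex of multidegree `a`, without its powers of `N`. -/
def vertexCoeff (c : Fin d) (a : Fin d →₀ ℕ) : ℂ :=
  if 2 ≤ a.degree then (1 / (a.degree : ℂ)) * (a.multinomial : ℂ) * a c else 0

/-- The exponent `d - 2 - (d - 2)|a|/2` equals `-2δ(|a| - 2)`: each degree beyond two costs `N ^
(-2δ)`. This is where the form of `d` enters. -/
theorem coupling_eq {δ : ℕ} (hd : d = 4 * δ + 2) {N : ℕ} (hN : 1 ≤ N) (a : Fin d →₀ ℕ) :
    coupling d N a = if 2 ≤ a.degree then -(1 / (a.degree : ℂ)) * (a.multinomial : ℂ) *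
      (((N : ℂ) ^ 2)⁻¹) ^ (δ * (a.degree - 2)) else 0 := by
  rw [coupling]
  refine if_ctx_congr Iff.rfl (fun h => ?_) fun _ => rfl
  congr 1
  have hN0 : (0 : ℝ) < N := by exact_mod_cast hN
  have h1 : (d : ℝ) - 2 - ((d : ℝ) - 2) / 2 * (a.degree : ℝ) =
      ((-(2 * (δ * (a.degree - 2) : ℕ) : ℤ) : ℤ) : ℝ) := by
    have hd' : (d : ℝ) = 4 * δ + 2 := by exact_mod_cast hd
    rw [hd']
    push_cast [Nat.cast_sub h]
    ring
  rw [h1, Real.rpow_intCast, zpow_neg]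
  push_cast
  rw [inv_pow, ← pow_mul]
  congr 1

theorem vertex_scale {δ : ℕ} (hd : d = 4 * δ + 2) {N : ℕ} (hN : 1 ≤ N) (c : Fin d) (a : Fin d →₀ ℕ) :
    -((N : ℂ) ^ (2 - (d : ℤ))) * coupling d N a * a c * (N : ℂ) ^ ((d : ℤ) - 2) =
      vertexCoeff c a * (((N : ℂ) ^ 2)⁻¹) ^ (δ * (a.degree - 2)) := by
  have hN0 : (N : ℂ) ≠ 0 := by exact_mod_cast (by omega : N ≠ 0)
  have h1 : (N : ℂ) ^ (2 - (d : ℤ)) * (N : ℂ) ^ ((d : ℤ) - 2) = 1 := by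
    rw [← zpow_add₀ hN0]; simp
  rw [coupling_eq hd hN, vertexCoeff]
  split_ifs
  · linear_combination ((1 / (a.degree : ℂ)) * (a.multinomial : ℂ) *
      (((N : ℂ) ^ 2)⁻¹) ^ (δ * (a.degree - 2)) * a c) * h1
  · simp

/-- The right-hand side of the loop equation for a family `K` of logarithmic derivatives. -/
def loopRHS {R : Type*} [CommRing R] (h : MvPowerSeries (Fin d) R)
    (v : (Fin d →₀ ℕ) → MvPowerSeries (Fin d) R) (c : Fin d) (k : ℕ)
    (K : Label d → Src (MvPowerSeries (Fin d) R) (Label d)) :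
    Src (MvPowerSeries (Fin d) R) (Label d) :=
  ∑ i ∈ Finset.range k, (Src.hder h (c, i) (K (c, k - 1 - i)) + K (c, i) * K (c, k - 1 - i)) +
    Src.shift (shiftWeight c) (shiftLabel c k) K +
    srcDiagSum fun a => Src.const (v a) * Src.nablaList h K (vertexLabels c k a)

/-- Every term of `momentZ_loop` is a multiple of `momentZ`, which has constant term one and can be
cancelled. -/
theorem scaledLog_loop {δ : ℕ} (hd : d = 4 * δ + 2) {N : ℕ} (hN : 1 ≤ N) (c : Fin d) (k : ℕ) :
    Src.der (c, k + 1) (scaledLog d N) =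
      loopRHS (hScale d N) (fun a => C (vertexCoeff c a) * hScale d N ^ (δ * (a.degree - 2))) c k
        (fun a => Src.der a (scaledLog d N)) := by
  have hK := hder_momentZ (d := d) N
  refine Src.mul_right_cancel_of_zero (Z := momentZ d N) momentZ_zero ?_
  rw [← hK, momentZ_loop hN, loopRHS, add_mul, add_mul, ← Src.shift_mul, srcDiagSum_mul,
    Finset.sum_mul]
  simp only [← hK]
  congr 1
  · congr 1
    refine Finset.sum_congr rfl fun i _ => ?_
    rw [hK (c, k - 1 - i)]
    have h1 := hK (c, i)
    simp only [Src.hder, Src.der_mul] at h1 ⊢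
    linear_combination Src.der (c, k - 1 - i) (scaledLog d N) * h1
  · congr 1
    funext a
    rw [Src.insertList_eq hK, vertex_scale hd hN, hScale, ← map_pow, ← map_mul, mul_assoc]

/-- A function of `N ≥ 1` that is a polynomial in `N ^ (-2)`. -/
def IsPolyFam (f : ℕ → ℂ) : Prop :=
  ∃ Q : Polynomial ℂ, ∀ N : ℕ, 1 ≤ N → f N = Q.eval (((N : ℂ) ^ 2)⁻¹)

theorem IsPolyFam.congr {f g : ℕ → ℂ} (hf : IsPolyFam f) (h : ∀ N, 1 ≤ N → g N = f N) :
    IsPolyFam g := by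
  obtain ⟨Q, hQ⟩ := hf
  exact ⟨Q, fun N hN => by rw [h N hN, hQ N hN]⟩

theorem IsPolyFam.const (x : ℂ) : IsPolyFam fun _ => x := ⟨Polynomial.C x, by simp⟩

theorem IsPolyFam.scale : IsPolyFam fun N => ((N : ℂ) ^ 2)⁻¹ := ⟨Polynomial.X, by simp⟩

theorem IsPolyFam.add {f g : ℕ → ℂ} (hf : IsPolyFam f) (hg : IsPolyFam g) :
    IsPolyFam fun N => f N + g N := by
  obtain ⟨Q, hQ⟩ := hf
  obtain ⟨R, hR⟩ := hg
  exact ⟨Q + R, fun N hN => by simp [hQ N hN, hR N hN]⟩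

theorem IsPolyFam.mul {f g : ℕ → ℂ} (hf : IsPolyFam f) (hg : IsPolyFam g) :
    IsPolyFam fun N => f N * g N := by
  obtain ⟨Q, hQ⟩ := hf
  obtain ⟨R, hR⟩ := hg
  exact ⟨Q * R, fun N hN => by simp [hQ N hN, hR N hN]⟩

theorem IsPolyFam.pow {f : ℕ → ℂ} (hf : IsPolyFam f) (k : ℕ) : IsPolyFam fun N => f N ^ k := by
  obtain ⟨Q, hQ⟩ := hf
  exact ⟨Q ^ k, fun N hN => by simp [hQ N hN]⟩

theorem IsPolyFam.sum {ι : Type*} (s : Finset ι) {f : ι → ℕ → ℂ} (h : ∀ i ∈ s, IsPolyFam (f i)) :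
    IsPolyFam fun N => ∑ i ∈ s, f i N := by
  classical
  induction s using Finset.induction_on with
  | empty => simpa using IsPolyFam.const 0
  | insert a s ha ih =>
    simp only [Finset.sum_insert ha]
    exact (h a (by simp)).add (ih fun i hi => h i (Finset.mem_insert_of_mem hi))

/-- The coefficients of degree less than `M` are polynomials in `N ^ (-2)`. -/
def PolyBelow (M : ℕ) (s : ℕ → Ser d) : Prop :=
  ∀ m : Fin d →₀ ℕ, m.degree < M → IsPolyFam fun N => coeff m (s N)

theorem PolyBelow.congr {M : ℕ} {s t : ℕ → Ser d} (hs : PolyBelow M s)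
    (h : ∀ N, 1 ≤ N → t N = s N) : PolyBelow M t :=
  fun m hm => (hs m hm).congr fun N hN => by rw [h N hN]

theorem PolyBelow.add {M : ℕ} {s t : ℕ → Ser d} (hs : PolyBelow M s) (ht : PolyBelow M t) :
    PolyBelow M fun N => s N + t N := fun m hm => by
  simpa using (hs m hm).add (ht m hm)

theorem PolyBelow.zero {M : ℕ} : PolyBelow M fun _ => (0 : Ser d) := fun m _ => by
  simpa using IsPolyFam.const 0

theorem PolyBelow.mul {M : ℕ} {s t : ℕ → Ser d} (hs : PolyBelow M s) (ht : PolyBelow M t) :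
    PolyBelow M fun N => s N * t N := fun m hm => by
  simp only [coeff_mul]
  refine IsPolyFam.sum _ fun q hq => ?_
  have := congrArg Finsupp.degree (Finset.HasAntidiagonal.mem_antidiagonal.1 hq)
  rw [map_add] at this
  exact (hs _ (by omega)).mul (ht _ (by omega))

theorem PolyBelow.C {M : ℕ} {f : ℕ → ℂ} (hf : IsPolyFam f) :
    PolyBelow M fun N => (MvPowerSeries.C (f N) : Ser d) := fun m _ => by
  simp only [coeff_C]
  split_ifs
  · exact hf
  · exact IsPolyFam.const 0

theorem PolyBelow.sum {ι : Type*} {M : ℕ} (S : Finset ι) {f : ι → ℕ → Ser d}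
    (h : ∀ i ∈ S, PolyBelow M (f i)) : PolyBelow M fun N => ∑ i ∈ S, f i N := fun m hm => by
  simp only [map_sum]
  exact IsPolyFam.sum _ fun i hi => h i hi m hm

theorem PolyBelow.multiset_sum {ι : Type*} {M : ℕ} (S : Multiset ι) {f : ι → ℕ → Ser d}
    (h : ∀ i ∈ S, PolyBelow M (f i)) : PolyBelow M fun N => (S.map fun i => f i N).sum := by
  induction S using Multiset.induction with
  | empty => simpa using PolyBelow.zero
  | cons a S ih =>
    simp only [Multiset.map_cons, Multiset.sum_cons]
    exact (h a (by simp)).add (ih fun i hi => h i (Multiset.mem_cons_of_mem hi))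

/-- `PolyBelow` for all coefficients of a family of generating functions. -/
def SrcPolyBelow (M : ℕ) (f : ℕ → Src (Ser d) (Label d)) : Prop :=
  ∀ P, PolyBelow M fun N => f N P

theorem SrcPolyBelow.mul {M : ℕ} {f g : ℕ → Src (Ser d) (Label d)} (hf : SrcPolyBelow M f)
    (hg : SrcPolyBelow M g) : SrcPolyBelow M fun N => f N * g N := fun P => by
  simp only [Src.mul_apply]
  exact PolyBelow.multiset_sum _ fun q _ => (hf q.1).mul (hg q.2)

theorem SrcPolyBelow.nablaList {M : ℕ} {K : ℕ → Label d → Src (Ser d) (Label d)}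
    (hK : ∀ a, SrcPolyBelow M fun N => K N a) (L : List (Label d)) :
    SrcPolyBelow M fun N => Src.nablaList (hScale d N) (K N) L := by
  induction L with
  | nil =>
    intro P
    simp only [Src.nablaList, List.foldr_nil, Src.one_apply]
    split_ifs
    · simpa using PolyBelow.C (d := d) (M := M) (IsPolyFam.const 1)
    · exact PolyBelow.zero
  | cons a L ih =>
    intro P
    change PolyBelow M fun N => Src.hder (hScale d N) a (Src.nablaList (hScale d N) (K N) L) P +
      (K N a * Src.nablaList (hScale d N) (K N) L) P
    refine PolyBelow.add ?_ ((hK a).mul ih P)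
    simp only [Src.hder, Src.const_mul_apply, Src.der_apply]
    exact (PolyBelow.C IsPolyFam.scale).mul (ih _)

/-- The total exponent of a multiset of labels. -/
def totalWeight (P : Multiset (Label d)) : ℕ := (P.map Prod.snd).sum

theorem totalWeight_cons (a : Label d) (P : Multiset (Label d)) :
    totalWeight (a ::ₘ P) = a.2 + totalWeight P := by simp [totalWeight]

theorem totalWeight_add (P Q : Multiset (Label d)) :
    totalWeight (P + Q) = totalWeight P + totalWeight Q := by simp [totalWeight]

/-- Two nested inductions. The terms of the Gaussian loop equation keep the order in `α` but lower
the total exponent by two; the vertices may raise the total exponent but have order at least two in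
`α`. All coefficients of the recursion are polynomials in `N ^ (-2)`, the vertices included by
`vertex_scale`. -/
theorem scaledLog_polyBelow {δ : ℕ} (hd : d = 4 * δ + 2) (M : ℕ) (a : Label d) :
    SrcPolyBelow M fun N => Src.der a (scaledLog d N) := by
  induction M generalizing a with
  | zero => exact fun P m hm => absurd hm (Nat.not_lt_zero _)
  | succ M ihM =>
    have key : ∀ D : ℕ, ∀ (a : Label d) (P : Multiset (Label d)), a.2 + totalWeight P < D →
        PolyBelow (M + 1) fun N => Src.der a (scaledLog d N) P := by
      intro D
      induction D with
      | zero => exact fun a P h => absurd h (Nat.not_lt_zero _)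
      | succ D ih =>
        rintro ⟨c, k⟩ P hP
        cases k with
        | zero =>
          refine PolyBelow.congr (s := fun _ => (1 : Src (Ser d) (Label d)) P) ?_
            fun N hN => by rw [der_scaledLog_zero hN]
          rw [Src.one_apply]
          split_ifs
          · simpa using PolyBelow.C (d := d) (M := M + 1) (IsPolyFam.const 1)
          · exact PolyBelow.zero
        | succ k =>
          simp only at hP
          refine PolyBelow.congr ?_ fun N hN => congrArg (fun f : Src _ _ => f P)
            (scaledLog_loop hd hN c k)
          simp only [loopRHS, Src.add_apply, Src.sum_apply]
          refine PolyBelow.add (PolyBelow.add (PolyBelow.sum _ fun i hi => ?_) ?_) ?_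
          · have hi' := Finset.mem_range.1 hi
            refine PolyBelow.add ?_ ?_
            · simp only [Src.hder, Src.const_mul_apply, Src.der_apply]
              refine (PolyBelow.C IsPolyFam.scale).mul (ih (c, k - 1 - i) ((c, i) ::ₘ P) ?_)
              rw [totalWeight_cons]
              simp only; omega
            · simp only [Src.mul_apply]
              refine PolyBelow.multiset_sum _ fun q hq => ?_
              have hw := congrArg totalWeight (Multiset.mem_antidiagonal.1 hq)
              rw [totalWeight_add] at hw
              refine (ih (c, i) q.1 ?_).mul (ih (c, k - 1 - i) q.2 ?_)
              · simp only; omega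
              · simp only; omega
          · simp only [Src.shift, Src.mk_apply]
            refine PolyBelow.multiset_sum _ fun j hj => ?_
            have hw := congrArg totalWeight (Multiset.cons_erase hj)
            rw [totalWeight_cons] at hw
            by_cases hjc : j.1 = c ∧ 1 ≤ j.2
            · refine PolyBelow.mul ?_ (ih _ _ ?_)
              · simp only [shiftWeight, if_pos hjc.1]
                simpa using PolyBelow.C (d := d) (M := M + 1) (IsPolyFam.const (j.2 : ℂ))
              · simp only [shiftLabel]; omega
            -- Sources `tr 1` and sources of another colour have weight zero, so the truncated
            -- subtraction in `shiftLabel` never matters.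
            · have h0 : (shiftWeight c j : Ser d) = 0 := by
                rw [shiftWeight]
                split_ifs with h1
                · have : j.2 = 0 := by
                    by_contra h2
                    exact hjc ⟨h1, by omega⟩
                  simp [this]
                · rfl
              simpa [h0] using PolyBelow.zero
          · intro m hm
            simp only [srcDiagSum, Src.mk_apply, coeff_diagSum, Src.const_mul_apply]
            refine IsPolyFam.sum _ fun b hb => ?_
            by_cases hb2 : 2 ≤ b.degree
            · have hle := Finset.mem_Iic.1 hb
              have hdeg := congrArg Finsupp.degree (tsub_add_cancel_of_le hle)
              rw [map_add] at hdeg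
              -- The monomial `α ^ b` with `|b| ≥ 2` leaves an order below `M`, where the outer
              -- induction hypothesis covers all total exponents.
              refine PolyBelow.mul (M := M) ?_ (SrcPolyBelow.nablaList ihM _ P) _ (by omega)
              simp only [hScale, ← map_pow, ← map_mul]
              exact PolyBelow.C ((IsPolyFam.const _).mul (IsPolyFam.scale.pow _))
            · simpa [vertexCoeff, hb2] using IsPolyFam.const 0
    exact fun P => key _ a P (Nat.lt_succ_self _)

theorem scaledLog_isPolyFam {δ : ℕ} (hd : d = 4 * δ + 2) (X : Multiset (Label d)) (m : Fin d →₀ ℕ) :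
    IsPolyFam fun N => coeff m (scaledLog d N X) := by
  induction X using Multiset.induction with
  | empty =>
    have : ∀ N, scaledLog d N 0 = 0 := by
      intro N
      rw [scaledLog, Src.const_mul_apply, Src.log, Src.mk_apply, dif_neg (by simp), mul_zero]
    simpa [this] using IsPolyFam.const 0
  | cons a P _ => exact scaledLog_polyBelow hd (m.degree + 1) a P m (Nat.lt_succ_self _)

end Genus

/-! ### The universal free energy -/

section Universal

open MvPowerSeries

variable {d δ : ℕ}

/-- Evaluation at `N ^ (-2)`. -/
def evalN (N : ℕ) : Polynomial ℂ →+* ℂ := Polynomial.evalRingHom (((N : ℂ) ^ 2)⁻¹)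

/-- The values `N ^ (-2)` are infinitely many. This lifts identities known for every `N` to
polynomials, where coefficients of each genus can be compared. -/
theorem Polynomial_eq_of_evalN {p q : Polynomial ℂ} (h : ∀ N, 1 ≤ N → evalN N p = evalN N q) :
    p = q := by
  refine Polynomial.eq_of_infinite_eval_eq p q ?_
  have hinj : Function.Injective fun N : ℕ => (((N + 1 : ℕ) : ℂ) ^ 2)⁻¹ := by
    intro a b hab
    have h1 : ((a + 1) ^ 2 : ℕ) = (b + 1) ^ 2 := by
      have := inv_injective hab
      exact_mod_cast this
    have := Nat.pow_left_injective (n := 2) (by norm_num) h1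
    omega
  refine (Set.infinite_range_of_injective hinj).mono ?_
  rintro _ ⟨N, rfl⟩
  exact h (N + 1) (Nat.succ_pos N)

/-- `evalN` on coefficients of generating functions. -/
def evalSrc {T : Type*} (N : ℕ) : Src (MvPowerSeries (Fin d) (Polynomial ℂ)) T → Src (Ser d) T :=
  Src.map (MvPowerSeries.map (evalN N))

theorem eq_of_evalSrc {T : Type*} {f g : Src (MvPowerSeries (Fin d) (Polynomial ℂ)) T}
    (h : ∀ N, 1 ≤ N → evalSrc N f = evalSrc N g) : f = g := by
  refine Src.ext' fun P => ?_
  ext m : 1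
  refine Polynomial_eq_of_evalN fun N hN => ?_
  have := congrArg (fun s : Src (Ser d) T => coeff m (s P)) (h N hN)
  simpa [evalSrc] using this

/-- The rescaled logarithm of the generating function of moments, as a polynomial in `N ^ (-2)` at
each order. -/
def universalLog (hd : d = 4 * δ + 2) : Src (MvPowerSeries (Fin d) (Polynomial ℂ)) (Label d) :=
  ⟨fun X m => (scaledLog_isPolyFam hd X m).choose⟩

theorem evalSrc_universalLog (hd : d = 4 * δ + 2) {N : ℕ} (hN : 1 ≤ N) :
    evalSrc N (universalLog hd) = scaledLog d N := by
  refine Src.ext' fun X => ?_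
  ext m
  exact ((scaledLog_isPolyFam hd X m).choose_spec N hN).symm

theorem Src.map_nablaList {A B T : Type*} [CommRing A] [CommRing B] (φ : A →+* B) (h : A)
    (K : T → Src A T) (L : List T) :
    Src.map φ (Src.nablaList h K L) = Src.nablaList (φ h) (fun a => Src.map φ (K a)) L := by
  induction L with
  | nil => exact Src.map_one φ
  | cons a L ih =>
    change Src.map φ (Src.hder h a (Src.nablaList h K L) + K a * Src.nablaList h K L) =
      Src.hder (φ h) a (Src.nablaList (φ h) (fun a => Src.map φ (K a)) L) + Src.map φ (K a) *
        Src.nablaList (φ h) (fun a => Src.map φ (K a)) L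
    rw [← ih, ← Src.map_mul]
    refine Src.ext' fun P => ?_
    simp [Src.hder]

theorem map_loopRHS {R S : Type*} [CommRing R] [CommRing S] (φ : R →+* S)
    (h : MvPowerSeries (Fin d) R) (v : (Fin d →₀ ℕ) → MvPowerSeries (Fin d) R) (c : Fin d) (k : ℕ)
    (K : Label d → Src (MvPowerSeries (Fin d) R) (Label d)) :
    Src.map (MvPowerSeries.map φ) (loopRHS h v c k K) =
      loopRHS (MvPowerSeries.map φ h) (fun a => MvPowerSeries.map φ (v a)) c k
        (fun a => Src.map (MvPowerSeries.map φ) (K a)) := by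
  refine Src.ext' fun P => ?_
  simp only [loopRHS, Src.map_apply, Src.add_apply, Src.sum_apply, _root_.map_add, _root_.map_sum]
  congr 1
  · congr 1
    · refine Finset.sum_congr rfl fun i _ => ?_
      rw [← Src.map_mul]
      simp [Src.hder]
    · simp only [Src.shift, Src.mk_apply, map_multiset_sum, Multiset.map_map]
      refine congrArg _ (Multiset.map_congr rfl fun j _ => ?_)
      simp only [Function.comp_apply, _root_.map_mul, Src.map_apply, shiftWeight]
      split_ifs <;> simp
  · simp only [srcDiagSum, Src.mk_apply, map_diagSum]
    congr 1
    funext a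
    rw [Src.const_mul_apply, Src.const_mul_apply, ← Src.map_nablaList, _root_.map_mul]
    rfl

theorem der_universalLog_zero (hd : d = 4 * δ + 2) (c : Fin d) :
    Src.der (c, 0) (universalLog hd) = 1 := by
  refine eq_of_evalSrc fun N hN => ?_
  have := der_scaledLog_zero hN c
  rw [← evalSrc_universalLog hd hN] at this
  exact this.trans (Src.map_one _).symm

theorem universalLog_loop (hd : d = 4 * δ + 2) (c : Fin d) (k : ℕ) :
    Src.der (c, k + 1) (universalLog hd) = loopRHS (C Polynomial.X)
      (fun a => C (Polynomial.C (vertexCoeff c a)) * C Polynomial.X ^ (δ * (a.degree - 2))) c k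
      (fun a => Src.der a (universalLog hd)) := by
  refine eq_of_evalSrc fun N hN => ?_
  have := scaledLog_loop hd hN c k
  rw [← evalSrc_universalLog hd hN] at this
  refine this.trans ?_
  rw [evalSrc, map_loopRHS]
  simp only [_root_.map_mul, map_pow, MvPowerSeries.map_C, evalN, Polynomial.coe_evalRingHom,
    Polynomial.eval_X, Polynomial.eval_C, hScale]
  rfl

/-- The genus `g` part of a series. -/
def genusPart (g : ℕ) : MvPowerSeries (Fin d) (Polynomial ℂ) →+ Ser d where
  toFun f := fun m => (coeff m f).coeff g
  map_zero' := by ext m; exact Polynomial.coeff_zero g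
  map_add' f f' := by ext m; exact Polynomial.coeff_add _ _ g

theorem coeff_genusPart (g : ℕ) (f : MvPowerSeries (Fin d) (Polynomial ℂ)) (m : Fin d →₀ ℕ) :
    coeff m (genusPart g f) = (coeff m f).coeff g := rfl

theorem genusPart_mul (g : ℕ) (f f' : MvPowerSeries (Fin d) (Polynomial ℂ)) :
    genusPart g (f * f') = ∑ q ∈ Finset.HasAntidiagonal.antidiagonal g, genusPart q.1 f * genusPart q.2 f' := by
  ext m
  rw [coeff_genusPart, coeff_mul, Polynomial.finsetSum_coeff, map_sum]
  simp only [coeff_mul, Polynomial.coeff_mul]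
  rw [Finset.sum_comm]
  rfl

theorem genusPart_one (g : ℕ) : genusPart g (1 : MvPowerSeries (Fin d) (Polynomial ℂ)) =
    if g = 0 then 1 else 0 := by
  classical
  ext m
  rw [coeff_genusPart, coeff_one]
  by_cases hm : m = 0 <;> by_cases hg : g = 0 <;> simp [hm, hg, coeff_one, Polynomial.coeff_one]

theorem genusPart_C_X_mul (g : ℕ) (f : MvPowerSeries (Fin d) (Polynomial ℂ)) :
    genusPart g (C Polynomial.X * f) = if g = 0 then 0 else genusPart (g - 1) f := by
  ext m
  rw [coeff_genusPart, coeff_C_mul]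
  cases g with
  | zero => simp
  | succ g => rw [Polynomial.coeff_X_mul]; rfl

theorem genusPart_natCast_mul (g n : ℕ) (f : MvPowerSeries (Fin d) (Polynomial ℂ)) :
    genusPart g ((n : MvPowerSeries (Fin d) (Polynomial ℂ)) * f) = (n : Ser d) * genusPart g f := by
  rw [← nsmul_eq_mul, map_nsmul, nsmul_eq_mul]

/-- The genus `g` connected correlations, rescaled. -/
def genusKappa (hd : d = 4 * δ + 2) (g : ℕ) (X : Multiset (Label d)) : Ser d :=
  genusPart g (universalLog hd X)

/-- The genus expansion coefficients of the model. -/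
def genusData (hd : d = 4 * δ + 2) : GenusData d := fun g n c p =>
  genusKappa hd g ((Finset.univ : Finset (Fin n)).val.map fun i => (c i, p i))

theorem expectation_eq {N : ℕ} (hN : 1 ≤ N) {n : ℕ} (c : Fin n → Fin d) (p : Fin n → ℕ)
    (S : Finset (Fin n)) : expectation d N c p S =
      Src.scale (C ((N : ℂ)⁻¹)) (momentZ d N) (S.val.map fun i => (c i, p i)) := by
  have hN0 : (N : ℂ) ≠ 0 := by exact_mod_cast (by omega : N ≠ 0)
  have h1 := formalIntegral_eq (d := d) (N := N) (∏ i ∈ S, genTr N (c i) (p i))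
    (fun A => ∏ i ∈ S, (herm (A (c i)) ^ p i).trace)
    (fun A => by rw [_root_.map_prod]; simp only [evalArrays_genTr])
  have h2 := formalIntegral_eq (d := d) (N := N) 1 (fun _ => 1) (fun A => _root_.map_one _)
  simp only [_root_.map_one, one_mul] at h2
  rw [expectation, h1, h2, Src.scale_apply, momentZ, srcE, Src.mk_apply, one_mul, ← mul_assoc,
    ← map_pow, ← modelE_C_mul]
  refine congrArg (fun F => modelE d N F * (modelE d N 1)⁻¹) ?_
  rw [srcProd, Multiset.map_map]
  change _ = _ * ∏ i ∈ S, (MvPolynomial.C (N : ℂ) * genTr N (c i) (p i))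
  rw [Finset.prod_mul_distrib, Finset.prod_const, ← mul_assoc, ← MvPolynomial.C_pow,
    ← MvPolynomial.C_mul, Multiset.card_map, Finset.card_val, ← mul_pow, inv_mul_cancel₀ hN0,
    one_pow, MvPolynomial.C_1, one_mul]

/-- The moments of `tr M` are those of `N tr M` with sources scaled by `1/N`, and the logarithm
commutes with this scaling. The factors `N ^ (-n)` and `N ^ 2` combine. -/
theorem connected_eq {N : ℕ} (hN : 1 ≤ N) {n : ℕ} (hn : 1 ≤ n) (c : Fin n → Fin d)
    (p : Fin n → ℕ) : connected d N c p =
      C ((N : ℂ) ^ (2 - (n : ℤ))) *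
        scaledLog d N ((Finset.univ : Finset (Fin n)).val.map fun i => (c i, p i)) := by
  have hN0 : (N : ℂ) ≠ 0 := by exact_mod_cast (by omega : N ≠ 0)
  have hne : (Finset.univ : Finset (Fin n)).Nonempty := ⟨⟨0, hn⟩, Finset.mem_univ _⟩
  set x : Ser d := C ((N : ℂ)⁻¹)
  have hZ : Src.scale x (momentZ d N) 0 = 1 := by simp [momentZ_zero]
  have h1 : connected d N c p = Src.log (Src.scale x (momentZ d N))
      ((Finset.univ : Finset (Fin n)).val.map fun i => (c i, p i)) := by
    rw [← cumulant_eq_log hZ _ hne]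
    refine Finset.sum_congr rfl fun π _ => congrArg _ (Finset.prod_congr rfl fun S _ => ?_)
    exact expectation_eq hN c p S
  have hX : (Finset.univ : Finset (Fin n)).val.map (fun i => (c i, p i)) ≠ 0 := by
    rw [← Multiset.card_pos, Multiset.card_map, Finset.card_val]
    exact hne.card_pos
  have h2 := Src.log_unique (κ := Src.scale x (Src.log (momentZ d N))) hZ (fun a => by
    rw [Src.der_scale, Src.der_log momentZ_zero, mul_assoc, ← Src.scale_mul,
      Src.logDer_mul momentZ_zero, Src.der_scale]) hX
  rw [h1, ← h2, Src.scale_apply, Multiset.card_map, Finset.card_val, Finset.card_univ,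
    Fintype.card_fin, scaledLog, Src.const_mul_apply, ← mul_assoc, hScale, ← map_pow, ← map_mul]
  congr 2
  rw [zpow_sub₀ hN0]
  simp only [inv_pow, zpow_natCast]
  norm_cast
  field_simp

theorem isTopologicalExpansion_genusData (hd : d = 4 * δ + 2) :
    IsTopologicalExpansion d (genusData hd) := by
  intro n hn c p m
  set X := (Finset.univ : Finset (Fin n)).val.map fun i => (c i, p i) with hX
  have hfun : (fun g => coeff m (genusData hd g n c p)) = fun g => (coeff m (universalLog hd X)).coeff g :=
    rfl
  rw [hfun]
  set Q := coeff m (universalLog hd X) with hQ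
  have hfin : (Function.support fun g => Q.coeff g).Finite :=
    Q.support.finite_toSet.subset fun g hg => Polynomial.mem_support_iff.2 hg
  refine ⟨hfin, fun N hN => ?_⟩
  have hN0 : (N : ℂ) ≠ 0 := by exact_mod_cast (by omega : N ≠ 0)
  have hs : coeff m (scaledLog d N X) = Q.eval (((N : ℂ) ^ 2)⁻¹) := by
    rw [← evalSrc_universalLog hd hN]; rfl
  change coeff m (connected d N c p) = ∑ᶠ g : ℕ, Q.coeff g * (N : ℂ) ^ (2 - (n : ℤ) - 2 * (g : ℤ))
  rw [connected_eq hN hn, coeff_C_mul, hs, Polynomial.eval_eq_sum, Polynomial.sum, Finset.mul_sum]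
  rw [finsum_eq_sum_of_support_subset (s := Q.support)]
  · refine Finset.sum_congr rfl fun g _ => ?_
    have : ((N : ℂ) ^ (2 - (n : ℤ) - 2 * (g : ℤ))) =
        (N : ℂ) ^ (2 - (n : ℤ)) * (((N : ℂ) ^ 2)⁻¹) ^ g := by
      rw [zpow_sub₀ hN0 (2 - (n : ℤ)), div_eq_mul_inv, inv_pow, ← pow_mul]
      congr 2
    rw [this]; ring
  · intro g hg
    refine Finset.mem_coe.2 (Polynomial.mem_support_iff.2 fun h => hg ?_)
    simp [h]

theorem isTopologicalExpansion_unique {w w' : GenusData d} (h : IsTopologicalExpansion d w)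
    (h' : IsTopologicalExpansion d w') (g n : ℕ) (hn : 1 ≤ n) : w g n = w' g n := by
  funext c p
  ext m
  obtain ⟨h1, h2⟩ := h n hn c p m
  obtain ⟨h1', h2'⟩ := h' n hn c p m
  have key : ∀ u : ℕ → ℂ, ∀ hu : (Function.support u).Finite, ∀ N : ℕ, 1 ≤ N →
      ∑ᶠ g : ℕ, u g * (N : ℂ) ^ (2 - (n : ℤ) - 2 * (g : ℤ)) = (N : ℂ) ^ (2 - (n : ℤ)) *
        evalN N (∑ g ∈ hu.toFinset, Polynomial.monomial g (u g)) := by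
    intro u hu N hN
    have hN0 : (N : ℂ) ≠ 0 := by exact_mod_cast (by omega : N ≠ 0)
    rw [finsum_eq_sum_of_support_subset (s := hu.toFinset), map_sum, Finset.mul_sum]
    · refine Finset.sum_congr rfl fun g _ => ?_
      have : ((N : ℂ) ^ (2 - (n : ℤ) - 2 * (g : ℤ))) =
          (N : ℂ) ^ (2 - (n : ℤ)) * (((N : ℂ) ^ 2)⁻¹) ^ g := by
        rw [zpow_sub₀ hN0 (2 - (n : ℤ)), div_eq_mul_inv, inv_pow, ← pow_mul]
        congr 2
      rw [this, evalN, Polynomial.coe_evalRingHom, Polynomial.eval_monomial]; ring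
    · intro g hg
      rw [Set.Finite.coe_toFinset]
      exact fun h => hg (by simp [h])
  have hcoeff : ∀ u : ℕ → ℂ, ∀ hu : (Function.support u).Finite,
      (∑ g ∈ hu.toFinset, Polynomial.monomial g (u g)).coeff g = u g := by
    intro u hu
    rw [Polynomial.finsetSum_coeff]
    simp only [Polynomial.coeff_monomial]
    rw [Finset.sum_ite_eq']
    split_ifs with h
    · rfl
    · by_contra h3
      exact h ((Set.Finite.mem_toFinset hu).2 fun h4 => h3 h4.symm)
  have heq : (∑ g ∈ h1.toFinset, Polynomial.monomial g (coeff m (w g n c p))) =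
      ∑ g ∈ h1'.toFinset, Polynomial.monomial g (coeff m (w' g n c p)) := by
    refine Polynomial_eq_of_evalN fun N hN => ?_
    have hN0 : (N : ℂ) ≠ 0 := by exact_mod_cast (by omega : N ≠ 0)
    have := (h2 N hN).symm.trans (h2' N hN)
    rw [key _ h1 N hN, key _ h1' N hN] at this
    exact mul_left_cancel₀ (zpow_ne_zero _ hN0) this
  have := hcoeff _ h1
  rw [heq, hcoeff _ h1'] at this
  exact this.symm

end Universal

/-! ### Loop equations at fixed genus -/

namespace Src

variable {A T : Type*} [CommRing A]

/-- Insertions commute because the cross derivatives of `K` agree. The colours that occur in a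
vertex can then be brought to the front, where the remaining trivial labels contribute one. -/
theorem nablaList_perm {h : A} {K : T → Src A T} (hK : ∀ a b, der a (K b) = der b (K a))
    {L L' : List T} (hL : L.Perm L') : nablaList h K L = nablaList h K L' := by
  induction hL with
  | nil => rfl
  | cons a _ ih => simp only [nablaList, List.foldr_cons] at ih ⊢; rw [ih]
  | swap a b L =>
    simp only [nablaList, List.foldr_cons]
    generalize List.foldr _ _ L = f
    have h1 := hK a b
    have h2 := der_comm a b f
    simp only [hder, der_add, der_mul, der_const]
    linear_combination -(const h) * f * h1 - const h ^ 2 * h2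
  | trans _ _ ih1 ih2 => exact ih1.trans ih2

end Src

/-! ### Reduction to quadratic vertices below genus `δ`. -/

section Quadratic

open MvPowerSeries

variable {d δ : ℕ}

theorem nablaList_of_zero {A : Type*} [CommRing A] {h : A} {K : Label d → Src A (Label d)}
    (hK0 : ∀ c, K (c, 0) = 1) {L : List (Label d)} (hL : ∀ a ∈ L, a.2 = 0) :
    Src.nablaList h K L = 1 := by
  induction L with
  | nil => rfl
  | cons a L ih =>
    change Src.hder h a (Src.nablaList h K L) + K a * Src.nablaList h K L = 1
    have ha : a = (a.1, 0) := Prod.ext rfl (hL a (by simp))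
    rw [ih fun b hb => hL b (List.mem_cons_of_mem _ hb), ha, hK0]
    simp [Src.hder]

theorem nablaList_vertexLabels_self {A : Type*} [CommRing A] {h : A} {K : Label d → Src A (Label d)}
    (hK : ∀ a b, Src.der a (K b) = Src.der b (K a)) (hK0 : ∀ c, K (c, 0) = 1) (c : Fin d) (k : ℕ) :
    Src.nablaList h K (vertexLabels c k ⇑(Finsupp.single c 1 + Finsupp.single c 1 : Fin d →₀ ℕ)) =
      K (c, k + 1) := by
  have hp := (List.perm_cons_erase (List.mem_finRange c)).map
    fun c' => (c', Function.update (⇑(Finsupp.single c 1 + Finsupp.single c 1 : Fin d →₀ ℕ)) c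
      (k + (Finsupp.single c 1 + Finsupp.single c 1 : Fin d →₀ ℕ) c - 1) c')
  rw [vertexLabels, Src.nablaList_perm hK hp, List.map_cons]
  change Src.hder h _ (Src.nablaList h K _) + K _ * Src.nablaList h K _ = _
  rw [nablaList_of_zero hK0]
  · simp [Src.hder]
  · intro a ha
    obtain ⟨c', hc', rfl⟩ := List.mem_map.1 ha
    have hne : c' ≠ c := ((List.nodup_finRange d).mem_erase_iff.1 hc').1
    simp [hne]

theorem nablaList_vertexLabels {A : Type*} [CommRing A] {h : A} {K : Label d → Src A (Label d)}
    (hK : ∀ a b, Src.der a (K b) = Src.der b (K a)) (hK0 : ∀ c, K (c, 0) = 1) {c c' : Fin d}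
    (hc : c' ≠ c) (k : ℕ) :
    Src.nablaList h K (vertexLabels c k ⇑(Finsupp.single c 1 + Finsupp.single c' 1 : Fin d →₀ ℕ)) =
      Src.hder h (c, k) (K (c', 1)) + K (c, k) * K (c', 1) := by
  have hm : c' ∈ (List.finRange d).erase c :=
    (List.nodup_finRange d).mem_erase_iff.2 ⟨hc, List.mem_finRange c'⟩
  have hp := ((List.perm_cons_erase (List.mem_finRange c)).trans
      ((List.perm_cons_erase hm).cons c)).map
    fun c'' => (c'', Function.update (⇑(Finsupp.single c 1 + Finsupp.single c' 1 : Fin d →₀ ℕ)) c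
      (k + (Finsupp.single c 1 + Finsupp.single c' 1 : Fin d →₀ ℕ) c - 1) c'')
  rw [vertexLabels, Src.nablaList_perm hK hp, List.map_cons, List.map_cons]
  change Src.hder h _ (Src.hder h _ (Src.nablaList h K _) + K _ * Src.nablaList h K _) +
    K _ * (Src.hder h _ (Src.nablaList h K _) + K _ * Src.nablaList h K _) = _
  rw [nablaList_of_zero hK0]
  · simp [Src.hder, hc, hc.symm]
  · intro a ha
    obtain ⟨c'', hc'', rfl⟩ := List.mem_map.1 ha
    have h1 := ((List.nodup_finRange d).erase c).mem_erase_iff.1 hc''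
    have h2 := (List.nodup_finRange d).mem_erase_iff.1 h1.2
    simp [h1.1, h2.1]

/-- The product of `1/|a|`, the multinomial and `a c` is `1/2 * 1 * 2` for equal colours and `1/2 *
2 * 1` for different ones. -/
theorem vertexCoeff_single_add_single (c c' : Fin d) :
    vertexCoeff c (Finsupp.single c 1 + Finsupp.single c' 1) = 1 := by
  have hdeg : (Finsupp.single c 1 + Finsupp.single c' 1 : Fin d →₀ ℕ).degree = 2 := by simp
  rw [vertexCoeff, if_pos hdeg.ge, hdeg, Finsupp.multinomial_eq]
  by_cases h : c = c'
  · subst h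
    rw [← Finsupp.single_add, Finsupp.support_single_ne_zero _ (by norm_num)]
    simp
  · have hs : (Finsupp.single c 1 + Finsupp.single c' 1 : Fin d →₀ ℕ).support = {c, c'} := by
      ext x
      simp only [Finsupp.mem_support_iff, Finsupp.add_apply, Finsupp.single_apply, Finset.mem_insert,
        Finset.mem_singleton]
      split_ifs <;> simp_all [eq_comm]
    rw [hs, Nat.binomial_eq_choose h]
    simp [h, Ne.symm h]

/-- If `a_c ≠ 0` and `a` has degree two then `a` is a sum of two unit vectors. -/
theorem exists_eq_single_add_single {c : Fin d} {a : Fin d →₀ ℕ} (h : a.degree = 2) (hc : a c ≠ 0) :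
    ∃ c', a = Finsupp.single c 1 + Finsupp.single c' 1 := by
  have h1 : Finsupp.single c 1 ≤ a := Finsupp.single_le_iff.2 (by omega)
  have h2 := congrArg Finsupp.degree (add_tsub_cancel_of_le h1)
  rw [_root_.map_add, Finsupp.degree_single, h] at h2
  obtain ⟨c', hc'⟩ : a - Finsupp.single c 1 ∈ Set.range fun i : Fin d => Finsupp.single i 1 := by
    rw [Finsupp.range_single_one]
    exact Nat.add_left_cancel h2
  exact ⟨c', by rw [show Finsupp.single c' 1 = a - Finsupp.single c 1 from hc', add_tsub_cancel_of_le h1]⟩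

/-- The contribution to the loop equations of a pair of labels: both in the same connected component,
or in two components. -/
def pairTerm {A T : Type*} [CommRing A] (w : ℕ → Multiset T → A) (g : ℕ) (a b : T)
    (P : Multiset T) : A :=
  (if g = 0 then 0 else w (g - 1) (a ::ₘ b ::ₘ P)) +
    ∑ q ∈ Finset.HasAntidiagonal.antidiagonal g,
      (P.antidiagonal.map fun r => w q.1 (a ::ₘ r.1) * w q.2 (b ::ₘ r.2)).sum

theorem genusPart_multiset_sum {ι : Type*} (g : ℕ) (S : Multiset ι)
    (f : ι → MvPowerSeries (Fin d) (Polynomial ℂ)) :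
    genusPart g (S.map f).sum = (S.map fun i => genusPart g (f i)).sum := by
  rw [map_multiset_sum, Multiset.map_map]; rfl

theorem genusPart_pair (hd : d = 4 * δ + 2) (g : ℕ) (a b : Label d) (P : Multiset (Label d)) :
    genusPart g ((Src.hder (C Polynomial.X) a (Src.der b (universalLog hd)) +
      Src.der a (universalLog hd) * Src.der b (universalLog hd)) P) =
      pairTerm (genusKappa hd) g a b P := by
  rw [Src.add_apply, _root_.map_add, Src.hder, Src.const_mul_apply, genusPart_C_X_mul, pairTerm]
  congr 1
  · rw [Src.der_apply, Src.der_apply, Multiset.cons_swap]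
    rfl
  · rw [Src.mul_apply, genusPart_multiset_sum]
    simp only [genusPart_mul]
    exact Multiset.sum_map_sum_map P.antidiagonal (Finset.HasAntidiagonal.antidiagonal g).val

/-- A vertex with `|a| ≥ 3` carries at least `δ` powers of the genus variable and cannot contribute
to genus `g < δ`. Among the vertices of degree two the factor `a c` keeps those in which colour `c`
occurs. -/
theorem genusPart_vertex (hd : d = 4 * δ + 2) {g : ℕ} (hg : g < δ) (c : Fin d) (k : ℕ)
    (P : Multiset (Label d)) :
    genusPart g (srcDiagSum (fun a : Fin d →₀ ℕ => Src.const (C (Polynomial.C (vertexCoeff c a)) *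
        C Polynomial.X ^ (δ * (a.degree - 2))) * Src.nablaList (C Polynomial.X)
        (fun a => Src.der a (universalLog hd)) (vertexLabels c k a)) P) =
      ∑ c', X c * X c' * genusPart g (Src.nablaList (C Polynomial.X)
        (fun a => Src.der a (universalLog hd))
        (vertexLabels c k ⇑(Finsupp.single c 1 + Finsupp.single c' 1 : Fin d →₀ ℕ)) P) := by
  classical
  set nb : (Fin d →₀ ℕ) → MvPowerSeries (Fin d) (Polynomial ℂ) := fun a =>
    Src.nablaList (C Polynomial.X) (fun a => Src.der a (universalLog hd)) (vertexLabels c k a) P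
  set e : Fin d → Fin d →₀ ℕ := fun c' => Finsupp.single c 1 + Finsupp.single c' 1 with he
  have hinj : Function.Injective e := fun x y hxy => by
    have := add_left_cancel hxy
    exact (Finsupp.single_left_injective one_ne_zero) this
  have hX : ∀ c', (X c * X c' : Ser d) = monomial (e c') 1 := fun c' => by
    rw [X, X, monomial_mul_monomial, one_mul]
  ext m
  rw [coeff_genusPart]
  simp only [srcDiagSum, Src.mk_apply, coeff_diagSum, Src.const_mul_apply]
  rw [Polynomial.finsetSum_coeff, map_sum]
  simp only [hX, coeff_monomial_mul, one_mul]
  rw [← Finset.sum_image (s := Finset.univ) (g := e) (f := fun a =>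
    if a ≤ m then coeff (m - a) (genusPart g (nb a)) else 0) (fun x _ y _ h => hinj h)]
  rw [← Finset.sum_filter]
  symm
  refine Finset.sum_subset_zero_on_sdiff ?_ ?_ ?_
  · intro a ha
    exact Finset.mem_Iic.2 (Finset.mem_filter.1 ha).2
  · intro a ha
    rw [Finset.mem_sdiff, Finset.mem_Iic, Finset.mem_filter, not_and'] at ha
    rw [mul_assoc, coeff_C_mul, Polynomial.coeff_C_mul, ← map_pow, coeff_C_mul,
      Polynomial.coeff_X_pow_mul']
    split_ifs with hle
    · have h2 : vertexCoeff c a = 0 := by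
        by_contra h0
        rw [vertexCoeff] at h0
        split_ifs at h0 with h3
        · have hac : a c ≠ 0 := fun h4 => h0 (by simp [h4])
          have h4 : a.degree = 2 := by
            by_contra h5
            have : δ * 1 ≤ δ * (a.degree - 2) := Nat.mul_le_mul_left _ (by omega)
            omega
          obtain ⟨c', hc'⟩ := exists_eq_single_add_single h4 hac
          exact ha.2 ha.1 (Finset.mem_image.2 ⟨c', Finset.mem_univ _, hc'.symm⟩)
        · exact h0 rfl
      rw [h2, zero_mul]
    · rw [mul_zero]
  · intro a ha
    rw [Finset.mem_filter, Finset.mem_image] at ha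
    obtain ⟨⟨c', _, rfl⟩, _⟩ := ha
    have hdeg : (e c').degree = 2 := by simp [he]
    rw [hdeg, he, vertexCoeff_single_add_single]
    simp [coeff_genusPart, nb, he]

/-- The loop equations at genus smaller than `δ`. -/
theorem genusKappa_loop (hd : d = 4 * δ + 2) {g : ℕ} (hg : g < δ) (c : Fin d) (k : ℕ)
    (P : Multiset (Label d)) :
    (1 - X c ^ 2) * genusKappa hd g ((c, k + 1) ::ₘ P) =
      ∑ i ∈ Finset.range k, pairTerm (genusKappa hd) g (c, i) (c, k - 1 - i) P +
      (P.map fun j => shiftWeight c j * genusKappa hd g (shiftLabel c k j ::ₘ P.erase j)).sum +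
      ∑ c', if c' = c then 0 else X c * X c' * pairTerm (genusKappa hd) g (c, k) (c', 1) P := by
  have h := congrArg (fun f : Src _ (Label d) => genusPart g (f P)) (universalLog_loop hd c k)
  simp only [loopRHS, Src.add_apply, Src.sum_apply, _root_.map_add, _root_.map_sum] at h
  rw [genusPart_vertex hd hg] at h
  simp only [← _root_.map_add, ← Src.add_apply] at h
  have hK : ∀ a b, Src.der a (Src.der b (universalLog hd)) = Src.der b (Src.der a (universalLog hd)) :=
    fun a b => Src.der_comm a b _
  have hK0 := der_universalLog_zero hd
  have h1 : genusPart g (Src.shift (shiftWeight c) (shiftLabel c k)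
      (fun a => Src.der a (universalLog hd)) P) =
      (P.map fun j => shiftWeight c j * genusKappa hd g (shiftLabel c k j ::ₘ P.erase j)).sum := by
    rw [Src.shift, Src.mk_apply, genusPart_multiset_sum]
    refine congrArg _ (Multiset.map_congr rfl fun j _ => ?_)
    simp only [shiftWeight]
    split_ifs
    · rw [genusPart_natCast_mul]; rfl
    · simp
  -- The vertex with `c' = c` reproduces the unknown. Moved to the left-hand side, it changes the
  -- Gaussian weight by `1 - α_c ^ 2`.
  have h2 : ∑ c', X c * X c' * genusPart g (Src.nablaList (C Polynomial.X)
        (fun a => Src.der a (universalLog hd))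
        (vertexLabels c k ⇑(Finsupp.single c 1 + Finsupp.single c' 1 : Fin d →₀ ℕ)) P) =
      X c ^ 2 * genusKappa hd g ((c, k + 1) ::ₘ P) +
        ∑ c', if c' = c then 0 else X c * X c' * pairTerm (genusKappa hd) g (c, k) (c', 1) P := by
    rw [← Finset.add_sum_erase _ _ (Finset.mem_univ c), ← Finset.add_sum_erase _
      (fun c' => if c' = c then 0 else X c * X c' * pairTerm (genusKappa hd) g (c, k) (c', 1) P)
      (Finset.mem_univ c), if_pos rfl, zero_add,
      nablaList_vertexLabels_self hK hK0, sq]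
    congr 1
    refine Finset.sum_congr rfl fun c' hc' => ?_
    have hne := Finset.ne_of_mem_erase hc'
    rw [if_neg hne, nablaList_vertexLabels hK hK0 hne, genusPart_pair]
  rw [h1, h2] at h
  simp only [genusPart_pair] at h
  have h3 : genusPart g (Src.der (c, k + 1) (universalLog hd) P) =
    genusKappa hd g ((c, k + 1) ::ₘ P) := rfl
  rw [h3] at h
  linear_combination h

theorem genusKappa_zero (hd : d = 4 * δ + 2) (g : ℕ) (c : Fin d) (P : Multiset (Label d)) :
    genusKappa hd g ((c, 0) ::ₘ P) = if g = 0 ∧ P.card = 0 then 1 else 0 := by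
  have h := congrArg (fun f : Src _ (Label d) => genusPart g (f P)) (der_universalLog_zero hd c)
  refine h.trans ?_
  rw [Src.one_apply]
  by_cases h0 : P.card = 0 <;> by_cases hg : g = 0 <;> simp [h0, hg, genusPart_one]

end Quadratic

/-! ### Rescaled loop equations -/

/-- A system of connected correlations indexed by genus that satisfies the loop equations of a
Gaussian potential with bilinear couplings `lam` between the colours, up to genus `δ`. -/
structure LoopSystem (A : Type*) [CommRing A] (d δ : ℕ) where
  /-- The correlations. -/
  w : ℕ → Multiset (Label d) → A
  /-- The couplings. -/
  lam : Fin d → Fin d → A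
  lam_self : ∀ c, lam c c = 0
  fixed_eq_zero : ∀ u : Fin d → A, (∀ c, u c = ∑ c', lam c c' * u c') → ∀ c, u c = 0
  zero_label : ∀ g c P, w g ((c, 0) ::ₘ P) = if g = 0 ∧ P.card = 0 then 1 else 0
  loop : ∀ g, g < δ → ∀ c k P, w g ((c, k + 1) ::ₘ P) =
    ∑ i ∈ Finset.range k, pairTerm w g (c, i) (c, k - 1 - i) P +
    (P.map fun j => shiftWeight c j * w g (shiftLabel c k j ::ₘ P.erase j)).sum +
    ∑ c', lam c c' * pairTerm w g (c, k) (c', 1) P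

section Rescale

open MvPowerSeries

variable {d δ : ℕ}

theorem hasSubst_neg_X_sq (c : Fin d) : PowerSeries.HasSubst (-(X c : Ser d) ^ 2) :=
  PowerSeries.HasSubst.of_constantCoeff_zero (by simp)

theorem sqrtOneSub_sq (c : Fin d) : (sqrtOneSub c : Ser d) ^ 2 = 1 - X c ^ 2 := by
  have hs := hasSubst_neg_X_sq c
  have h1 : PowerSeries.binomialSeries ℂ (1 / 2 : ℚ) ^ 2 = 1 + PowerSeries.X := by
    rw [sq, ← PowerSeries.binomialSeries_add]
    have := PowerSeries.binomialSeries_nat (R := ℚ) (A := ℂ) 1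
    rw [pow_one] at this
    rw [← this]
    norm_num
  rw [sqrtOneSub, ← PowerSeries.subst_pow hs, h1, PowerSeries.subst_add hs, PowerSeries.subst_X hs]
  have h2 : PowerSeries.subst (-(X c : Ser d) ^ 2) (1 : PowerSeries ℂ) = 1 := by
    rw [← PowerSeries.coe_substAlgHom hs, _root_.map_one]
  rw [h2]; ring

theorem constantCoeff_sqrtOneSub_ne (c : Fin d) : constantCoeff (sqrtOneSub c : Ser d) ≠ 0 := by
  have := congrArg constantCoeff (sqrtOneSub_sq c)
  simp only [map_pow, map_sub, _root_.map_one, constantCoeff_X] at this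
  intro h
  rw [h] at this
  norm_num at this

theorem sqrtOneSub_mul_inv (c : Fin d) : (sqrtOneSub c : Ser d) * (sqrtOneSub c)⁻¹ = 1 :=
  MvPowerSeries.mul_inv_cancel _ (constantCoeff_sqrtOneSub_ne c)

theorem sqrtOneSub_ne_zero (c : Fin d) : (sqrtOneSub c : Ser d) ≠ 0 := fun h =>
  constantCoeff_sqrtOneSub_ne c (by rw [h, _root_.map_zero])

/-- The couplings between the colours, after rescaling. -/
def coupl (c c' : Fin d) : Ser d :=
  if c' = c then 0 else X c * X c' * ((sqrtOneSub c)⁻¹ * (sqrtOneSub c')⁻¹)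

theorem constantCoeff_coupl (c c' : Fin d) : constantCoeff (coupl c c') = 0 := by
  rw [coupl]; split_ifs <;> simp

/-- Rescaling of a multiset of labels. -/
def labelScale (P : Multiset (Label d)) : Ser d := (P.map fun j => sqrtOneSub j.1 ^ j.2).prod

theorem labelScale_cons (a : Label d) (P : Multiset (Label d)) :
    labelScale (a ::ₘ P) = sqrtOneSub a.1 ^ a.2 * labelScale P := by simp [labelScale]

theorem labelScale_add (P Q : Multiset (Label d)) :
    labelScale (P + Q) = labelScale P * labelScale Q := by simp [labelScale]

theorem pairTerm_rescale (w : ℕ → Multiset (Label d) → Ser d) (g : ℕ) (a b : Label d)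
    (P : Multiset (Label d)) :
    pairTerm (fun g P => w g P * labelScale P) g a b P =
      sqrtOneSub a.1 ^ a.2 * sqrtOneSub b.1 ^ b.2 * labelScale P * pairTerm w g a b P := by
  rw [pairTerm, pairTerm, mul_add, Finset.mul_sum]
  congr 1
  · split_ifs
    · rw [mul_zero]
    · rw [labelScale_cons, labelScale_cons]; ring
  · refine Finset.sum_congr rfl fun q _ => ?_
    rw [← Multiset.sum_map_mul_left]
    refine congrArg _ (Multiset.map_congr rfl fun r hr => ?_)
    rw [← Multiset.mem_antidiagonal.1 hr, labelScale_add, labelScale_cons, labelScale_cons]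
    ring

/-- The couplings have no constant term, so each use of the equation raises the order in `α`. -/
theorem eq_zero_of_eq_sum_coupl (u : Fin d → Ser d) (h : ∀ c, u c = ∑ c', coupl c c' * u c')
    (c : Fin d) : u c = 0 := by
  have key : ∀ n : ℕ, ∀ c m, m.degree < n → coeff m (u c) = 0 := by
    intro n
    induction n with
    | zero => exact fun _ _ hm => absurd hm (Nat.not_lt_zero _)
    | succ n ih =>
      intro c m hm
      rw [h, map_sum]
      refine Finset.sum_eq_zero fun c' _ => ?_
      rw [coeff_mul]
      refine Finset.sum_eq_zero fun q hq => ?_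
      have hd := congrArg Finsupp.degree (Finset.HasAntidiagonal.mem_antidiagonal.1 hq)
      rw [_root_.map_add] at hd
      by_cases h0 : q.1 = 0
      · rw [h0, coeff_zero_eq_constantCoeff_apply, constantCoeff_coupl, zero_mul]
      · have : q.1.degree ≠ 0 := fun h1 => h0 ((Finsupp.degree_eq_zero_iff _).1 h1)
        rw [ih c' q.2 (by omega), mul_zero]
  ext m
  rw [key _ c m (Nat.lt_succ_self _), _root_.map_zero]

/-- The rescaled correlations of the quartic melonic model. -/
def modelSystem (hd : d = 4 * δ + 2) : LoopSystem (Ser d) d δ where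
  w g P := genusKappa hd g P * labelScale P
  lam := coupl
  lam_self c := if_pos rfl
  fixed_eq_zero := eq_zero_of_eq_sum_coupl
  zero_label g c P := by
    rw [genusKappa_zero, labelScale_cons, pow_zero, one_mul]
    split_ifs with h
    · rw [Multiset.card_eq_zero.1 h.2]; simp [labelScale]
    · rw [zero_mul]
  loop g hg c k P := by
    -- After multiplication by `√(1 - α_c ^ 2)` the left-hand side contains its square `1 - α_c ^
    -- 2`, as in `genusKappa_loop`. On the right every trace power of colour `c` gets one root, and
    -- the couplings get the inverse roots in `coupl`.
    refine mul_left_cancel₀ (sqrtOneSub_ne_zero c) ?_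
    have h := genusKappa_loop hd hg c k P
    simp only [pairTerm_rescale]
    rw [← sqrtOneSub_sq] at h
    have hl : sqrtOneSub c * (genusKappa hd g ((c, k + 1) ::ₘ P) * labelScale ((c, k + 1) ::ₘ P)) =
        sqrtOneSub c ^ k * labelScale P *
          (sqrtOneSub c ^ 2 * genusKappa hd g ((c, k + 1) ::ₘ P)) := by
      rw [labelScale_cons]; ring
    rw [hl, h, mul_add, mul_add, mul_add, mul_add]
    congr 1
    · congr 1
      · rw [Finset.mul_sum, Finset.mul_sum]
        refine Finset.sum_congr rfl fun i hi => ?_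
        have : (sqrtOneSub c : Ser d) ^ k =
            sqrtOneSub c * (sqrtOneSub c ^ i * sqrtOneSub c ^ (k - 1 - i)) := by
          rw [← pow_add, ← pow_succ']
          congr 1
          have := Finset.mem_range.1 hi
          omega
        simp only [this]; ring
      · rw [← Multiset.sum_map_mul_left, ← Multiset.sum_map_mul_left]
        refine congrArg _ (Multiset.map_congr rfl fun j hj => ?_)
        rw [shiftWeight]
        split_ifs with hjc
        · rcases Nat.eq_zero_or_pos j.2 with h0 | h0
          · simp [h0]
          · have hP : labelScale P = sqrtOneSub c ^ j.2 * labelScale (P.erase j) := by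
              conv_lhs => rw [← Multiset.cons_erase hj]
              rw [labelScale_cons, hjc]
            rw [hP, labelScale_cons, shiftLabel]
            have : (sqrtOneSub c : Ser d) ^ k * sqrtOneSub c ^ j.2 =
                sqrtOneSub c * sqrtOneSub c ^ (k + j.2 - 1) := by
              rw [← pow_add, ← pow_succ']
              congr 1
              omega
            linear_combination (labelScale (P.erase j) * (j.2 : Ser d) *
              genusKappa hd g ((c, k + j.2 - 1) ::ₘ P.erase j)) * this
        · simp
    · rw [Finset.mul_sum, Finset.mul_sum]
      refine Finset.sum_congr rfl fun c' _ => ?_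
      rw [coupl]
      split_ifs
      · simp
      · have h1 := sqrtOneSub_mul_inv c
        have h2 := sqrtOneSub_mul_inv c'
        generalize pairTerm (genusKappa hd) g (c, k) (c', 1) P = p
        simp only [pow_one]
        linear_combination (-(sqrtOneSub c ^ k * labelScale P * X c * X c' * p)) *
          (h1 * (sqrtOneSub c' * (sqrtOneSub c')⁻¹) + h2)

end Rescale

/-! ### The square root of the discriminant -/

section Phi

open PowerSeries

/-- The series `√(1 - 4 t ^ 2)` with integer coefficients. -/
def phiInt : PowerSeries ℤ :=
  1 - 2 * X ^ 2 * (catalanSeries.map (Nat.castRingHom ℤ)).subst (X ^ 2 : PowerSeries ℤ)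

/-- The quadratic equation of the Catalan series, taken at `t ^ 2`, with the square completed. -/
theorem phiInt_sq : phiInt ^ 2 = 1 - 4 * X ^ 2 := by
  have hs : HasSubst (X ^ 2 : PowerSeries ℤ) := .X_pow two_ne_zero
  have h := congrArg (fun f : PowerSeries ℕ => (f.map (Nat.castRingHom ℤ)).subst (X ^ 2 : PowerSeries ℤ))
    catalanSeries_sq_mul_X_add_one
  simp only [map_add, map_mul, map_pow, map_one, PowerSeries.map_X] at h
  rw [subst_add hs, subst_mul hs, subst_pow hs, subst_X hs, ← coe_substAlgHom hs, map_one] at h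
  rw [phiInt, ← coe_substAlgHom hs]
  linear_combination (4 * X ^ 2) * h

theorem coeff_phiInt (n : ℕ) : coeff n phiInt = (if n = 0 then 1 else 0) -
    if 2 ≤ n ∧ 2 ∣ n then 2 * (catalan ((n - 2) / 2) : ℤ) else 0 := by
  rw [phiInt, map_sub, coeff_one, mul_assoc, mul_comm (X ^ 2), ← mul_assoc,
    coeff_mul_X_pow', show (2 : PowerSeries ℤ) = C 2 from rfl, coeff_C_mul, coeff_subst_X_pow two_ne_zero]
  congr 1
  by_cases h : 2 ≤ n
  · have : 2 ∣ n - 2 ↔ 2 ∣ n := by omega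
    simp [h, this]
  · simp [h]

theorem constantCoeff_phiInt : constantCoeff phiInt = 1 := by
  rw [← coeff_zero_eq_constantCoeff_apply, coeff_phiInt]; simp

theorem abs_coeff_phiInt_le (n : ℕ) : |coeff n phiInt| ≤ 2 ^ n := by
  rw [coeff_phiInt]
  have hcat : ∀ m : ℕ, catalan m ≤ 4 ^ m := fun m => by
    rw [catalan_eq_centralBinom_div]
    refine (Nat.div_le_self _ _).trans ?_
    rw [Nat.centralBinom_eq_two_mul_choose, show (4 : ℕ) = 2 ^ 2 by norm_num, ← pow_mul]
    exact Nat.choose_le_two_pow _ _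
  split_ifs with h0 h1 h1
  · omega
  · simp [h0]
  · obtain ⟨h2, m, rfl⟩ := h1
    obtain ⟨k, rfl⟩ : ∃ k, m = k + 1 := ⟨m - 1, by omega⟩
    have h3 : (2 * (k + 1) - 2) / 2 = k := by omega
    rw [h3, zero_sub, abs_neg, abs_of_nonneg (by positivity)]
    have h4 : (catalan k : ℤ) ≤ 4 ^ k := by exact_mod_cast hcat k
    have h5 : (2 : ℤ) ^ (2 * (k + 1)) = 4 * 4 ^ k := by
      rw [pow_mul]; norm_num [pow_succ, mul_comm]
    rw [h5]
    have : (0 : ℤ) ≤ 4 ^ k := by positivity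
    linarith
  · simp

variable (A : Type*) [CommRing A]

/-- The series `√(1 - 4 t ^ 2)`. -/
def phi : PowerSeries A := phiInt.map (Int.castRingHom A)

theorem phi_sq : phi A ^ 2 = 1 - 4 * X ^ 2 := by
  rw [phi, ← map_pow, phiInt_sq]
  simp only [map_sub, map_one, map_mul, map_pow, PowerSeries.map_X, map_ofNat]

theorem constantCoeff_phi : constantCoeff (phi A) = 1 := by
  rw [← coeff_zero_eq_constantCoeff_apply, phi, coeff_map, coeff_zero_eq_constantCoeff_apply,
    constantCoeff_phiInt, map_one]

variable {A}

theorem two_ne_zero_powerSeries [CharZero A] : (2 : PowerSeries A) ≠ 0 := fun h => by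
  have := congrArg constantCoeff h
  rw [map_ofNat, map_zero] at this
  exact two_ne_zero this

theorem eq_phi_of_sq [IsDomain A] [CharZero A] {f : PowerSeries A} (h : f ^ 2 = 1 - 4 * X ^ 2)
    (h0 : constantCoeff f = 1) : f = phi A := by
  rw [← phi_sq, sq_eq_sq_iff_eq_or_eq_neg] at h
  refine h.resolve_right fun h1 => ?_
  have := congrArg constantCoeff h1
  rw [h0, map_neg, constantCoeff_phi] at this
  have h2 : (2 : A) = 0 := by linear_combination this
  exact two_ne_zero h2

/-- Two differentiations of `φ ^ 2 = 1 - 4 t ^ 2`. It evaluates the coincident-point limit of the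
two-point function. -/
theorem phi_derivative [IsDomain A] [CharZero A] :
    phi A ^ 3 * derivative A (derivative A (phi A)) = -4 := by
  have h1 := congrArg (derivative A) (phi_sq A)
  have h4 : derivative A (4 : PowerSeries A) = 0 := by
    have := (derivative A).map_natCast 4
    exact_mod_cast this
  simp only [Derivation.leibniz_pow, map_sub, Derivation.leibniz, Derivation.map_one_eq_zero,
    derivative_X, h4, smul_eq_mul, nsmul_eq_mul] at h1
  have h2 : phi A * derivative A (phi A) = -4 * X := by
    refine mul_left_cancel₀ two_ne_zero_powerSeries ?_
    linear_combination h1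
  have h3 := congrArg (derivative A) h2
  simp only [Derivation.leibniz, map_neg, derivative_X, h4, smul_eq_mul] at h3
  linear_combination phi A ^ 2 * h3 - (phi A * derivative A (phi A) - 4 * X) * h2 - 4 * phi_sq A

end Phi

/-! ### Laurent series bounded above -/

section Laurent

variable {A : Type*} [CommRing A]

/-- The inclusion of power series. -/
abbrev toL : PowerSeries A →+* LaurentSeries A := HahnSeries.ofPowerSeries ℤ A

theorem coeff_toL_natCast (f : PowerSeries A) (n : ℕ) : (toL f).coeff (n : ℤ) = PowerSeries.coeff n f :=
  LaurentSeries.coeff_coe_powerSeries f n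

/-- The coefficients of degree larger than `n` vanish. -/
def TopLe (n : ℤ) (F : LaurentSeries A) : Prop := ∀ m, n < m → F.coeff m = 0

theorem TopLe.mono {n m : ℤ} {F : LaurentSeries A} (h : TopLe n F) (hnm : n ≤ m) : TopLe m F :=
  fun k hk => h k (lt_of_le_of_lt hnm hk)

theorem TopLe.zero (n : ℤ) : TopLe n (0 : LaurentSeries A) := fun _ _ => rfl

theorem TopLe.add {n : ℤ} {F G : LaurentSeries A} (hF : TopLe n F) (hG : TopLe n G) :
    TopLe n (F + G) := fun m hm => by rw [HahnSeries.coeff_add, hF m hm, hG m hm, add_zero]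

theorem TopLe.neg {n : ℤ} {F : LaurentSeries A} (hF : TopLe n F) : TopLe n (-F) := fun m hm => by
  rw [HahnSeries.coeff_neg, hF m hm, neg_zero]

theorem TopLe.sub {n : ℤ} {F G : LaurentSeries A} (hF : TopLe n F) (hG : TopLe n G) :
    TopLe n (F - G) := sub_eq_add_neg F G ▸ hF.add hG.neg

theorem TopLe.mul {n m : ℤ} {F G : LaurentSeries A} (hF : TopLe n F) (hG : TopLe m G) :
    TopLe (n + m) (F * G) := fun k hk => by
  rw [HahnSeries.coeff_mul]
  refine Finset.sum_eq_zero fun q hq => ?_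
  have h1 : q.1 + q.2 = k := (Finset.mem_antidiagonal.1 hq).2.2
  by_cases h : n < q.1
  · rw [hF _ h, zero_mul]
  · rw [hG _ (by omega), mul_zero]

theorem TopLe.single (n : ℤ) (r : A) : TopLe n (HahnSeries.single n r) := fun m hm =>
  HahnSeries.coeff_single_of_ne hm.ne'

theorem TopLe.multiset_sum {ι : Type*} {n : ℤ} (S : Multiset ι) {f : ι → LaurentSeries A}
    (h : ∀ i ∈ S, TopLe n (f i)) : TopLe n (S.map f).sum := by
  induction S using Multiset.induction with
  | empty => simpa using TopLe.zero n
  | cons a S ih =>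
    rw [Multiset.map_cons, Multiset.sum_cons]
    exact (h a (by simp)).add (ih fun i hi => h i (Multiset.mem_cons_of_mem hi))

theorem TopLe.sum {ι : Type*} {n : ℤ} (S : Finset ι) {f : ι → LaurentSeries A}
    (h : ∀ i ∈ S, TopLe n (f i)) : TopLe n (∑ i ∈ S, f i) := TopLe.multiset_sum S.val h

theorem topLe_toL_iff {n : ℕ} {f : PowerSeries A} :
    TopLe n (toL f) ↔ ∀ m, n < m → PowerSeries.coeff m f = 0 := by
  constructor
  · intro h m hm
    rw [← coeff_toL_natCast]
    exact h m (by exact_mod_cast hm)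
  · intro h m hm
    lift m to ℕ using by omega
    rw [coeff_toL_natCast]
    exact h m (by exact_mod_cast hm)

/-- `s ^ K y F` is a polynomial in `x = 1/t` for `M = 2 K + 1`, `s = y ^ 2 = x ^ 2 - 4`. -/
def Adm (M : ℕ) (F : LaurentSeries A) : Prop := TopLe M (toL (phi A) ^ M * F)

theorem Adm.add {M : ℕ} {F G : LaurentSeries A} (hF : Adm M F) (hG : Adm M G) : Adm M (F + G) := by
  rw [Adm, mul_add]; exact TopLe.add hF hG

theorem Adm.zero (M : ℕ) : Adm M (0 : LaurentSeries A) := by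
  rw [Adm, mul_zero]; exact TopLe.zero _

theorem Adm.neg {M : ℕ} {F : LaurentSeries A} (hF : Adm M F) : Adm M (-F) := by
  rw [Adm, mul_neg]; exact TopLe.neg hF

theorem Adm.multiset_sum {ι : Type*} {n : ℕ} (S : Multiset ι) {f : ι → LaurentSeries A}
    (h : ∀ i ∈ S, Adm n (f i)) : Adm n (S.map f).sum := by
  induction S using Multiset.induction with
  | empty => simpa using Adm.zero n
  | cons a S ih =>
    rw [Multiset.map_cons, Multiset.sum_cons]
    exact (h a (by simp)).add (ih fun i hi => h i (Multiset.mem_cons_of_mem hi))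

theorem Adm.mul {M M' : ℕ} {F G : LaurentSeries A} (hF : Adm M F) (hG : Adm M' G) :
    Adm (M + M') (F * G) := by
  have := TopLe.mul hF hG
  rw [Adm, pow_add, Nat.cast_add]
  convert this using 1
  ring

theorem topLe_phi_sq : TopLe (2 : ℕ) (toL (phi A) ^ 2) := by
  rw [← map_pow, phi_sq]
  refine topLe_toL_iff.2 fun m hm => ?_
  rw [map_sub, PowerSeries.coeff_one, if_neg (by omega), show (4 : PowerSeries A) = PowerSeries.C 4 from rfl,
    PowerSeries.coeff_C_mul, PowerSeries.coeff_X_pow, if_neg (by omega)]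
  simp

/-- `y ^ 2` is a polynomial in `x`, so exponents can be raised in steps of two. The parity kept in
this way records the behaviour under `y ↦ -y`: even for polynomials in `x`, odd for the
correlations. -/
theorem Adm.add_two {M : ℕ} {F : LaurentSeries A} (hF : Adm M F) (k : ℕ) : Adm (M + 2 * k) F := by
  induction k with
  | zero => exact hF
  | succ k ih =>
    have := TopLe.mul topLe_phi_sq ih
    rw [Adm, show M + 2 * (k + 1) = 2 + (M + 2 * k) by ring, pow_add, mul_assoc, Nat.cast_add]
    exact this

theorem Adm.of_topLe {F : LaurentSeries A} (hF : TopLe 0 F) (k : ℕ) : Adm (2 * k) F := by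
  have : Adm 0 F := by rw [Adm, pow_zero, one_mul]; exact hF
  simpa using this.add_two k

end Laurent

/-! ### Diagonals of double series -/

section Diagonal

variable {A : Type*} [CommRing A]

/-- The diagonal of a double series. -/
def diagSeries (E : ℕ → ℕ → A) : PowerSeries A :=
  PowerSeries.mk fun n => ∑ q ∈ Finset.HasAntidiagonal.antidiagonal n, E q.1 q.2

/-- The product with a series in the first variable. -/
def leftMul (f : PowerSeries A) (E : ℕ → ℕ → A) : ℕ → ℕ → A := fun i j =>
  PowerSeries.coeff i (f * PowerSeries.mk fun i' => E i' j)

theorem diagSeries_leftMul (f : PowerSeries A) (E : ℕ → ℕ → A) :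
    diagSeries (leftMul f E) = f * diagSeries E := by
  ext n
  simp only [diagSeries, leftMul, PowerSeries.coeff_mk, PowerSeries.coeff_mul, Finset.mul_sum]
  rw [Finset.sum_sigma', Finset.sum_sigma']
  refine Finset.sum_nbij' (fun s => ⟨(s.2.1, s.2.2 + s.1.2), (s.2.2, s.1.2)⟩)
    (fun s => ⟨(s.1.1 + s.2.1, s.2.2), (s.1.1, s.2.1)⟩) ?_ ?_ ?_ ?_ fun _ _ => rfl
  all_goals
    rintro ⟨⟨a, b⟩, ⟨e, f⟩⟩ h
    simp only [Finset.mem_sigma, Finset.HasAntidiagonal.mem_antidiagonal] at h ⊢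
  · refine ⟨by omega, trivial⟩
  · refine ⟨by omega, trivial⟩
  · obtain ⟨h1, rfl⟩ := h; rfl
  · obtain ⟨h1, rfl⟩ := h; rfl

theorem diagSeries_swap (E : ℕ → ℕ → A) : diagSeries (fun i j => E j i) = diagSeries E := by
  ext n
  simp only [diagSeries, PowerSeries.coeff_mk]
  exact Finset.Nat.sum_antidiagonal_swap (f := fun q => E q.1 q.2)

end Diagonal

/-! ### The loop equations for generating functions -/

namespace Src

variable {A T : Type*} [CommRing A] [DecidableEq T]

/-- The generating function supported on single labels. -/
def sing (t : T → A) : Src A T := ⟨fun P => if P.card = 1 then (P.map t).sum else 0⟩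

theorem der_sing (t : T → A) (a : T) : der a (sing t) = const (t a) := by
  refine ext' fun P => ?_
  simp only [sing, der_apply, mk_apply, const, Multiset.card_cons]
  by_cases h : P.card = 0
  · rw [Multiset.card_eq_zero.1 h]; simp
  · simp [h]

theorem sing_mul (t : T → A) (f : Src A T) (P : Multiset T) :
    (sing t * f) P = (P.map fun j => t j * f (P.erase j)).sum := by
  induction P using Multiset.induction generalizing f with
  | empty => simp [sing]
  | cons a P ih =>
    rw [mul_apply_cons, der_sing, const_mul_apply, ih]
    exact (shift_apply_cons t id (fun _ => f) a P).symm

end Src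

section GenFun

variable {A : Type*} [CommRing A] {d δ : ℕ}

/-- The coefficient of a given genus and multiset of labels. -/
def gcoeff (g : ℕ) (P : Multiset (Label d)) :
    Src (PowerSeries (LaurentSeries A)) (Label d) →+ LaurentSeries A where
  toFun F := PowerSeries.coeff g (F P)
  map_zero' := map_zero _
  map_add' _ _ := map_add _ _ _

theorem gcoeff_apply (g : ℕ) (P : Multiset (Label d))
    (F : Src (PowerSeries (LaurentSeries A)) (Label d)) :
    gcoeff g P F = PowerSeries.coeff g (F P) := rfl

theorem gcoeff_mk (g : ℕ) (P : Multiset (Label d)) (u : ℕ → Multiset (Label d) → LaurentSeries A) :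
    gcoeff g P ⟨fun P => PowerSeries.mk fun g => u g P⟩ = u g P := by
  rw [gcoeff_apply, Src.mk_apply, PowerSeries.coeff_mk]

theorem gcoeff_mul (g : ℕ) (P : Multiset (Label d))
    (F G : Src (PowerSeries (LaurentSeries A)) (Label d)) :
    gcoeff g P (F * G) = ∑ q ∈ Finset.HasAntidiagonal.antidiagonal g,
      (P.antidiagonal.map fun r => gcoeff q.1 r.1 F * gcoeff q.2 r.2 G).sum := by
  rw [gcoeff_apply, Src.mul_apply, map_multiset_sum, Multiset.map_map]
  simp only [Function.comp_def, PowerSeries.coeff_mul]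
  exact Multiset.sum_map_sum_map P.antidiagonal (Finset.HasAntidiagonal.antidiagonal g).val

/-- Coefficients of Laurent series, as an additive map. -/
def lcoeff (n : ℤ) : LaurentSeries A →+ A where
  toFun F := F.coeff n
  map_zero' := rfl
  map_add' _ _ := rfl

theorem lcoeff_apply (n : ℤ) (F : LaurentSeries A) : lcoeff n F = F.coeff n := rfl

theorem lcoeff_toL (f : PowerSeries A) (n : ℕ) : lcoeff (n : ℤ) (toL f) = PowerSeries.coeff n f :=
  coeff_toL_natCast f n

/-- All coefficients are polynomials in `1/t`. -/
def SrcTop (F : Src (PowerSeries (LaurentSeries A)) (Label d)) : Prop :=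
  ∀ g P, TopLe 0 (gcoeff g P F)

theorem SrcTop.add {F G : Src (PowerSeries (LaurentSeries A)) (Label d)} (hF : SrcTop F)
    (hG : SrcTop G) : SrcTop (F + G) := fun g P => by
  rw [map_add]; exact (hF g P).add (hG g P)

theorem SrcTop.sub {F G : Src (PowerSeries (LaurentSeries A)) (Label d)} (hF : SrcTop F)
    (hG : SrcTop G) : SrcTop (F - G) := fun g P => by
  rw [map_sub]; exact (hF g P).sub (hG g P)

theorem SrcTop.mul {F G : Src (PowerSeries (LaurentSeries A)) (Label d)} (hF : SrcTop F)
    (hG : SrcTop G) : SrcTop (F * G) := fun g P => by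
  rw [gcoeff_mul]
  exact TopLe.sum _ fun q _ => TopLe.multiset_sum _ fun r _ => (hF q.1 r.1).mul (hG q.2 r.2)

/-- `x = 1/t`. -/
def xL : LaurentSeries A := HahnSeries.single (-1) 1

theorem coeff_xL_mul (F : LaurentSeries A) (n : ℤ) : (xL * F).coeff n = F.coeff (n + 1) := by
  rw [xL, HahnSeries.coeff_single_mul, one_mul, sub_neg_eq_add]

theorem xL_mul_toL_X : (xL : LaurentSeries A) * toL PowerSeries.X = 1 := by
  rw [xL, toL, HahnSeries.ofPowerSeries_X, HahnSeries.single_mul_single]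
  simp

/-- The generating series `∑_k a_k t ^ (k + 1)`. -/
def resolvent (a : ℕ → A) : PowerSeries A := PowerSeries.X * PowerSeries.mk a

theorem coeff_resolvent_succ (a : ℕ → A) (k : ℕ) : PowerSeries.coeff (k + 1) (resolvent a) = a k := by
  rw [resolvent, PowerSeries.coeff_succ_X_mul, PowerSeries.coeff_mk]

theorem coeff_resolvent_zero (a : ℕ → A) : PowerSeries.coeff 0 (resolvent a) = 0 := by
  rw [resolvent, PowerSeries.coeff_zero_X_mul]

theorem coeff_resolvent_mul (a b : ℕ → A) (k : ℕ) :
    PowerSeries.coeff (k + 1) (resolvent a * resolvent b) = ∑ i ∈ Finset.range k, a i * b (k - 1 - i) := by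
  rw [resolvent, mul_assoc, PowerSeries.coeff_succ_X_mul, resolvent, mul_left_comm]
  cases k with
  | zero => simp
  | succ k =>
    rw [PowerSeries.coeff_succ_X_mul, PowerSeries.coeff_mul,
      Finset.Nat.sum_antidiagonal_eq_sum_range_succ_mk]
    simp

namespace LoopSystem

variable (S : LoopSystem A d δ) (c : Fin d)

/-- The generating function of the correlations with one resolvent of colour `c`. -/
def resolv : Src (PowerSeries (LaurentSeries A)) (Label d) :=
  ⟨fun P => PowerSeries.mk fun g => toL (resolvent fun k => S.w g ((c, k) ::ₘ P))⟩

/-- The effective linear potential. -/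
def lin (g : ℕ) (P : Multiset (Label d)) : A := ∑ c', S.lam c c' * S.w g ((c', 1) ::ₘ P)

/-- `lin` as a generating function. -/
def linS : Src (PowerSeries (LaurentSeries A)) (Label d) :=
  ⟨fun P => PowerSeries.mk fun g => HahnSeries.C (S.lin c g P)⟩

/-- The derivative of the sources. -/
def theta (j : Label d) : LaurentSeries A := HahnSeries.single (1 - (j.2 : ℤ)) (shiftWeight c j)

/-- `theta` as a generating function. -/
def thetaS : Src (PowerSeries (LaurentSeries A)) (Label d) := Src.sing fun j => PowerSeries.C (theta c j)

/-- `x` as a generating function. -/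
def xS : Src (PowerSeries (LaurentSeries A)) (Label d) := Src.const (PowerSeries.C xL)

theorem srcTop_linS : SrcTop (S.linS c) := fun g P => by
  rw [linS, gcoeff_mk]; exact TopLe.single 0 _

theorem topLe_theta (j : Label d) : TopLe 0 (theta c j : LaurentSeries A) := by
  rw [theta]
  rcases Nat.eq_zero_or_pos j.2 with h | h
  · have : (shiftWeight c j : A) = 0 := by rw [shiftWeight, h]; simp
    rw [this, HahnSeries.single_eq_zero]; exact TopLe.zero 0
  · exact (TopLe.single _ _).mono (by omega)

theorem gcoeff_thetaS (g : ℕ) (P : Multiset (Label d)) : gcoeff g P (thetaS c) =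
    if g = 0 ∧ P.card = 1 then (P.map (theta c)).sum else (0 : LaurentSeries A) := by
  rw [gcoeff_apply, thetaS, Src.sing, Src.mk_apply]
  by_cases h : P.card = 1
  · obtain ⟨j, rfl⟩ := Multiset.card_eq_one.1 h
    simp [PowerSeries.coeff_C]
  · simp [h]

theorem srcTop_thetaS : SrcTop (thetaS c : Src (PowerSeries (LaurentSeries A)) (Label d)) := fun g P => by
  rw [gcoeff_thetaS]
  split_ifs
  · exact TopLe.multiset_sum _ fun j _ => topLe_theta c j
  · exact TopLe.zero 0

theorem gcoeff_xS (g : ℕ) (P : Multiset (Label d)) : gcoeff g P xS =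
    if g = 0 ∧ P.card = 0 then xL else (0 : LaurentSeries A) := by
  rw [gcoeff_apply, xS, Src.const, Src.mk_apply]
  by_cases h : P.card = 0 <;> by_cases hg : g = 0 <;> simp [h, hg, PowerSeries.coeff_C]

theorem srcTop_xS : SrcTop (xS : Src (PowerSeries (LaurentSeries A)) (Label d)) := fun g P => by
  rw [gcoeff_xS]
  split_ifs
  · exact (TopLe.single _ _).mono (by norm_num)
  · exact TopLe.zero 0

/-- Extended insertions: the effective linear potential and twice the resolvent. -/
def ext (i : ℕ) (u : Multiset (Label d) → A) (P : Multiset (Label d)) : A :=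
  match i with
  | 0 => ∑ c', S.lam c c' * u ((c', 1) ::ₘ P)
  | i + 1 => 2 * u ((c, i) ::ₘ P)

/-- Commuting insertions give the symmetry of the double series `ext2`, and allow the variables to
be expanded one after another. -/
theorem ext_comm (c' : Fin d) (i j : ℕ) (u : Multiset (Label d) → A) (P : Multiset (Label d)) :
    S.ext c i (S.ext c' j u) P = S.ext c' j (S.ext c i u) P := by
  cases i <;> cases j <;> simp only [ext, Finset.mul_sum]
  · rw [Finset.sum_comm]
    refine Finset.sum_congr rfl fun _ _ => Finset.sum_congr rfl fun _ _ => ?_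
    rw [Multiset.cons_swap]; ring
  · refine Finset.sum_congr rfl fun _ _ => ?_
    rw [Multiset.cons_swap]; ring
  · refine Finset.sum_congr rfl fun _ _ => ?_
    rw [Multiset.cons_swap]; ring
  · rw [Multiset.cons_swap]

/-- The series of extended insertions. -/
def row (g : ℕ) (P : Multiset (Label d)) : PowerSeries A := PowerSeries.mk fun i => S.ext c i (S.w g) P

/-- The double sequence of extended insertions. -/
def ext2 (g : ℕ) (P : Multiset (Label d)) (i j : ℕ) : A := S.ext c i (S.ext c j (S.w g)) P

/-- The interior of the antidiagonal gives the pairs of traces from a split; its two ends, where one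
insertion is the linear potential, give the coupling term twice. The factor 4 comes from the
normalization of the resolvent as `2 W`. -/
theorem coeff_diagSeries_ext2_succ (g : ℕ) (P : Multiset (Label d)) (k : ℕ) :
    PowerSeries.coeff (k + 1) (diagSeries (S.ext2 c g P)) =
      4 * (∑ i ∈ Finset.range k, S.w g ((c, i) ::ₘ (c, k - 1 - i) ::ₘ P) +
        ∑ c', S.lam c c' * S.w g ((c, k) ::ₘ (c', 1) ::ₘ P)) := by
  rw [diagSeries, PowerSeries.coeff_mk, Finset.Nat.sum_antidiagonal_succ]
  have h0 : S.ext2 c g P 0 (k + 1) = 2 * ∑ c', S.lam c c' * S.w g ((c, k) ::ₘ (c', 1) ::ₘ P) := by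
    simp only [ext2, ext, Finset.mul_sum]
    exact Finset.sum_congr rfl fun _ _ => by ring
  have h1 : S.ext2 c g P (k + 1) 0 = 2 * ∑ c', S.lam c c' * S.w g ((c, k) ::ₘ (c', 1) ::ₘ P) := by
    rw [← h0]; exact S.ext_comm c c _ _ _ _
  cases k with
  | zero =>
    rw [Finset.Nat.antidiagonal_zero, Finset.sum_singleton, h0, h1]
    simp; ring
  | succ k =>
    rw [Finset.Nat.sum_antidiagonal_succ', h0, h1,
      Finset.Nat.sum_antidiagonal_eq_sum_range_succ_mk]
    have : ∀ i, S.ext2 c g P (i + 1) (k - i + 1) = 4 * S.w g ((c, i) ::ₘ (c, k - i) ::ₘ P) := by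
      intro i
      simp only [ext2, ext]
      rw [Multiset.cons_swap]; ring
    simp only [this, Nat.add_sub_cancel, ← Finset.mul_sum]
    ring

/-- The shifted resolvent `2 W - V'`. -/
def spec : Src (PowerSeries (LaurentSeries A)) (Label d) :=
  2 * S.resolv c + S.linS c + thetaS c - xS

theorem toL_row (g : ℕ) (P : Multiset (Label d)) :
    toL (S.row c g P) = gcoeff g P (2 * S.resolv c + S.linS c) := by
  rw [two_mul, map_add, map_add, resolv, gcoeff_mk, linS, gcoeff_mk, ← map_add,
    ← HahnSeries.ofPowerSeries_C, ← map_add]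
  congr 1
  ext n
  rw [row, PowerSeries.coeff_mk, map_add, map_add]
  cases n with
  | zero => simp [ext, coeff_resolvent_zero, lin]
  | succ n => rw [coeff_resolvent_succ, PowerSeries.coeff_succ_C]; simp only [ext]; ring

theorem gcoeff_spec (g : ℕ) (P : Multiset (Label d)) : gcoeff g P (S.spec c) =
    toL (S.row c g P) + (if g = 0 ∧ P.card = 1 then (P.map (theta c)).sum else 0) -
      (if g = 0 ∧ P.card = 0 then xL else 0) := by
  rw [spec, map_sub, map_add, ← toL_row, gcoeff_thetaS, gcoeff_xS]

/-- The coefficient of `t ^ (k + 1)` is four times the loop equation with exponent `k`: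
multiplication by `x = 1/t` selects `w(k + 1)`, and `theta` moves a source. Hence no positive power
of `t` is left. -/
theorem topLe_loop {g : ℕ} (hg : g < δ) (P : Multiset (Label d)) :
    TopLe 0 (4 * gcoeff g P (xS * S.resolv c - S.resolv c * S.resolv c - S.resolv c * S.linS c -
      thetaS c * S.resolv c) - if g = 0 then 0 else toL (diagSeries (S.ext2 c (g - 1) P))) := by
  intro m hm
  obtain ⟨k, rfl⟩ : ∃ k : ℕ, m = ((k + 1 : ℕ) : ℤ) := ⟨(m - 1).toNat, by omega⟩
  have hf : ∀ g P, gcoeff g P (S.resolv c) = toL (resolvent fun k => S.w g ((c, k) ::ₘ P)) :=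
    fun g P => gcoeff_mk g P _
  have hl : ∀ g P, gcoeff g P (S.linS c) = toL (PowerSeries.C (S.lin c g P)) :=
    fun g P => (gcoeff_mk g P _).trans (HahnSeries.ofPowerSeries_C _).symm
  rw [← lcoeff_apply]
  have h1 : lcoeff ((k + 1 : ℕ) : ℤ) (gcoeff g P (xS * S.resolv c)) = S.w g ((c, k + 1) ::ₘ P) := by
    rw [gcoeff_apply, xS, Src.const_mul_apply, PowerSeries.coeff_C_mul, ← gcoeff_apply, hf]
    exact (coeff_xL_mul _ _).trans ((coeff_toL_natCast _ (k + 2)).trans (coeff_resolvent_succ _ _))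
  have h2 : lcoeff ((k + 1 : ℕ) : ℤ) (gcoeff g P (S.resolv c * S.resolv c)) =
      ∑ i ∈ Finset.range k, ∑ q ∈ Finset.HasAntidiagonal.antidiagonal g,
        (P.antidiagonal.map fun r => S.w q.1 ((c, i) ::ₘ r.1) * S.w q.2 ((c, k - 1 - i) ::ₘ r.2)).sum := by
    rw [gcoeff_mul]
    simp only [hf, ← map_mul]
    rw [map_sum, Finset.sum_comm]
    refine Finset.sum_congr rfl fun q _ => ?_
    rw [map_multiset_sum, Multiset.map_map]
    simp only [Function.comp_def, lcoeff_toL, coeff_resolvent_mul]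
    exact Multiset.sum_map_sum_map P.antidiagonal (Finset.range k).val
  have h3 : lcoeff ((k + 1 : ℕ) : ℤ) (gcoeff g P (S.resolv c * S.linS c)) =
      ∑ c', S.lam c c' * ∑ q ∈ Finset.HasAntidiagonal.antidiagonal g,
        (P.antidiagonal.map fun r => S.w q.1 ((c, k) ::ₘ r.1) * S.w q.2 ((c', 1) ::ₘ r.2)).sum := by
    rw [gcoeff_mul]
    simp only [hf, hl, ← map_mul, Finset.mul_sum]
    rw [map_sum, Finset.sum_comm]
    refine Finset.sum_congr rfl fun q _ => ?_
    rw [map_multiset_sum, Multiset.map_map]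
    simp only [Function.comp_def, lcoeff_toL, PowerSeries.coeff_mul_C, coeff_resolvent_succ, lin,
      Finset.mul_sum]
    refine (Multiset.sum_map_sum_map P.antidiagonal Finset.univ.val).trans ?_
    refine Finset.sum_congr rfl fun c' _ => ?_
    rw [← Multiset.sum_map_mul_left]
    exact congrArg _ (Multiset.map_congr rfl fun r _ => by ring)
  have h4 : lcoeff ((k + 1 : ℕ) : ℤ) (gcoeff g P (thetaS c * S.resolv c)) =
      (P.map fun j => shiftWeight c j * S.w g (shiftLabel c k j ::ₘ P.erase j)).sum := by
    rw [gcoeff_apply, thetaS, Src.sing_mul, map_multiset_sum, map_multiset_sum, Multiset.map_map,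
      Multiset.map_map]
    refine congrArg _ (Multiset.map_congr rfl fun j _ => ?_)
    simp only [Function.comp_apply]
    rw [PowerSeries.coeff_C_mul, ← gcoeff_apply, hf, theta]
    rw [lcoeff_apply, HahnSeries.coeff_single_mul]
    rcases Nat.eq_zero_or_pos j.2 with h0 | h0
    · have : (shiftWeight c j : A) = 0 := by rw [shiftWeight, h0]; simp
      rw [this, zero_mul, zero_mul]
    · have : (((k + 1 : ℕ) : ℤ) - (1 - (j.2 : ℤ))) = ((k + j.2 - 1 + 1 : ℕ) : ℤ) := by omega
      rw [this, coeff_toL_natCast, coeff_resolvent_succ, shiftLabel]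
  have h5 : lcoeff ((k + 1 : ℕ) : ℤ) (if g = 0 then 0 else toL (diagSeries (S.ext2 c (g - 1) P))) =
      4 * (∑ i ∈ Finset.range k, (if g = 0 then 0 else S.w (g - 1) ((c, i) ::ₘ (c, k - 1 - i) ::ₘ P)) +
        ∑ c', S.lam c c' * if g = 0 then 0 else S.w (g - 1) ((c, k) ::ₘ (c', 1) ::ₘ P)) := by
    split_ifs
    · simp
    · rw [lcoeff_toL, coeff_diagSeries_ext2_succ]
  have h6 := S.loop g hg c k P
  simp only [pairTerm, mul_add, Finset.sum_add_distrib] at h6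
  have h7 : (4 : LaurentSeries A) = (4 : ℕ) := by norm_cast
  rw [h7, ← nsmul_eq_mul, map_sub, map_nsmul]
  simp only [map_sub, h1, h2, h3, h4, h5, nsmul_eq_mul]
  push_cast
  linear_combination 4 * h6

/-- The loop equations in terms of the shifted resolvent. -/
theorem topLe_spec_sq {g : ℕ} (hg : g < δ) (P : Multiset (Label d)) :
    TopLe 0 (gcoeff g P (S.spec c * S.spec c) +
      if g = 0 then 0 else toL (diagSeries (S.ext2 c (g - 1) P))) := by
  have h1 := S.topLe_loop c hg P
  have hV : SrcTop (S.linS c + thetaS c - xS) := ((S.srcTop_linS c).add (srcTop_thetaS c)).sub srcTop_xS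
  have h2 := (hV.mul hV) g P
  -- Completing the square; what is added is the square of the effective potential's derivative, a
  -- polynomial in `x`.
  have h3 : S.spec c * S.spec c = -(4 • (xS * S.resolv c - S.resolv c * S.resolv c -
      S.resolv c * S.linS c - thetaS c * S.resolv c)) +
      (S.linS c + thetaS c - xS) * (S.linS c + thetaS c - xS) := by
    rw [spec, nsmul_eq_mul]; push_cast; ring
  rw [h3, map_add, map_neg, map_nsmul, nsmul_eq_mul]
  push_cast
  have h4 := h2.sub h1
  convert h4 using 1
  ring

end LoopSystem

end GenFun

/-! ### Structure of the correlations -/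

section Diagonal

variable {A : Type*} [CommRing A]

theorem leftMul_comm (f g : PowerSeries A) (E : ℕ → ℕ → A) (i j : ℕ) :
    leftMul f (fun i' j' => leftMul g (fun i'' j'' => E j'' i'') j' i') i j =
      leftMul g (fun j' i' => leftMul f E i' j') j i := by
  simp only [leftMul, PowerSeries.coeff_mul, PowerSeries.coeff_mk, Finset.mul_sum]
  rw [Finset.sum_comm]
  exact Finset.sum_congr rfl fun _ _ => Finset.sum_congr rfl fun _ _ => by ring

/-- The product with the same series in both variables. -/
def bothMul (f : PowerSeries A) (E : ℕ → ℕ → A) : ℕ → ℕ → A :=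
  leftMul f fun i j => leftMul f E j i

theorem diagSeries_bothMul (f : PowerSeries A) (E : ℕ → ℕ → A) :
    diagSeries (bothMul f E) = f * (f * diagSeries E) := by
  rw [bothMul, diagSeries_leftMul, diagSeries_swap fun i j => leftMul f E i j, diagSeries_leftMul]

theorem bothMul_symm (f : PowerSeries A) {E : ℕ → ℕ → A} (hE : ∀ i j, E i j = E j i) (i j : ℕ) :
    bothMul f E i j = bothMul f E j i := by
  have hE' : (fun i j => E j i) = E := by funext i j; exact hE j i
  have := leftMul_comm f f E i j
  rw [hE'] at this
  exact this

theorem bothMul_eq_zero (f : PowerSeries A) {E : ℕ → ℕ → A} {i j : ℕ}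
    (h : ∀ k, leftMul f E j k = 0) : bothMul f E i j = 0 := by
  rw [bothMul, leftMul, PowerSeries.coeff_mul]
  exact Finset.sum_eq_zero fun q _ => by rw [PowerSeries.coeff_mk, h, mul_zero]

/-- Multiplied by `φ ^ M` in both variables the array is supported in the square `[0, M] ^ 2`, so
its diagonal has degree at most `2M`; on the diagonal the two factors become `φ ^ (2M)`. -/
theorem adm_diagSeries {E : ℕ → ℕ → A} (hE : ∀ i j, E i j = E j i) {M : ℕ}
    (h : ∀ j, Adm M (toL (PowerSeries.mk fun i => E i j))) : Adm (2 * M) (toL (diagSeries E)) := by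
  have h0 : ∀ i, M < i → ∀ j, leftMul (phi A ^ M) E i j = 0 := fun i hi j => by
    have := h j
    rw [Adm, ← map_pow, ← map_mul, topLe_toL_iff] at this
    exact this i hi
  have h1 : ∀ i j, M < j → bothMul (phi A ^ M) E i j = 0 := fun i j hj => bothMul_eq_zero _ (h0 j hj)
  rw [Adm, ← map_pow, ← map_mul, two_mul, pow_add, mul_assoc, ← diagSeries_bothMul, topLe_toL_iff]
  intro n hn
  rw [diagSeries, PowerSeries.coeff_mk]
  refine Finset.sum_eq_zero fun q hq => ?_
  have := Finset.HasAntidiagonal.mem_antidiagonal.1 hq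
  by_cases h2 : M < q.2
  · exact h1 _ _ h2
  · rw [bothMul_symm _ hE]
    exact h1 _ _ (by omega)

end Diagonal

/-! ### The one- and two-point functions of genus zero, and the induction on `2g + n`. -/

namespace LoopSystem

variable {A : Type*} [CommRing A] {d δ : ℕ} (S : LoopSystem A d δ) (c : Fin d)

/-- The means of the linear traces solve the homogeneous system of the couplings, so no linear
potential arises at leading order. -/
theorem w_zero_one (hδ : 0 < δ) : S.w 0 ((c, 1) ::ₘ 0) = 0 := by
  refine S.fixed_eq_zero (fun c => S.w 0 ((c, 1) ::ₘ 0)) (fun c => ?_) c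
  rw [S.loop 0 hδ]
  simp [pairTerm, S.zero_label]

theorem lin_zero (hδ : 0 < δ) : S.lin c 0 0 = 0 :=
  Finset.sum_eq_zero fun c' _ => by rw [S.w_zero_one c' hδ, mul_zero]

theorem row_zero (hδ : 0 < δ) :
    S.row c 0 0 = 2 * (PowerSeries.X * PowerSeries.mk fun k => S.w 0 ((c, k) ::ₘ 0)) := by
  ext n
  rw [row, PowerSeries.coeff_mk, show (2 : PowerSeries A) = PowerSeries.C 2 from rfl,
    PowerSeries.coeff_C_mul]
  cases n with
  | zero =>
    rw [PowerSeries.coeff_zero_X_mul, mul_zero]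
    exact S.lin_zero c hδ
  | succ n => rw [PowerSeries.coeff_succ_X_mul, PowerSeries.coeff_mk]; rfl

theorem toL_X_mul_xL : toL PowerSeries.X * (xL : LaurentSeries A) = 1 := by
  rw [mul_comm, xL_mul_toL_X]

theorem gcoeff_spec_zero_eq : gcoeff 0 0 (S.spec c) =
    -(toL (1 - PowerSeries.X * S.row c 0 0)) * xL := by
  rw [gcoeff_spec, if_neg (by simp), if_pos (by simp), map_sub, map_one, map_mul]
  have := toL_X_mul_xL (A := A)
  linear_combination (-toL (S.row c 0 0)) * this

theorem gcoeff_zero_mul (F G : Src (PowerSeries (LaurentSeries A)) (Label d)) :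
    gcoeff 0 0 (F * G) = gcoeff 0 0 F * gcoeff 0 0 G := by
  rw [gcoeff_mul]; simp

variable [IsDomain A] [CharZero A]

/-- The semicircle law. The loop equation bounds the degree of `H ^ 2` by two, and `H = 1 - 2 t ^ 2
a` with `a` of constant term one fixes its coefficients up to order two. -/
theorem one_sub_row (hδ : 0 < δ) : 1 - PowerSeries.X * S.row c 0 0 = phi A := by
  set H := 1 - PowerSeries.X * S.row c 0 0 with hH
  set a : PowerSeries A := PowerSeries.mk fun k => S.w 0 ((c, k) ::ₘ 0) with ha
  have ha0 : PowerSeries.constantCoeff a = 1 := by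
    rw [ha, ← PowerSeries.coeff_zero_eq_constantCoeff_apply, PowerSeries.coeff_mk, S.zero_label]
    simp
  have hHa : H = 1 - 2 * PowerSeries.X ^ 2 * a := by rw [hH, S.row_zero c hδ]; ring
  refine eq_phi_of_sq ?_ (by rw [hHa]; simp)
  have htop : TopLe (2 : ℕ) (toL (H ^ 2)) := by
    have h1 := S.topLe_spec_sq c hδ 0
    rw [if_pos rfl, add_zero, gcoeff_zero_mul, S.gcoeff_spec_zero_eq, ← hH] at h1
    have h2 : TopLe 2 (toL PowerSeries.X * toL PowerSeries.X : LaurentSeries A) := by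
      rw [toL, HahnSeries.ofPowerSeries_X, HahnSeries.single_mul_single]
      exact (TopLe.single _ _).mono (by norm_num)
    have h3 := h2.mul h1
    have h4 : toL PowerSeries.X * toL PowerSeries.X * (-toL H * xL * (-toL H * xL)) = toL (H ^ 2) := by
      rw [map_pow]
      linear_combination (toL H ^ 2 * (toL PowerSeries.X * xL + 1)) * toL_X_mul_xL (A := A)
    rw [h4] at h3
    exact h3
  rw [topLe_toL_iff] at htop
  obtain ⟨b, hb⟩ : ∃ b, a = 1 + PowerSeries.X * b := by
    have := PowerSeries.X_dvd_iff.2 (show PowerSeries.constantCoeff (a - 1) = 0 by simp [ha0])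
    obtain ⟨b, hb⟩ := this
    exact ⟨b, by linear_combination hb⟩
  have hsplit : H ^ 2 = 1 - 4 * PowerSeries.X ^ 2 +
      PowerSeries.X ^ 3 * (4 * PowerSeries.X * a ^ 2 - 4 * b) := by
    rw [hHa]; linear_combination (-4 * PowerSeries.X ^ 2) * hb
  have h4 : ∀ n, 2 < n → PowerSeries.coeff n (1 - 4 * PowerSeries.X ^ 2 : PowerSeries A) = 0 := by
    intro n hn
    rw [map_sub, PowerSeries.coeff_one, if_neg (by omega), show (4 : PowerSeries A) = PowerSeries.C 4 from rfl,
      PowerSeries.coeff_C_mul, PowerSeries.coeff_X_pow, if_neg (by omega)]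
    simp
  ext n
  by_cases hn : 2 < n
  · rw [htop n hn, h4 n hn]
  · rw [hsplit, map_add, PowerSeries.coeff_X_pow_mul', if_neg (by omega), add_zero]

theorem gcoeff_spec_zero (hδ : 0 < δ) : gcoeff 0 0 (S.spec c) = -(toL (phi A)) * xL := by
  rw [S.gcoeff_spec_zero_eq, S.one_sub_row c hδ]

theorem topLe_of_two_mul {n : ℤ} {F : LaurentSeries A} (h : TopLe n (2 * F)) : TopLe n F := by
  intro m hm
  have := h m hm
  rw [two_mul, HahnSeries.coeff_add, ← two_mul] at this
  exact (mul_eq_zero.1 this).resolve_left two_ne_zero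

/-- From the product with the leading resolvent to the series itself. -/
theorem adm_of_leading {R : ℕ} {F : LaurentSeries A} (h : Adm R (2 * (-(toL (phi A)) * xL) * F)) :
    Adm (R + 1) F := by
  refine topLe_of_two_mul ?_
  have h1 : TopLe 1 (toL PowerSeries.X : LaurentSeries A) := by
    rw [toL, HahnSeries.ofPowerSeries_X]; exact TopLe.single 1 1
  have h2 := (TopLe.mul h h1).neg
  have h3 : -(toL (phi A) ^ R * (2 * (-toL (phi A) * xL) * F) * toL PowerSeries.X) =
      2 * (toL (phi A) ^ (R + 1) * F) := by
    linear_combination (2 * toL (phi A) ^ (R + 1) * F) * toL_X_mul_xL (A := A)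
  rw [h3] at h2
  exact_mod_cast h2

theorem adm_spec_zero (hδ : 0 < δ) : Adm 1 (gcoeff 0 0 (S.spec c)) := by
  have h2 : TopLe (-1) (xL : LaurentSeries A) := TopLe.single _ _
  have h3 := (TopLe.mul (topLe_phi_sq (A := A)) h2).neg
  rw [S.gcoeff_spec_zero c hδ, Adm]
  convert h3 using 1
  · norm_num
  · ring

/-- At genus zero the first variation of `spec ^ 2` with respect to a source is twice the leading
term times the unknown, and it is a polynomial in `x`. -/
theorem adm_spec_single (hδ : 0 < δ) (l : Label d) : Adm 1 (gcoeff 0 (l ::ₘ 0) (S.spec c)) := by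
  refine adm_of_leading (R := 0) ?_
  have h := S.topLe_spec_sq c hδ (l ::ₘ 0)
  rw [if_pos rfl, add_zero, gcoeff_mul] at h
  simp only [Finset.Nat.antidiagonal_zero, Finset.sum_singleton, Multiset.antidiagonal_cons,
    Multiset.antidiagonal_zero, Multiset.map_add, Multiset.map_singleton, Prod.map,
    Multiset.sum_add, Multiset.sum_singleton, id] at h
  rw [S.gcoeff_spec_zero c hδ] at h
  rw [Adm, pow_zero, one_mul]
  convert h using 1
  · norm_num
  · ring

/-- The genus zero two-point double series, multiplied by `phi` in one variable. -/
theorem leftMul_ext2_zero (hδ : 0 < δ) {i : ℕ} (hi : 2 ≤ i) (j : ℕ) :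
    leftMul (phi A) (S.ext2 c 0 0) i j = -2 * ((j - 1 : ℕ) : A) * PowerSeries.coeff (i + j - 2) (phi A) := by
  have h1 : ∀ l : Label d, PowerSeries.coeff i (phi A * S.row c 0 (l ::ₘ 0)) =
      -(toL (phi A) * theta c l).coeff (i : ℤ) := by
    intro l
    have h := S.adm_spec_single c hδ l (i : ℤ) (by push_cast; omega)
    rw [gcoeff_spec, if_pos (by simp), if_neg (by simp), sub_zero, pow_one, mul_add,
      HahnSeries.coeff_add, ← map_mul, coeff_toL_natCast] at h
    simp only [Multiset.map_cons, Multiset.map_zero, Multiset.sum_cons, Multiset.sum_zero,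
      add_zero] at h
    exact eq_neg_of_add_eq_zero_left h
  rw [leftMul]
  cases j with
  | zero =>
    have h2 : (PowerSeries.mk fun i' => S.ext2 c 0 0 i' 0) =
        ∑ c', PowerSeries.C (S.lam c c') * S.row c 0 ((c', 1) ::ₘ 0) := by
      ext n
      simp only [PowerSeries.coeff_mk, map_sum, PowerSeries.coeff_C_mul, row]
      exact S.ext_comm c c n 0 _ _
    rw [h2, Finset.mul_sum, map_sum]
    simp only [Nat.zero_sub, Nat.cast_zero, mul_zero, zero_mul]
    -- The linear potential of colour `c` is made of other colours, as `lam c c = 0`, and these have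
    -- no source term in the equation of colour `c`.
    refine Finset.sum_eq_zero fun c' _ => ?_
    rw [mul_left_comm, PowerSeries.coeff_C_mul, h1, theta]
    by_cases hc : c' = c
    · rw [hc, S.lam_self, zero_mul]
    · simp [shiftWeight, hc]
  | succ p =>
    have h2 : (PowerSeries.mk fun i' => S.ext2 c 0 0 i' (p + 1)) =
        2 * S.row c 0 ((c, p) ::ₘ 0) := by
      ext n
      rw [PowerSeries.coeff_mk, show (2 : PowerSeries A) = PowerSeries.C 2 from rfl,
        PowerSeries.coeff_C_mul, row, PowerSeries.coeff_mk]
      exact S.ext_comm c c n (p + 1) _ _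
    rw [h2, mul_left_comm, show (2 : PowerSeries A) = PowerSeries.C 2 from rfl,
      PowerSeries.coeff_C_mul, h1, theta, HahnSeries.coeff_mul_single]
    have h3 : (i : ℤ) - (1 - (p : ℤ)) = ((i + (p + 1) - 2 : ℕ) : ℤ) := by omega
    rw [h3, coeff_toL_natCast]
    simp [shiftWeight]
    ring

theorem ext2_symm (g : ℕ) (P : Multiset (Label d)) (i j : ℕ) : S.ext2 c g P i j = S.ext2 c g P j i :=
  S.ext_comm c c i j _ _

/-- The exceptional case of `adm_diagSeries`: the rows of the genus-zero two-point function contain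
the source term. With the explicit rows, the diagonal of `F` is `-t ^ 4 φ''`, and `φ ^ 3 φ'' = -4`
gives `φ ^ 4` times the diagonal as `4 t ^ 4 + φ ^ 2 Q` with `Q` of degree at most two. -/
theorem adm_diag_zero (hδ : 0 < δ) : Adm 4 (toL (diagSeries (S.ext2 c 0 0))) := by
  set E := S.ext2 c 0 0 with hE
  have hsymm := S.ext2_symm c 0 0
  set B := bothMul (phi A) E with hB
  set F : ℕ → ℕ → A := fun i j =>
    if 2 ≤ j then -2 * ((i - 1 : ℕ) : A) * PowerSeries.coeff (i + j - 2) (phi A) else 0 with hF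
  have h1 : ∀ i j, 2 ≤ j → B i j = leftMul (phi A) F i j := by
    intro i j hj
    rw [hB, bothMul, leftMul, leftMul]
    congr 2
    congr 1
    funext k
    rw [S.leftMul_ext2_zero c hδ hj, hF]
    simp only [if_pos hj]
    rw [add_comm]
  have h2 : ∀ i j, j < 2 → leftMul (phi A) F i j = 0 := by
    intro i j hj
    have : (PowerSeries.mk fun i' => F i' j) = 0 := by
      ext n; simp [hF, Nat.not_le.2 hj]
    rw [leftMul, this, mul_zero, map_zero]
  -- After exchanging the variables all entries involved carry a truncated factor `q.2 - 1` with
  -- `q.2 ≤ 1`.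
  have h3 : ∀ i j, 2 ≤ i → j < 2 → B i j = 0 := by
    intro i j hi hj
    rw [hB, bothMul_symm _ hsymm, ← hB, h1 _ _ hi, leftMul, PowerSeries.coeff_mul]
    refine Finset.sum_eq_zero fun q hq => ?_
    have := Finset.HasAntidiagonal.mem_antidiagonal.1 hq
    have h0 : q.2 - 1 = 0 := by omega
    simp [hF, h0]
  have h4 : ∀ n, 2 < n → PowerSeries.coeff n (diagSeries B - phi A * diagSeries F) = 0 := by
    intro n hn
    rw [← diagSeries_leftMul, map_sub, diagSeries, diagSeries, PowerSeries.coeff_mk,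
      PowerSeries.coeff_mk, ← Finset.sum_sub_distrib]
    refine Finset.sum_eq_zero fun q hq => ?_
    have := Finset.HasAntidiagonal.mem_antidiagonal.1 hq
    by_cases hq2 : 2 ≤ q.2
    · rw [h1 _ _ hq2, sub_self]
    · rw [h2 _ _ (by omega), h3 _ _ (by omega) (by omega), sub_self]
  have h5 : diagSeries F = -(PowerSeries.X ^ 4 * PowerSeries.derivative A (PowerSeries.derivative A (phi A))) := by
    ext s
    rw [diagSeries, PowerSeries.coeff_mk, map_neg, PowerSeries.coeff_X_pow_mul']
    have h6 : ∀ q ∈ Finset.HasAntidiagonal.antidiagonal s, F q.1 q.2 =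
        (if 2 ≤ q.2 then ((q.1 - 1 : ℕ) : A) else 0) * (-2 * PowerSeries.coeff (s - 2) (phi A)) := by
      intro q hq
      rw [← Finset.HasAntidiagonal.mem_antidiagonal.1 hq]
      simp only [hF]
      split_ifs <;> ring
    rw [Finset.sum_congr rfl h6, ← Finset.sum_mul]
    -- The sum of `i - 1` over `i ≤ s`, truncated at zero, is `s (s - 1) / 2`, the coefficient
    -- produced by a second derivative.
    have h7 : ∀ s : ℕ, 2 * ∑ q ∈ Finset.HasAntidiagonal.antidiagonal (s + 2),
        (if 2 ≤ q.2 then ((q.1 - 1 : ℕ) : A) else 0) = (s : A) * ((s - 1 : ℕ) : A) := by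
      intro s
      rw [Finset.Nat.sum_antidiagonal_eq_sum_range_succ_mk, Finset.sum_range_succ,
        Finset.sum_range_succ, if_neg (by omega), if_neg (by omega), add_zero, add_zero,
        Finset.sum_congr rfl fun i hi => if_pos (by have := Finset.mem_range.1 hi; omega),
        ← Nat.cast_sum, Finset.sum_range_succ']
      simp only [Nat.add_sub_cancel, Nat.zero_sub, add_zero]
      have := Finset.sum_range_id_mul_two s
      rw [mul_comm]
      exact_mod_cast this
    by_cases hs : s < 2
    · rw [if_neg (by omega), Finset.sum_eq_zero, zero_mul, neg_zero]
      intro q hq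
      have := Finset.HasAntidiagonal.mem_antidiagonal.1 hq
      rw [if_neg (by omega)]
    · obtain ⟨r, rfl⟩ : ∃ r, s = r + 2 := ⟨s - 2, by omega⟩
      have h8 := h7 r
      have h9 : r + 2 - 2 = r := rfl
      rw [h9]
      by_cases hr : 2 ≤ r
      · obtain ⟨k, rfl⟩ : ∃ k, r = k + 2 := ⟨r - 2, by omega⟩
        have h10 : k + 2 + 2 - 4 = k := by omega
        have h11 : k + 2 - 1 = k + 1 := rfl
        rw [if_pos (by omega), h10, PowerSeries.coeff_derivative, PowerSeries.coeff_derivative]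
        rw [h11] at h8
        push_cast at h8 ⊢
        linear_combination (-PowerSeries.coeff (k + 2) (phi A)) * h8
      · have h10 : (r : A) * ((r - 1 : ℕ) : A) = 0 := by
          interval_cases r <;> simp
        rw [if_neg (by omega), neg_zero]
        rw [h10] at h8
        linear_combination (-PowerSeries.coeff r (phi A)) * h8
  set Q := diagSeries B - phi A * diagSeries F with hQ
  have h6 : phi A ^ 4 * diagSeries E = 4 * PowerSeries.X ^ 4 + phi A ^ 2 * Q := by
    rw [hQ, hB, diagSeries_bothMul, h5]
    linear_combination (-PowerSeries.X ^ 4) * phi_derivative (A := A)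
  rw [Adm, ← map_pow, ← map_mul, h6, map_add]
  refine TopLe.add (topLe_toL_iff.2 fun m hm => ?_) ?_
  · rw [show (4 : PowerSeries A) = PowerSeries.C 4 from rfl, PowerSeries.coeff_C_mul,
      PowerSeries.coeff_X_pow, if_neg (by omega), mul_zero]
  · rw [map_mul, map_pow]
    exact TopLe.mul topLe_phi_sq (topLe_toL_iff.2 h4)

/-- All stable correlations, and the unstable ones, are admissible. -/
theorem exists_adm_spec (hδ : 0 < δ) (D : ℕ) : ∃ K, ∀ g P c, g < δ → 2 * g + P.card ≤ D →
    Adm (2 * K + 1) (gcoeff g P (S.spec c)) := by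
  induction D with
  | zero =>
    refine ⟨0, fun g P c _ hD => ?_⟩
    obtain rfl : g = 0 := by omega
    obtain rfl : P = 0 := Multiset.card_eq_zero.1 (by omega)
    exact S.adm_spec_zero c hδ
  | succ D ih =>
    obtain ⟨K, hK⟩ := ih
    -- Products of two known terms have exponent `4K + 2`, the diagonal of the genus-zero two-point
    -- function has exponent 4. Both are raised to the even number `4K + 6`, and division by the
    -- leading term adds one.
    refine ⟨2 * K + 3, fun g P c hg hD => ?_⟩
    by_cases h0 : g = 0 ∧ P.card = 0
    · obtain ⟨rfl, h0⟩ := h0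
      obtain rfl : P = 0 := Multiset.card_eq_zero.1 h0
      have := (S.adm_spec_zero c hδ).add_two (2 * K + 3)
      rwa [add_comm] at this
    rw [show 2 * (2 * K + 3) + 1 = (4 * K + 6) + 1 by ring]
    refine adm_of_leading ?_
    set G0 : LaurentSeries A := -(toL (phi A)) * xL with hG0
    set cG : Src (PowerSeries (LaurentSeries A)) (Label d) := Src.const (PowerSeries.C G0) with hcG
    have hc : ∀ g P (F : Src (PowerSeries (LaurentSeries A)) (Label d)),
        gcoeff g P (cG * F) = G0 * gcoeff g P F := by
      intro g P F
      rw [gcoeff_apply, hcG, Src.const_mul_apply, PowerSeries.coeff_C_mul, gcoeff_apply]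
    have hc' : ∀ g P, gcoeff g P cG = if g = 0 ∧ P.card = 0 then G0 else 0 := by
      intro g P
      rw [gcoeff_apply, hcG, Src.const, Src.mk_apply]
      by_cases h : P.card = 0 <;> by_cases hg : g = 0 <;> simp [h, hg, PowerSeries.coeff_C]
    -- The leading part `cG` is split off, so that the remaining square contains only pairs of
    -- correlations with smaller `2g + n`.
    have hsq : S.spec c * S.spec c = cG * (S.spec c + S.spec c) - cG * cG +
        (S.spec c - cG) * (S.spec c - cG) := by ring
    have hmain : 2 * G0 * gcoeff g P (S.spec c) =
        (gcoeff g P (S.spec c * S.spec c) + if g = 0 then 0 else toL (diagSeries (S.ext2 c (g - 1) P))) -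
        gcoeff g P ((S.spec c - cG) * (S.spec c - cG)) -
        if g = 0 then 0 else toL (diagSeries (S.ext2 c (g - 1) P)) := by
      rw [hsq, map_add, map_sub, hc, hc, map_add, hc', if_neg h0]
      ring
    rw [hmain, sub_eq_add_neg, sub_eq_add_neg]
    refine ((Adm.add ?_ (Adm.neg ?_)).add (Adm.neg ?_))
    · have := Adm.of_topLe (S.topLe_spec_sq c hg P) (2 * K + 3)
      rwa [show 2 * (2 * K + 3) = 4 * K + 6 by ring] at this
    · rw [gcoeff_mul]
      have hz : ∀ g P, g < δ → 2 * g + P.card ≤ D → Adm (2 * K + 1) (gcoeff g P (S.spec c - cG)) := by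
        intro g P hg hD
        rw [map_sub, hc']
        split_ifs with h
        · obtain ⟨rfl, h⟩ := h
          obtain rfl : P = 0 := Multiset.card_eq_zero.1 h
          rw [S.gcoeff_spec_zero c hδ, sub_self]
          exact Adm.zero _
        · rw [sub_zero]; exact hK g P c hg hD
      have hz0 : gcoeff 0 0 (S.spec c - cG) = 0 := by
        rw [map_sub, hc', if_pos ⟨rfl, rfl⟩, S.gcoeff_spec_zero c hδ, sub_self]
      refine Adm.multiset_sum (Finset.HasAntidiagonal.antidiagonal g).val fun q hq =>
        Adm.multiset_sum _ fun r hr => ?_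
      have h1 := Finset.HasAntidiagonal.mem_antidiagonal.1 (show q ∈ Finset.HasAntidiagonal.antidiagonal g from hq)
      have h2 := congrArg Multiset.card (Multiset.mem_antidiagonal.1 hr)
      rw [Multiset.card_add] at h2
      by_cases h3 : 2 * q.1 + r.1.card = 0
      · have h4 : q.1 = 0 := by omega
        have h5 : r.1 = 0 := Multiset.card_eq_zero.1 (by omega)
        rw [h4, h5, hz0, zero_mul]; exact Adm.zero _
      by_cases h3' : 2 * q.2 + r.2.card = 0
      · have h4 : q.2 = 0 := by omega
        have h5 : r.2 = 0 := Multiset.card_eq_zero.1 (by omega)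
        rw [h4, h5, hz0, mul_zero]; exact Adm.zero _
      have h6 := ((hz q.1 r.1 (by omega) (by omega)).mul (hz q.2 r.2 (by omega) (by omega))).add_two 2
      rwa [show 2 * K + 1 + (2 * K + 1) + 2 * 2 = 4 * K + 6 by ring] at h6
    · split_ifs with hg0
      · exact Adm.zero _
      -- Only here the diagonal involves the unstable two-point function. Otherwise its rows are
      -- stable and covered by induction.
      by_cases h1 : g - 1 = 0 ∧ P.card = 0
      · rw [h1.1, Multiset.card_eq_zero.1 h1.2]
        have := (S.adm_diag_zero c hδ).add_two (2 * K + 1)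
        rwa [show 4 + 2 * (2 * K + 1) = 4 * K + 6 by ring] at this
      have hrow : ∀ l : Label d, Adm (2 * K + 1) (toL (S.row c (g - 1) (l ::ₘ P))) := by
        intro l
        have := hK (g - 1) (l ::ₘ P) c (by omega) (by rw [Multiset.card_cons]; omega)
        rwa [gcoeff_spec, if_neg (by rw [Multiset.card_cons]; omega),
          if_neg (by rw [Multiset.card_cons]; omega), add_zero, sub_zero] at this
      have hC : ∀ (a : A) (f : PowerSeries A), Adm (2 * K + 1) (toL f) →
          Adm (2 * K + 1) (toL (PowerSeries.C a * f)) := by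
        intro a f hf
        have := (TopLe.single 0 a).mul hf
        rw [zero_add] at this
        rw [Adm, map_mul, HahnSeries.ofPowerSeries_C, mul_left_comm]
        exact this
      have h2 := (adm_diagSeries (S.ext2_symm c (g - 1) P) (M := 2 * K + 1) fun j => by
        cases j with
        | zero =>
          have h2 : (PowerSeries.mk fun i' => S.ext2 c (g - 1) P i' 0) =
              ∑ c', PowerSeries.C (S.lam c c') * S.row c (g - 1) ((c', 1) ::ₘ P) := by
            ext n
            simp only [PowerSeries.coeff_mk, map_sum, PowerSeries.coeff_C_mul, row]
            exact S.ext_comm c c n 0 _ _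
          rw [h2, map_sum]
          exact Adm.multiset_sum Finset.univ.val fun c' _ => hC _ _ (hrow _)
        | succ p =>
          have h2 : (PowerSeries.mk fun i' => S.ext2 c (g - 1) P i' (p + 1)) =
              PowerSeries.C 2 * S.row c (g - 1) ((c, p) ::ₘ P) := by
            ext n
            rw [PowerSeries.coeff_mk, PowerSeries.coeff_C_mul, row, PowerSeries.coeff_mk]
            exact S.ext_comm c c n (p + 1) _ _
          rw [h2]
          exact hC _ _ (hrow _)).add_two 2
      rwa [show 2 * (2 * K + 1) + 2 * 2 = 4 * K + 6 by ring] at h2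

end LoopSystem

/-! ### Expansion of the correlations in a finite family of series -/

section Psi

open PowerSeries

variable (A : Type*) [CommRing A]

/-- The series `1 / (1 - 4 t ^ 2)`. -/
def geo : PowerSeries A := PowerSeries.mk fun n => if 2 ∣ n then 2 ^ n else 0

theorem geo_spec : (1 - 4 * X ^ 2) * geo A = 1 := by
  ext n
  rw [sub_mul, one_mul, map_sub, mul_assoc, show (4 : PowerSeries A) = C 4 from rfl, coeff_C_mul,
    coeff_X_pow_mul', geo, coeff_mk, coeff_one]
  by_cases h : 2 ≤ n
  · obtain ⟨m, rfl⟩ : ∃ m, n = m + 2 := ⟨n - 2, by omega⟩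
    have h1 : 2 ∣ m + 2 ↔ 2 ∣ m := by omega
    simp only [if_pos h, Nat.add_sub_cancel, coeff_mk, h1]
    split_ifs <;> first | contradiction | ring
  · interval_cases n <;> simp

/-- The series `1 / √(1 - 4 t ^ 2)`. -/
def psi : PowerSeries A := phi A * geo A

theorem phi_mul_psi : phi A * psi A = 1 := by
  rw [psi, ← mul_assoc, ← sq, phi_sq, geo_spec]

theorem coeff_zero_phi : coeff 0 (phi A) = 1 := by
  rw [coeff_zero_eq_constantCoeff_apply, constantCoeff_phi]

theorem coeff_phi (n : ℕ) : coeff n (phi A) = ((coeff n phiInt : ℤ) : A) := by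
  rw [phi, coeff_map]; rfl

theorem coeff_one_phi : coeff 1 (phi A) = 0 := by rw [coeff_phi, coeff_phiInt]; simp

theorem coeff_two_phi : coeff 2 (phi A) = -2 := by rw [coeff_phi, coeff_phiInt]; simp

theorem coeff_zero_psi : coeff 0 (psi A) = 1 := by
  rw [psi, coeff_mul]; simp [geo, coeff_zero_phi]

theorem coeff_one_psi : coeff 1 (psi A) = 0 := by
  rw [psi, coeff_mul, Finset.Nat.sum_antidiagonal_eq_sum_range_succ_mk]
  simp [Finset.sum_range_succ, geo, coeff_one_phi]

theorem coeff_two_psi : coeff 2 (psi A) = 2 := by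
  rw [psi, coeff_mul, Finset.Nat.sum_antidiagonal_eq_sum_range_succ_mk]
  simp only [Finset.sum_range_succ, geo, coeff_mk, coeff_one_phi, coeff_two_phi, coeff_zero_phi]
  simp; ring

/-- The basis of series in which rows are expanded. -/
def basis (M j : ℕ) : PowerSeries A := if j = 0 then psi A else X ^ j * psi A ^ M

theorem map_geo {B : Type*} [CommRing B] (f : A →+* B) : (geo A).map f = geo B := by
  ext n
  simp only [geo, coeff_map, coeff_mk]
  split_ifs
  · rw [map_pow, map_ofNat]
  · rw [map_zero]

theorem map_phi {B : Type*} [CommRing B] (f : A →+* B) : (phi A).map f = phi B := by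
  ext n; simp only [coeff_map, coeff_phi, map_intCast]

theorem map_basis {B : Type*} [CommRing B] (f : A →+* B) (M j : ℕ) :
    (basis A M j).map f = basis B M j := by
  rw [basis, basis]
  split_ifs <;> simp [psi, map_phi, map_geo]

end Psi

namespace LoopSystem

open PowerSeries

variable {A : Type*} [CommRing A] {d δ : ℕ} (S : LoopSystem A d δ)

/-- Extended insertions, as linear maps. -/
def extL (c : Fin d) (i : ℕ) : (Multiset (Label d) → A) →ₗ[A] (Multiset (Label d) → A) where
  toFun := S.ext c i
  map_add' u v := by
    funext P
    cases i <;> simp [ext, mul_add, Finset.sum_add_distrib]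
  map_smul' a u := by
    funext P
    cases i <;> simp only [ext, Pi.smul_apply, smul_eq_mul, RingHom.id_apply, Finset.mul_sum]
    · exact Finset.sum_congr rfl fun _ _ => by ring
    · ring

theorem extL_apply (c : Fin d) (i : ℕ) (u : Multiset (Label d) → A) : S.extL c i u = S.ext c i u := rfl

theorem extL_comm (c c' : Fin d) (i j : ℕ) : Commute (S.extL c i) (S.extL c' j) :=
  LinearMap.ext fun u => funext fun P => S.ext_comm c c' i j u P

/-- The coefficients in the expansion of rows. -/
def polC (M : ℕ) (c : Fin d) (j : ℕ) : (Multiset (Label d) → A) →ₗ[A] (Multiset (Label d) → A) :=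
  if j = 0 then S.extL c 0 else ∑ q ∈ Finset.HasAntidiagonal.antidiagonal j,
    coeff q.1 (phi A ^ M) • (S.extL c q.2 - coeff q.2 (psi A) • S.extL c 0)

/-- Expanding in one variable preserves the boundedness in the others, which is what the iterated
expansion `arr` needs. -/
theorem polC_comm (M : ℕ) (c c' : Fin d) (i j : ℕ) : Commute (S.polC M c i) (S.polC M c' j) := by
  have h1 : ∀ k, Commute (S.extL c k) (S.polC M c' j) := by
    intro k
    rw [polC]
    split_ifs
    · exact S.extL_comm _ _ _ _
    · exact Commute.sum_right _ _ _ fun q _ => ((S.extL_comm _ _ _ _).sub_right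
        ((S.extL_comm _ _ _ _).smul_right _)).smul_right _
  rw [polC]
  split_ifs
  · exact h1 0
  · exact Commute.sum_left _ _ _ fun q _ => ((h1 _).sub_left ((h1 _).smul_left _)).smul_left _

theorem polC_succ_apply (M : ℕ) (c : Fin d) {j : ℕ} (hj : j ≠ 0) (u : Multiset (Label d) → A)
    (P : Multiset (Label d)) : S.polC M c j u P = coeff j (phi A ^ M *
      ((PowerSeries.mk fun i => S.ext c i u P) - C (S.ext c 0 u P) * psi A)) := by
  rw [polC, if_neg hj, coeff_mul]
  simp only [LinearMap.coe_sum, Finset.sum_apply, LinearMap.smul_apply, LinearMap.sub_apply,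
    Pi.smul_apply, Pi.sub_apply, smul_eq_mul, map_sub, coeff_mk, coeff_C_mul, extL_apply]
  exact Finset.sum_congr rfl fun _ _ => by ring

/-- Rows vanish above `M` after multiplication by `phi ^ M`. -/
def RowBounded (M : ℕ) (u : Multiset (Label d) → A) : Prop := ∀ c j, M < j → S.polC M c j u = 0

/-- No insertion of a label with zero power. -/
def NoZero (u : Multiset (Label d) → A) : Prop := ∀ c P, u ((c, 0) ::ₘ P) = 0

variable {S}

theorem RowBounded.polC {M : ℕ} {u : Multiset (Label d) → A} (hu : S.RowBounded M u) (c : Fin d)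
    (j : ℕ) : S.RowBounded M (S.polC M c j u) := fun c' j' hj => by
  have := LinearMap.congr_fun (S.polC_comm M c' c j' j) u
  simp only [Module.End.mul_apply] at this
  rw [this, hu c' j' hj, map_zero]

/-- Subtracting a multiple of `ψ = 1/φ` does no harm: for an odd exponent `φ ^ (2K + 1) ψ = (φ ^ 2)
^ K` is a polynomial of degree at most `2K`. -/
theorem rowBounded_of_adm {K : ℕ} {u : Multiset (Label d) → A}
    (h : ∀ c P, Adm (2 * K + 1) (toL (PowerSeries.mk fun i => S.ext c i u P))) :
    S.RowBounded (2 * K + 1) u := by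
  intro c j hj
  funext P
  rw [S.polC_succ_apply _ _ (by omega), mul_sub, map_sub]
  have h1 := h c P
  rw [Adm, ← map_pow, ← map_mul, topLe_toL_iff] at h1
  rw [h1 j hj, zero_sub, Pi.zero_apply, neg_eq_zero, mul_left_comm, coeff_C_mul]
  have h2 : phi A ^ (2 * K + 1) * psi A = (phi A ^ 2) ^ K := by
    rw [pow_succ, mul_assoc, phi_mul_psi, mul_one, pow_mul]
  have h3 : TopLe ((2 * K : ℕ) : ℤ) (toL ((phi A ^ 2) ^ K)) := by
    clear h1 h2 h hj
    induction K with
    | zero =>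
      rw [pow_zero]
      exact topLe_toL_iff.2 fun m hm => by rw [coeff_one, if_neg (by omega)]
    | succ K ih =>
      rw [pow_succ, map_mul, map_pow _ (phi A)]
      have := TopLe.mul ih topLe_phi_sq
      exact_mod_cast this
  rw [h2, topLe_toL_iff.1 h3 j (by omega), mul_zero]

/-- With `ψ` times its constant term removed, a row multiplied by `φ ^ M` is a polynomial of degree
at most `M` without constant term; multiply back by `ψ ^ M`. Separating `ψ` isolates the linear
potential, which has no pole at the ramification points. -/
theorem RowBounded.ext_eq {M : ℕ} {u : Multiset (Label d) → A} (hu : S.RowBounded M u)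
    (c : Fin d) (i : ℕ) (P : Multiset (Label d)) :
    S.ext c i u P = ∑ j : Fin (M + 1), coeff i (basis A M j) * S.polC M c j u P := by
  set ρ := (PowerSeries.mk fun i => S.ext c i u P) - C (S.ext c 0 u P) * psi A with hρ
  have h0 : coeff 0 (phi A ^ M * ρ) = 0 := by
    rw [coeff_mul, Finset.Nat.antidiagonal_zero, Finset.sum_singleton, hρ, map_sub, coeff_mk, coeff_C_mul, coeff_zero_psi]
    simp
  have h1 : phi A ^ M * ρ = ∑ j ∈ Finset.range M, C (S.polC M c (j + 1) u P) * X ^ (j + 1) := by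
    ext n
    rw [map_sum]
    simp only [coeff_C_mul, coeff_X_pow]
    cases n with
    | zero => rw [h0]; simp
    | succ n =>
      by_cases hn : n < M
      · rw [Finset.sum_eq_single_of_mem n (Finset.mem_range.2 hn)]
        · rw [if_pos rfl, mul_one, S.polC_succ_apply _ _ (Nat.succ_ne_zero n)]
        · intro b _ hb
          rw [if_neg (by omega), mul_zero]
      · rw [← S.polC_succ_apply _ _ (Nat.succ_ne_zero n), hu c (n + 1) (by omega), Finset.sum_eq_zero]
        · rfl
        · intro b hb
          have := Finset.mem_range.1 hb
          rw [if_neg (by omega), mul_zero]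
  have h2 : (PowerSeries.mk fun i => S.ext c i u P) = C (S.ext c 0 u P) * psi A +
      ∑ j ∈ Finset.range M, C (S.polC M c (j + 1) u P) * (X ^ (j + 1) * psi A ^ M) := by
    have h3 : psi A ^ M * (phi A ^ M * ρ) = ρ := by
      rw [← mul_assoc, ← mul_pow, mul_comm (psi A), phi_mul_psi, one_pow, one_mul]
    have h4 : (PowerSeries.mk fun i => S.ext c i u P) = C (S.ext c 0 u P) * psi A + ρ := by
      rw [hρ]; ring
    rw [h4, ← h3, h1, Finset.mul_sum]
    congr 1
    exact Finset.sum_congr rfl fun _ _ => by ring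
  have h5 := congrArg (coeff i) h2
  rw [coeff_mk, map_add, map_sum, coeff_C_mul] at h5
  rw [h5, Fin.sum_univ_succ, Finset.sum_range]
  congr 1
  · rw [Fin.val_zero, basis, if_pos rfl, LoopSystem.polC, if_pos rfl, mul_comm]; rfl
  · refine Finset.sum_congr rfl fun j _ => ?_
    rw [coeff_C_mul, basis, if_neg (by simp), mul_comm]
    rfl

variable (S)

/-- The array of coefficients in the expansion of the correlations. -/
def arr (M : ℕ) : ∀ n : ℕ, (Fin n → Fin d) → (Fin n → ℕ) → ((Multiset (Label d) → A) →ₗ[A] A)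
  | 0, _, _ => LinearMap.proj 0
  | n + 1, c, j => (arr M n (Fin.init c) (Fin.init j)).comp (S.polC M (c (Fin.last n)) (j (Fin.last n)))

variable {S}

theorem univ_map_succ {n : ℕ} (c : Fin (n + 1) → Fin d) (p : Fin (n + 1) → ℕ) :
    (Finset.univ : Finset (Fin (n + 1))).val.map (fun i => (c i, p i)) =
      (c (Fin.last n), p (Fin.last n)) ::ₘ
        (Finset.univ : Finset (Fin n)).val.map fun i => (Fin.init c i, Fin.init p i) := by
  rw [Fin.univ_castSuccEmb, Finset.cons_val, Multiset.map_cons, Finset.map_val, Multiset.map_map]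
  rfl

/-- One application of `ext_eq` for each variable, the last one first. The factor `2 ^ n` comes from
the factor two in `ext`. -/
theorem RowBounded.eq_sum_arr {M : ℕ} {n : ℕ} {u : Multiset (Label d) → A} (hu : S.RowBounded M u)
    (c : Fin n → Fin d) (p : Fin n → ℕ) :
    2 ^ n * u ((Finset.univ : Finset (Fin n)).val.map fun i => (c i, p i)) =
      ∑ j : Fin n → Fin (M + 1), (∏ l, coeff (p l + 1) (basis A M (j l))) *
        S.arr M n c (fun l => j l) u := by
  induction n generalizing u with
  | zero => simp [arr]
  | succ n ih =>
    rw [univ_map_succ, pow_succ, mul_assoc]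
    have h1 := hu.ext_eq (c (Fin.last n)) (p (Fin.last n) + 1)
      ((Finset.univ : Finset (Fin n)).val.map fun i => (Fin.init c i, Fin.init p i))
    rw [ext] at h1
    rw [h1, Finset.mul_sum, ← (Fin.snocEquiv fun _ => Fin (M + 1)).sum_comp, Fintype.sum_prod_type]
    refine Finset.sum_congr rfl fun j0 _ => ?_
    rw [mul_left_comm, ih (hu.polC _ _), Finset.mul_sum]
    refine Finset.sum_congr rfl fun j _ => ?_
    rw [Fin.prod_univ_castSucc]
    simp only [Fin.snocEquiv_apply, Fin.snoc_last, Fin.snoc_castSucc, arr, LinearMap.comp_apply]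
    have h2 : (Fin.init fun l => ((Fin.snoc (α := fun _ => Fin (M + 1)) j j0 l : Fin (M + 1)) : ℕ)) =
        fun l => ((j l : Fin (M + 1)) : ℕ) := by
      funext l; simp [Fin.init]
    rw [h2]
    simp only [Fin.init]
    ring

/-- The coefficient of `t` in a row is an insertion of `tr 1`. Its vanishing excludes `basisForm M
1`, which would have a simple pole at `z = 0`. -/
theorem NoZero.polC_one {M : ℕ} {u : Multiset (Label d) → A} (hu : NoZero u) (c : Fin d) :
    S.polC M c 1 u = 0 := by
  funext P
  rw [polC, if_neg one_ne_zero, Finset.Nat.sum_antidiagonal_eq_sum_range_succ_mk]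
  simp only [Finset.sum_range_succ, Finset.range_zero, Finset.sum_empty, zero_add, Nat.sub_zero,
    Nat.sub_self, coeff_one_psi, coeff_zero_psi, zero_smul, sub_zero, one_smul, sub_self, smul_zero,
    add_zero, LinearMap.smul_apply, Pi.smul_apply, extL_apply, ext, hu c P, mul_zero, Pi.zero_apply]

/-- The linear potential is a combination of insertions of `tr M_c'`, which are read from the
coefficient of `t ^ 2` in the rows. As `ψ = 1 + 2 t ^ 2 + ⋯`, that coefficient is `polC 2 + 2 polC
0`. This determines the part without poles at `±1` by linear response. -/
theorem NoZero.two_polC_zero {M : ℕ} {u : Multiset (Label d) → A} (hu : NoZero u) (c : Fin d) :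
    (2 : A) • S.polC M c 0 u =
      ∑ c', S.lam c c' • (S.polC M c' 2 u + (2 : A) • S.polC M c' 0 u) := by
  have h1 : ∀ c, S.polC M c 2 u + (2 : A) • S.polC M c 0 u = S.ext c 2 u := by
    intro c
    funext P
    have h0 : coeff 0 (phi A ^ M) = 1 := by
      rw [coeff_zero_eq_constantCoeff_apply, map_pow, constantCoeff_phi, one_pow]
    have h2 : S.ext c 1 u P = 0 := by rw [ext, hu c P, mul_zero]
    rw [polC, if_neg two_ne_zero, polC, if_pos rfl, Finset.Nat.sum_antidiagonal_eq_sum_range_succ_mk]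
    simp only [Finset.sum_range_succ, Finset.range_zero, Finset.sum_empty, zero_add, Nat.sub_zero,
      Nat.sub_self, coeff_one_psi, coeff_zero_psi, coeff_two_psi, zero_smul, sub_zero, one_smul,
      sub_self, smul_zero, add_zero, LinearMap.smul_apply, LinearMap.add_apply, LinearMap.sub_apply,
      Pi.smul_apply, Pi.add_apply, Pi.sub_apply, extL_apply, smul_eq_mul, h0, h2,
      show 2 - 1 = 1 from rfl]
    ring
  simp only [h1]
  funext P
  simp only [polC, if_pos, extL_apply, Pi.smul_apply, smul_eq_mul, ext, Finset.mul_sum,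
    Finset.sum_apply]
  exact Finset.sum_congr rfl fun _ _ => by ring

end LoopSystem

/-! ### The two-point function of genus zero -/

section Tail

open PowerSeries

variable (A : Type*) [CommRing A]

/-- The universal part of the two-point function of genus zero. -/
def tail (i j : ℕ) : A := ∑ q ∈ Finset.HasAntidiagonal.antidiagonal (i + 1),
  coeff q.1 (psi A) * if 2 ≤ q.2 then coeff (q.2 + j - 1) (phi A) else 0

theorem tail_one (i : ℕ) : tail A i 1 = -coeff (i + 1) (psi A) := by
  have h1 : tail A i 1 = coeff (i + 1) (psi A * (phi A - 1)) := by
    rw [tail, coeff_mul]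
    refine Finset.sum_congr rfl fun q _ => ?_
    rw [Nat.add_sub_cancel, map_sub, coeff_one]
    congr 1
    split_ifs with h h' h'
    · omega
    · rw [sub_zero]
    · rw [h', coeff_zero_phi, sub_self]
    · have : q.2 = 1 := by omega
      rw [this, coeff_one_phi, sub_zero]
  rw [h1, mul_sub, mul_comm (psi A), phi_mul_psi, mul_one, map_sub, coeff_one, if_neg (by omega), zero_sub]

end Tail

namespace LoopSystem

open PowerSeries

variable {A : Type*} [CommRing A] [IsDomain A] [CharZero A] {d δ : ℕ} (S : LoopSystem A d δ)

/-- By `adm_spec_single` the product of `φ` with a row is known above degree one, where it comes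
from the source; its constant term is the linear potential and its linear term is zero. Multiplying
by `ψ` recovers the row. -/
theorem two_mul_w_zero_pair (hδ : 0 < δ) (c c' : Fin d) (i j : ℕ) :
    2 * S.w 0 ((c, i) ::ₘ (c', j) ::ₘ 0) = coeff (i + 1) (psi A) * S.lin c 0 ((c', j) ::ₘ 0) -
      if c' = c then j * tail A i j else 0 := by
  set l : Label d := (c', j) with hl
  have h1 : ∀ k, 2 ≤ k → coeff k (phi A * S.row c 0 (l ::ₘ 0)) =
      -if c' = c then j * coeff (k + j - 1) (phi A) else 0 := by
    intro k hk
    have h := S.adm_spec_single c hδ l (k : ℤ) (by push_cast; omega)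
    rw [gcoeff_spec, if_pos (by simp), if_neg (by simp), sub_zero, pow_one, mul_add,
      HahnSeries.coeff_add, ← map_mul, coeff_toL_natCast] at h
    simp only [Multiset.map_cons, Multiset.map_zero, Multiset.sum_cons, Multiset.sum_zero,
      add_zero] at h
    rw [eq_neg_of_add_eq_zero_left h, theta, HahnSeries.coeff_mul_single]
    have h3 : (k : ℤ) - (1 - (j : ℤ)) = ((k + j - 1 : ℕ) : ℤ) := by omega
    rw [hl, h3, coeff_toL_natCast, shiftWeight]
    split_ifs
    · rw [mul_comm]
    · rw [mul_zero]
  have h2 : coeff 0 (phi A * S.row c 0 (l ::ₘ 0)) = S.lin c 0 (l ::ₘ 0) := by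
    rw [coeff_mul, Finset.Nat.antidiagonal_zero, Finset.sum_singleton, coeff_zero_phi, one_mul, row,
      coeff_mk]
    rfl
  have h3 : coeff 1 (phi A * S.row c 0 (l ::ₘ 0)) = 0 := by
    rw [coeff_mul, Finset.Nat.sum_antidiagonal_eq_sum_range_succ_mk]
    simp only [Finset.sum_range_succ, Finset.range_zero, Finset.sum_empty, zero_add, coeff_one_phi,
      zero_mul, add_zero, coeff_zero_phi, one_mul, Nat.sub_zero, row, coeff_mk, ext]
    rw [S.zero_label, if_neg (by simp), mul_zero]
  have h4 : psi A * (phi A * S.row c 0 (l ::ₘ 0)) = S.row c 0 (l ::ₘ 0) := by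
    rw [← mul_assoc, mul_comm (psi A), phi_mul_psi, one_mul]
  have h5 : coeff (i + 1) (S.row c 0 (l ::ₘ 0)) = 2 * S.w 0 ((c, i) ::ₘ l ::ₘ 0) := by
    rw [row, coeff_mk]; rfl
  have h6 : ∀ k, coeff k (phi A * S.row c 0 (l ::ₘ 0)) = (if k = 0 then S.lin c 0 (l ::ₘ 0) else 0) -
      if c' = c then j * (if 2 ≤ k then coeff (k + j - 1) (phi A) else 0) else 0 := by
    intro k
    by_cases hk : 2 ≤ k
    · have hk0 : k ≠ 0 := by omega
      rw [h1 k hk, if_neg hk0, zero_sub, if_pos hk]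
    · interval_cases k
      · rw [h2]; simp
      · rw [h3]; simp
  rw [← h5, ← h4, coeff_mul]
  simp only [h6, mul_sub, Finset.sum_sub_distrib]
  congr 1
  · rw [Finset.sum_eq_single_of_mem (i + 1, 0) (by simp)]
    · rw [if_pos rfl]
    · intro q hq hne
      rw [if_neg, mul_zero]
      intro h0
      have := Finset.HasAntidiagonal.mem_antidiagonal.1 hq
      exact hne (Prod.ext (by simp only; omega) h0)
  · split_ifs
    · rw [tail, Finset.mul_sum]
      exact Finset.sum_congr rfl fun q _ => by ring
    · simp

/-- The correlations of the linear traces. -/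
def lin2 (c c' : Fin d) : A := S.w 0 ((c, 1) ::ₘ (c', 1) ::ₘ 0)

/-- The correlations of the linear traces, without the Gaussian part. -/
def kmat (c c' : Fin d) : A := ∑ c'', S.lam c c'' * S.lin2 c'' c'

theorem lin2_symm (c c' : Fin d) : S.lin2 c c' = S.lin2 c' c := by
  rw [lin2, lin2, Multiset.cons_swap]

theorem two_mul_w_zero_pair_one (hδ : 0 < δ) (c c' : Fin d) (i : ℕ) :
    2 * S.w 0 ((c, i) ::ₘ (c', 1) ::ₘ 0) =
      coeff (i + 1) (psi A) * (S.kmat c c' + if c' = c then 1 else 0) := by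
  rw [S.two_mul_w_zero_pair hδ, tail_one]
  have : S.lin c 0 ((c', 1) ::ₘ 0) = S.kmat c c' := rfl
  rw [this]
  split_ifs
  · push_cast; ring
  · ring

theorem lin2_eq (hδ : 0 < δ) (c c' : Fin d) : S.lin2 c c' = S.kmat c c' + if c' = c then 1 else 0 := by
  have h := S.two_mul_w_zero_pair_one hδ c c' 1
  rw [coeff_two_psi] at h
  exact mul_left_cancel₀ two_ne_zero h

/-- The Dyson equation: `kmat` is the sum over chains of couplings between colours, formally `lam /
(1 - lam)`. -/
theorem kmat_eq (hδ : 0 < δ) (c c' : Fin d) :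
    S.kmat c c' = S.lam c c' + ∑ c'', S.lam c c'' * S.kmat c'' c' := by
  conv_lhs => rw [kmat]
  simp only [S.lin2_eq hδ, mul_add, Finset.sum_add_distrib]
  rw [add_comm]
  simp

theorem kmat_symm (hδ : 0 < δ) (c c' : Fin d) : S.kmat c c' = S.kmat c' c := by
  have h1 := S.lin2_eq hδ c c'
  have h2 := S.lin2_eq hδ c' c
  rw [S.lin2_symm, h2] at h1
  simp only [eq_comm (a := c')] at h1
  exact (add_right_cancel h1).symm

/-- The linear potential in `two_mul_w_zero_pair` is itself a two-point function with one linear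
trace, evaluated by exchanging the two labels. -/
theorem four_mul_w_zero_pair (hδ : 0 < δ) (c c' : Fin d) (i j : ℕ) :
    4 * S.w 0 ((c, i) ::ₘ (c', j) ::ₘ 0) =
      S.kmat c c' * coeff (i + 1) (psi A) * coeff (j + 1) (psi A) -
        if c' = c then 2 * (j * tail A i j) else 0 := by
  have h1 : 2 * S.lin c 0 ((c', j) ::ₘ 0) = coeff (j + 1) (psi A) * S.kmat c c' := by
    rw [lin, kmat, Finset.mul_sum, Finset.mul_sum]
    refine Finset.sum_congr rfl fun c'' _ => ?_
    have := S.two_mul_w_zero_pair_one hδ c' c'' j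
    rw [Multiset.cons_swap, mul_left_comm, this, S.lin2_symm, S.lin2_eq hδ c' c'']
    ring
  have h2 := S.two_mul_w_zero_pair hδ c c' i j
  have h3 : 4 * S.w 0 ((c, i) ::ₘ (c', j) ::ₘ 0) = 2 * (2 * S.w 0 ((c, i) ::ₘ (c', j) ::ₘ 0)) := by ring
  rw [h3, h2]
  split_ifs
  · linear_combination coeff (i + 1) (psi A) * h1
  · linear_combination coeff (i + 1) (psi A) * h1

/-- The pairing of `kmat` with a solution of the linear response equation. -/
theorem eq_sum_kmat (hδ : 0 < δ) {a b : Fin d → A} (h : ∀ c, a c = ∑ c', S.lam c c' * (b c' + a c'))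
    (c : Fin d) : a c = ∑ c', S.kmat c c' * b c' := by
  have h1 : ∀ c, ∑ c', S.kmat c c' * b c' =
      ∑ c', S.lam c c' * (b c' + ∑ c'', S.kmat c' c'' * b c'') := by
    intro c
    simp only [mul_add, Finset.sum_add_distrib, Finset.mul_sum]
    rw [Finset.sum_comm (γ := Fin d), ← Finset.sum_add_distrib]
    refine Finset.sum_congr rfl fun c' _ => ?_
    rw [S.kmat_eq hδ c c', add_mul, Finset.sum_mul]
    congr 1
    exact Finset.sum_congr rfl fun _ _ => by ring
  have h2 := S.fixed_eq_zero (fun c => a c - ∑ c', S.kmat c c' * b c') (fun c => by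
    rw [h c, h1 c, ← Finset.sum_sub_distrib]
    exact Finset.sum_congr rfl fun _ _ => by ring) c
  exact sub_eq_zero.1 h2

/-- The correlations of fixed genus and number of points. -/
def stable (g n : ℕ) (P : Multiset (Label d)) : A := if P.card = n then S.w g P else 0

theorem noZero_stable {g n : ℕ} (h : 2 < 2 * g + n) : NoZero (S.stable g n) := by
  intro c P
  rw [stable]
  split_ifs with h1
  · rw [S.zero_label, if_neg]
    rw [Multiset.card_cons] at h1
    omega
  · rfl

theorem exists_rowBounded_stable {g n : ℕ} (hg : g < δ) (h : 2 < 2 * g + n) :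
    ∃ K, S.RowBounded (2 * K + 1) (S.stable g n) := by
  obtain ⟨K, hK⟩ := S.exists_adm_spec (by omega) (2 * g + n)
  refine ⟨K, rowBounded_of_adm fun c P => ?_⟩
  by_cases hP : P.card + 1 = n
  · have h1 := hK g P c hg (by omega)
    rw [gcoeff_spec, if_neg (by omega), if_neg (by omega), add_zero, sub_zero] at h1
    have h2 : (PowerSeries.mk fun i => S.ext c i (S.stable g n) P) = S.row c g P := by
      ext i
      rw [row, coeff_mk, coeff_mk]
      cases i <;> simp [ext, stable, hP]
    rw [h2]; exact h1
  · have h2 : (PowerSeries.mk fun i => S.ext c i (S.stable g n) P) = 0 := by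
      ext i
      rw [coeff_mk]
      cases i <;> simp [ext, stable, hP]
    rw [h2, map_zero]; exact Adm.zero _

end LoopSystem

/-! ### Evaluation of power series -/

section Evaluation

open PowerSeries

/-- The power series `f` converges absolutely at `t`, with sum `v`. -/
def EvalsTo (f : PowerSeries ℂ) (t v : ℂ) : Prop :=
  (Summable fun n => ‖coeff n f * t ^ n‖) ∧ HasSum (fun n => coeff n f * t ^ n) v

theorem EvalsTo.sub {f g : PowerSeries ℂ} {t v w : ℂ} (hf : EvalsTo f t v) (hg : EvalsTo g t w) :
    EvalsTo (f - g) t (v - w) := by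
  refine ⟨(hf.1.add hg.1).of_nonneg_of_le (fun _ => norm_nonneg _) fun n => ?_, ?_⟩
  · rw [map_sub, sub_mul]
    exact norm_sub_le _ _
  · simpa only [map_sub, sub_mul] using hf.2.sub hg.2

theorem EvalsTo.mul {f g : PowerSeries ℂ} {t v w : ℂ} (hf : EvalsTo f t v) (hg : EvalsTo g t w) :
    EvalsTo (f * g) t (v * w) := by
  have h : ∀ n, coeff n (f * g) * t ^ n = ∑ q ∈ Finset.HasAntidiagonal.antidiagonal n,
      coeff q.1 f * t ^ q.1 * (coeff q.2 g * t ^ q.2) := by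
    intro n
    rw [coeff_mul, Finset.sum_mul]
    refine Finset.sum_congr rfl fun q hq => ?_
    rw [← Finset.HasAntidiagonal.mem_antidiagonal.1 hq, pow_add]
    ring
  have hs := summable_norm_sum_mul_antidiagonal_of_summable_norm (f := fun n => coeff n f * t ^ n)
    (g := fun n => coeff n g * t ^ n) hf.1 hg.1
  have ht := tsum_mul_tsum_eq_tsum_sum_antidiagonal_of_summable_norm (f := fun n => coeff n f * t ^ n)
    (g := fun n => coeff n g * t ^ n) hf.1 hg.1
  rw [hf.2.tsum_eq, hg.2.tsum_eq] at ht
  refine ⟨?_, ?_⟩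
  · simp only [h]
    exact hs
  · simp only [h]
    rw [ht]
    exact hs.of_norm.hasSum

theorem evalsTo_monomial (k : ℕ) (a t : ℂ) : EvalsTo (monomial k a) t (a * t ^ k) := by
  have h : ∀ n, n ≠ k → coeff n (monomial k a) * t ^ n = 0 := fun n hn => by
    rw [coeff_monomial, if_neg hn, zero_mul]
  refine ⟨summable_of_ne_finset_zero (s := {k}) fun n hn => ?_, ?_⟩
  · rw [h n (by simpa using hn), norm_zero]
  · have := hasSum_single k h
    rwa [coeff_monomial, if_pos rfl] at this

theorem EvalsTo.pow {f : PowerSeries ℂ} {t v : ℂ} (hf : EvalsTo f t v) (n : ℕ) :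
    EvalsTo (f ^ n) t (v ^ n) := by
  induction n with
  | zero => simpa using evalsTo_monomial 0 1 t
  | succ n ih => rw [pow_succ, pow_succ]; exact ih.mul hf

theorem EvalsTo.unique {f : PowerSeries ℂ} {t v w : ℂ} (hf : EvalsTo f t v) (hg : EvalsTo f t w) :
    v = w := hf.2.unique hg.2

theorem exists_evalsTo {f : PowerSeries ℂ} {t : ℂ} {k : ℕ} {C : ℝ}
    (hf : ∀ n, ‖coeff n f‖ ≤ C * (n ^ k * 2 ^ n)) (ht : ‖t‖ < 1 / 2) : ∃ v, EvalsTo f t v := by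
  have h : Summable fun n => ‖coeff n f * t ^ n‖ := by
    have h1 : Summable fun n : ℕ => C * ((n : ℝ) ^ k * (2 * ‖t‖) ^ n) :=
      (summable_pow_mul_geometric_of_norm_lt_one k (by
        rw [Real.norm_of_nonneg (by positivity)]; linarith)).mul_left C
    refine h1.of_nonneg_of_le (fun _ => norm_nonneg _) fun n => ?_
    rw [norm_mul, norm_pow, mul_pow]
    calc _ ≤ C * (n ^ k * 2 ^ n) * ‖t‖ ^ n := by gcongr; exact hf n
      _ = _ := by ring
  exact ⟨_, h, h.of_norm.hasSum⟩

theorem norm_coeff_phi_le (n : ℕ) : ‖coeff n (phi ℂ)‖ ≤ 2 ^ n := by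
  rw [coeff_phi, Complex.norm_intCast]
  exact_mod_cast abs_coeff_phiInt_le n

theorem norm_coeff_geo_le (n : ℕ) : ‖coeff n (geo ℂ)‖ ≤ 2 ^ n := by
  rw [geo, coeff_mk]
  split_ifs
  · simp
  · simp

/-- The value `1 / (z + 1 / z)`. -/
def joukowskyInv (z : ℂ) : ℂ := (z + z⁻¹)⁻¹

theorem sq_ne_of_large {z : ℂ} (hz : 8 < ‖z‖) : z ≠ 0 ∧ z ^ 2 + 1 ≠ 0 ∧ z ^ 2 - 1 ≠ 0 ∧ 63 < ‖z ^ 2 + 1‖ := by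
  have h1 : 64 < ‖z ^ 2‖ := by rw [norm_pow]; nlinarith
  have h2 : 63 < ‖z ^ 2 + 1‖ := by
    have := norm_sub_norm_le (z ^ 2) (-1)
    rw [sub_neg_eq_add, norm_neg, norm_one] at this
    linarith
  have h3 : 63 < ‖z ^ 2 - 1‖ := by
    have := norm_sub_norm_le (z ^ 2) 1
    rw [norm_one] at this
    linarith
  exact ⟨norm_pos_iff.1 (by linarith), norm_pos_iff.1 (by linarith), norm_pos_iff.1 (by linarith), h2⟩

theorem joukowskyInv_eq {z : ℂ} (hz : z ≠ 0) : joukowskyInv z = z / (z ^ 2 + 1) := by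
  have : z + z⁻¹ = (z ^ 2 + 1) / z := by field_simp
  rw [joukowskyInv, this, inv_div]

theorem norm_joukowskyInv_lt {z : ℂ} (hz : 8 < ‖z‖) : ‖joukowskyInv z‖ < 1 / 7 := by
  rw [joukowskyInv, norm_inv, inv_lt_comm₀ (by
    have := norm_sub_norm_le z (-z⁻¹)
    rw [sub_neg_eq_add, norm_neg, norm_inv] at this
    have h2 : ‖z‖⁻¹ < 1 := inv_lt_one_of_one_lt₀ (by linarith)
    linarith) (by norm_num)]
  have := norm_sub_norm_le z (-z⁻¹)
  rw [sub_neg_eq_add, norm_neg, norm_inv] at this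
  have h2 : ‖z‖⁻¹ < 1 := inv_lt_one_of_one_lt₀ (by linarith)
  norm_num
  linarith

/-- The sum and the claimed value have the same square, and both lie at distance less than one from
1, so they are not opposite. The bound on `z` gives `‖t‖ < 1/7`, which is more than enough for the
geometric estimate. -/
theorem evalsTo_phi {z : ℂ} (hz : 8 < ‖z‖) :
    EvalsTo (phi ℂ) (joukowskyInv z) ((z ^ 2 - 1) / (z ^ 2 + 1)) := by
  obtain ⟨h0, h1, h2, h3⟩ := sq_ne_of_large hz
  have ht := norm_joukowskyInv_lt hz
  set t := joukowskyInv z with htdef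
  obtain ⟨v, hv⟩ := exists_evalsTo (f := phi ℂ) (k := 0) (C := 1) (t := t)
    (fun n => by simpa using norm_coeff_phi_le n) (by linarith)
  have hsq : v ^ 2 = ((z ^ 2 - 1) / (z ^ 2 + 1)) ^ 2 := by
    have e1 := hv.pow 2
    rw [phi_sq] at e1
    have e2 : EvalsTo (1 - 4 * X ^ 2) t (1 * t ^ 0 - 4 * t ^ 2) := by
      have := (evalsTo_monomial 0 1 t).sub (evalsTo_monomial 2 4 t)
      rwa [show (4 : ℂ) = 4 * 1 by norm_num, ← smul_eq_mul, map_smul, ← X_pow_eq, ← X_pow_eq, pow_zero, smul_eq_C_mul, show (C (4 : ℂ)) = 4 from rfl, smul_eq_mul, mul_one] at this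
    rw [e1.unique e2, htdef, joukowskyInv_eq h0]
    field_simp
    ring
  have hv1 : ‖v - 1‖ < 1 := by
    have e3 : HasSum (fun n => coeff (n + 1) (phi ℂ) * t ^ (n + 1)) (v - 1) := by
      have := (hasSum_nat_add_iff' 1).2 hv.2
      simpa [coeff_zero_phi] using this
    have e4 : HasSum (fun n : ℕ => 2 * ‖t‖ * (2 * ‖t‖) ^ n) (2 * ‖t‖ * (1 - 2 * ‖t‖)⁻¹) :=
      (hasSum_geometric_of_lt_one (by positivity) (by linarith)).mul_left _
    have e5 := e3.norm_le_of_bounded e4 fun n => by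
      rw [norm_mul, norm_pow, ← pow_succ', mul_pow]
      gcongr
      exact norm_coeff_phi_le _
    refine e5.trans_lt ?_
    rw [← div_eq_mul_inv, div_lt_one (by linarith)]
    linarith
  have hw1 : ‖(z ^ 2 - 1) / (z ^ 2 + 1) - 1‖ < 1 := by
    have : (z ^ 2 - 1) / (z ^ 2 + 1) - 1 = -2 / (z ^ 2 + 1) := by field_simp; ring
    rw [this, norm_div, div_lt_one (by linarith)]
    norm_num
    linarith
  rcases sq_eq_sq_iff_eq_or_eq_neg.1 hsq with h | h
  · rwa [h] at hv
  · exfalso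
    have e6 : (v - 1) + ((z ^ 2 - 1) / (z ^ 2 + 1) - 1) = -2 := by rw [h]; ring
    have e7 := norm_add_le (v - 1) ((z ^ 2 - 1) / (z ^ 2 + 1) - 1)
    rw [e6, norm_neg, RCLike.norm_ofNat] at e7
    linarith

theorem evalsTo_psi {z : ℂ} (hz : 8 < ‖z‖) :
    EvalsTo (psi ℂ) (joukowskyInv z) ((z ^ 2 + 1) / (z ^ 2 - 1)) := by
  obtain ⟨h0, h1, h2, h3⟩ := sq_ne_of_large hz
  have hphi := evalsTo_phi hz
  obtain ⟨v, hv⟩ := exists_evalsTo (f := geo ℂ) (k := 0) (C := 1) (t := joukowskyInv z)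
    (fun n => by simpa using norm_coeff_geo_le n) (by linarith [norm_joukowskyInv_lt hz])
  have h4 : EvalsTo (psi ℂ) (joukowskyInv z) ((z ^ 2 - 1) / (z ^ 2 + 1) * v) := hphi.mul hv
  have h5 := hphi.mul h4
  rw [phi_mul_psi] at h5
  have h6 : EvalsTo (1 : PowerSeries ℂ) (joukowskyInv z) 1 := by
    simpa using evalsTo_monomial 0 1 (joukowskyInv z)
  have h7 := h5.unique h6
  have h8 : (z ^ 2 - 1) / (z ^ 2 + 1) * v = (z ^ 2 + 1) / (z ^ 2 - 1) := by
    rw [← inv_div (z ^ 2 - 1)]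
    exact eq_inv_of_mul_eq_one_right h7
  rwa [h8] at h4

/-- The differential form of a basis series, in the Joukowsky coordinate. -/
def basisForm (M j : ℕ) (z : ℂ) : ℂ :=
  if j = 0 then 2 * (z ^ 2)⁻¹
  else z ^ j * (z ^ 2)⁻¹ * (z ^ 2 + 1) ^ (M - j) * ((z ^ 2 - 1) ^ (M - 1))⁻¹

/-- The resolvent begins at order `t`, so the constant term of the series is dropped before
multiplying by `dx`. For `j = 0` this gives `(ψ - 1) dx = 2 dz / z ^ 2`, without poles at `±1`. -/
theorem evalsTo_basis {M j : ℕ} {z : ℂ} (hM : 1 ≤ M) (hj : j ≤ M) (hz : 8 < ‖z‖) :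
    (Summable fun n => ‖joukowskyInv z ^ (n + 1) * (1 - (z ^ 2)⁻¹) * coeff (n + 1) (basis ℂ M j)‖) ∧
    HasSum (fun n => joukowskyInv z ^ (n + 1) * (1 - (z ^ 2)⁻¹) * coeff (n + 1) (basis ℂ M j))
      (basisForm M j z) := by
  obtain ⟨h0, h1, h2, h3⟩ := sq_ne_of_large hz
  have h4 : ∃ v, EvalsTo (basis ℂ M j) (joukowskyInv z) v ∧
      (v - coeff 0 (basis ℂ M j)) * (1 - (z ^ 2)⁻¹) = basisForm M j z := by
    rw [basis, basisForm]
    split_ifs with h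
    · refine ⟨_, evalsTo_psi hz, ?_⟩
      rw [coeff_zero_psi]
      field_simp
      ring
    · have e1 := (evalsTo_monomial j 1 (joukowskyInv z)).mul ((evalsTo_psi hz).pow M)
      rw [← X_pow_eq] at e1
      refine ⟨_, e1, ?_⟩
      have e2 : coeff 0 (X ^ j * psi ℂ ^ M) = 0 := by
        rw [coeff_X_pow_mul', if_neg (by omega)]
      rw [e2, joukowskyInv_eq h0]
      obtain ⟨k, rfl⟩ := Nat.exists_eq_add_of_le hj
      obtain ⟨l, hl⟩ := Nat.exists_eq_add_of_le hM
      rw [hl, Nat.add_sub_cancel_left, ← hl, Nat.add_sub_cancel_left]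
      have e3 : (z ^ 2 - 1) ^ (j + k) = (z ^ 2 - 1) * (z ^ 2 - 1) ^ l := by rw [hl, pow_add, pow_one]
      rw [div_pow, div_pow, e3, pow_add]
      field_simp
      ring
  obtain ⟨v, hv, hv2⟩ := h4
  have h5 : ∀ n, joukowskyInv z ^ (n + 1) * (1 - (z ^ 2)⁻¹) * coeff (n + 1) (basis ℂ M j) =
      coeff (n + 1) (basis ℂ M j) * joukowskyInv z ^ (n + 1) * (1 - (z ^ 2)⁻¹) := fun n => by ring
  simp only [h5]
  refine ⟨?_, ?_⟩
  · simp only [norm_mul _ (1 - (z ^ 2)⁻¹)]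
    exact ((summable_nat_add_iff 1).2 hv.1).mul_right _
  · rw [← hv2]
    refine HasSum.mul_right _ ?_
    have := (hasSum_nat_add_iff' 1).2 hv.2
    simpa using this

theorem summable_norm_mul {ι ι' : Type*} {f : ι → ℂ} {g : ι' → ℂ} (hf : Summable fun x => ‖f x‖)
    (hg : Summable fun x => ‖g x‖) : Summable fun q : ι × ι' => ‖f q.1 * g q.2‖ :=
  hf.mul_norm hg

theorem hasSum_prod_pi {n : ℕ} (f : Fin n → ℕ → ℂ) (v : Fin n → ℂ) (h1 : ∀ i, Summable fun k => ‖f i k‖)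
    (h2 : ∀ i, HasSum (f i) (v i)) : (Summable fun p : Fin n → ℕ => ‖∏ i, f i (p i)‖) ∧
      HasSum (fun p : Fin n → ℕ => ∏ i, f i (p i)) (∏ i, v i) := by
  induction n with
  | zero =>
    exact ⟨Summable.of_finite, by simpa using hasSum_unique (fun p : Fin 0 → ℕ => ∏ i, f i (p i))⟩
  | succ n ih =>
    obtain ⟨h3, h4⟩ := ih (fun i => f i.succ) (fun i => v i.succ) (fun i => h1 _) fun i => h2 _
    have h10 := h1 0
    have h20 := h2 0
    have e : ∀ q : ℕ × (Fin n → ℕ), ∏ i, f i (Fin.cons (α := fun _ => ℕ) q.1 q.2 i) =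
        f 0 q.1 * ∏ i, f (Fin.succ i) (q.2 i) := fun q => by
      rw [Fin.prod_univ_succ]
      simp only [Fin.cons_zero, Fin.cons_succ]
    rw [Fin.prod_univ_succ]
    generalize f 0 = f0 at *
    generalize v 0 = v0 at *
    generalize hg : (fun p : Fin n → ℕ => ∏ i, f i.succ (p i)) = g at *
    generalize ∏ i : Fin n, v i.succ = v1 at *
    have e' : (fun q : ℕ × (Fin n → ℕ) => ∏ i, f i (Fin.cons (α := fun _ => ℕ) q.1 q.2 i)) =
        fun q => f0 q.1 * g q.2 := by
      funext q
      rw [e, ← hg]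
    have h3' : Summable fun p => ‖g p‖ := by rw [← hg]; exact h3
    have h5 := summable_norm_mul h10 h3'
    refine ⟨(Fin.consEquiv fun _ => ℕ).summable_iff.1 ?_, (Fin.consEquiv fun _ => ℕ).hasSum_iff.1 ?_⟩
    · have := congrArg (fun F : ℕ × (Fin n → ℕ) → ℂ => fun q => ‖F q‖) e'
      rw [← this] at h5
      exact h5
    · have := h20.mul h4 h5.of_norm
      rw [← e'] at this
      exact this

end Evaluation

/-! ### The sum of the universal part of the two-point function -/

section TwoPoint

open PowerSeries

/-- Truncated geometric sums with denominators cleared; they carry no information for `t = u`, which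
`sum_antidiagonal_diag` treats separately. -/
theorem sum_antidiagonal_two_le (t u : ℂ) (n : ℕ) :
    (t - u) * ∑ q ∈ Finset.HasAntidiagonal.antidiagonal (n + 1),
      (if 2 ≤ q.1 then t ^ q.1 * u ^ (q.2 + 1) else 0) = t ^ 2 * u * (t ^ n - u ^ n) := by
  induction n with
  | zero => simp [Finset.Nat.antidiagonal_succ]
  | succ n ih =>
    rw [Finset.Nat.sum_antidiagonal_succ', if_pos (by simp)]
    have h : ∀ q : ℕ × ℕ, (if 2 ≤ q.1 then t ^ q.1 * u ^ (q.2 + 1 + 1) else 0) =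
        u * if 2 ≤ q.1 then t ^ q.1 * u ^ (q.2 + 1) else 0 := fun q => by
      split_ifs
      · rw [pow_succ u (q.2 + 1)]; ring
      · rw [mul_zero]
    simp only [h]
    rw [← Finset.mul_sum]
    linear_combination u * ih

theorem sum_antidiagonal_two_le_mul (t u : ℂ) (n : ℕ) :
    (t - u) ^ 2 * ∑ q ∈ Finset.HasAntidiagonal.antidiagonal (n + 1),
      (if 2 ≤ q.1 then (q.2 : ℂ) * t ^ q.1 * u ^ (q.2 + 1) else 0) =
        t ^ 2 * u ^ 2 * (t ^ n - u ^ n) - t ^ 2 * u * (t - u) * (n * u ^ n) := by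
  induction n with
  | zero => simp [Finset.Nat.antidiagonal_succ]
  | succ n ih =>
    rw [Finset.Nat.sum_antidiagonal_succ', if_pos (by simp)]
    have h : ∀ q : ℕ × ℕ, (if 2 ≤ q.1 then ((q.2 + 1 : ℕ) : ℂ) * t ^ q.1 * u ^ (q.2 + 1 + 1) else 0) =
        u * (if 2 ≤ q.1 then (q.2 : ℂ) * t ^ q.1 * u ^ (q.2 + 1) else 0) +
        u * if 2 ≤ q.1 then t ^ q.1 * u ^ (q.2 + 1) else 0 := fun q => by
      split_ifs
      · rw [pow_succ u (q.2 + 1)]; push_cast; ring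
      · ring
    simp only [h]
    rw [Finset.sum_add_distrib, ← Finset.mul_sum, ← Finset.mul_sum]
    have h2 := sum_antidiagonal_two_le t u n
    push_cast
    linear_combination u * ih + u * (t - u) * h2

theorem sum_antidiagonal_diag (t : ℂ) (n : ℕ) :
    2 * ∑ q ∈ Finset.HasAntidiagonal.antidiagonal (n + 1),
      (if 2 ≤ q.1 then (q.2 : ℂ) * t ^ q.1 * t ^ (q.2 + 1) else 0) =
        n * (n - 1) * t ^ (n + 2) := by
  have h1 : ∀ n : ℕ, ∑ q ∈ Finset.HasAntidiagonal.antidiagonal (n + 1),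
      (if 2 ≤ q.1 then t ^ q.1 * t ^ (q.2 + 1) else 0) = n * t ^ (n + 2) := by
    intro n
    induction n with
    | zero => simp [Finset.Nat.antidiagonal_succ]
    | succ n ih =>
      rw [Finset.Nat.sum_antidiagonal_succ', if_pos (by simp)]
      have h : ∀ q : ℕ × ℕ, (if 2 ≤ q.1 then t ^ q.1 * t ^ (q.2 + 1 + 1) else 0) =
          t * if 2 ≤ q.1 then t ^ q.1 * t ^ (q.2 + 1) else 0 := fun q => by
        split_ifs
        · rw [pow_succ t (q.2 + 1)]; ring
        · rw [mul_zero]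
      simp only [h]
      rw [← Finset.mul_sum, ih]
      push_cast
      ring
  induction n with
  | zero => simp [Finset.Nat.antidiagonal_succ]
  | succ n ih =>
    rw [Finset.Nat.sum_antidiagonal_succ', if_pos (by simp)]
    have h : ∀ q : ℕ × ℕ, (if 2 ≤ q.1 then ((q.2 + 1 : ℕ) : ℂ) * t ^ q.1 * t ^ (q.2 + 1 + 1) else 0) =
        t * (if 2 ≤ q.1 then (q.2 : ℂ) * t ^ q.1 * t ^ (q.2 + 1) else 0) +
        t * if 2 ≤ q.1 then t ^ q.1 * t ^ (q.2 + 1) else 0 := fun q => by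
      split_ifs
      · rw [pow_succ t (q.2 + 1)]; push_cast; ring
      · ring
    simp only [h]
    rw [Finset.sum_add_distrib, ← Finset.mul_sum, ← Finset.mul_sum, h1]
    push_cast
    linear_combination t * ih

theorem norm_coeff_psi_le (n : ℕ) : ‖coeff n (psi ℂ)‖ ≤ (n + 1) * 2 ^ n := by
  rw [psi, coeff_mul]
  refine (norm_sum_le_of_le (f := fun q : ℕ × ℕ => coeff q.1 (phi ℂ) * coeff q.2 (geo ℂ))
    (n := fun _ => (2 : ℝ) ^ n) _ fun q hq => ?_).trans ?_
  · rw [norm_mul, ← Finset.HasAntidiagonal.mem_antidiagonal.1 hq, pow_add]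
    exact mul_le_mul (norm_coeff_phi_le _) (norm_coeff_geo_le _) (norm_nonneg _) (by positivity)
  · rw [Finset.sum_const, Finset.Nat.card_antidiagonal, nsmul_eq_mul]
    push_cast
    exact le_rfl

theorem norm_tail_le (i j : ℕ) : ‖tail ℂ i j‖ ≤ (i + 2) ^ 2 * 2 ^ (i + 1) * 2 ^ j := by
  rw [tail]
  refine (norm_sum_le_of_le (f := fun q : ℕ × ℕ => coeff q.1 (psi ℂ) *
    if 2 ≤ q.2 then coeff (q.2 + j - 1) (phi ℂ) else 0)
    (n := fun _ => ((i : ℝ) + 2) * 2 ^ (i + 1) * 2 ^ j) _ fun q hq => ?_).trans ?_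
  · have hq := Finset.HasAntidiagonal.mem_antidiagonal.1 hq
    split_ifs with h
    · rw [norm_mul]
      calc _ ≤ ((q.1 : ℝ) + 1) * 2 ^ q.1 * 2 ^ (q.2 + j - 1) :=
            mul_le_mul (norm_coeff_psi_le _) (norm_coeff_phi_le _) (norm_nonneg _) (by positivity)
        _ ≤ ((i : ℝ) + 2) * 2 ^ q.1 * 2 ^ (q.2 + j) := by
            have : (q.1 : ℝ) ≤ i + 1 := by exact_mod_cast (show q.1 ≤ i + 1 by omega)
            have h2 : (2 : ℝ) ^ (q.2 + j - 1) ≤ 2 ^ (q.2 + j) :=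
              pow_le_pow_right₀ (by norm_num) (Nat.sub_le _ _)
            gcongr
            · linarith
            · norm_num
        _ = _ := by rw [← hq, pow_add, pow_add]; ring
    · rw [mul_zero, norm_zero]; positivity
  · rw [Finset.sum_const, Finset.Nat.card_antidiagonal, nsmul_eq_mul]
    push_cast
    apply le_of_eq
    ring

theorem hasSum_prod_of_antidiagonal {f : ℕ × ℕ → ℂ} (hf : Summable f) {s : ℂ}
    (h : HasSum (fun n => ∑ q ∈ Finset.HasAntidiagonal.antidiagonal n, f q) s) : HasSum f s := by
  have h1 := (Finset.HasAntidiagonal.sigmaAntidiagonalEquivProd (A := ℕ)).hasSum_iff.2 hf.hasSum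
  have h2 := h1.sigma (g := fun n => ∑ q ∈ Finset.HasAntidiagonal.antidiagonal n, f q) fun n => by
    have := (Finset.HasAntidiagonal.antidiagonal n).hasSum f
    exact this
  rw [h.unique h2]
  exact hf.hasSum

/-- The values follow algebraically from `φ φ' = -4 t` and `φ ^ 3 φ'' = -4` once convergence is
known, without differentiating a sum. -/
theorem evalsTo_derivative_phi {z : ℂ} (hz : 8 < ‖z‖) {p : ℂ → ℂ}
    (hp : p = fun w => (w ^ 2 - 1) / (w ^ 2 + 1)) :
    EvalsTo (derivative ℂ (phi ℂ)) (joukowskyInv z) (-4 * joukowskyInv z / p z) ∧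
    EvalsTo (derivative ℂ (derivative ℂ (phi ℂ))) (joukowskyInv z) (-4 / p z ^ 3) := by
  obtain ⟨h0, h1, h2, h3⟩ := sq_ne_of_large hz
  have hphi := evalsTo_phi hz
  have hpz : p z ≠ 0 := by rw [hp]; exact div_ne_zero h2 h1
  have hpz' : (z ^ 2 - 1) / (z ^ 2 + 1) = p z := by rw [hp]
  rw [hpz'] at hphi
  have hlt := norm_joukowskyInv_lt hz
  set t := joukowskyInv z
  have b1 : ∀ n, ‖coeff n (derivative ℂ (phi ℂ))‖ ≤ (n + 1) * 2 ^ (n + 1) := fun n => by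
    rw [coeff_derivative, norm_mul, mul_comm]
    refine mul_le_mul ?_ (norm_coeff_phi_le _) (norm_nonneg _) (by positivity)
    exact_mod_cast le_of_eq (Complex.norm_natCast (n + 1))
  have key : ∀ (f : PowerSeries ℂ) (k : ℕ), (∀ n, ‖coeff n f‖ ≤ (n + 2) ^ k * 2 ^ (n + 2)) →
      ∃ v, EvalsTo f t v := by
    intro f k hf
    have hs : Summable fun n => ‖coeff n f * t ^ n‖ := by
      have s1 : Summable fun n : ℕ => (n : ℝ) ^ k * (2 * ‖t‖) ^ n :=
        summable_pow_mul_geometric_of_norm_lt_one k (by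
          rw [Real.norm_of_nonneg (by positivity)]; linarith)
      by_cases ht : ‖t‖ = 0
      · rw [norm_eq_zero] at ht
        refine summable_of_ne_finset_zero (s := {0}) fun n hn => ?_
        rw [ht, zero_pow (by simpa using hn), mul_zero, norm_zero]
      have s2 := ((summable_nat_add_iff 2).2 s1).mul_right (‖t‖ ^ 2)⁻¹
      refine s2.of_nonneg_of_le (fun _ => norm_nonneg _) fun n => ?_
      rw [norm_mul, norm_pow]
      calc _ ≤ (n + 2) ^ k * 2 ^ (n + 2) * ‖t‖ ^ n := by gcongr; exact hf n
        _ = _ := by push_cast; rw [mul_pow, pow_add ‖t‖]; field_simp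
    exact ⟨_, hs, hs.of_norm.hasSum⟩
  have d1 : phi ℂ * derivative ℂ (phi ℂ) = monomial 1 (-4 : ℂ) := by
    have := congrArg (derivative ℂ) (phi_sq ℂ)
    rw [derivative_pow] at this
    have h4 : derivative ℂ (1 - 4 * X ^ 2 : PowerSeries ℂ) = 2 * monomial 1 (-4 : ℂ) := by
      ext n
      rw [coeff_derivative, show (4 : PowerSeries ℂ) = C 4 from rfl, show (2 : PowerSeries ℂ) = C 2 from rfl,
        map_sub, coeff_one, coeff_C_mul, coeff_C_mul, coeff_X_pow, coeff_monomial, if_neg (by omega)]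
      by_cases h : n = 1
      · subst h; norm_num
      · rw [if_neg (by omega), if_neg h]; simp
    rw [h4] at this
    have h5 : (2 : PowerSeries ℂ) ≠ 0 := two_ne_zero_powerSeries
    apply mul_left_cancel₀ h5
    rw [← this]
    push_cast
    ring
  constructor
  · obtain ⟨v, hv⟩ := key _ 1 fun n => (b1 n).trans (by
      rw [pow_one]; gcongr <;> norm_num)
    have e1 := hphi.mul hv
    rw [d1] at e1
    have e2 := e1.unique (evalsTo_monomial 1 (-4) t)
    rw [pow_one] at e2
    rw [← e2, mul_div_cancel_left₀ _ hpz]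
    exact hv
  · obtain ⟨v, hv⟩ := key (derivative ℂ (derivative ℂ (phi ℂ))) 2 fun n => by
      rw [coeff_derivative, norm_mul]
      have : ‖(n : ℂ) + 1‖ = n + 1 := by exact_mod_cast Complex.norm_natCast (n + 1)
      rw [this]
      have b2 := b1 (n + 1)
      push_cast at b2
      calc _ ≤ ((n : ℝ) + 1 + 1) * 2 ^ (n + 1 + 1) * (n + 1) := by gcongr
        _ ≤ (n + 2) * 2 ^ (n + 1 + 1) * (n + 2) := by
            rw [add_assoc (n : ℝ), one_add_one_eq_two]
            gcongr
            norm_num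
        _ = _ := by ring
    have e1 := (hphi.pow 3).mul hv
    rw [phi_derivative] at e1
    have e3 : EvalsTo (-4 : PowerSeries ℂ) t (-4 * t ^ 0) := by
      have := evalsTo_monomial 0 (-4) t
      rwa [monomial_zero_eq_C_apply, map_neg, show C (4 : ℂ) = (4 : PowerSeries ℂ) from rfl] at this
    have e2 := e1.unique e3
    rw [pow_zero, mul_one] at e2
    rw [← e2, mul_div_cancel_left₀ _ (pow_ne_zero 3 hpz)]
    exact hv

end TwoPoint

/-! ### Summation of the two-point series over both variables. -/

section TwoPoint

open PowerSeries

theorem HasSum.congr_of_eq {ι : Type*} {f g : ι → ℂ} {a b : ℂ} (h : HasSum f a) (hf : ∀ i, g i = f i)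
    (hab : b = a) : HasSum g b := by
  rw [hab, show g = f from funext hf]
  exact h

theorem hasSum_swap_fiberwise {f : ℕ × ℕ → ℂ} {a : ℂ} {g : ℕ → ℂ} (h : HasSum f a)
    (hg : ∀ j, HasSum (fun i => f (i, j)) (g j)) : HasSum g a :=
  ((Equiv.prodComm ℕ ℕ).hasSum_iff.2 h).prod_fiberwise hg

theorem summable_pow_mul_two_mul (k : ℕ) {t : ℂ} (ht : ‖t‖ < 1 / 2) :
    Summable fun n : ℕ => (n : ℝ) ^ k * (2 * ‖t‖) ^ n :=
  summable_pow_mul_geometric_of_norm_lt_one k (by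
    rw [Real.norm_of_nonneg (by positivity)]; linarith)

/-- The series whose product with `psi` gives the rows of `tail`. -/
def phiTail (j : ℕ) : PowerSeries ℂ := PowerSeries.mk fun k => if 2 ≤ k then coeff (k + j - 1) (phi ℂ) else 0

theorem norm_coeff_phiTail_le (j k : ℕ) : ‖coeff k (phiTail j)‖ ≤ 2 ^ j * 2 ^ k := by
  rw [phiTail, coeff_mk]
  split_ifs
  · refine (norm_coeff_phi_le _).trans ?_
    rw [← pow_add]
    exact pow_le_pow_right₀ (by norm_num) (by omega)
  · rw [norm_zero]; positivity

theorem tail_eq_coeff (i j : ℕ) : tail ℂ i j = coeff (i + 1) (psi ℂ * phiTail j) := by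
  rw [tail, coeff_mul]
  simp only [phiTail, coeff_mk]

theorem summable_tail {t u : ℂ} (ht : ‖t‖ < 1 / 2) (hu : ‖u‖ < 1 / 2) :
    Summable fun q : ℕ × ℕ => (q.2 : ℂ) * tail ℂ q.1 q.2 * t ^ (q.1 + 1) * u ^ (q.2 + 1) := by
  have h1 : Summable fun n : ℕ => ((n + 1 : ℕ) + 1 : ℝ) ^ 2 * (2 * ‖t‖) ^ (n + 1) := by
    refine (summable_nat_add_iff (f := fun n : ℕ => ((n : ℝ) + 1) ^ 2 * (2 * ‖t‖) ^ n) 1).2 ?_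
    have := ((summable_pow_mul_two_mul 2 ht).add ((summable_pow_mul_two_mul 1 ht).mul_left 2)).add
      (summable_pow_mul_two_mul 0 ht)
    refine this.congr fun n => ?_
    ring
  have h2 := (summable_pow_mul_two_mul 1 hu).mul_right ‖u‖
  have h3 := h1.mul_of_nonneg h2 (fun _ => by positivity) (fun _ => by positivity)
  refine Summable.of_norm_bounded h3 fun q => ?_
  rw [norm_mul, norm_mul, norm_mul, norm_pow, norm_pow, Complex.norm_natCast]
  calc _ ≤ (q.2 : ℝ) * ((q.1 + 2) ^ 2 * 2 ^ (q.1 + 1) * 2 ^ q.2) * ‖t‖ ^ (q.1 + 1) * ‖u‖ ^ (q.2 + 1) := by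
        gcongr
        exact norm_tail_le _ _
    _ = _ := by push_cast; ring

theorem summable_phiTail {t u : ℂ} (ht : ‖t‖ < 1 / 2) (hu : ‖u‖ < 1 / 2) :
    Summable fun q : ℕ × ℕ => (q.2 : ℂ) * coeff q.1 (phiTail q.2) * t ^ q.1 * u ^ (q.2 + 1) := by
  have h2 := (summable_pow_mul_two_mul 1 hu).mul_right ‖u‖
  have h3 := (summable_pow_mul_two_mul 0 ht).mul_of_nonneg h2 (fun _ => by positivity)
    (fun _ => by positivity)
  refine Summable.of_norm_bounded h3 fun q => ?_
  rw [norm_mul, norm_mul, norm_mul, norm_pow, norm_pow, Complex.norm_natCast]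
  calc _ ≤ (q.2 : ℝ) * (2 ^ q.2 * 2 ^ q.1) * ‖t‖ ^ q.1 * ‖u‖ ^ (q.2 + 1) := by
        gcongr
        exact norm_coeff_phiTail_le _ _
    _ = _ := by ring

/-- Each row of `tail` is `ψ` times a row of `phiTail`, and absolute summability allows the rows to
be summed first. -/
theorem hasSum_tail_of_phiTail {t u ψ s : ℂ} (ht : ‖t‖ < 1 / 2) (hu : ‖u‖ < 1 / 2)
    (hψ : EvalsTo (psi ℂ) t ψ)
    (hs : HasSum (fun q : ℕ × ℕ => (q.2 : ℂ) * coeff q.1 (phiTail q.2) * t ^ q.1 * u ^ (q.2 + 1)) s) :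
    HasSum (fun q : ℕ × ℕ => (q.2 : ℂ) * tail ℂ q.1 q.2 * t ^ (q.1 + 1) * u ^ (q.2 + 1)) (ψ * s) := by
  have h1 : ∀ j, ∃ R, EvalsTo (phiTail j) t R := fun j =>
    exists_evalsTo (k := 0) (C := 2 ^ j) (fun n => by simpa using norm_coeff_phiTail_le j n) ht
  choose R hR using h1
  have h2 : HasSum (fun j : ℕ => (j : ℂ) * u ^ (j + 1) * R j) s := by
    refine hasSum_swap_fiberwise hs fun j => ?_
    exact HasSum.congr_of_eq ((hR j).2.mul_left ((j : ℂ) * u ^ (j + 1))) (fun _ => by ring) rfl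
  have h3 : HasSum (fun j : ℕ => (j : ℂ) * u ^ (j + 1) * (ψ * R j)) (∑' q : ℕ × ℕ,
      (q.2 : ℂ) * tail ℂ q.1 q.2 * t ^ (q.1 + 1) * u ^ (q.2 + 1)) := by
    refine hasSum_swap_fiberwise (summable_tail ht hu).hasSum fun j => ?_
    have h4 := (hasSum_nat_add_iff' 1).2 (hψ.mul (hR j)).2
    have h5 : coeff 0 (psi ℂ * phiTail j) = 0 := by
      rw [coeff_mul, Finset.Nat.antidiagonal_zero, Finset.sum_singleton, phiTail, coeff_mk]
      simp
    rw [Finset.sum_range_one, h5, zero_mul, sub_zero] at h4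
    exact HasSum.congr_of_eq (h4.mul_left ((j : ℂ) * u ^ (j + 1)))
      (fun _ => by rw [tail_eq_coeff]; ring) rfl
  have h6 : HasSum (fun j : ℕ => (j : ℂ) * u ^ (j + 1) * (ψ * R j)) (ψ * s) := by
    exact HasSum.congr_of_eq (h2.mul_left ψ) (fun _ => by ring) rfl
  rw [h6.unique h3]
  exact (summable_tail ht hu).hasSum

theorem sum_antidiagonal_phiTail (t u : ℂ) (n : ℕ) :
    ∑ q ∈ Finset.HasAntidiagonal.antidiagonal (n + 1),
      (q.2 : ℂ) * coeff q.1 (phiTail q.2) * t ^ q.1 * u ^ (q.2 + 1) =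
    coeff n (phi ℂ) * ∑ q ∈ Finset.HasAntidiagonal.antidiagonal (n + 1),
      (if 2 ≤ q.1 then (q.2 : ℂ) * t ^ q.1 * u ^ (q.2 + 1) else 0) := by
  rw [Finset.mul_sum]
  refine Finset.sum_congr rfl fun q hq => ?_
  have h := Finset.HasAntidiagonal.mem_antidiagonal.1 hq
  rw [phiTail, coeff_mk]
  split_ifs
  · rw [h, Nat.add_sub_cancel]
    ring
  · ring

theorem EvalsTo.natCast_mul {f : PowerSeries ℂ} {t v : ℂ} (h : EvalsTo (derivative ℂ f) t v) :
    HasSum (fun n : ℕ => (n : ℂ) * (coeff n f * t ^ n)) (t * v) := by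
  refine (hasSum_nat_add_iff' 1).1 ?_
  rw [Finset.sum_range_one, Nat.cast_zero, zero_mul, sub_zero]
  refine HasSum.congr_of_eq (h.2.mul_left t) (fun n => ?_) rfl
  rw [coeff_derivative]
  push_cast
  ring

/-- Along an antidiagonal the coefficient of `φ` is constant, which leaves a finite geometric sum.
Equality of the two values of `t` forces `z = w`, as `‖z w‖ > 1`; that case uses the second
derivative of `φ`. -/
theorem hasSum_phiTail {z w : ℂ} (hz : 8 < ‖z‖) (hw : 8 < ‖w‖) :
    HasSum (fun q : ℕ × ℕ => (q.2 : ℂ) * coeff q.1 (phiTail q.2) * joukowskyInv z ^ q.1 *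
      joukowskyInv w ^ (q.2 + 1))
      (-2 * (z ^ 2 - 1) / (z ^ 2 + 1) * (z ^ 2 * w ^ 2 / ((z ^ 2 - 1) * (w ^ 2 - 1))) /
        (z * w - 1) ^ 2) := by
  obtain ⟨z0, z1, z2, z3⟩ := sq_ne_of_large hz
  obtain ⟨w0, w1, w2, w3⟩ := sq_ne_of_large hw
  have hzw : z * w - 1 ≠ 0 := by
    intro h
    have : ‖z * w‖ = 1 := by rw [sub_eq_zero.1 h, norm_one]
    rw [norm_mul] at this
    nlinarith
  have ht : ‖joukowskyInv z‖ < 1 / 2 := (norm_joukowskyInv_lt hz).trans (by norm_num)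
  have hu : ‖joukowskyInv w‖ < 1 / 2 := (norm_joukowskyInv_lt hw).trans (by norm_num)
  obtain ⟨d1, -⟩ := evalsTo_derivative_phi hw rfl
  obtain ⟨-, d2⟩ := evalsTo_derivative_phi hz rfl
  have e1 := evalsTo_phi hz
  have e2 := evalsTo_phi hw
  refine hasSum_prod_of_antidiagonal (summable_phiTail ht hu) ((hasSum_nat_add_iff' 1).1 ?_)
  simp only [sum_antidiagonal_phiTail, Finset.sum_range_one, Finset.Nat.antidiagonal_zero,
    Finset.sum_singleton, Nat.cast_zero, zero_mul, sub_zero]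
  have hzt := joukowskyInv_eq z0
  have hwu := joukowskyInv_eq w0
  by_cases htu : joukowskyInv z = joukowskyInv w
  · have hzw2 : z = w := by
      rw [hzt, hwu, div_eq_div_iff z1 w1] at htu
      have : (z - w) * (z * w - 1) = 0 := by linear_combination -htu
      exact sub_eq_zero.1 ((mul_eq_zero.1 this).resolve_right hzw)
    subst hzw2
    have h3 : HasSum (fun n : ℕ => (n : ℂ) * (n - 1) * (coeff n (phi ℂ) * joukowskyInv z ^ n))
        (joukowskyInv z * (joukowskyInv z * (-4 / ((z ^ 2 - 1) / (z ^ 2 + 1)) ^ 3))) := by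
      refine (hasSum_nat_add_iff' 1).1 ?_
      rw [Finset.sum_range_one, Nat.cast_zero, zero_mul, zero_mul, sub_zero]
      refine HasSum.congr_of_eq ((d2.natCast_mul).mul_left (joukowskyInv z)) (fun n => ?_) rfl
      rw [coeff_derivative]
      push_cast
      ring
    have h4 := h3.mul_left (joukowskyInv z ^ 2 / 2)
    refine HasSum.congr_of_eq h4 (fun n => ?_) ?_
    · have := sum_antidiagonal_diag (joukowskyInv z) n
      linear_combination (coeff n (phi ℂ) / 2) * this
    · rw [hzt]
      have hzw' : z ^ 2 - 1 ≠ 0 := z2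
      have : z * z - 1 = z ^ 2 - 1 := by ring
      rw [this]
      field_simp
      ring
  · have h0 : joukowskyInv z - joukowskyInv w ≠ 0 := sub_ne_zero.2 htu
    have h4 := ((e1.2.sub e2.2).mul_left (joukowskyInv z ^ 2 * joukowskyInv w ^ 2 /
      (joukowskyInv z - joukowskyInv w) ^ 2)).sub (d1.natCast_mul.mul_left (joukowskyInv z ^ 2 * joukowskyInv w /
      (joukowskyInv z - joukowskyInv w)))
    refine HasSum.congr_of_eq h4 (fun n => ?_) ?_
    · have := sum_antidiagonal_two_le_mul (joukowskyInv z) (joukowskyInv w) n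
      rw [eq_comm, ← sub_eq_zero]
      field_simp
      linear_combination -coeff n (phi ℂ) * this
    · have h5 : joukowskyInv z - joukowskyInv w = -((z - w) * (z * w - 1)) / ((z ^ 2 + 1) * (w ^ 2 + 1)) := by
        rw [hzt, hwu]
        field_simp
        ring
      have h6 : z - w ≠ 0 := by
        intro h
        rw [h5, h, zero_mul, neg_zero, zero_div] at h0
        exact h0 rfl
      rw [h5, hzt, hwu]
      field_simp
      ring

/-- Multiplication by `ψ` and the two factors `dx` leaves the Bergman kernel with one argument
reflected by `w ↦ 1/w`, up to a constant factor. -/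
theorem hasSum_tail {z w : ℂ} (hz : 8 < ‖z‖) (hw : 8 < ‖w‖) :
    HasSum (fun q : ℕ × ℕ => (q.2 : ℂ) * tail ℂ q.1 q.2 *
      (joukowskyInv z ^ (q.1 + 1) * (1 - (z ^ 2)⁻¹)) * (joukowskyInv w ^ (q.2 + 1) * (1 - (w ^ 2)⁻¹)))
      (-2 / (z * w - 1) ^ 2) := by
  have ht : ‖joukowskyInv z‖ < 1 / 2 := (norm_joukowskyInv_lt hz).trans (by norm_num)
  have hu : ‖joukowskyInv w‖ < 1 / 2 := (norm_joukowskyInv_lt hw).trans (by norm_num)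
  have h := (hasSum_tail_of_phiTail ht hu (evalsTo_psi hz) (hasSum_phiTail hz hw)).mul_left
    ((1 - (z ^ 2)⁻¹) * (1 - (w ^ 2)⁻¹))
  obtain ⟨z0, z1, z2, z3⟩ := sq_ne_of_large hz
  obtain ⟨w0, w1, w2, w3⟩ := sq_ne_of_large hw
  have hzw : z * w - 1 ≠ 0 := by
    intro h
    have : ‖z * w‖ = 1 := by rw [sub_eq_zero.1 h, norm_one]
    rw [norm_mul] at this
    nlinarith
  refine HasSum.congr_of_eq h (fun n => by ring) ?_
  field_simp

end TwoPoint

/-! ### Residues -/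

section Residues

/-- The circle integrals of `f` around `p` are eventually equal to `2πi r`. -/
def HasRes (f : ℂ → ℂ) (p r : ℂ) : Prop := ∀ᶠ ε in 𝓝[>] (0 : ℝ), CircleIntegrable f p ε ∧
  (2 * (Real.pi : ℂ) * Complex.I)⁻¹ * ∮ u in C(p, ε), f u = r

theorem HasRes.residue_eq {f : ℂ → ℂ} {p r : ℂ} (h : HasRes f p r) : residue f p = r :=
  Tendsto.limUnder_eq (tendsto_const_nhds.congr' (h.mono fun _ hε => hε.2.symm))

theorem HasRes.add {f g : ℂ → ℂ} {p r s : ℂ} (hf : HasRes f p r) (hg : HasRes g p s) :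
    HasRes (fun u => f u + g u) p (r + s) := by
  filter_upwards [hf, hg] with ε h1 h2
  exact ⟨h1.1.add h2.1, by rw [circleIntegral.integral_add h1.1 h2.1, mul_add, h1.2, h2.2]⟩

theorem HasRes.const_mul {f : ℂ → ℂ} {p r : ℂ} (hf : HasRes f p r) (a : ℂ) :
    HasRes (fun u => a * f u) p (a * r) := by
  filter_upwards [hf] with ε h1
  exact ⟨IntervalIntegrable.const_mul h1.1 a, by
    rw [circleIntegral.integral_const_mul, mul_left_comm, h1.2]⟩

theorem eventually_sphere {p : ℂ} {P : ℂ → Prop} (h : ∀ᶠ u in 𝓝[≠] p, P u) :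
    ∀ᶠ ε in 𝓝[>] (0 : ℝ), ∀ u ∈ Metric.sphere p ε, P u := by
  rw [eventually_nhdsWithin_iff, Metric.eventually_nhds_iff] at h
  obtain ⟨δ, hδ, h⟩ := h
  filter_upwards [Ioo_mem_nhdsGT hδ] with ε hε u hu
  refine h ?_ ?_
  · rw [Metric.mem_sphere.1 hu]; exact hε.2
  · intro h0
    rw [Set.mem_singleton_iff.1 h0, Metric.mem_sphere, dist_self] at hu
    exact hε.1.ne hu

theorem HasRes.congr {f g : ℂ → ℂ} {p r : ℂ} (hf : HasRes f p r) (h : ∀ᶠ u in 𝓝[≠] p, g u = f u) :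
    HasRes g p r := by
  filter_upwards [hf, eventually_sphere h, self_mem_nhdsWithin] with ε h1 h2 h3
  have h4 : (0 : ℝ) ≤ ε := le_of_lt h3
  refine ⟨?_, ?_⟩
  · refine (circleIntegrable_congr fun u hu => ?_).1 h1.1
    rw [abs_of_nonneg h4] at hu
    exact (h2 u hu).symm
  · rw [circleIntegral.integral_congr h4 fun u hu => h2 u hu, h1.2]

theorem hasRes_zero_of_differentiable {f : ℂ → ℂ} {p : ℂ} (h : ∀ᶠ u in 𝓝 p, DifferentiableAt ℂ f u) :
    HasRes f p 0 := by
  rw [Metric.eventually_nhds_iff] at h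
  obtain ⟨δ, hδ, h⟩ := h
  filter_upwards [Ioo_mem_nhdsGT hδ] with ε hε
  have h0 : (0 : ℝ) ≤ ε := hε.1.le
  have hd : ∀ z ∈ Metric.closedBall p ε, DifferentiableAt ℂ f z := fun z hz =>
    h ((Metric.mem_closedBall.1 hz).trans_lt hε.2)
  have hc : ContinuousOn f (Metric.closedBall p ε) := fun z hz => (hd z hz).continuousAt.continuousWithinAt
  refine ⟨(hc.mono Metric.sphere_subset_closedBall).circleIntegrable h0, ?_⟩
  rw [Complex.circleIntegral_eq_zero_of_differentiable_on_off_countable h0 Set.countable_empty hc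
    fun z hz => hd z (Metric.ball_subset_closedBall hz.1), mul_zero]

theorem hasRes_pow_inv (p : ℂ) (k : ℕ) :
    HasRes (fun u => ((u - p) ^ (k + 1))⁻¹) p (if k = 0 then 1 else 0) := by
  filter_upwards [self_mem_nhdsWithin] with ε hε
  have hε : 0 < ε := hε
  refine ⟨?_, ?_⟩
  · refine ContinuousOn.circleIntegrable hε.le fun u hu => ?_
    have : u - p ≠ 0 := by
      intro h
      rw [sub_eq_zero.1 h, Metric.mem_sphere, dist_self] at hu
      exact hε.ne hu
    exact ((continuousAt_id.sub continuousAt_const).pow (k + 1)).inv₀ (pow_ne_zero _ this)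
      |>.continuousWithinAt
  · split_ifs with h
    · subst h
      simp only [zero_add, pow_one]
      rw [circleIntegral.integral_sub_center_inv _ hε.ne', inv_mul_cancel₀]
      exact Complex.two_pi_I_ne_zero
    · have h1 := circleIntegral.integral_sub_zpow_of_ne (n := -((k + 1 : ℕ) : ℤ)) (by omega) p p ε
      simp only [zpow_neg, zpow_natCast] at h1
      rw [h1, mul_zero]

/-- Induction on `k` by the partial fraction obtained from `(u - p) - (u - q) = q - p`. -/
theorem hasRes_pow_inv_mul_inv {p q : ℂ} (hpq : q ≠ p) (k : ℕ) :
    HasRes (fun u => ((u - p) ^ k)⁻¹ * (u - q)⁻¹) p (if k = 0 then 0 else -((q - p) ^ k)⁻¹) := by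
  have hne : q - p ≠ 0 := sub_ne_zero.2 hpq
  have hev : ∀ᶠ u in 𝓝 p, u - q ≠ 0 := by
    filter_upwards [isOpen_ne.mem_nhds (Ne.symm hpq)] with u hu using sub_ne_zero.2 hu
  induction k with
  | zero =>
    refine hasRes_zero_of_differentiable ?_
    filter_upwards [hev] with u hu
    simp only [pow_zero, inv_one, one_mul]
    exact (differentiableAt_id.sub_const q).inv hu
  | succ k ih =>
    have h1 := ((ih.add ((hasRes_pow_inv p k).const_mul (-1))).const_mul (q - p)⁻¹)
    have h2 : (q - p)⁻¹ * ((if k = 0 then 0 else -((q - p) ^ k)⁻¹) + -1 * if k = 0 then 1 else 0) =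
        if k + 1 = 0 then 0 else -((q - p) ^ (k + 1))⁻¹ := by
      rw [if_neg (Nat.succ_ne_zero k)]
      split_ifs with hk
      · subst hk; simp
      · rw [mul_zero, add_zero, pow_succ, mul_inv]; ring
    rw [h2] at h1
    refine h1.congr ?_
    rw [eventually_nhdsWithin_iff]
    filter_upwards [hev] with u hu hup
    have hup : u - p ≠ 0 := sub_ne_zero.2 hup
    have e : (q - p)⁻¹ * (((u - p) ^ k)⁻¹ * (u - q)⁻¹ + -1 * ((u - p) ^ (k + 1))⁻¹) =
        (q - p)⁻¹ * ((u - p) - (u - q)) * (((u - p) ^ (k + 1))⁻¹ * (u - q)⁻¹) := by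
      rw [pow_succ]
      field_simp
      ring
    rw [e, show u - p - (u - q) = q - p by ring, inv_mul_cancel₀ hne, one_mul]

/-- The sum of the residues of `f` at `1` and `-1` is `r`. -/
def HasResSum (f : ℂ → ℂ) (r : ℂ) : Prop := ∃ r₁ r₂, HasRes f 1 r₁ ∧ HasRes f (-1) r₂ ∧ r₁ + r₂ = r

theorem HasResSum.add {f g : ℂ → ℂ} {r s : ℂ} (hf : HasResSum f r) (hg : HasResSum g s) :
    HasResSum (fun u => f u + g u) (r + s) := by
  obtain ⟨a, b, h1, h2, h3⟩ := hf
  obtain ⟨c, d, h4, h5, h6⟩ := hg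
  exact ⟨_, _, h1.add h4, h2.add h5, by rw [← h3, ← h6]; ring⟩

theorem HasResSum.const_mul {f : ℂ → ℂ} {r : ℂ} (hf : HasResSum f r) (a : ℂ) :
    HasResSum (fun u => a * f u) (a * r) := by
  obtain ⟨r₁, r₂, h1, h2, h3⟩ := hf
  exact ⟨_, _, h1.const_mul a, h2.const_mul a, by rw [← h3]; ring⟩

theorem HasResSum.congr {f g : ℂ → ℂ} {r : ℂ} (hf : HasResSum f r) (h1 : ∀ᶠ u in 𝓝[≠] 1, g u = f u)
    (h2 : ∀ᶠ u in 𝓝[≠] (-1), g u = f u) : HasResSum g r := by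
  obtain ⟨r₁, r₂, h3, h4, h5⟩ := hf
  exact ⟨_, _, h3.congr h1, h4.congr h2, h5⟩

theorem hasResSum_zero : HasResSum (fun _ => 0) 0 :=
  ⟨0, 0, hasRes_zero_of_differentiable (Eventually.of_forall fun _ => differentiableAt_const _),
    hasRes_zero_of_differentiable (Eventually.of_forall fun _ => differentiableAt_const _), add_zero 0⟩

theorem HasResSum.sum {ι : Type*} (s : Finset ι) {f : ι → ℂ → ℂ} {r : ι → ℂ}
    (h : ∀ i ∈ s, HasResSum (f i) (r i)) : HasResSum (fun u => ∑ i ∈ s, f i u) (∑ i ∈ s, r i) := by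
  classical
  induction s using Finset.induction_on with
  | empty => simpa using hasResSum_zero
  | insert i s hi ih =>
    simp only [Finset.sum_insert hi]
    exact (h i (Finset.mem_insert_self _ _)).add (ih fun j hj => h j (Finset.mem_insert_of_mem hj))

/-- The function is recovered from its polar parts at `1` and `-1`. -/
def IsPolar (f : ℂ → ℂ) : Prop :=
  ∀ q, q ≠ 1 → q ≠ -1 → HasResSum (fun u => f u * (u - q)⁻¹) (-f q)

theorem IsPolar.add {f g : ℂ → ℂ} (hf : IsPolar f) (hg : IsPolar g) : IsPolar fun u => f u + g u := by
  intro q h1 h2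
  have := (hf q h1 h2).add (hg q h1 h2)
  rw [← neg_add] at this
  simpa only [add_mul] using this

theorem IsPolar.const_mul {f : ℂ → ℂ} (hf : IsPolar f) (a : ℂ) : IsPolar fun u => a * f u := by
  intro q h1 h2
  have := (hf q h1 h2).const_mul a
  rw [mul_neg] at this
  simpa only [mul_assoc] using this

theorem IsPolar.sum {ι : Type*} (s : Finset ι) {f : ι → ℂ → ℂ} (h : ∀ i ∈ s, IsPolar (f i)) :
    IsPolar fun u => ∑ i ∈ s, f i u := by
  intro q h1 h2
  have := HasResSum.sum s fun i hi => h i hi q h1 h2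
  rw [Finset.sum_neg_distrib] at this
  simpa only [Finset.sum_mul] using this

theorem eventually_ne_of_ne {p : ℂ} {s : Finset ℂ} : ∀ᶠ u in 𝓝[≠] p, ∀ a ∈ s, u ≠ a := by
  have h : {u : ℂ | ∀ a ∈ s, a ≠ p → u ≠ a} ∈ 𝓝 p := by
    have : {u : ℂ | ∀ a ∈ s, a ≠ p → u ≠ a} = (↑(s.erase p) : Set ℂ)ᶜ := by
      ext u
      simp only [Set.mem_ofPred_eq, Finset.coe_erase, Set.mem_compl_iff, Set.mem_sdiff, Finset.mem_coe,
        Set.mem_singleton_iff, not_and, not_not]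
      exact ⟨fun h h1 => by_contra fun h2 => h u h1 h2 rfl, fun h a ha hap h1 => hap (h1 ▸ h (h1 ▸ ha))⟩
    rw [this]
    exact (s.erase p).finite_toSet.isClosed.isOpen_compl.mem_nhds (by simp)
  rw [eventually_nhdsWithin_iff]
  filter_upwards [h] with u hu hup a ha
  by_cases hap : a = p
  · rw [hap]; exact hup
  · exact hu a ha hap

theorem IsPolar.congr {f g : ℂ → ℂ} (hf : IsPolar f) (h : ∀ u, u ≠ 1 → u ≠ -1 → g u = f u) : IsPolar g := by
  intro q h1 h2
  have e : ∀ p : ℂ, ∀ᶠ u in 𝓝[≠] p, g u * (u - q)⁻¹ = f u * (u - q)⁻¹ := fun p => by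
    filter_upwards [eventually_ne_of_ne (p := p) (s := {1, -1})] with u hu
    rw [h u (hu _ (by simp)) (hu _ (by simp))]
  rw [h q h1 h2]
  exact (hf q h1 h2).congr (e 1) (e (-1))

theorem isPolar_pole {p p' : ℂ} (hp : p' ≠ p) {k : ℕ} {q : ℂ} (h1 : q ≠ p) (h2 : q ≠ p') :
    HasRes (fun u => ((u - p) ^ (k + 1))⁻¹ * (u - q)⁻¹) p (-((q - p) ^ (k + 1))⁻¹) ∧
    HasRes (fun u => ((u - p) ^ (k + 1))⁻¹ * (u - q)⁻¹) p' 0 := by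
  have h := hasRes_pow_inv_mul_inv h1 (k + 1)
  rw [if_neg (Nat.succ_ne_zero k)] at h
  refine ⟨h, hasRes_zero_of_differentiable ?_⟩
  have e1 : ∀ᶠ u in 𝓝 p', u ≠ q := isOpen_ne.mem_nhds (Ne.symm h2)
  have e2 : ∀ᶠ u in 𝓝 p', u ≠ p := isOpen_ne.mem_nhds hp
  filter_upwards [e1, e2] with u hu hu1
  have d1 : DifferentiableAt ℂ (fun u => (u - p) ^ (k + 1)) u := by fun_prop
  have d2 : DifferentiableAt ℂ (fun u => u - q) u := by fun_prop
  exact (d1.fun_inv (pow_ne_zero _ (sub_ne_zero.2 hu1))).fun_mul (d2.fun_inv (sub_ne_zero.2 hu))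

theorem isPolar_pole_one (k : ℕ) : IsPolar fun u => ((u - 1) ^ (k + 1))⁻¹ := by
  intro q h1 h2
  obtain ⟨h3, h4⟩ := isPolar_pole (k := k) (show (-1 : ℂ) ≠ 1 by norm_num) h1 h2
  exact ⟨_, _, h3, h4, add_zero _⟩

theorem isPolar_pole_neg_one (k : ℕ) : IsPolar fun u => ((u + 1) ^ (k + 1))⁻¹ := by
  intro q h1 h2
  obtain ⟨h3, h4⟩ := isPolar_pole (k := k) (show (1 : ℂ) ≠ -1 by norm_num) h2 h1
  simp only [sub_neg_eq_add] at h3 h4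
  exact ⟨_, _, h4, h3, zero_add _⟩

/-- The identity `1/((u - 1)(u + 1)) = (1/(u - 1) - 1/(u + 1))/2` lowers the total order until only
one of the two poles remains. -/
theorem isPolar_poles (a b : ℕ) (h : 0 < a + b) :
    IsPolar fun u => ((u - 1) ^ a)⁻¹ * ((u + 1) ^ b)⁻¹ := by
  induction h' : a + b using Nat.strong_induction_on generalizing a b with
  | _ n ih =>
    rcases a with _ | a
    · obtain ⟨b, rfl⟩ := Nat.exists_eq_add_of_le' (show 1 ≤ b by omega)
      simpa using isPolar_pole_neg_one b
    · rcases b with _ | b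
      · simpa using isPolar_pole_one a
      · have h1 := ih _ (by omega) (a + 1) b (by omega) rfl
        have h2 := ih _ (by omega) a (b + 1) (by omega) rfl
        refine ((h1.const_mul (1 / 2)).add (h2.const_mul (-1 / 2))).congr fun u hu hu' => ?_
        have hu : u - 1 ≠ 0 := sub_ne_zero.2 hu
        have hu' : u + 1 ≠ 0 := fun h => hu' (eq_neg_of_add_eq_zero_left h)
        field_simp
        ring

/-- Writing `u = (u - 1) + 1`, or `u = (u + 1) - 1`, removes one power of `u`. The bound `i < a + b`
says that the function vanishes at infinity. -/
theorem isPolar_pow_mul_poles (i a b : ℕ) (h : i < a + b) :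
    IsPolar fun u => u ^ i * (((u - 1) ^ a)⁻¹ * ((u + 1) ^ b)⁻¹) := by
  induction i generalizing a b with
  | zero => simpa using isPolar_poles a b h
  | succ i ih =>
    rcases a with _ | a
    · obtain ⟨b, rfl⟩ := Nat.exists_eq_add_of_le' (show 1 ≤ b by omega)
      refine ((ih 0 b (by omega)).add ((ih 0 (b + 1) (by omega)).const_mul (-1))).congr
        fun u hu hu' => ?_
      have hu' : u + 1 ≠ 0 := fun h => hu' (eq_neg_of_add_eq_zero_left h)
      field_simp
      ring
    · refine ((ih a b (by omega)).add (ih (a + 1) b (by omega))).congr fun u hu hu' => ?_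
      have hu : u - 1 ≠ 0 := sub_ne_zero.2 hu
      have hu' : u + 1 ≠ 0 := fun h => hu' (eq_neg_of_add_eq_zero_left h)
      field_simp
      ring

theorem isPolar_polynomial (P : Polynomial ℂ) (k : ℕ) (h : P.natDegree < 2 * k) :
    IsPolar fun u => P.eval u * ((u ^ 2 - 1) ^ k)⁻¹ := by
  have h1 := IsPolar.sum (Finset.range (2 * k)) fun i hi =>
    (isPolar_pow_mul_poles i k k (by have := Finset.mem_range.1 hi; omega)).const_mul (P.coeff i)
  refine h1.congr fun u _ _ => ?_
  rw [Polynomial.eval_eq_sum_range' h, Finset.sum_mul]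
  refine Finset.sum_congr rfl fun i _ => ?_
  rw [← mul_inv, ← mul_pow, show (u - 1) * (u + 1) = u ^ 2 - 1 by ring, mul_assoc]

/-- The total residue, from the polar property of `u f`. -/
theorem IsPolar.hasResSum_zero {f : ℂ → ℂ} (hf : IsPolar fun u => u * f u) : HasResSum f 0 := by
  have h := hf 0 (by norm_num) (by norm_num)
  simp only [zero_mul, neg_zero] at h
  have e : ∀ p : ℂ, ∀ᶠ u in 𝓝[≠] p, f u = u * f u * (u - 0)⁻¹ := fun p => by
    filter_upwards [eventually_ne_of_ne (p := p) (s := {0})] with u hu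
    have := hu 0 (by simp)
    rw [sub_zero]
    field_simp
  exact h.congr (e 1) (e (-1))

/-- A regular extension of `basisForm` to `0`. -/
def basisFun (M j : ℕ) (u : ℂ) : ℂ := u ^ (j - 2) * (u ^ 2 + 1) ^ (M - j) * ((u ^ 2 - 1) ^ (M - 1))⁻¹

theorem basisForm_eq_basisFun {M j : ℕ} (hj : 2 ≤ j) {u : ℂ} (hu : u ≠ 0) :
    basisForm M j u = basisFun M j u := by
  obtain ⟨k, rfl⟩ := Nat.exists_eq_add_of_le' hj
  rw [basisForm, if_neg (by omega), basisFun, Nat.add_sub_cancel, pow_add]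
  field_simp

/-- The function decays like `u ^ (-j)`. So for `j ≥ 2` it still vanishes at infinity after
multiplication by `u`, which yields a zero total residue at `±1`. -/
theorem isPolar_basisFun {M j : ℕ} (h2 : 2 ≤ j) (hj : j ≤ M) :
    IsPolar (basisFun M j) ∧ IsPolar fun u => u * basisFun M j u := by
  have hd : ((Polynomial.X ^ 2 + 1 : Polynomial ℂ) ^ (M - j)).natDegree ≤ 2 * (M - j) := by
    refine Polynomial.natDegree_pow_le.trans ?_
    rw [mul_comm]
    gcongr
    compute_degree
  constructor
  · have := isPolar_polynomial (Polynomial.X ^ (j - 2) * (Polynomial.X ^ 2 + 1) ^ (M - j)) (M - 1) (by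
      refine (Polynomial.natDegree_mul_le).trans_lt ?_
      rw [Polynomial.natDegree_X_pow]
      omega)
    refine this.congr fun u _ _ => ?_
    simp only [basisFun, Polynomial.eval_mul, Polynomial.eval_pow, Polynomial.eval_X, Polynomial.eval_add,
      Polynomial.eval_one]
  · have := isPolar_polynomial (Polynomial.X ^ (j - 2 + 1) * (Polynomial.X ^ 2 + 1) ^ (M - j)) (M - 1) (by
      refine (Polynomial.natDegree_mul_le).trans_lt ?_
      rw [Polynomial.natDegree_X_pow]
      omega)
    refine this.congr fun u _ _ => ?_
    simp only [basisFun, Polynomial.eval_mul, Polynomial.eval_pow, Polynomial.eval_X, Polynomial.eval_add,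
      Polynomial.eval_one]
    ring

/-- The odd exponent matters: `(-1) ^ (M - 1) = 1`. This value is what the kernel `u⁻¹` picks out in
the projection. -/
theorem basisFun_zero {K j : ℕ} (h2 : 2 ≤ j) : basisFun (2 * K + 1) j 0 = if j = 2 then 1 else 0 := by
  rw [basisFun]
  split_ifs with h
  · subst h
    simp [pow_mul]
  · rw [zero_pow (by omega)]; simp

end Residues

/-! ### The correlation forms -/

section Forms

variable {d δ : ℕ}

instance : IsDomain (Ser d) := NoZeroDivisors.to_isDomain _

instance : CharZero (Ser d) := algebraRat.charZero _

theorem xCurve_inv (q : Curve d) : (xCurve q)⁻¹ = MvPowerSeries.C (joukowskyInv q.2) * sqrtOneSub q.1 := by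
  have h : ((sqrtOneSub q.1 : Ser d)⁻¹)⁻¹ = sqrtOneSub q.1 := by
    refine (MvPowerSeries.inv_eq_iff_mul_eq_one ?_).2 (sqrtOneSub_mul_inv q.1)
    rw [MvPowerSeries.constantCoeff_inv]
    exact inv_ne_zero (constantCoeff_sqrtOneSub_ne q.1)
  rw [xCurve, MvPowerSeries.mul_inv_rev, MvPowerSeries.C_inv, h, joukowskyInv, mul_comm]

/-- One root `√(1 - α_c ^ 2)` is absorbed by `dx`; the remaining `p` roots are the rescaling
`labelScale` of the correlations. -/
theorem xCurve_inv_pow_mul_dxCurve (q : Curve d) (p : ℕ) :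
    (xCurve q)⁻¹ ^ (p + 1) * dxCurve q =
      MvPowerSeries.C (joukowskyInv q.2 ^ (p + 1) * (1 - (q.2 ^ 2)⁻¹)) * sqrtOneSub q.1 ^ p := by
  rw [xCurve_inv, dxCurve, map_mul, map_pow, mul_pow, pow_succ (sqrtOneSub q.1)]
  calc _ = MvPowerSeries.C (joukowskyInv q.2) ^ (p + 1) * MvPowerSeries.C (1 - (q.2 ^ 2)⁻¹) *
      sqrtOneSub q.1 ^ p * (sqrtOneSub q.1 * (sqrtOneSub q.1)⁻¹) := by ring
    _ = _ := by rw [sqrtOneSub_mul_inv, mul_one]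

theorem genusData_mul_prod (hd : d = 4 * δ + 2) (g n : ℕ) (c : Fin n → Fin d) (p : Fin n → ℕ)
    (z : Fin n → ℂ) :
    genusData hd g n c p * ∏ i, ((xCurve (c i, z i))⁻¹ ^ (p i + 1) * dxCurve (c i, z i)) =
      MvPowerSeries.C (∏ i, (joukowskyInv (z i) ^ (p i + 1) * (1 - (z i ^ 2)⁻¹))) *
        (modelSystem hd).w g ((Finset.univ : Finset (Fin n)).val.map fun i => (c i, p i)) := by
  have h : (modelSystem hd).w g ((Finset.univ : Finset (Fin n)).val.map fun i => (c i, p i)) =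
      genusData hd g n c p * ∏ i, sqrtOneSub (c i) ^ p i := by
    rw [genusData]
    change genusKappa hd g _ * labelScale _ = _
    rw [labelScale, Multiset.map_map]
    rfl
  simp only [xCurve_inv_pow_mul_dxCurve, Finset.prod_mul_distrib]
  rw [h, map_mul, map_prod, map_prod]
  simp only [map_mul, Finset.prod_mul_distrib]
  ring

/-- The correlation form of genus `g` with `n` points. -/
def omegaForm (hd : d = 4 * δ + 2) (M g n : ℕ) : Form d n := fun q =>
  MvPowerSeries.C ((2 ^ n : ℂ)⁻¹) * ∑ j : Fin n → Fin (M + 1),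
    MvPowerSeries.C (∏ l, basisForm M (j l) (q l).2) *
      (modelSystem hd).arr M n (fun l => (q l).1) (fun l => j l) ((modelSystem hd).stable g n)

theorem coeff_basis_ser (M j n : ℕ) :
    PowerSeries.coeff n (basis (Ser d) M j) = MvPowerSeries.C (PowerSeries.coeff n (basis ℂ M j)) := by
  rw [← map_basis (A := ℂ) (MvPowerSeries.C : ℂ →+* Ser d), PowerSeries.coeff_map]

theorem coeff_psi_ser (n : ℕ) :
    PowerSeries.coeff n (psi (Ser d)) = MvPowerSeries.C (PowerSeries.coeff n (psi ℂ)) := by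
  have := coeff_basis_ser (d := d) 1 0 n
  rwa [basis, basis, if_pos rfl, if_pos rfl] at this

theorem tail_ser (i j : ℕ) : tail (Ser d) i j = MvPowerSeries.C (tail ℂ i j) := by
  rw [tail, tail, map_sum]
  refine Finset.sum_congr rfl fun q _ => ?_
  rw [map_mul, coeff_psi_ser]
  congr 1
  split_ifs
  · rw [← map_phi (A := ℂ) (MvPowerSeries.C : ℂ →+* Ser d), PowerSeries.coeff_map]
  · rw [map_zero]

theorem hasSum_omegaForm (hd : d = 4 * δ + 2) {M g n : ℕ} (hM : 1 ≤ M)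
    (hb : (modelSystem hd).RowBounded M ((modelSystem hd).stable g n)) (c : Fin n → Fin d)
    (m : Fin d →₀ ℕ) (z : Fin n → ℂ) (hz : ∀ i, 8 < ‖z i‖) :
    HasSum (fun p : Fin n → ℕ => MvPowerSeries.coeff m
        (genusData hd g n c p * ∏ i, ((xCurve (c i, z i))⁻¹ ^ (p i + 1) * dxCurve (c i, z i))))
      (MvPowerSeries.coeff m (omegaForm hd M g n fun i => (c i, z i))) := by
  have h1 : ∀ j : Fin n → Fin (M + 1), HasSum (fun p : Fin n → ℕ =>
      ∏ i, (joukowskyInv (z i) ^ (p i + 1) * (1 - (z i ^ 2)⁻¹) *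
        PowerSeries.coeff (p i + 1) (basis ℂ M (j i)))) (∏ i, basisForm M (j i) (z i)) := fun j =>
    (hasSum_prod_pi (fun i k => joukowskyInv (z i) ^ (k + 1) * (1 - (z i ^ 2)⁻¹) *
        PowerSeries.coeff (k + 1) (basis ℂ M (j i))) (fun i => basisForm M (j i) (z i))
      (fun i => (evalsTo_basis hM (Nat.lt_succ_iff.1 (j i).2) (hz i)).1)
      fun i => (evalsTo_basis hM (Nat.lt_succ_iff.1 (j i).2) (hz i)).2).2
  have h2 := (hasSum_sum fun (j : Fin n → Fin (M + 1)) (_ : j ∈ Finset.univ) => (h1 j).mul_right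
    (MvPowerSeries.coeff m ((modelSystem hd).arr M n c (fun l => j l) ((modelSystem hd).stable g n)))
    ).mul_left (2 ^ n : ℂ)⁻¹
  refine HasSum.congr_of_eq h2 (fun p => ?_) ?_
  · have h3 := hb.eq_sum_arr c p
    rw [LoopSystem.stable, if_pos (by simp)] at h3
    simp only [coeff_basis_ser, ← map_prod] at h3
    have h4 := congrArg (MvPowerSeries.coeff m) h3
    rw [map_sum, show (2 : Ser d) ^ n = MvPowerSeries.C ((2 : ℂ) ^ n) by rw [map_pow]; rfl,
      MvPowerSeries.coeff_C_mul] at h4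
    simp only [MvPowerSeries.coeff_C_mul] at h4
    rw [genusData_mul_prod, MvPowerSeries.coeff_C_mul]
    have h5 : (2 : ℂ) ^ n ≠ 0 := pow_ne_zero _ two_ne_zero
    have h6 : ∀ j : Fin n → Fin (M + 1), ∏ i, (joukowskyInv (z i) ^ (p i + 1) * (1 - (z i ^ 2)⁻¹) *
        PowerSeries.coeff (p i + 1) (basis ℂ M (j i))) =
        (∏ i, (joukowskyInv (z i) ^ (p i + 1) * (1 - (z i ^ 2)⁻¹))) *
          ∏ i, PowerSeries.coeff (p i + 1) (basis ℂ M (j i)) := fun j => Finset.prod_mul_distrib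
    simp only [h6]
    simp only [mul_assoc]
    rw [← Finset.mul_sum, ← h4]
    field_simp
  · rw [omegaForm, MvPowerSeries.coeff_C_mul, map_sum]
    simp only [MvPowerSeries.coeff_C_mul]

theorem isCorrelationForm_of_hasSum {w : GenusData d} {g n : ℕ} {F : Form d n}
    (h1 : ∀ (c : Fin n → Fin d) (m : Fin d →₀ ℕ), AnalyticOnNhd ℂ
      (fun z : Fin n → ℂ => MvPowerSeries.coeff m (F fun i => (c i, z i))) (regularDomain n))
    (h2 : ∀ (c : Fin n → Fin d) (m : Fin d →₀ ℕ) (z : Fin n → ℂ), (∀ i, 8 < ‖z i‖) →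
      HasSum (fun p : Fin n → ℕ => MvPowerSeries.coeff m
        (w g n c p * ∏ i, ((xCurve (c i, z i))⁻¹ ^ (p i + 1) * dxCurve (c i, z i))))
      (MvPowerSeries.coeff m (F fun i => (c i, z i)))) : IsCorrelationForm w g n F :=
  fun c m => ⟨h1 c m, 8, h2 c m⟩

theorem sq_sub_one_ne_zero {z : ℂ} (h1 : z ≠ 1) (h2 : z ≠ -1) : z ^ 2 - 1 ≠ 0 := by
  have : z ^ 2 - 1 = (z - 1) * (z - -1) := by ring
  rw [this]
  exact mul_ne_zero (sub_ne_zero.2 h1) (sub_ne_zero.2 h2)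

theorem analyticAt_basisForm (M j : ℕ) {z : ℂ} (h0 : z ≠ 0) (h1 : z ≠ 1) (h2 : z ≠ -1) :
    AnalyticAt ℂ (basisForm M j) z := by
  have e1 : AnalyticAt ℂ (fun z : ℂ => (z ^ 2)⁻¹) z :=
    (analyticAt_id.pow 2).inv (pow_ne_zero 2 h0)
  have e2 : AnalyticAt ℂ (fun z : ℂ => ((z ^ 2 - 1) ^ (M - 1))⁻¹) z :=
    (((analyticAt_id.pow 2).sub analyticAt_const).pow (M - 1)).inv
      (pow_ne_zero _ (sq_sub_one_ne_zero h1 h2))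
  have e3 : AnalyticAt ℂ (fun z : ℂ => (z ^ 2 + 1) ^ (M - j)) z :=
    ((analyticAt_id.pow 2).add analyticAt_const).pow (M - j)
  by_cases hj : j = 0
  · have : basisForm M j = fun z => 2 * (z ^ 2)⁻¹ := funext fun z => if_pos hj
    rw [this]
    exact analyticAt_const.mul e1
  · have : basisForm M j = fun z => z ^ j * (z ^ 2)⁻¹ * (z ^ 2 + 1) ^ (M - j) * ((z ^ 2 - 1) ^ (M - 1))⁻¹ :=
      funext fun z => if_neg hj
    rw [this]
    exact (((analyticAt_id.pow j).mul e1).mul e3).mul e2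

theorem analyticAt_coord {n : ℕ} (l : Fin n) (z : Fin n → ℂ) : AnalyticAt ℂ (fun z : Fin n → ℂ => z l) z :=
  (ContinuousLinearMap.proj (R := ℂ) (φ := fun _ : Fin n => ℂ) l).analyticAt z

theorem analyticOnNhd_omegaForm (hd : d = 4 * δ + 2) (M g n : ℕ) (c : Fin n → Fin d)
    (m : Fin d →₀ ℕ) : AnalyticOnNhd ℂ (fun z : Fin n → ℂ =>
      MvPowerSeries.coeff m (omegaForm hd M g n fun i => (c i, z i))) (regularDomain n) := by
  intro z hz
  simp only [omegaForm, MvPowerSeries.coeff_C_mul, map_sum]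
  refine analyticAt_const.mul (Finset.analyticAt_fun_sum _ fun j _ => AnalyticAt.mul ?_ analyticAt_const)
  refine Finset.analyticAt_fun_prod _ fun l _ => ?_
  obtain ⟨h0, h1, h2⟩ := hz.1 l
  exact (analyticAt_basisForm M (j l) h0 h1 h2).comp (f := fun z : Fin n → ℂ => z l) (analyticAt_coord l z)

theorem isCorrelationForm_omegaForm (hd : d = 4 * δ + 2) {M g n : ℕ} (hM : 1 ≤ M)
    (hb : (modelSystem hd).RowBounded M ((modelSystem hd).stable g n)) :
    IsCorrelationForm (genusData hd) g n (omegaForm hd M g n) :=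
  isCorrelationForm_of_hasSum (analyticOnNhd_omegaForm hd M g n) (hasSum_omegaForm hd hM hb)

/-- The form of the two-point function of genus zero. -/
def pairForm (hd : d = 4 * δ + 2) (q q' : Curve d) : Ser d :=
  (if q'.1 = q.1 then MvPowerSeries.C (((q.2 * q'.2 - 1) ^ 2)⁻¹) else 0) +
    MvPowerSeries.C ((q.2 ^ 2)⁻¹ * (q'.2 ^ 2)⁻¹) * (modelSystem hd).kmat q.1 q'.1

theorem hasSum_pairForm (hd : d = 4 * δ + 2) (hδ : 0 < δ) (c : Fin 2 → Fin d)
    (m : Fin d →₀ ℕ) (z : Fin 2 → ℂ) (hz : ∀ i, 8 < ‖z i‖) :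
    HasSum (fun p : Fin 2 → ℕ => MvPowerSeries.coeff m
        (genusData hd 0 2 c p * ∏ i, ((xCurve (c i, z i))⁻¹ ^ (p i + 1) * dxCurve (c i, z i))))
      (MvPowerSeries.coeff m (pairForm hd (c 0, z 0) (c 1, z 1))) := by
  set S := modelSystem hd with hS
  obtain ⟨a1, a2⟩ := evalsTo_basis (M := 1) (j := 0) le_rfl (by norm_num) (hz 0)
  obtain ⟨b1, b2⟩ := evalsTo_basis (M := 1) (j := 0) le_rfl (by norm_num) (hz 1)
  have h1 := ((a2.mul b2 (summable_norm_mul a1 b1).of_norm).mul_right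
    (MvPowerSeries.coeff m (S.kmat (c 0) (c 1)) / 4))
  have h2 := ((hasSum_tail (hz 0) (hz 1)).mul_right
    (if c 1 = c 0 then -(MvPowerSeries.coeff m (1 : Ser d)) / 2 else 0))
  refine (finTwoArrowEquiv ℕ).symm.hasSum_iff.1 (HasSum.congr_of_eq (h1.add h2) (fun p => ?_) ?_)
  · obtain ⟨i, j⟩ := p
    have h3 := S.four_mul_w_zero_pair hδ (c 0) (c 1) i j
    rw [show (4 : Ser d) = MvPowerSeries.C (4 : ℂ) from rfl, coeff_psi_ser, coeff_psi_ser, tail_ser] at h3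
    have h4 := congrArg (MvPowerSeries.coeff m) h3
    have h6 : S.kmat (c 0) (c 1) * MvPowerSeries.C (PowerSeries.coeff (i + 1) (psi ℂ)) *
        MvPowerSeries.C (PowerSeries.coeff (j + 1) (psi ℂ)) =
        MvPowerSeries.C (PowerSeries.coeff (i + 1) (psi ℂ) * PowerSeries.coeff (j + 1) (psi ℂ)) *
          S.kmat (c 0) (c 1) := by rw [map_mul]; ring
    have h7 : (2 : Ser d) * ((j : Ser d) * MvPowerSeries.C (tail ℂ i j)) =
        MvPowerSeries.C (2 * (j * tail ℂ i j)) * 1 := by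
      rw [map_mul, map_mul, map_natCast, mul_one]; rfl
    rw [h6, h7, map_sub, MvPowerSeries.coeff_C_mul, MvPowerSeries.coeff_C_mul] at h4
    have h5 : ((Finset.univ : Finset (Fin 2)).val.map fun l => (c l, (![i, j] : Fin 2 → ℕ) l)) =
        (c 0, i) ::ₘ (c 1, j) ::ₘ 0 := rfl
    simp only [Function.comp_apply, finTwoArrowEquiv_symm_apply]
    rw [genusData_mul_prod, MvPowerSeries.coeff_C_mul, h5, Fin.prod_univ_two]
    simp only [Matrix.cons_val_zero, Matrix.cons_val_one, basis, if_true]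
    split_ifs at h4 ⊢ with h
    · rw [MvPowerSeries.coeff_C_mul] at h4
      linear_combination (joukowskyInv (z 0) ^ (i + 1) * (1 - (z 0 ^ 2)⁻¹) *
        (joukowskyInv (z 1) ^ (j + 1) * (1 - (z 1 ^ 2)⁻¹)) / 4) * h4
    · rw [map_zero] at h4
      linear_combination (joukowskyInv (z 0) ^ (i + 1) * (1 - (z 0 ^ 2)⁻¹) *
        (joukowskyInv (z 1) ^ (j + 1) * (1 - (z 1 ^ 2)⁻¹)) / 4) * h4
  · rw [pairForm, map_add, MvPowerSeries.coeff_C_mul]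
    simp only [basisForm, if_true]
    split_ifs with h
    · have : (MvPowerSeries.C (((z 0 * z 1 - 1) ^ 2)⁻¹) : Ser d) =
        MvPowerSeries.C (((z 0 * z 1 - 1) ^ 2)⁻¹) * 1 := (mul_one _).symm
      rw [this, MvPowerSeries.coeff_C_mul]
      ring
    · rw [map_zero]
      ring

theorem isCorrelationForm_pairForm (hd : d = 4 * δ + 2) (hδ : 0 < δ) :
    IsCorrelationForm (genusData hd) 0 2 fun q => pairForm hd (q 0) (q 1) := by
  refine isCorrelationForm_of_hasSum (fun c m z hz => ?_) (hasSum_pairForm hd hδ)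
  simp only [pairForm, map_add, MvPowerSeries.coeff_C_mul]
  obtain ⟨h0, -, -⟩ := hz.1 0
  obtain ⟨h1, -, -⟩ := hz.1 1
  have e : ∀ l, z l ≠ 0 → AnalyticAt ℂ (fun z : Fin 2 → ℂ => (z l ^ 2)⁻¹) z := fun l hl =>
    ((analyticAt_coord l z).pow 2).inv (pow_ne_zero 2 hl)
  refine AnalyticAt.add ?_ (((e 0 h0).mul (e 1 h1)).mul analyticAt_const)
  split_ifs with h
  · have : (fun z : Fin 2 → ℂ => MvPowerSeries.coeff m
        (MvPowerSeries.C (((z 0 * z 1 - 1) ^ 2)⁻¹) : Ser d)) =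
        fun z => ((z 0 * z 1 - 1) ^ 2)⁻¹ * MvPowerSeries.coeff m (1 : Ser d) := by
      funext z
      rw [← MvPowerSeries.coeff_C_mul, mul_one]
    rw [this]
    refine AnalyticAt.mul ?_ analyticAt_const
    exact ((((analyticAt_coord 0 z).mul (analyticAt_coord 1 z)).sub analyticAt_const).pow 2).inv
      (pow_ne_zero 2 (sub_ne_zero.2 (hz.2 0 1 (by decide))))
  · exact analyticAt_const

end Forms

/-! ### Analytic continuation -/

section Continuation

-- Two points of the domain span a complex line, on which the excluded set is the zero set of a
-- nonzero polynomial. The complement of a finite set in the plane is connected.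
open Polynomial in
theorem isPreconnected_regularDomain (n : ℕ) : IsPreconnected (regularDomain n) := by
  refine isPreconnected_of_forall_pair fun a ha b hb => ?_
  let L : Fin n → ℂ[X] := fun i => C (a i) + X * C (b i - a i)
  let Q : ℂ[X] := (∏ i, L i * (L i - 1) * (L i + 1)) * ∏ i, ∏ j, if i = j then 1 else L i * L j - 1
  let γ : ℂ → Fin n → ℂ := fun s i => a i + s * (b i - a i)
  have hL : ∀ i s, (L i).eval s = γ s i := fun i s => by simp [L, γ]
  have hQ : ∀ s, Q.eval s ≠ 0 ↔ γ s ∈ regularDomain n := by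
    intro s
    have h1 : Q.eval s = (∏ i, γ s i * (γ s i - 1) * (γ s i + 1)) *
        ∏ i, ∏ j, if i = j then 1 else γ s i * γ s j - 1 := by
      simp only [Q, eval_mul, eval_prod, eval_sub, eval_add, eval_one, hL, apply_ite (eval s)]
    rw [h1, mul_ne_zero_iff, Finset.prod_ne_zero_iff, Finset.prod_ne_zero_iff]
    simp only [Finset.prod_ne_zero_iff, Finset.mem_univ, true_imp_iff, mul_ne_zero_iff, regularDomain]
    constructor
    · rintro ⟨h2, h3⟩
      refine ⟨fun i => ⟨(h2 i).1.1, fun h => (h2 i).1.2 (by rw [h, sub_self]), fun h => (h2 i).2 (by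
        rw [h, neg_add_cancel])⟩, fun i j hij h => ?_⟩
      have := h3 i j
      rw [if_neg hij, h, sub_self] at this
      exact this rfl
    · rintro ⟨h2, h3⟩
      refine ⟨fun i => ⟨⟨(h2 i).1, sub_ne_zero.2 (h2 i).2.1⟩, fun h => (h2 i).2.2
        (eq_neg_of_add_eq_zero_left h)⟩, fun i j => ?_⟩
      split_ifs with hij
      · exact one_ne_zero
      · exact sub_ne_zero.2 (h3 i j hij)
  have h0 : γ 0 = a := by funext i; simp [γ]
  have h1 : γ 1 = b := by funext i; simp [γ]
  have hQ0 : Q.eval 0 ≠ 0 := (hQ 0).2 (by rwa [h0])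
  have hQ1 : Q.eval 1 ≠ 0 := (hQ 1).2 (by rwa [h1])
  have hfin : {s | Q.IsRoot s}.Finite := finite_setOfPred_isRoot (fun h => by rw [h, eval_zero] at hQ0; exact hQ0 rfl)
  have hconn := (hfin.countable.isPathConnected_compl_of_one_lt_rank (by
    rw [Complex.rank_real_complex]; exact Cardinal.one_lt_two)).isConnected.isPreconnected
  have hγ : Continuous γ := by fun_prop
  refine ⟨γ '' {s | Q.IsRoot s}ᶜ, ?_, ⟨0, hQ0, h0⟩, ⟨1, hQ1, h1⟩, hconn.image γ hγ.continuousOn⟩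
  rintro _ ⟨s, hs, rfl⟩
  exact (hQ s).1 hs

variable {d : ℕ}

/-- Both forms are the sum of the same series near the point with all coordinates equal to a large
real `R`; the identity theorem propagates the equality. -/
theorem IsCorrelationForm.eq_of_mem {w w' : GenusData d} {g n : ℕ} {F F' : Form d n}
    (hw : w g n = w' g n) (hF : IsCorrelationForm w g n F) (hF' : IsCorrelationForm w' g n F')
    (q : Fin n → Curve d) (hq : (fun i => (q i).2) ∈ regularDomain n) : F q = F' q := by
  ext m
  obtain ⟨h1, r, h2⟩ := hF (fun i => (q i).1) m
  obtain ⟨h3, r', h4⟩ := hF' (fun i => (q i).1) m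
  rw [← hw] at h4
  let R : ℝ := max (max r r') 1 + 1
  have hR1 : 2 ≤ R := by
    have := le_max_right (max r r') 1
    simp only [R]; linarith
  have hRr : r < R := lt_of_le_of_lt ((le_max_left r r').trans (le_max_left _ 1)) (lt_add_one _)
  have hRr' : r' < R := lt_of_le_of_lt ((le_max_right r r').trans (le_max_left _ 1)) (lt_add_one _)
  have hz : (fun _ : Fin n => (R : ℂ)) ∈ regularDomain n := by
    have e0 : (R : ℂ) ≠ 0 := by exact_mod_cast (by linarith : R ≠ 0)
    have e1 : (R : ℂ) ≠ 1 := by exact_mod_cast (by linarith : R ≠ 1)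
    have e2 : (R : ℂ) ≠ -1 := by exact_mod_cast (by linarith : R ≠ -1)
    have e3 : (R : ℂ) * R ≠ 1 := by exact_mod_cast (by nlinarith : R * R ≠ 1)
    exact ⟨fun _ => ⟨e0, e1, e2⟩, fun _ _ _ => e3⟩
  have hnorm : ‖(R : ℂ)‖ = R := by
    rw [Complex.norm_real, Real.norm_of_nonneg (by linarith)]
  have hev : ∀ᶠ z : Fin n → ℂ in 𝓝 (fun _ : Fin n => (R : ℂ)), ∀ i, r < ‖z i‖ ∧ r' < ‖z i‖ := by
    refine eventually_all.2 fun i => ?_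
    have hc : ContinuousAt (fun z : Fin n → ℂ => ‖z i‖) (fun _ : Fin n => (R : ℂ)) :=
      (continuous_apply i).norm.continuousAt
    have e1 : ∀ᶠ z : Fin n → ℂ in 𝓝 (fun _ : Fin n => (R : ℂ)), r < ‖z i‖ :=
      hc.eventually (lt_mem_nhds (show r < ‖(R : ℂ)‖ by rw [hnorm]; exact hRr))
    have e2 : ∀ᶠ z : Fin n → ℂ in 𝓝 (fun _ : Fin n => (R : ℂ)), r' < ‖z i‖ :=
      hc.eventually (lt_mem_nhds (show r' < ‖(R : ℂ)‖ by rw [hnorm]; exact hRr'))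
    exact e1.and e2
  have h5 := h1.eqOn_of_preconnected_of_eventuallyEq h3 (isPreconnected_regularDomain n) hz
    (hev.mono fun z hz => (h2 z fun i => (hz i).1).unique (h4 z fun i => (hz i).2))
  exact h5 hq

/-! ### The primitive -/

variable {δ : ℕ}

/-- The primitive of the fundamental bidifferential. -/
def pairPrimitive (hd : d = 4 * δ + 2) (p q : Curve d) : Ser d :=
  (if q.1 = p.1 then MvPowerSeries.C (-(p.2 - q.2)⁻¹) else 0) +
    MvPowerSeries.C (-p.2⁻¹ * (q.2 ^ 2)⁻¹) * (modelSystem hd).kmat p.1 q.1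

theorem sub_sq_inv_mul_dxCurve (c : Fin d) (z w : ℂ) :
    dxCurve (c, z) * dxCurve (c, w) * ((xCurve (c, z) - xCurve (c, w)) ^ 2)⁻¹ =
      MvPowerSeries.C ((1 - (z ^ 2)⁻¹) * (1 - (w ^ 2)⁻¹) * ((z + z⁻¹ - (w + w⁻¹)) ^ 2)⁻¹) := by
  have h : ((sqrtOneSub c : Ser d)⁻¹)⁻¹ = sqrtOneSub c := by
    refine (MvPowerSeries.inv_eq_iff_mul_eq_one ?_).2 (sqrtOneSub_mul_inv c)
    rw [MvPowerSeries.constantCoeff_inv]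
    exact inv_ne_zero (constantCoeff_sqrtOneSub_ne c)
  have h1 : ((xCurve (c, z) - xCurve (c, w)) ^ 2)⁻¹ =
      MvPowerSeries.C (((z + z⁻¹ - (w + w⁻¹)) ^ 2)⁻¹) * sqrtOneSub c ^ 2 := by
    rw [xCurve, xCurve, ← sub_mul, ← map_sub, pow_two, MvPowerSeries.mul_inv_rev,
      MvPowerSeries.mul_inv_rev, h, MvPowerSeries.C_inv, pow_two, mul_inv, map_mul]
    ring
  rw [h1, dxCurve, dxCurve, map_mul, map_mul]
  calc _ = MvPowerSeries.C (1 - (z ^ 2)⁻¹) * MvPowerSeries.C (1 - (w ^ 2)⁻¹) *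
      MvPowerSeries.C (((z + z⁻¹ - (w + w⁻¹)) ^ 2)⁻¹) *
        ((sqrtOneSub c * (sqrtOneSub c)⁻¹) * (sqrtOneSub c * (sqrtOneSub c)⁻¹)) := by ring
    _ = _ := by rw [sqrtOneSub_mul_inv, mul_one, mul_one]

/-- On one component `dx dx' / (x - x') ^ 2` is `dz dw / (z - w) ^ 2 - dz dw / (z w - 1) ^ 2`, and
the last term cancels the reflected kernel in `pairForm`. -/
theorem omegaTwo_eq (hd : d = 4 * δ + 2) {F : Form d 2} {q q' : Curve d}
    (hF : F ![q, q'] = pairForm hd q q') (h0 : q.2 ≠ 0) (h0' : q'.2 ≠ 0)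
    (h1 : q.2 ≠ q'.2) (h2 : q.2 * q'.2 ≠ 1) :
    omegaTwo F q q' = (if q'.1 = q.1 then MvPowerSeries.C (((q.2 - q'.2) ^ 2)⁻¹) else 0) +
      MvPowerSeries.C ((q.2 ^ 2)⁻¹ * (q'.2 ^ 2)⁻¹) * (modelSystem hd).kmat q.1 q'.1 := by
  obtain ⟨c, z⟩ := q
  obtain ⟨c', w⟩ := q'
  simp only at h0 h0' h1 h2
  rw [omegaTwo, hF, pairForm]
  by_cases h : c' = c
  · subst h
    simp only [if_true]
    rw [sub_sq_inv_mul_dxCurve, add_right_comm, ← map_add]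
    congr 2
    have e1 : z * w - 1 ≠ 0 := sub_ne_zero.2 h2
    have e2 : z - w ≠ 0 := sub_ne_zero.2 h1
    have e3 : z + z⁻¹ - (w + w⁻¹) = (z - w) * (z * w - 1) / (z * w) := by field_simp; ring
    rw [e3]
    field_simp
    ring
  · have h' : c ≠ c' := fun h1 => h h1.symm
    simp only [h, h', if_false, add_zero]

theorem hasDerivAt_pairPrimitive (hd : d = 4 * δ + 2) (c : Fin d) (q : Curve d) (m : Fin d →₀ ℕ)
    {z : ℂ} (hz : z ≠ 0) (hzq : z ≠ q.2) :
    HasDerivAt (fun u : ℂ => MvPowerSeries.coeff m (pairPrimitive hd (c, u) q))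
      (MvPowerSeries.coeff m ((if q.1 = c then MvPowerSeries.C (((z - q.2) ^ 2)⁻¹) else 0) +
      MvPowerSeries.C ((z ^ 2)⁻¹ * (q.2 ^ 2)⁻¹) * (modelSystem hd).kmat c q.1)) z := by
  simp only [pairPrimitive, map_add, MvPowerSeries.coeff_C_mul]
  refine HasDerivAt.add ?_ ?_
  · split_ifs
    · have e : ∀ a : ℂ, MvPowerSeries.coeff m (MvPowerSeries.C a : Ser d) =
          a * MvPowerSeries.coeff m (1 : Ser d) := fun a => by
        rw [← MvPowerSeries.coeff_C_mul, mul_one]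
      simp only [e]
      refine HasDerivAt.mul_const ?_ _
      refine (((hasDerivAt_id z).sub_const q.2).fun_inv (sub_ne_zero.2 hzq)).fun_neg.congr_deriv ?_
      rw [id, neg_div, neg_neg, one_div]
    · exact hasDerivAt_const _ _
  · refine HasDerivAt.mul_const (HasDerivAt.mul_const ?_ _) _
    exact (hasDerivAt_inv hz).fun_neg.congr_deriv (neg_neg _)

theorem isPrimitive_pairPrimitive (hd : d = 4 * δ + 2) {F : Form d 2}
    (hF : F = fun q => pairForm hd (q 0) (q 1)) : IsPrimitive (omegaTwo F) (pairPrimitive hd) := by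
  intro c q m z h0 h1 h2 h3 h4 h5 h6 h7
  rw [omegaTwo_eq hd (by rw [hF]; rfl) h3 h0 h6 h7]
  exact hasDerivAt_pairPrimitive hd c q m h3 h6

/-- A primitive is determined up to constants. -/
theorem IsPrimitive.eq_add_const (hd : d = 4 * δ + 2) {F : Form d 2}
    {G : Curve d → Curve d → Ser d} (hG : IsPrimitive (omegaTwo F) G)
    (hF : ∀ q : Fin 2 → Curve d, (fun i => (q i).2) ∈ regularDomain 2 → F q = pairForm hd (q 0) (q 1))
    (c : Fin d) (q : Curve d) (h0 : q.2 ≠ 0) (h1 : q.2 ≠ 1) (h2 : q.2 ≠ -1) :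
    ∃ Γ : Ser d, ∀ u : ℂ, (∀ a ∈ ({0, 1, -1, q.2, q.2⁻¹} : Finset ℂ), u ≠ a) →
      G (c, u) q = pairPrimitive hd (c, u) q + Γ := by
  let U : Set ℂ := (↑({0, 1, -1, q.2, q.2⁻¹} : Finset ℂ) : Set ℂ)ᶜ
  have hU : ∀ u, u ∈ U ↔ ∀ a ∈ ({0, 1, -1, q.2, q.2⁻¹} : Finset ℂ), u ≠ a := fun u =>
    ⟨fun h a ha h' => h (h' ▸ ha), fun h h' => h u h' rfl⟩
  have hUo : IsOpen U := (Finset.finite_toSet _).isClosed.isOpen_compl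
  have hUc : IsPreconnected U := ((Finset.finite_toSet _).countable.isPathConnected_compl_of_one_lt_rank (by
    rw [Complex.rank_real_complex]; exact Cardinal.one_lt_two)).isConnected.isPreconnected
  have key : ∀ m : Fin d →₀ ℕ, ∀ u ∈ U, HasDerivAt (fun u => MvPowerSeries.coeff m (G (c, u) q) -
      MvPowerSeries.coeff m (pairPrimitive hd (c, u) q)) 0 u := by
    intro m u hu
    rw [hU] at hu
    have e0 := hu 0 (by simp)
    have e1 := hu 1 (by simp)
    have e2 := hu (-1) (by simp)
    have e3 := hu q.2 (by simp)
    have e4 : u * q.2 ≠ 1 := fun h => hu q.2⁻¹ (by simp) (eq_inv_of_mul_eq_one_left h)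
    have e5 := hG c q m u h0 h1 h2 e0 e1 e2 e3 e4
    rw [omegaTwo_eq hd (hF _ ?_) e0 h0 e3 e4] at e5
    · have := e5.sub (hasDerivAt_pairPrimitive hd c q m e0 e3)
      rwa [sub_self] at this
    · refine ⟨fun i => ?_, fun i j hij => ?_⟩
      · fin_cases i
        · exact ⟨e0, e1, e2⟩
        · exact ⟨h0, h1, h2⟩
      · fin_cases i <;> fin_cases j
        · exact absurd rfl hij
        · exact e4
        · simpa [mul_comm] using e4
        · exact absurd rfl hij
  have key2 : ∀ m : Fin d →₀ ℕ, ∃ a : ℂ, ∀ u ∈ U, MvPowerSeries.coeff m (G (c, u) q) -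
      MvPowerSeries.coeff m (pairPrimitive hd (c, u) q) = a := by
    intro m
    refine IsOpen.exists_is_const_of_deriv_eq_zero hUo hUc
      (fun u hu => (key m u hu).differentiableAt.differentiableWithinAt) fun u hu => (key m u hu).deriv
  choose Γ hΓ using key2
  obtain ⟨Γ', hΓ'⟩ : ∃ Γ' : Ser d, ∀ m, MvPowerSeries.coeff m Γ' = Γ m := ⟨fun m => Γ m, fun _ => rfl⟩
  refine ⟨Γ', fun u hu => ?_⟩
  ext m
  rw [map_add, ← sub_eq_iff_eq_add', hΓ m u ((hU u).2 hu), hΓ']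

end Continuation

/-! ### The polar projection of the correlation forms -/

section Polar

variable {d : ℕ}

/-- Coefficientwise sum of the residues at `1` and `-1`. -/
def HasResSumSer (F : ℂ → Ser d) (r : Ser d) : Prop :=
  ∀ m, HasResSum (fun u => MvPowerSeries.coeff m (F u)) (MvPowerSeries.coeff m r)

theorem HasResSumSer.sum_residueSer {F : ℂ → Ser d} {r : Ser d} (h : HasResSumSer F r) :
    ∑ p ∈ ({1, -1} : Finset ℂ), residueSer F p = r := by
  ext m
  obtain ⟨r₁, r₂, h1, h2, h3⟩ := h m
  rw [Finset.sum_pair (by norm_num), map_add, ← h3, ← h1.residue_eq, ← h2.residue_eq]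
  rfl

theorem HasResSum.ser {f : ℂ → ℂ} {r : ℂ} (h : HasResSum f r) (A : Ser d) :
    HasResSumSer (fun u => MvPowerSeries.C (f u) * A) (MvPowerSeries.C r * A) := fun m => by
  simp only [MvPowerSeries.coeff_C_mul, mul_comm _ (MvPowerSeries.coeff m A)]
  exact h.const_mul _

theorem HasResSumSer.add {F F' : ℂ → Ser d} {r r' : Ser d} (h : HasResSumSer F r)
    (h' : HasResSumSer F' r') : HasResSumSer (fun u => F u + F' u) (r + r') := fun m => by
  simp only [map_add]
  exact (h m).add (h' m)

theorem HasResSumSer.sum {ι : Type*} (s : Finset ι) {F : ι → ℂ → Ser d} {r : ι → Ser d}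
    (h : ∀ i ∈ s, HasResSumSer (F i) (r i)) :
    HasResSumSer (fun u => ∑ i ∈ s, F i u) (∑ i ∈ s, r i) := fun m => by
  simp only [map_sum]
  exact HasResSum.sum s fun i hi => h i hi m

theorem HasResSumSer.congr {F F' : ℂ → Ser d} {r : Ser d} (h : HasResSumSer F r) {s : Finset ℂ}
    (hs : ∀ u, (∀ a ∈ s, u ≠ a) → F' u = F u) : HasResSumSer F' r := fun m =>
  (h m).congr (eventually_ne_of_ne.mono fun u hu => by rw [hs u hu])
    (eventually_ne_of_ne.mono fun u hu => by rw [hs u hu])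

theorem hasResSum_zero_of_differentiable {f : ℂ → ℂ} {q : ℂ} (h1 : q ≠ 1) (h2 : q ≠ -1)
    (h : ∀ u, u ≠ 0 → u ≠ q → DifferentiableAt ℂ f u) : HasResSum f 0 := by
  have e : ∀ p : ℂ, p ≠ 0 → p ≠ q → HasRes f p 0 := fun p hp hq => by
    refine hasRes_zero_of_differentiable ?_
    filter_upwards [isOpen_ne.mem_nhds hp, isOpen_ne.mem_nhds hq] with u hu hu'
    exact h u hu hu'
  exact ⟨0, 0, e 1 one_ne_zero h1.symm, e (-1) (by norm_num) h2.symm, add_zero 0⟩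

theorem differentiableAt_basisForm_zero (M : ℕ) {u : ℂ} (hu : u ≠ 0) :
    DifferentiableAt ℂ (basisForm M 0) u := by
  have h : basisForm M 0 = fun z : ℂ => 2 * (z ^ 2)⁻¹ := funext fun z => if_pos rfl
  have h2 : DifferentiableAt ℂ (fun z : ℂ => z ^ 2) u := by fun_prop
  rw [h]
  exact (h2.fun_inv (pow_ne_zero 2 hu)).const_mul 2

/-- For `j ≥ 2` the form is recovered from its poles at `±1`; for `j = 0` it is regular there, so
the Bergman part of the kernel does not see it. -/
theorem hasResSum_basisForm_mul_inv {M j : ℕ} (hj : j ≤ M) (hj1 : j ≠ 1) {q : ℂ} (h0 : q ≠ 0)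
    (h1 : q ≠ 1) (h2 : q ≠ -1) :
    HasResSum (fun u => basisForm M j u * (u - q)⁻¹) (if j = 0 then 0 else -basisForm M j q) := by
  split_ifs with h
  · subst h
    refine hasResSum_zero_of_differentiable h1 h2 fun u hu hq => ?_
    have e : DifferentiableAt ℂ (fun u => u - q) u := by fun_prop
    exact (differentiableAt_basisForm_zero M hu).fun_mul (e.fun_inv (sub_ne_zero.2 hq))
  · have h3 : 2 ≤ j := by omega
    rw [basisForm_eq_basisFun h3 h0]
    have e : ∀ p : ℂ, ∀ᶠ u in 𝓝[≠] p, basisForm M j u * (u - q)⁻¹ = basisFun M j u * (u - q)⁻¹ :=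
      fun p => (eventually_ne_of_ne (s := {0})).mono fun u hu => by
        rw [basisForm_eq_basisFun h3 (hu 0 (by simp))]
    exact ((isPolar_basisFun h3 hj).1 q h1 h2).congr (e 1) (e (-1))

/-- The polar property at `q = 0` gives minus the value at the origin, so only `j = 2` contributes
through the coupling part of the kernel. -/
theorem hasResSum_basisForm_mul_inv_zero {K j : ℕ} (hj : j ≤ 2 * K + 1) (hj1 : j ≠ 1) :
    HasResSum (fun u => basisForm (2 * K + 1) j u * u⁻¹) (if j = 2 then -1 else 0) := by
  by_cases h : j = 0
  · subst h
    refine hasResSum_zero_of_differentiable (q := 0) (by norm_num) (by norm_num) fun u hu _ => ?_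
    exact (differentiableAt_basisForm_zero _ hu).fun_mul (differentiableAt_inv hu)
  · have h3 : 2 ≤ j := by omega
    have h4 := (isPolar_basisFun h3 hj).1 0 (by norm_num) (by norm_num)
    have h5 : -basisFun (2 * K + 1) j 0 = if j = 2 then -1 else 0 := by
      rw [basisFun_zero h3]
      split_ifs <;> simp
    rw [h5] at h4
    have e : ∀ p : ℂ, ∀ᶠ u in 𝓝[≠] p, basisForm (2 * K + 1) j u * u⁻¹ =
        basisFun (2 * K + 1) j u * (u - 0)⁻¹ :=
      fun p => (eventually_ne_of_ne (s := {0})).mono fun u hu => by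
        rw [basisForm_eq_basisFun h3 (hu 0 (by simp)), sub_zero]
    exact h4.congr (e 1) (e (-1))

theorem hasResSum_basisForm {M j : ℕ} (hj : j ≤ M) (hj1 : j ≠ 1) : HasResSum (basisForm M j) 0 := by
  by_cases h : j = 0
  · subst h
    exact hasResSum_zero_of_differentiable (q := 0) (by norm_num) (by norm_num) fun u hu _ =>
      differentiableAt_basisForm_zero M hu
  · have h3 : 2 ≤ j := by omega
    have e : ∀ p : ℂ, ∀ᶠ u in 𝓝[≠] p, basisForm M j u = basisFun M j u :=
      fun p => (eventually_ne_of_ne (s := {0})).mono fun u hu => by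
        rw [basisForm_eq_basisFun h3 (hu 0 (by simp))]
    exact ((isPolar_basisFun h3 hj).2.hasResSum_zero).congr (e 1) (e (-1))

theorem update_mem_regularDomain {n : ℕ} {q : Fin n → Curve d} (hq : (fun i => (q i).2) ∈ regularDomain n)
    (i : Fin n) (c : Fin d) {u : ℂ} (h0 : u ≠ 0) (h1 : u ≠ 1) (h2 : u ≠ -1)
    (h : ∀ j, u ≠ (q j).2⁻¹) : (fun j => (Function.update q i (c, u) j).2) ∈ regularDomain n := by
  have h' : ∀ j, u * (q j).2 ≠ 1 := fun j h3 => h j (eq_inv_of_mul_eq_one_left h3)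
  refine ⟨fun j => ?_, fun j k hjk => ?_⟩
  · by_cases hj : j = i
    · subst hj; simpa using ⟨h0, h1, h2⟩
    · simpa [Function.update_of_ne hj] using hq.1 j
  · by_cases hj : j = i
    · subst hj
      simpa [Function.update_of_ne (Ne.symm hjk)] using h' k
    · by_cases hk : k = i
      · subst hk
        simpa [Function.update_of_ne hj, mul_comm] using h' j
      · simpa [Function.update_of_ne hj, Function.update_of_ne hk] using hq.2 j k hjk

variable {δ : ℕ}

/-- All the variables of a correlation form except the last one, as a linear map. -/
def leadMap (hd : d = 4 * δ + 2) (M n : ℕ) (q : Fin n → Curve d) :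
    (Multiset (Label d) → Ser d) →ₗ[Ser d] Ser d :=
  (MvPowerSeries.C ((2 ^ (n + 1) : ℂ)⁻¹) : Ser d) • ∑ j : Fin n → Fin (M + 1),
    (MvPowerSeries.C (∏ l, basisForm M (j l) (q l).2) : Ser d) •
      (modelSystem hd).arr M n (fun l => (q l).1) (fun l => j l)

theorem omegaForm_succ (hd : d = 4 * δ + 2) (M g n : ℕ) (q : Fin (n + 1) → Curve d) :
    omegaForm hd M g (n + 1) q = ∑ j : Fin (M + 1),
      MvPowerSeries.C (basisForm M j (q (Fin.last n)).2) * leadMap hd M n (fun l => q l.castSucc)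
        ((modelSystem hd).polC M (q (Fin.last n)).1 j ((modelSystem hd).stable g (n + 1))) := by
  rw [omegaForm, ← (Fin.snocEquiv fun _ => Fin (M + 1)).sum_comp, Fintype.sum_prod_type, Finset.mul_sum]
  refine Finset.sum_congr rfl fun j0 _ => ?_
  rw [leadMap, LinearMap.smul_apply, smul_eq_mul, mul_left_comm, LinearMap.sum_apply, Finset.mul_sum,
    Finset.mul_sum, Finset.mul_sum]
  refine Finset.sum_congr rfl fun j _ => ?_
  rw [Fin.prod_univ_castSucc, LinearMap.smul_apply, smul_eq_mul]
  simp only [Fin.snocEquiv_apply, Fin.snoc_last, Fin.snoc_castSucc, LoopSystem.arr, LinearMap.comp_apply]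
  have h2 : (Fin.init fun l => ((Fin.snoc (α := fun _ => Fin (M + 1)) j j0 l : Fin (M + 1)) : ℕ)) =
      fun l => ((j l : Fin (M + 1)) : ℕ) := by
    funext l; simp [Fin.init]
  rw [h2, map_mul]
  simp only [Fin.init_def]
  ring

/-- The polar projection in the last variable reproduces the correlation form. -/
theorem polarPart_last_omegaForm (hd : d = 4 * δ + 2) (hδ : 0 < δ) {K g n : ℕ}
    (hb : (modelSystem hd).RowBounded (2 * K + 1) ((modelSystem hd).stable g (n + 1)))
    (hg : 2 < 2 * g + (n + 1)) {ω : Form d (n + 1)}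
    (hω : ∀ q : Fin (n + 1) → Curve d, (fun i => (q i).2) ∈ regularDomain (n + 1) →
      ω q = omegaForm hd (2 * K + 1) g (n + 1) q)
    {G : Curve d → Curve d → Ser d}
    (hG : ∀ (c : Fin d) (q : Curve d), q.2 ≠ 0 → q.2 ≠ 1 → q.2 ≠ -1 → ∃ Γ : Ser d,
      ∀ u : ℂ, (∀ a ∈ ({0, 1, -1, q.2, q.2⁻¹} : Finset ℂ), u ≠ a) →
        G (c, u) q = pairPrimitive hd (c, u) q + Γ)
    (q : Fin (n + 1) → Curve d) (hq : (fun i => (q i).2) ∈ regularDomain (n + 1)) :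
    polarPart G (Fin.last n) ω q = ω q := by
  set S := modelSystem hd with hS
  set c₀ := (q (Fin.last n)).1 with hc₀
  set x := (q (Fin.last n)).2 with hx
  obtain ⟨x0, x1, x2⟩ := hq.1 (Fin.last n)
  simp only [← hx] at x0 x1 x2
  let T := leadMap hd (2 * K + 1) n fun l => q l.castSucc
  let V : Fin d → ℕ → Ser d := fun c j => T (S.polC (2 * K + 1) c j (S.stable g (n + 1)))
  have hz := S.noZero_stable hg
  have hV1 : ∀ c, V c 1 = 0 := fun c => by
    simp only [V]; rw [hz.polC_one, map_zero]
  -- The other variables are frozen by the linear map `T`, so the linear response relation holds for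
  -- the coefficients in the last variable.
  have hV0 : ∀ c, 2 * V c 0 = ∑ c', S.kmat c c' * V c' 2 := by
    refine S.eq_sum_kmat hδ (a := fun c => 2 * V c 0) (b := fun c => V c 2) fun c => ?_
    have := congrArg T (hz.two_polC_zero (S := S) (M := 2 * K + 1) c)
    simpa only [map_smul, map_sum, map_add, smul_eq_mul] using this
  let R : Fin d → ℕ → Ser d := fun c j =>
    (if j = 0 then 0 else if c₀ = c then MvPowerSeries.C (basisForm (2 * K + 1) j x) * V c j else 0) +
      if j = 2 then MvPowerSeries.C ((x ^ 2)⁻¹) * (S.kmat c c₀ * V c j) else 0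
  have hres : ∀ c, HasResSumSer (fun u => ω (Function.update q (Fin.last n) (c, u)) *
      G (c, u) (q (Fin.last n))) (∑ j : Fin (2 * K + 1 + 1), R c j) := by
    intro c
    obtain ⟨Γ, hΓ⟩ := hG c (q (Fin.last n)) x0 x1 x2
    -- The kernel has three parts: `-(u - x)⁻¹`, the multiple of `u⁻¹` with `kmat`, and the constant
    -- `Γ`. The last gives nothing, since the total residue of each basis form is zero.
    have h1 : ∀ j : Fin (2 * K + 1 + 1), HasResSumSer (fun u =>
        MvPowerSeries.C (basisForm (2 * K + 1) j u) * V c j *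
          (pairPrimitive hd (c, u) (q (Fin.last n)) + Γ)) (R c j) := by
      intro j
      by_cases hj1 : (j : ℕ) = 1
      · have e : R c j = MvPowerSeries.C 0 * 0 := by
          simp only [R, hj1, hV1]; simp
        rw [e]
        refine (hasResSum_zero.ser 0).congr (s := ∅) fun u _ => ?_
        rw [hj1, hV1]; simp
      · have hj : (j : ℕ) ≤ 2 * K + 1 := Nat.lt_succ_iff.1 j.2
        have h2 := ((hasResSum_basisForm_mul_inv hj hj1 x0 x1 x2).ser (if c₀ = c then -V c j else 0)).add
          (((hasResSum_basisForm_mul_inv_zero hj hj1).ser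
            (-(MvPowerSeries.C ((x ^ 2)⁻¹) * (S.kmat c c₀ * V c j)))).add
            ((hasResSum_basisForm hj hj1).ser (V c j * Γ)))
        have e : MvPowerSeries.C (if (j : ℕ) = 0 then 0 else -basisForm (2 * K + 1) j x) *
            (if c₀ = c then -V c j else 0) + (MvPowerSeries.C (if (j : ℕ) = 2 then -1 else 0) *
            (-(MvPowerSeries.C ((x ^ 2)⁻¹) * (S.kmat c c₀ * V c j))) +
            MvPowerSeries.C 0 * (V c j * Γ)) = R c j := by
          simp only [R]
          split_ifs <;> simp
        rw [e] at h2
        refine h2.congr (s := ∅) fun u _ => ?_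
        rw [pairPrimitive]
        simp only [← hc₀, ← hx]
        split_ifs
        · simp only [map_mul, map_neg]; ring
        · simp only [map_mul, map_neg]; ring
    have h2 := HasResSumSer.sum Finset.univ fun j (_ : j ∈ Finset.univ) => h1 j
    refine h2.congr (s := ({0, 1, -1, (q (Fin.last n)).2, (q (Fin.last n)).2⁻¹} : Finset ℂ) ∪
      Finset.univ.image fun i => (q i).2⁻¹) fun u hu => ?_
    have hu0 : ∀ a ∈ ({0, 1, -1, (q (Fin.last n)).2, (q (Fin.last n)).2⁻¹} : Finset ℂ), u ≠ a :=
      fun a ha => hu a (Finset.mem_union_left _ ha)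
    have hreg := update_mem_regularDomain hq (Fin.last n) c (hu0 0 (by simp)) (hu0 1 (by simp))
      (hu0 (-1) (by simp)) fun j => hu _ (Finset.mem_union_right _ (Finset.mem_image_of_mem _ (Finset.mem_univ j)))
    have e1 : (fun l : Fin n => Function.update q (Fin.last n) (c, u) l.castSucc) =
        fun l => q l.castSucc := by
      funext l
      exact Function.update_of_ne (Fin.castSucc_lt_last l).ne _ _
    rw [hω _ hreg, hΓ u hu0, omegaForm_succ, Finset.sum_mul, e1]
    simp only [Function.update_self]
    rfl
  have hsum : polarPart G (Fin.last n) ω q = ∑ c, ∑ j : Fin (2 * K + 1 + 1), R c j :=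
    Finset.sum_congr rfl fun c _ => (hres c).sum_residueSer
  have hV2 : ∀ c, ∑ j : Fin (2 * K + 1 + 1), (if (j : ℕ) = 2 then
      MvPowerSeries.C ((x ^ 2)⁻¹) * (S.kmat c c₀ * V c j) else 0) =
      MvPowerSeries.C ((x ^ 2)⁻¹) * (S.kmat c c₀ * V c 2) := by
    intro c
    rw [Fin.sum_univ_eq_sum_range (fun j => if j = 2 then
      MvPowerSeries.C ((x ^ 2)⁻¹) * (S.kmat c c₀ * V c j) else 0), Finset.sum_ite_eq']
    split_ifs with h
    · rfl
    · have : V c 2 = 0 := by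
        simp only [V]
        rw [hb c 2 (by simpa using h), map_zero]
      rw [this, mul_zero, mul_zero]
  rw [hsum, hω q hq, omegaForm_succ]
  simp only [R, Finset.sum_add_distrib, hV2]
  rw [Finset.sum_comm, ← Finset.mul_sum]
  -- The coupling part of the kernel, summed over all components, returns exactly the coefficient of
  -- the form `2 dx / x ^ 2`. The symmetry of `kmat` matches the order of its indices in the kernel
  -- with that in the response relation.
  have hk : ∑ c, S.kmat c c₀ * V c 2 = 2 * V c₀ 0 := by
    rw [hV0]
    exact Finset.sum_congr rfl fun c _ => by rw [S.kmat_symm hδ]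
  change _ = ∑ j : Fin (2 * K + 1 + 1), MvPowerSeries.C (basisForm (2 * K + 1) j x) * V c₀ j
  conv_rhs => rw [Fin.sum_univ_succ]
  rw [hk, Fin.sum_univ_succ]
  simp only [Fin.val_zero, if_true, Finset.sum_const_zero, zero_add, Fin.val_succ, Nat.succ_ne_zero,
    if_false, Finset.sum_ite_eq, Finset.mem_univ]
  rw [add_comm]
  congr 1
  have h0 : basisForm (2 * K + 1) 0 x = 2 * (x ^ 2)⁻¹ := if_pos rfl
  rw [h0, map_mul]
  have : (MvPowerSeries.C (2 : ℂ) : Ser d) = 2 := rfl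
  rw [this]
  ring

end Polar

/-! ### Vanishing of the blobs -/

section Blobs

variable {d δ : ℕ}

/-- Residues only involve small circles about `±1`, which stay in the regular domain when the other
variables are kept fixed. Hence vanishing there is preserved. -/
theorem holPart_eq_zero {n : ℕ} (G : Curve d → Curve d → Ser d) (i : Fin n) {ω : Form d n}
    (h : ∀ q : Fin n → Curve d, (fun i => (q i).2) ∈ regularDomain n → ω q = 0)
    (q : Fin n → Curve d) (hq : (fun i => (q i).2) ∈ regularDomain n) : holPart G i ω q = 0 := by
  rw [holPart, h q hq, zero_sub, neg_eq_zero, polarPart]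
  refine Finset.sum_eq_zero fun c _ => HasResSumSer.sum_residueSer ?_
  have h0 : HasResSumSer (fun _ => (0 : Ser d)) 0 := by
    have := hasResSum_zero.ser (0 : Ser d)
    simpa using this
  refine h0.congr (s := ({0, 1, -1} : Finset ℂ) ∪ Finset.univ.image fun i => (q i).2⁻¹) fun u hu => ?_
  rw [h, zero_mul]
  exact update_mem_regularDomain hq i c (hu 0 (by simp)) (hu 1 (by simp)) (hu (-1) (by simp)) fun j =>
    hu _ (Finset.mem_union_right _ (Finset.mem_image_of_mem _ (Finset.mem_univ j)))

/-- The fold applies the projection in the last variable first, and the remaining ones then act on a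
form that is zero on the regular domain. -/
theorem holPartAll_eq_zero {n : ℕ} (G : Curve d → Curve d → Ser d) {ω : Form d (n + 1)}
    (h : ∀ q : Fin (n + 1) → Curve d, (fun i => (q i).2) ∈ regularDomain (n + 1) →
      holPart G (Fin.last n) ω q = 0)
    (q : Fin (n + 1) → Curve d) (hq : (fun i => (q i).2) ∈ regularDomain (n + 1)) :
    holPartAll G ω q = 0 := by
  rw [holPartAll, List.finRange_succ_last, List.foldr_append, List.foldr_cons, List.foldr_nil]
  generalize List.map Fin.castSucc (List.finRange n) = l
  induction l generalizing q with
  | nil => exact h q hq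
  | cons i l ih => exact holPart_eq_zero G i ih q hq

/-- The constructed expansion, forms and primitive show that a blob exists. Any other choice agrees
with them on the regular domain, up to constants in the primitive, and these do not affect the polar
projection. -/
theorem blobVanishes (hd : d = 4 * δ + 2) {g n : ℕ} (hg : g < δ) (hn : 1 ≤ n) (hgn : 2 < 2 * g + n) :
    BlobVanishes d g n := by
  have hδ : 0 < δ := by omega
  obtain ⟨K, hK⟩ := (modelSystem hd).exists_rowBounded_stable hg hgn
  have hω := isCorrelationForm_omegaForm hd (by omega) hK
  have hF := isCorrelationForm_pairForm hd hδ
  refine ⟨⟨_, genusData hd, _, _, _, isTopologicalExpansion_genusData hd, hω, hF,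
    isPrimitive_pairPrimitive hd rfl, rfl⟩, ?_⟩
  rintro _ ⟨w, ω, F, G, hw, hω', hF', hG, rfl⟩ q hq
  obtain ⟨n, rfl⟩ := Nat.exists_eq_add_of_le' hn
  have hωeq := fun q hq => hω'.eq_of_mem
    (isTopologicalExpansion_unique hw (isTopologicalExpansion_genusData hd) g (n + 1) hn) hω q hq
  have hFeq := fun q hq => hF'.eq_of_mem
    (isTopologicalExpansion_unique hw (isTopologicalExpansion_genusData hd) 0 2 (by norm_num)) hF q hq
  refine holPartAll_eq_zero G (fun q hq => ?_) q hq
  rw [holPart, polarPart_last_omegaForm hd hδ hK hgn hωeq (hG.eq_add_const hd hFeq) q hq, sub_self]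

/-! ### The expansion of the potential -/

/-- The coefficients of the topological expansion of the potential. -/
def potentialCoeff (δ h : ℕ) (a : Fin d →₀ ℕ) : ℂ :=
  if 2 ≤ a.degree ∧ h = δ * (a.degree - 2) then -(1 / (a.degree : ℂ)) * (a.multinomial : ℂ) else 0

theorem potentialCoeff_ne_zero (δ h : ℕ) (a : Fin d →₀ ℕ) :
    potentialCoeff δ h a ≠ 0 ↔ 2 ≤ a.degree ∧ h = δ * (a.degree - 2) := by
  rw [potentialCoeff]
  split_ifs with h1
  · refine iff_of_true ?_ h1
    have h2 : (a.degree : ℂ) ≠ 0 := by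
      have := h1.1
      exact_mod_cast (by omega : a.degree ≠ 0)
    have h3 : (a.multinomial : ℂ) ≠ 0 := by
      exact_mod_cast (Nat.multinomial_pos _ _).ne'
    exact mul_ne_zero (neg_ne_zero.2 (one_div_ne_zero h2)) h3
  · exact iff_of_false (fun h => h rfl) h1

theorem isPotentialExpansion_potentialCoeff (hd : d = 4 * δ + 2) :
    IsPotentialExpansion d (potentialCoeff δ) := by
  intro a
  have hsupp : ∀ h, h ≠ δ * (a.degree - 2) → potentialCoeff δ h a = 0 := fun h hh =>
    if_neg fun h1 => hh h1.2
  refine ⟨(Set.finite_singleton (δ * (a.degree - 2))).subset fun h hh => ?_, fun N hN => ?_⟩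
  · by_contra h1
    exact hh (hsupp h h1)
  · have hN0 : (N : ℂ) ≠ 0 := by exact_mod_cast (by omega : N ≠ 0)
    rw [finsum_eq_single _ (δ * (a.degree - 2)) fun h hh => by simp only [hsupp h hh, zero_mul]]
    simp only [coupling_eq hd hN, potentialCoeff]
    by_cases h2 : 2 ≤ a.degree
    · simp only [h2, true_and, if_true]
      set k := δ * (a.degree - 2)
      have : (N : ℂ) ^ (2 - ((0 : ℕ) : ℤ) - 2 * (k : ℤ)) = (N : ℂ) ^ 2 * (((N : ℂ) ^ 2)⁻¹) ^ k := by
        rw [Nat.cast_zero, sub_zero, zpow_sub₀ hN0, zpow_mul, zpow_natCast, inv_pow, div_eq_mul_inv]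
        rfl
      rw [this]
      ring
    · simp only [h2, false_and, if_false, mul_zero, zero_mul]

end Blobs

end QuarticMelonic

end

/-! ### The vanishing of the blobs and the expansion of the potential. -/

theorem mainTheorem9 :
    (∀ d δ : ℕ, d = 4 * δ + 2 →
      ∀ h n : ℕ, (h : ℤ) ≤ (δ : ℤ) - 1 → 1 ≤ n → 0 < 2 * (h : ℤ) - 2 + (n : ℤ) →
        QuarticMelonic.BlobVanishes d h n) ∧
    (∀ n : ℕ, 3 ≤ n → QuarticMelonic.BlobVanishes 6 0 n) ∧
    (∀ d δ : ℕ, d = 4 * δ + 2 → 1 ≤ δ →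
      ∃ T : ℕ → (Fin d →₀ ℕ) → ℂ, QuarticMelonic.IsPotentialExpansion d T ∧
        (∀ a, T 0 a ≠ 0 ↔ a.degree = 2) ∧
        (∀ h, 1 ≤ h → h < δ → ∀ a, T h a = 0) ∧
        (∀ a, T δ a ≠ 0 ↔ a.degree = 3)) := by
  refine ⟨fun d δ hd h n hh hn hn2 => QuarticMelonic.blobVanishes hd (by omega) hn (by omega),
    fun n hn => QuarticMelonic.blobVanishes (δ := 1) rfl (by omega) (by omega) (by omega),
    fun d δ hd hδ => ⟨QuarticMelonic.potentialCoeff δ,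
      QuarticMelonic.isPotentialExpansion_potentialCoeff hd, fun a => ?_, fun h h1 h2 a => ?_, fun a => ?_⟩⟩
  · rw [QuarticMelonic.potentialCoeff_ne_zero, eq_comm, mul_eq_zero]
    omega
  · by_contra h3
    obtain ⟨h4, h5⟩ := (QuarticMelonic.potentialCoeff_ne_zero δ h a).1 h3
    rcases Nat.eq_zero_or_pos (a.degree - 2) with h6 | h6
    · rw [h6, mul_zero] at h5
      omega
    · have := Nat.le_mul_of_pos_right δ h6
      omega
  · rw [QuarticMelonic.potentialCoeff_ne_zero, eq_comm, Nat.mul_eq_left (by omega)]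
    omega
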